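/- **Setting.** Let $v:\mathbb R^3\to\mathbb R$ with $\hat v(k)=\int v(x)e^{-ikx}\,dx$, and let $V>0$. Assume: $v\in L^1$; $\hat v\in L^2$; $v$ is even and rotation invariant; $\hat v(0)>0$; $\hat v\in C^1(\mathbb R^3)$ and $\hat v$ is $C^5$ near $0$; and, regarding $\hat v$ as a function of $k=|k|$, for every $\nu\in(0,V]$: $\hat v(k)>-\hat v(0)\frac{k^2}{4\nu}$ for $k\ne0$; $\frac{\nu}{\hat v(0)}\hat v''(0)>-1$; the function $h_\nu(k)=\frac{k^2}{2\nu}+\frac{\hat v(k)}{\hat v(0)}+\frac{k\,\hat v'(k)}{2\hat v(0)}$ has finitely many zeros in $(0,\infty)$ and $\liminf_{k\to\infty}h_\nu(k)>0$. Fix $\nu\in(0,V]$ and, for $\beta>0$, put $$\omega(k)=\sqrt{\tfrac14|k|^4+\nu\tfrac{\hat v(k)}{\hat v(0)}|k|^2},\quad \rho(k)=\frac1{e^{\beta\omega(k)}-1},\quad A(k)=\sqrt{\omega(k)^2+\nu^2\tfrac{\hat v(k)^2}{\hat v(0)^2}},$$ $$c_k=\frac{\sqrt{A(k)+\omega(k)}}{\sqrt{2\omega(k)}},\qquad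 s_k=\operatorname{sgn}(\hat v(k))\frac{\sqrt{A(k)-\omega(k)}}{\sqrt{2\omega(k)}},$$ $$j(k;p,q)=\sqrt{\tfrac{\nu}{\hat v(0)}}\big[\hat v(k)(s_k-c_k)(c_ps_q+c_qs_p)+\hat v(p)(c_p-s_p)(c_kc_q+s_ks_q)+\hat v(q)(c_q-s_q)(c_pc_k+s_ps_k)\big].$$ For $L>0$ let $\Xi_L^>=\frac{2\pi}L\mathbb Z^3\setminus\{0\}$. On the bosonic Fock space over $\ell^2(\Xi_L^>)\oplus\ell^2(\Xi_L^>)$, with vacuum $\Omega$ and left and right creation and annihilation operators $b_l^{(*)}(k)$, $b_r^{(*)}(k)$, let $L^L_{\rm bg}=\sum_k\omega(k)\big(b_l^*(k)b_l(k)-b_r^*(k)b_r(k)\big)$. The Araki–Woods operators are $$b_{\beta,l}^*(k)=(1-e^{-\beta\omega(k)})^{-1/2}b_l^*(k)+(e^{\beta\omega(k)}-1)^{-1/2}b_r(k),$$ their adjoints, and the same with $l\leftrightarrow r$. For $\sigma\in\{l,r\}$ put $a_{\sigma,k}=c_kb_{\beta,\sigma}(k)-s_kb^*_{\beta,\sigma}(-k)$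 and $$H_{3,\sigma}=L^{-3/2}\sum_{k,p,p+k\in\Xi_L^>}\frac{\sqrt\nu\,\hat v(k)}{\sqrt{\hat v(0)}}\big(a^*_{\sigma,p+k}a_{\sigma,k}a_{\sigma,p}+\text{h.c.}\big),$$ $$H_{4,\sigma}=\frac1{2L^3}\sum_{p,q,p+k,q-k\in\Xi_L^>}\hat v(k)\,a^*_{\sigma,p+k}a^*_{\sigma,q-k}a_{\sigma,q}a_{\sigma,p},$$ and $L^L_i=H_{i,l}-H_{i,r}$ for $i=3,4$, the difference being taken term by term in the sums. With $\Psi_k=b_l^*(k)b_r^*(k)\Omega$, the eigenvalue shift is $$\xi(k)=\lim_{\epsilon\searrow0}\lim_{L\to\infty}\Big\{(\Psi_k|L^L_4\Psi_k)-\big(L^L_3\Psi_k\big|(L^L_{\rm bg}-i\epsilon)^{-1}L^L_3\Psi_k\big)-(\Omega|L^L_4\Omega)+\big(L^L_3\Omega\big|(L^L_{\rm bg}-i\epsilon)^{-1}L^L_3\Omega\big)\Big\},$$ where in the limit $L\to\infty$ the momentum in the bracket is any $k_L\in\Xi_L^>$ with $k_L\to k$ (for instance $k_L=k$ along those $L$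 with $k\in\Xi_L^>$). The scalar products are evaluated in the occupation number basis. Finally, $\int F(p)\,\delta(g(p))\,dp$ means $\lim_{\eta\searrow0}\frac1{2\eta}\int_{|g|<\eta}F\,dp$, and it is called well defined if $F$ is integrable on $\{|g|<\eta\}$ for all small $\eta>0$ and this limit exists and is finite. Set $$\gamma_B(k)=\frac\pi2\int\frac{dp}{(2\pi)^3}\,j(k;p,p-k)^2\rho(p)\rho(p-k)\rho(k)\Big(1-e^{\frac\beta2(\omega(p)+\omega(p-k)+\omega(k))}\Big)^2\delta\big(\omega(p)+\omega(p-k)-\omega(k)\big),$$ $$\gamma_L(k)=\pi\int\frac{dp}{(2\pi)^3}\,j(p-k;p,k)^2\rho(p)\rho(p-k)\rho(k)\Big(e^{\frac\beta2(\omega(k)+\omega(p-k))}-e^{\frac\beta2\omega(p)}\Big)^2\delta\big(\omega(p)+\omega(k)-\omega(p-k)\big).$$ **Proposition.** 1. For all $\beta,L,\epsilon>0$ and $k\in\Xi_L^>$, the series of the two resolvent matrix elements above converge absolutely. 2. For all $\beta>0$ and all $k\in\mathbb R^3\setminus\{0\}$ at which the integrals $\gamma_B(k)$ and $\gamma_L(k)$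 are well defined, the double limit $\xi(k)$ exists and $$\xi(k)=-2i\big(\gamma_B(k)+\gamma_L(k)\big);$$ in particular $\xi(k)$ is purely imaginary. 3. There is a finite set $S\subset\mathbb R$, not depending on $\beta$, such that $\gamma_B(k)$ and $\gamma_L(k)$ are well defined (hence finite) for every $\beta>0$ and every $k\neq0$ with $|k|\notin S$; in particular for all sufficiently small $k\ne0$. -/

import Mathlib

noncomputable section

namespace BoseGas

open MeasureTheory Filter Topology

/-- Momentum (and position) space `ℝ³`. -/
abbrev E : Type := EuclideanSpace ℝ (Fin 3)

/-! ### The potential and the Bogoliubov functions -/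

/-- The Fourier transform `v̂(p) = ∫ v(x) exp (-i p·x) dx`. The potentials considered below are
real and even, so that the integral is real and taking the real part loses nothing. -/
def vhat (v : E → ℝ) (p : E) : ℝ :=
  (∫ x : E, Complex.exp (-(Complex.I * ((inner ℝ p x : ℝ) : ℂ))) * ((v x : ℝ) : ℂ)).re

/-- The transform of a rotation invariant potential as a function of the length of the momentum. -/
def vhatRadial (v : E → ℝ) (t : ℝ) : ℝ := vhat v (t • EuclideanSpace.single (0 : Fin 3) (1 : ℝ))

/-- The function `k²/(2ν) + v̂(k)/v̂(0) + k v̂'(k)/(2 v̂(0))` of `k > 0`, which equals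
`(d/dk ω(k)²)/(2νk)`. -/
def slopeFun (v : E → ℝ) (ν t : ℝ) : ℝ :=
  t ^ 2 / (2 * ν) + vhatRadial v t / vhat v 0 + t / (2 * vhat v 0) * deriv (vhatRadial v) t

/-- The assumptions on the potential, for all chemical potentials `ν ∈ (0, V]`. -/
structure IsAdmissible (v : E → ℝ) (V : ℝ) : Prop where
  integrable : Integrable v
  vhat_memLp : MemLp (vhat v) 2
  vhat_zero_pos : 0 < vhat v 0
  /-- equivalent to `ω(k)² > 0` for all `k ≠ 0` -/
  stable : ∀ ν ∈ Set.Ioc 0 V, ∀ k : E, k ≠ 0 → -(vhat v 0 * (‖k‖ ^ 2 / (4 * ν))) < vhat v k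
  even : ∀ᵐ x : E, v (-x) = v x
  rotationInvariant : ∀ R : E ≃ₗᵢ[ℝ] E, ∀ᵐ x : E, v (R x) = v x
  contDiffAt_zero : ContDiffAt ℝ 5 (vhat v) 0
  convexity : ∀ ν ∈ Set.Ioc 0 V, -1 < ν / vhat v 0 * iteratedDeriv 2 (vhatRadial v) 0
  contDiff : ContDiff ℝ 1 (vhat v)
  finite_stationary : ∀ ν ∈ Set.Ioc 0 V, {t : ℝ | 0 < t ∧ slopeFun v ν t = 0}.Finite
  /-- the lower limit of `slopeFun` at infinity is positive -/
  liminf_pos : ∀ ν ∈ Set.Ioc 0 V, ∃ c : ℝ, 0 < c ∧ ∀ᶠ t : ℝ in atTop, c ≤ slopeFun v ν t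

/-- The Bogoliubov dispersion relation. -/
def omega (v : E → ℝ) (ν : ℝ) (k : E) : ℝ :=
  √(‖k‖ ^ 4 / 4 + ν * vhat v k / vhat v 0 * ‖k‖ ^ 2)

/-- The Bogoliubov coefficient `c_k`. -/
def bogC (v : E → ℝ) (ν : ℝ) (k : E) : ℝ :=
  √(√(omega v ν k ^ 2 + ν ^ 2 * (vhat v k ^ 2 / vhat v 0 ^ 2)) + omega v ν k)
    / √(2 * omega v ν k)

/-- The Bogoliubov coefficient `s_k`. It carries the sign of `v̂(k)`, which is what makes the
rotation `a_k = c_k b_k - s_k b*_{-k}` remove the terms `b b` and `b* b*` from the quadratic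
Hamiltonian also where `v̂` is negative. -/
def bogS (v : E → ℝ) (ν : ℝ) (k : E) : ℝ :=
  Real.sign (vhat v k) *
    (√(√(omega v ν k ^ 2 + ν ^ 2 * (vhat v k ^ 2 / vhat v 0 ^ 2)) - omega v ν k)
      / √(2 * omega v ν k))

/-- The thermal density `ρ(k) = 1 / (exp (β ω(k)) - 1)`. -/
def rho (v : E → ℝ) (ν β : ℝ) (k : E) : ℝ := (Real.exp (β * omega v ν k) - 1)⁻¹

/-- The three-quasiparticle amplitude `j(k; p, q)`. -/
def jAmp (v : E → ℝ) (ν : ℝ) (k p q : E) : ℝ :=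
  √(ν / vhat v 0) *
    (vhat v k * (bogS v ν k - bogC v ν k) * (bogC v ν p * bogS v ν q + bogC v ν q * bogS v ν p)
    + vhat v p * (bogC v ν p - bogS v ν p) * (bogC v ν k * bogC v ν q + bogS v ν k * bogS v ν q)
    + vhat v q * (bogC v ν q - bogS v ν q) * (bogC v ν p * bogC v ν k + bogS v ν p * bogS v ν k))

/-! ### Integrals with a delta function, and the damping rates -/

/-- `∫ F(p) δ(g(p)) dp = I`, where `δ` is the limit of the normalised windows
`(2η)⁻¹ 1_{(-η, η)}` as `η ↘ 0`. -/
def HasDeltaIntegral (F g : E → ℝ) (I : ℝ) : Prop :=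
  (∀ᶠ η : ℝ in 𝓝[>] 0, IntegrableOn F {p | |g p| < η}) ∧
    Tendsto (fun η : ℝ => (2 * η)⁻¹ * ∫ p in {p | |g p| < η}, F p) (𝓝[>] 0) (𝓝 I)

/-- `γ` is the Beliaev damping rate at momentum `k`. -/
def IsBeliaevRate (v : E → ℝ) (ν β : ℝ) (k : E) (γ : ℝ) : Prop :=
  HasDeltaIntegral
    (fun p => Real.pi / 2 * ((2 * Real.pi) ^ 3)⁻¹ * (jAmp v ν k p (p - k) ^ 2
      * (rho v ν β p * rho v ν β (p - k) * rho v ν β k)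
      * (1 - Real.exp (β * (omega v ν p + omega v ν (p - k) + omega v ν k) / 2)) ^ 2))
    (fun p => omega v ν p + omega v ν (p - k) - omega v ν k) γ

/-- `γ` is the Landau damping rate at momentum `k`. -/
def IsLandauRate (v : E → ℝ) (ν β : ℝ) (k : E) (γ : ℝ) : Prop :=
  HasDeltaIntegral
    (fun p => Real.pi * ((2 * Real.pi) ^ 3)⁻¹ * (jAmp v ν (p - k) p k ^ 2
      * (rho v ν β p * rho v ν β (p - k) * rho v ν β k)
      * (Real.exp (β * (omega v ν k + omega v ν (p - k)) / 2)
          - Real.exp (β / 2 * omega v ν p)) ^ 2))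
    (fun p => omega v ν p + omega v ν k - omega v ν (p - k)) γ

/-! ### The doubled Fock space in the occupation number representation -/

/-- Labels of the left and right quasiparticles. -/
inductive Side : Type
  | left : Side
  | right : Side

/-- Exchange of left and right. -/
def Side.swap : Side → Side
  | Side.left => Side.right
  | Side.right => Side.left

/-- The sign with which a quasiparticle enters the Bogoliubov Liouvillean. -/
def Side.sign : Side → ℝ
  | Side.left => 1
  | Side.right => -1

/-- Labels of the nonzero lattice momenta: `m` stands for the momentum `(2π/L) m`. -/
abbrev Xi : Type := {m : Fin 3 → ℤ // m ≠ 0}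

/-- The label of the opposite momentum. -/
def Xi.opp (m : Xi) : Xi := ⟨-m.1, neg_ne_zero.mpr m.2⟩

/-- The momentum `(2π/L) m`. -/
def mom (L : ℝ) (m : Fin 3 → ℤ) : E := WithLp.toLp 2 fun i => 2 * Real.pi / L * (m i : ℝ)

/-- One-particle modes: the basis of `ℓ²(Ξ_L^>) ⊕ ℓ²(Ξ_L^>)`. -/
abbrev Mode : Type := Side × Xi

/-- Occupation numbers: they label the standard orthonormal basis of the bosonic Fock space. -/
abbrev Config : Type := Mode →₀ ℕ

/-- Vectors, given by their coefficients in the occupation number basis. No square summability is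
imposed here; sums over configurations are taken in `braket`. -/
abbrev State : Type := Config → ℂ

/-- The creation operator of a mode. -/
def create (m : Mode) : Module.End ℂ State where
  toFun f := fun n => (√(n m : ℝ) : ℂ) * f (n - Finsupp.single m 1)
  map_add' f g := by funext n; simp [mul_add]
  map_smul' c f := by funext n; simp [mul_left_comm]

/-- The annihilation operator of a mode. -/
def annih (m : Mode) : Module.End ℂ State where
  toFun f := fun n => (√((n m : ℝ) + 1) : ℂ) * f (n + Finsupp.single m 1)
  map_add' f g := by funext n; simp [mul_add]
  map_smul' c f := by funext n; simp [mul_left_comm]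

/-- The scalar product `(f | g)`, antilinear in the first argument. -/
def braket (f g : State) : ℂ := ∑' n : Config, (starRingEnd ℂ) (f n) * g n

open Classical in
/-- The Fock vacuum `Ω`, which represents the KMS state of the Bogoliubov Hamiltonian. -/
def vac : State := Pi.single 0 1

/-- The standard vector `b_l^*(k) b_r^*(k) Ω` of a single quasiparticle of momentum `k`. -/
def quasi (k : Xi) : State := create (Side.left, k) (create (Side.right, k) vac)

/-! ### The Bogoliubov Liouvillean and its resolvent -/

/-- The eigenvalue of the Bogoliubov Liouvillean on a basis vector. -/
def energy (v : E → ℝ) (ν L : ℝ) (n : Config) : ℝ :=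
  n.sum fun m N => (N : ℝ) * (m.1.sign * omega v ν (mom L m.2.1))

/-- The Bogoliubov Liouvillean `∑_k ω(k) (b_l^*(k) b_l(k) - b_r^*(k) b_r(k))`. -/
def bogLiouvillean (v : E → ℝ) (ν L : ℝ) (f : State) : State := fun n =>
  ∑' k : Xi, (omega v ν (mom L k.1) : ℂ) *
    ((create (Side.left, k) * annih (Side.left, k)
      - create (Side.right, k) * annih (Side.right, k)) f) n

/-- The resolvent `(L_bg - iε)⁻¹` of the Bogoliubov Liouvillean. -/
def bogResolvent (v : E → ℝ) (ν L ε : ℝ) (f : State) : State := fun n =>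
  ((energy v ν L n : ℂ) - Complex.I * (ε : ℂ))⁻¹ * f n

theorem create_annih_apply (m : Mode) (f : State) (n : Config) :
    ((create m * annih m) f) n = (n m : ℂ) * f n := by
  change (√(n m : ℝ) : ℂ) * ((√(((n - Finsupp.single m 1 : Config) m : ℝ) + 1) : ℂ)
    * f (n - Finsupp.single m 1 + Finsupp.single m 1)) = (n m : ℂ) * f n
  by_cases h : n m = 0
  · simp [h]
  · have h1 : 1 ≤ n m := Nat.one_le_iff_ne_zero.mpr h
    have h2 : n - Finsupp.single m 1 + Finsupp.single m 1 = n :=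
      tsub_add_cancel_of_le (Finsupp.single_le_iff.mpr h1)
    have h3 : (((n - Finsupp.single m 1 : Config) m : ℝ) + 1) = (n m : ℝ) := by
      simp [Nat.cast_sub h1]
    rw [h2, h3, ← mul_assoc, ← Complex.ofReal_mul, Real.mul_self_sqrt (Nat.cast_nonneg _)]
    simp

theorem bogLiouvillean_apply (v : E → ℝ) (ν L : ℝ) (f : State) (n : Config) :
    bogLiouvillean v ν L f n = (energy v ν L n : ℂ) * f n := by
  classical
  have hterm : ∀ k : Xi, (omega v ν (mom L k.1) : ℂ) *
      ((create (Side.left, k) * annih (Side.left, k)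
        - create (Side.right, k) * annih (Side.right, k)) f) n
      = ((omega v ν (mom L k.1) * ((n (Side.left, k) : ℝ) - (n (Side.right, k) : ℝ)) : ℝ) : ℂ)
        * f n := by
    intro k
    rw [LinearMap.sub_apply, Pi.sub_apply, create_annih_apply, create_annih_apply]
    push_cast
    ring
  let K : Finset Xi := n.support.image Prod.snd
  have hK : ∀ k : Xi, k ∉ K → ∀ σ : Side, n (σ, k) = 0 := by
    intro k hk σ
    by_contra h
    exact hk (Finset.mem_image.mpr ⟨(σ, k), Finsupp.mem_support_iff.mpr h, rfl⟩)
  have hE : energy v ν L n = ∑ k ∈ K,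
      omega v ν (mom L k.1) * ((n (Side.left, k) : ℝ) - (n (Side.right, k) : ℝ)) := by
    have hsub : n.support ⊆ ({Side.left, Side.right} : Finset Side) ×ˢ K := by
      rintro ⟨σ, k⟩ h
      refine Finset.mem_product.mpr ⟨?_, Finset.mem_image.mpr ⟨(σ, k), h, rfl⟩⟩
      cases σ <;> simp
    unfold energy
    rw [Finsupp.sum_of_support_subset n hsub _ (by intros; simp), Finset.sum_product_right]
    refine Finset.sum_congr rfl fun k _ => ?_
    rw [Finset.sum_pair (by intro h; cases h)]
    simp only [Side.sign]
    ring
  unfold bogLiouvillean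
  rw [tsum_congr hterm, tsum_eq_sum (s := K), hE, Complex.ofReal_sum, Finset.sum_mul]
  intro k hk
  simp [hK k hk]

/-- The operator `bogResolvent` inverts `L_bg - iε`. -/
theorem bogLiouvillean_sub_bogResolvent (v : E → ℝ) (ν L ε : ℝ) (hε : ε ≠ 0) (f : State)
    (n : Config) : bogLiouvillean v ν L (bogResolvent v ν L ε f) n
      - Complex.I * (ε : ℂ) * bogResolvent v ν L ε f n = f n := by
  have h : (energy v ν L n : ℂ) - Complex.I * (ε : ℂ) ≠ 0 := by
    intro h
    have := congrArg Complex.im h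
    simp at this
    exact hε this
  rw [bogLiouvillean_apply, ← sub_mul]
  unfold bogResolvent
  rw [← mul_assoc, mul_inv_cancel₀ h, one_mul]

/-! ### The interaction in the Araki--Woods representation -/

/-- The creation operator `b*_{β,l}(k)` or `b*_{β,r}(k)`. -/
def thermalCreate (v : E → ℝ) (ν β L : ℝ) (σ : Side) (k : Xi) : Module.End ℂ State :=
  (((√(1 - Real.exp (-(β * omega v ν (mom L k.1)))))⁻¹ : ℝ) : ℂ) • create (σ, k)
    + (((√(Real.exp (β * omega v ν (mom L k.1)) - 1))⁻¹ : ℝ) : ℂ) • annih (σ.swap, k)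

/-- The annihilation operator `b_{β,l}(k)` or `b_{β,r}(k)`. -/
def thermalAnnih (v : E → ℝ) (ν β L : ℝ) (σ : Side) (k : Xi) : Module.End ℂ State :=
  (((√(1 - Real.exp (-(β * omega v ν (mom L k.1)))))⁻¹ : ℝ) : ℂ) • annih (σ, k)
    + (((√(Real.exp (β * omega v ν (mom L k.1)) - 1))⁻¹ : ℝ) : ℂ) • create (σ.swap, k)

/-- `a_k^* = c_k b_k^* - s_k b_{-k}` with the thermal operators inserted for `b`, `b^*`. -/
def aCreate (v : E → ℝ) (ν β L : ℝ) (σ : Side) (k : Xi) : Module.End ℂ State :=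
  ((bogC v ν (mom L k.1) : ℝ) : ℂ) • thermalCreate v ν β L σ k
    - ((bogS v ν (mom L k.1) : ℝ) : ℂ) • thermalAnnih v ν β L σ k.opp

/-- `a_k = c_k b_k - s_k b_{-k}^*` with the thermal operators inserted for `b`, `b^*`. -/
def aAnnih (v : E → ℝ) (ν β L : ℝ) (σ : Side) (k : Xi) : Module.End ℂ State :=
  ((bogC v ν (mom L k.1) : ℝ) : ℂ) • thermalAnnih v ν β L σ k
    - ((bogS v ν (mom L k.1) : ℝ) : ℂ) • thermalCreate v ν β L σ k.opp

/-- Triples `(k, p, p + k)` of nonzero lattice momenta. -/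
abbrev CubicIndex : Type := {x : Xi × Xi × Xi // x.2.2.1 = x.2.1.1 + x.1.1}

/-- The summand `L^{-3/2} √ν v̂(k) / √v̂(0) (a*_{p+k} a_k a_p + h.c.)` of the cubic Hamiltonian. -/
def cubicTerm (v : E → ℝ) (ν β L : ℝ) (σ : Side) (x : CubicIndex) : Module.End ℂ State :=
  (((L ^ (3 / 2 : ℝ))⁻¹ * (√ν * vhat v (mom L x.1.1.1) / √(vhat v 0)) : ℝ) : ℂ) •
    (aCreate v ν β L σ x.1.2.2 * aAnnih v ν β L σ x.1.1 * aAnnih v ν β L σ x.1.2.1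
      + aCreate v ν β L σ x.1.2.1 * aCreate v ν β L σ x.1.1 * aAnnih v ν β L σ x.1.2.2)

/-- The cubic part `L_3 = H_{3,l} - H_{3,r}` of the Liouvillean. On vectors with finitely many
nonzero coefficients, each coefficient of the result is a finite sum. -/
def cubicLiouvillean (v : E → ℝ) (ν β L : ℝ) (f : State) : State := fun n =>
  ∑' x : CubicIndex, ((cubicTerm v ν β L Side.left x - cubicTerm v ν β L Side.right x) f) n

/-- Quadruples `(p, q, p + k, q - k)` of nonzero lattice momenta. -/
abbrev QuarticIndex : Type :=
  {x : Xi × Xi × Xi × Xi // x.2.2.1.1 + x.2.2.2.1 = x.1.1 + x.2.1.1}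

/-- The summand `(2 L³)⁻¹ v̂(k) a*_{p+k} a*_{q-k} a_q a_p` of the quartic Hamiltonian. -/
def quarticTerm (v : E → ℝ) (ν β L : ℝ) (σ : Side) (x : QuarticIndex) : Module.End ℂ State :=
  (((2 * L ^ 3)⁻¹ * vhat v (mom L (x.1.2.2.1.1 - x.1.1.1)) : ℝ) : ℂ) •
    (aCreate v ν β L σ x.1.2.2.1 * aCreate v ν β L σ x.1.2.2.2
      * aAnnih v ν β L σ x.1.2.1 * aAnnih v ν β L σ x.1.1)

/-- The quartic part `L_4 = H_{4,l} - H_{4,r}` of the Liouvillean. -/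
def quarticLiouvillean (v : E → ℝ) (ν β L : ℝ) (f : State) : State := fun n =>
  ∑' x : QuarticIndex, ((quarticTerm v ν β L Side.left x - quarticTerm v ν β L Side.right x) f) n

/-! ### The eigenvalue shift -/

/-- The series of the matrix element `(L_3 f | (L_bg - iε)⁻¹ L_3 f)` converges absolutely. -/
def GoldenRuleSummable (v : E → ℝ) (ν β L ε : ℝ) (f : State) : Prop :=
  Summable fun n : Config => (starRingEnd ℂ) (cubicLiouvillean v ν β L f n) *
    bogResolvent v ν L ε (cubicLiouvillean v ν β L f) n

/-- The Golden Rule term `(L_3 f | (L_bg - iε)⁻¹ L_3 f)`. -/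
def goldenRule (v : E → ℝ) (ν β L ε : ℝ) (f : State) : ℂ :=
  braket (cubicLiouvillean v ν β L f) (bogResolvent v ν L ε (cubicLiouvillean v ν β L f))

/-- The Feynman--Hellmann term `(f | L_4 f)`. -/
def feynmanHellmann (v : E → ℝ) (ν β L : ℝ) (f : State) : ℂ :=
  braket f (quarticLiouvillean v ν β L f)

/-- The finite volume expression for the shift at `ε > 0`, with the vacuum part subtracted. -/
def shiftBracket (v : E → ℝ) (ν β ε L : ℝ) (k : Xi) : ℂ :=
  feynmanHellmann v ν β L (quasi k) - goldenRule v ν β L ε (quasi k)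
    - feynmanHellmann v ν β L vac + goldenRule v ν β L ε vac

/-- The thermodynamic limit at momentum `k`: the side `L` tends to infinity and the lattice
momentum `(2π/L) m` tends to `k`. Where `k` itself belongs to the lattice, `(2π/L) m = k` is
allowed. -/
def thermodynamicLimit (k : E) : Filter (ℝ × Xi) :=
  comap Prod.fst atTop ⊓ comap (fun x => mom x.1 x.2.1) (𝓝 k)

/-- `ξ` is the order-`κ` eigenvalue shift at momentum `k`: first the thermodynamic limit at fixed
`ε > 0`, then `ε ↘ 0`. -/
def IsEigenvalueShift (v : E → ℝ) (ν β : ℝ) (k : E) (ξ : ℂ) : Prop :=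
  ∃ I : ℝ → ℂ,
    (∀ ε : ℝ, 0 < ε →
      Tendsto (fun x : ℝ × Xi => shiftBracket v ν β ε x.1 x.2) (thermodynamicLimit k) (𝓝 (I ε))) ∧
    Tendsto I (𝓝[>] 0) (𝓝 ξ)

end BoseGas

end

/-!
The shift is computed by expanding everything in ladder operators.

**Finite volume.** With `θ(t) = t / √(2 ω(t))` the Bogoliubov coefficients are `(θ⁻¹ ± θ) / 2`, and
`a_k` becomes a combination of four ladder operators which change the total momentum by the same
amount. The cubic Liouvillean is thus a sum over triples of ladder operators with total charge zero,
and summing over the rearrangements of a triple turns the coefficient into `j` times a *difference*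
of two products of thermal weights, one from the left and one from the right Hamiltonian
(`kern_symmetrize`). Two triples connect the same basis vectors only if they are rearrangements of
each other, so the Golden Rule term is one sum over triples (`goldenRule_basisVec`). It converges
absolutely although `v̂` is only known to be square integrable: the lower bound on `slopeFun` limits
the rate at which `v̂` can decrease, so that sums over the lattice can be compared with integrals
(`summable_decay`).

Exchanging left and right preserves the vacuum and `Ψ_k`. It reverses the sign of the quartic
Liouvillean, whose diagonal elements therefore vanish, and it pairs triples of opposite energy
change, so that of the resolvent only `i` times a Lorentzian survives (`goldenRule_eq`). In the
difference of the two Golden Rule terms only those triples remain which act on a mode of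
momentum `k`. All but boundedly many of them do so with exactly one member
(`shiftBracket_eq_tsum`).

**Thermodynamic limit.** The remaining sums over the lattice are integrals of step functions, and
dominated convergence yields sixteen integrals, labelled by the types of the three operators and by
the side of the first one (`tendsto_shiftBracket`).

**Removal of the regularization.** If all three operators create, then on the energy shell the two
products of thermal weights coincide. This is detailed balance: in `ε (P - Q)² / (g² + ε²)`
the numerator is `O(g²)`, so these processes vanish as `ε ↘ 0` (`tendsto_channel_same`). If the
quasiparticle is annihilated, there are four choices of types up to the exchange of left and right:
one cannot conserve energy (`tendsto_channel_nonresonant`), one gives Beliaev damping, and two give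
Landau damping. A Lorentzian
is a superposition of the windows which define the delta function (`lorentz_eq_integral`), so the
existence of a rate as a window limit implies convergence to `π` times it
(`tendsto_integral_lorentz`).

**Existence of the rates.** In the bipolar coordinates `y = ‖p‖`, `z = ‖p - k‖` the shell is a level
set of `±ω(y) + ω(z)`. Since `ω` has finitely many stationary points, it takes each value finitely
often, so both group velocities vanish at a point of the shell only for finitely many `‖k‖`,
the `resonantLengths`, which do not involve `β`. Otherwise
`ω'(y)² + ω'(z)²` is bounded below in terms of `y` near the shell. One splits the integrand in
proportion to the two squares and slices each part in the variable whose group velocity controls it;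
in one variable, windows around a level are understood by monotonicity between stationary points
(`exists_tendsto_slices`, `exists_tendsto_shell`). The domination needs the integrand to be bounded
near the points of the shell with a soft quasiparticle, where the thermal weights are singular:
there the two leading terms of `j` cancel (`exists_amp_sq_le_soft`).
-/

noncomputable section

namespace BoseGas

open MeasureTheory Filter Topology Set

variable {v : E → ℝ} {V ν β L : ℝ}

/-! ### The radial profile of the transform -/

theorem vhat_comp_isometry (hv : IsAdmissible v V) (R : E ≃ₗᵢ[ℝ] E) (p : E) :
    vhat v (R p) = vhat v p := by
  unfold vhat
  congr 1
  rw [← (LinearIsometryEquiv.measurePreserving R).integral_comp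
    R.toHomeomorph.measurableEmbedding]
  refine integral_congr_ae ?_
  filter_upwards [hv.rotationInvariant R] with x hx
  rw [hx, LinearIsometryEquiv.inner_map_map]

theorem vhat_eq_radial (hv : IsAdmissible v V) (p : E) : vhat v p = vhatRadial v ‖p‖ := by
  have h : ‖‖p‖ • EuclideanSpace.single (0 : Fin 3) (1 : ℝ)‖ = ‖p‖ := by
    rw [norm_smul]; simp
  have := Submodule.reflection_sub h
  unfold vhatRadial
  conv_lhs => rw [← this]
  exact vhat_comp_isometry hv _ _

theorem vhatRadial_zero : vhatRadial v 0 = vhat v 0 := by simp [vhatRadial]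

theorem abs_vhat_le (p : E) : |vhat v p| ≤ ∫ x, |v x| := by
  unfold vhat
  refine (Complex.abs_re_le_norm _).trans ((norm_integral_le_integral_norm _).trans (le_of_eq ?_))
  refine integral_congr_ae (Eventually.of_forall fun x => ?_)
  have : -(Complex.I * ((inner ℝ p x : ℝ) : ℂ)) = ((-(inner ℝ p x) : ℝ) : ℂ) * Complex.I := by
    push_cast; ring
  simp only [norm_mul]
  rw [this, Complex.norm_exp_ofReal_mul_I]
  simp

theorem exists_abs_vhatRadial_le (v : E → ℝ) :
    ∃ M, 0 < M ∧ ∀ t, |vhatRadial v t| ≤ M := by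
  refine ⟨(∫ x, |v x|) + 1, ?_, fun t => (abs_vhat_le _).trans (by linarith)⟩
  have : 0 ≤ ∫ x, |v x| := integral_nonneg fun x => abs_nonneg _
  linarith

theorem contDiff_vhatRadial (hv : IsAdmissible v V) : ContDiff ℝ 1 (vhatRadial v) := by
  unfold vhatRadial
  exact hv.contDiff.comp (contDiff_id.smul contDiff_const)

theorem continuous_vhatRadial (hv : IsAdmissible v V) : Continuous (vhatRadial v) :=
  (contDiff_vhatRadial hv).continuous

theorem continuous_deriv_vhatRadial (hv : IsAdmissible v V) :
    Continuous (deriv (vhatRadial v)) :=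
  (contDiff_vhatRadial hv).continuous_deriv le_rfl

theorem hasDerivAt_vhatRadial (hv : IsAdmissible v V) (t : ℝ) :
    HasDerivAt (vhatRadial v) (deriv (vhatRadial v) t) t :=
  ((contDiff_vhatRadial hv).differentiable (by norm_num) t).hasDerivAt

theorem continuous_slopeFun (hv : IsAdmissible v V) : Continuous (slopeFun v ν) := by
  have h1 := continuous_vhatRadial hv
  have h2 := continuous_deriv_vhatRadial hv
  unfold slopeFun
  fun_prop

/-! ### The dispersion relation as a function of the length of the momentum -/

/-- The ratio `(ω(t)/t)² = t²/4 + ν v̂(t)/v̂(0)`. -/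
def dispRatio (v : E → ℝ) (ν t : ℝ) : ℝ := t ^ 2 / 4 + ν * vhatRadial v t / vhat v 0

/-- The Bogoliubov dispersion relation as a function of the length of the momentum. -/
def disp (v : E → ℝ) (ν t : ℝ) : ℝ := t * √(dispRatio v ν t)

theorem continuous_dispRatio (hv : IsAdmissible v V) : Continuous (dispRatio v ν) := by
  have h1 := continuous_vhatRadial hv
  unfold dispRatio
  fun_prop

theorem continuous_disp (hv : IsAdmissible v V) : Continuous (disp v ν) := by
  have h1 := continuous_dispRatio (ν := ν) hv
  unfold disp
  fun_prop

theorem dispRatio_pos (hv : IsAdmissible v V) (hν : ν ∈ Ioc 0 V) {t : ℝ} (ht : 0 ≤ t) :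
    0 < dispRatio v ν t := by
  have h0 := hv.vhat_zero_pos
  unfold dispRatio
  rcases ht.eq_or_lt with rfl | ht
  · rw [vhatRadial_zero, mul_div_assoc, div_self h0.ne']
    have := hν.1
    positivity
  · have hk : t • EuclideanSpace.single (0 : Fin 3) (1 : ℝ) ≠ 0 := by
      simp [ht.ne']
    have h := hv.stable ν hν _ hk
    have hn : ‖t • EuclideanSpace.single (0 : Fin 3) (1 : ℝ)‖ = t := by
      rw [norm_smul]; simp [abs_of_pos ht]
    rw [hn] at h
    change _ < vhatRadial v t at h
    have hν0 := hν.1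
    have : t ^ 2 / 4 + ν * vhatRadial v t / vhat v 0
        = ν / vhat v 0 * (vhatRadial v t + vhat v 0 * (t ^ 2 / (4 * ν))) := by
      field_simp; ring
    rw [this]
    have : 0 < vhatRadial v t + vhat v 0 * (t ^ 2 / (4 * ν)) := by linarith
    positivity

theorem disp_pos (hv : IsAdmissible v V) (hν : ν ∈ Ioc 0 V) {t : ℝ} (ht : 0 < t) :
    0 < disp v ν t :=
  mul_pos ht (Real.sqrt_pos.2 (dispRatio_pos hv hν ht.le))

theorem disp_nonneg {t : ℝ} (ht : 0 ≤ t) : 0 ≤ disp v ν t :=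
  mul_nonneg ht (Real.sqrt_nonneg _)

theorem disp_sq (hv : IsAdmissible v V) (hν : ν ∈ Ioc 0 V) {t : ℝ} (ht : 0 ≤ t) :
    disp v ν t ^ 2 = t ^ 2 * dispRatio v ν t := by
  unfold disp
  rw [mul_pow, Real.sq_sqrt (dispRatio_pos hv hν ht).le]

theorem omega_eq_disp (hv : IsAdmissible v V) (p : E) :
    omega v ν p = disp v ν ‖p‖ := by
  unfold omega disp
  rw [vhat_eq_radial hv p]
  have : ‖p‖ ^ 4 / 4 + ν * vhatRadial v ‖p‖ / vhat v 0 * ‖p‖ ^ 2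
      = ‖p‖ ^ 2 * dispRatio v ν ‖p‖ := by unfold dispRatio; ring
  rw [this, Real.sqrt_mul (sq_nonneg _), Real.sqrt_sq (norm_nonneg p)]

/-- The dispersion relation is linear at small and quadratic at large momenta. -/
theorem exists_disp_bounds (hv : IsAdmissible v V) (hν : ν ∈ Ioc 0 V) :
    ∃ c C : ℝ, 0 < c ∧ 0 < C ∧ ∀ t, 0 ≤ t →
      c * (t * (1 + t)) ≤ disp v ν t ∧ disp v ν t ≤ C * (t * (1 + t)) := by
  obtain ⟨M, hM, hb⟩ := exists_abs_vhatRadial_le v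
  have h0 := hv.vhat_zero_pos
  have hν0 := hν.1
  set N : ℝ := ν * M / vhat v 0 with hN
  have hN0 : 0 < N := by positivity
  have hy : ∀ t, |ν * vhatRadial v t / vhat v 0| ≤ N := by
    intro t
    rw [abs_div, abs_mul, abs_of_pos h0, abs_of_pos hν0, hN]
    gcongr
    exact hb t
  obtain ⟨x, hx, hmin⟩ := (isCompact_Icc (a := (0 : ℝ)) (b := 4 + 8 * N)).exists_isMinOn
    ⟨0, by constructor <;> positivity⟩ (continuous_dispRatio (ν := ν) hv).continuousOn
  have hm := dispRatio_pos hv hν hx.1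
  set m := dispRatio v ν x
  set T := 4 + 8 * N
  have hlow : ∃ c, 0 < c ∧ ∀ t, 0 ≤ t → c ^ 2 * (1 + t) ^ 2 ≤ dispRatio v ν t := by
    refine ⟨min (√m / (1 + T)) (1 / 4), by positivity, fun t ht => ?_⟩
    by_cases htT : t ≤ T
    · have h1 : m ≤ dispRatio v ν t := hmin ⟨ht, htT⟩
      refine le_trans ?_ h1
      have hT : (1 + t) ≤ 1 + T := by linarith
      calc (min (√m / (1 + T)) (1 / 4)) ^ 2 * (1 + t) ^ 2
          ≤ (√m / (1 + T)) ^ 2 * (1 + T) ^ 2 := by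
            gcongr
            exact min_le_left _ _
        _ = m := by
            have : (1 + T) ≠ 0 := by positivity
            field_simp
            exact Real.sq_sqrt hm.le
    · have h1 := (abs_le.1 (hy t)).1
      have h2 : (min (√m / (1 + T)) (1 / 4)) ^ 2 * (1 + t) ^ 2 ≤ (1 / 4) ^ 2 * (1 + t) ^ 2 := by
        gcongr
        exact min_le_right _ _
      unfold dispRatio
      have h3 : 4 + 8 * N < t := not_le.1 htT
      nlinarith
  obtain ⟨c, hc, hlow⟩ := hlow
  refine ⟨c, 1 + √N, hc, by positivity, fun t ht => ⟨?_, ?_⟩⟩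
  · unfold disp
    have : c * (1 + t) ≤ √(dispRatio v ν t) := by
      refine Real.le_sqrt_of_sq_le ?_
      rw [mul_pow]; exact hlow t ht
    nlinarith
  · unfold disp
    have : √(dispRatio v ν t) ≤ (1 + √N) * (1 + t) := by
      refine Real.sqrt_le_iff.2 ⟨by positivity, ?_⟩
      unfold dispRatio
      have h1 := (abs_le.1 (hy t)).2
      have h2 := Real.sq_sqrt hN0.le
      have h3 := Real.sqrt_nonneg N
      nlinarith [mul_nonneg h3 ht, mul_nonneg (mul_nonneg h3 h3) ht, sq_nonneg t,
        mul_nonneg h3 (sq_nonneg t), mul_nonneg (mul_nonneg h3 h3) (sq_nonneg t)]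
    nlinarith

theorem hasDerivAt_disp (hv : IsAdmissible v V) (hν : ν ∈ Ioc 0 V) {t : ℝ} (ht : 0 < t) :
    HasDerivAt (disp v ν) (ν * t * slopeFun v ν t / disp v ν t) t := by
  have h0 := hv.vhat_zero_pos
  have hν0 := hν.1
  have hr := dispRatio_pos hv hν ht.le
  have h1 : HasDerivAt (dispRatio v ν) (2 * t / 4 + ν * deriv (vhatRadial v) t / vhat v 0) t := by
    unfold dispRatio
    have := (((hasDerivAt_id t).pow 2).div_const 4).add
      (((hasDerivAt_vhatRadial hv t).const_mul ν).div_const (vhat v 0))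
    exact this.congr_deriv (by simp)
  have h2 := (hasDerivAt_id t).mul (h1.sqrt hr.ne')
  unfold disp
  refine HasDerivAt.congr_deriv h2 ?_
  have hs : √(dispRatio v ν t) ≠ 0 := (Real.sqrt_pos.2 hr).ne'
  have hsq := Real.sq_sqrt hr.le
  simp only [id]
  field_simp
  rw [hsq]
  unfold dispRatio slopeFun
  field_simp
  ring

theorem continuousOn_disp_deriv (hv : IsAdmissible v V) (hν : ν ∈ Ioc 0 V) :
    ContinuousOn (fun t => ν * t * slopeFun v ν t / disp v ν t) (Ioi 0) := by
  have h1 := continuous_slopeFun (ν := ν) hv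
  have h2 := continuous_disp (ν := ν) hv
  exact ContinuousOn.div (by fun_prop) h2.continuousOn fun t ht => (disp_pos hv hν ht).ne'

/-! ### Bogoliubov coefficients -/

/-- The difference `c_t - s_t = t / √(2ω(t))` of the Bogoliubov coefficients; its inverse is
`c_t + s_t`. -/
def theta (v : E → ℝ) (ν t : ℝ) : ℝ := t / √(2 * disp v ν t)

theorem theta_pos (hv : IsAdmissible v V) (hν : ν ∈ Ioc 0 V) {t : ℝ} (ht : 0 < t) :
    0 < theta v ν t := by
  have := disp_pos hv hν ht
  unfold theta
  positivity

theorem theta_sq (hv : IsAdmissible v V) (hν : ν ∈ Ioc 0 V) {t : ℝ} (ht : 0 < t) :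
    theta v ν t ^ 2 = t ^ 2 / (2 * disp v ν t) := by
  have := disp_pos hv hν ht
  unfold theta
  rw [div_pow, Real.sq_sqrt (by positivity)]

theorem continuousOn_theta (hv : IsAdmissible v V) (hν : ν ∈ Ioc 0 V) :
    ContinuousOn (theta v ν) (Ioi 0) := by
  have h2 := continuous_disp (ν := ν) hv
  unfold theta
  refine ContinuousOn.div (by fun_prop) (by fun_prop) fun t ht => ?_
  have := disp_pos hv hν ht
  positivity

theorem bog_sqrt (hv : IsAdmissible v V) (hν : ν ∈ Ioc 0 V) {p : E} (hp : p ≠ 0) :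
    √(omega v ν p ^ 2 + ν ^ 2 * (vhat v p ^ 2 / vhat v 0 ^ 2))
      = ‖p‖ ^ 2 / 2 + ν * vhat v p / vhat v 0 := by
  have hn : 0 < ‖p‖ := norm_pos_iff.2 hp
  have h1 := dispRatio_pos hv hν hn.le
  rw [omega_eq_disp hv, disp_sq hv hν hn.le]
  unfold dispRatio at *
  rw [← vhat_eq_radial hv] at *
  refine (Real.sqrt_eq_iff_mul_self_eq (by positivity) (by nlinarith)).2 ?_
  ring

/-- A quotient of square roots whose square is known is known. -/
theorem sqrt_div_sqrt_eq {a b x : ℝ} (hb : 0 < b) (hx : 0 ≤ x) (h : x ^ 2 * b = a) :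
    √a / √b = x := by
  rw [← Real.sqrt_div' _ hb.le, ← h, mul_div_assoc, div_self hb.ne', mul_one, Real.sqrt_sq hx]

theorem bogC_eq (hv : IsAdmissible v V) (hν : ν ∈ Ioc 0 V) {p : E} (hp : p ≠ 0) :
    bogC v ν p = ((theta v ν ‖p‖)⁻¹ + theta v ν ‖p‖) / 2 := by
  have hn : 0 < ‖p‖ := norm_pos_iff.2 hp
  have hθ := theta_pos hv hν hn
  have hw := disp_pos hv hν hn
  have hw2 := disp_sq hv hν hn.le
  unfold bogC
  rw [bog_sqrt hv hν hp, omega_eq_disp hv]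
  refine sqrt_div_sqrt_eq (by positivity) (by positivity) ?_
  have : (((theta v ν ‖p‖)⁻¹ + theta v ν ‖p‖) / 2) ^ 2
      = ((theta v ν ‖p‖ ^ 2)⁻¹ + 2 + theta v ν ‖p‖ ^ 2) / 4 := by
    field_simp; ring
  rw [this, theta_sq hv hν hn]
  unfold dispRatio at hw2
  rw [← vhat_eq_radial hv] at hw2
  field_simp
  have h0 := hv.vhat_zero_pos
  field_simp at hw2 ⊢
  linarith

theorem bogS_eq (hv : IsAdmissible v V) (hν : ν ∈ Ioc 0 V) {p : E} (hp : p ≠ 0) :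
    bogS v ν p = ((theta v ν ‖p‖)⁻¹ - theta v ν ‖p‖) / 2 := by
  have hn : 0 < ‖p‖ := norm_pos_iff.2 hp
  have hθ := theta_pos hv hν hn
  have hw := disp_pos hv hν hn
  have hw2 := disp_sq hv hν hn.le
  have h0 := hv.vhat_zero_pos
  have hν0 := hν.1
  unfold dispRatio at hw2
  rw [← vhat_eq_radial hv] at hw2
  field_simp at hw2
  have hθ2 := theta_sq hv hν hn
  have hsq : ∀ x : ℝ, x ^ 2 = (((theta v ν ‖p‖)⁻¹ - theta v ν ‖p‖) / 2) ^ 2 →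
      x ^ 2 * (2 * disp v ν ‖p‖) = ‖p‖ ^ 2 / 2 + ν * vhat v p / vhat v 0 - disp v ν ‖p‖ := by
    intro x hx
    have : (((theta v ν ‖p‖)⁻¹ - theta v ν ‖p‖) / 2) ^ 2
        = ((theta v ν ‖p‖ ^ 2)⁻¹ - 2 + theta v ν ‖p‖ ^ 2) / 4 := by
      field_simp; ring
    rw [hx, this, theta_sq hv hν hn]
    field_simp
    linarith
  have hs : ((theta v ν ‖p‖)⁻¹ - theta v ν ‖p‖) / 2
      = (1 - theta v ν ‖p‖ ^ 2) / (2 * theta v ν ‖p‖) := by field_simp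
  have key : (2 * disp v ν ‖p‖ - ‖p‖ ^ 2) * ((2 * disp v ν ‖p‖ + ‖p‖ ^ 2) * vhat v 0)
      = 4 * ‖p‖ ^ 2 * (ν * vhat v p) := by nlinarith
  unfold bogS
  rw [bog_sqrt hv hν hp, omega_eq_disp hv]
  rcases lt_trichotomy (vhat v p) 0 with hneg | hz | hpos
  · have hle : 1 - theta v ν ‖p‖ ^ 2 ≤ 0 := by
      rw [hθ2, sub_nonpos, one_le_div (by positivity)]
      by_contra hcon
      have : 0 < (2 * disp v ν ‖p‖ - ‖p‖ ^ 2) * ((2 * disp v ν ‖p‖ + ‖p‖ ^ 2) * vhat v 0) :=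
        mul_pos (by linarith) (by positivity)
      rw [key] at this
      nlinarith [mul_pos hν0 (pow_pos hn 2), mul_neg_of_pos_of_neg (mul_pos hν0 (pow_pos hn 2)) hneg]
    rw [Real.sign_of_neg hneg, sqrt_div_sqrt_eq
      (x := -(((theta v ν ‖p‖)⁻¹ - theta v ν ‖p‖) / 2)) (by positivity) ?_ (hsq _ (by ring))]
    · ring
    · rw [hs, ← neg_div]
      exact div_nonneg (by linarith) (by positivity)
  · have : theta v ν ‖p‖ ^ 2 = 1 := by
      rw [hθ2, div_eq_one_iff_eq (by positivity)]
      rw [hz] at key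
      have h3 : (2 * disp v ν ‖p‖ + ‖p‖ ^ 2) * vhat v 0 ≠ 0 := by positivity
      have := mul_eq_zero.1 (key.trans (by ring))
      rcases this with h | h
      · linarith
      · exact absurd h h3
    rw [hs, this, hz]
    simp
  · have hle : 0 ≤ 1 - theta v ν ‖p‖ ^ 2 := by
      rw [hθ2, sub_nonneg, div_le_one (by positivity)]
      by_contra hcon
      have : (2 * disp v ν ‖p‖ - ‖p‖ ^ 2) * ((2 * disp v ν ‖p‖ + ‖p‖ ^ 2) * vhat v 0) < 0 :=
        mul_neg_of_neg_of_pos (by linarith) (by positivity)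
      rw [key] at this
      have : 0 < 4 * ‖p‖ ^ 2 * (ν * vhat v p) := by positivity
      linarith
    rw [Real.sign_of_pos hpos, sqrt_div_sqrt_eq
      (x := (((theta v ν ‖p‖)⁻¹ - theta v ν ‖p‖) / 2)) (by positivity) ?_ (hsq _ rfl)]
    · ring
    · rw [hs]
      exact div_nonneg hle (by positivity)

/-- `θ(t)²` is comparable to `t/(1+t)`. -/
theorem exists_theta_bounds (hv : IsAdmissible v V) (hν : ν ∈ Ioc 0 V) :
    ∃ c C : ℝ, 0 < c ∧ 0 < C ∧ ∀ t, 0 < t →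
      c * (t / (1 + t)) ≤ theta v ν t ^ 2 ∧ theta v ν t ^ 2 ≤ C * (t / (1 + t)) := by
  obtain ⟨c, C, hc, hC, h⟩ := exists_disp_bounds hv hν
  refine ⟨(2 * C)⁻¹, (2 * c)⁻¹, by positivity, by positivity, fun t ht => ?_⟩
  obtain ⟨h1, h2⟩ := h t ht.le
  have hw := disp_pos hv hν ht
  rw [theta_sq hv hν ht]
  constructor
  · rw [inv_mul_eq_div, div_div, div_le_div_iff₀ (by positivity) (by positivity)]
    nlinarith [mul_le_mul_of_nonneg_left h2 ht.le]
  · rw [inv_mul_eq_div, div_div, div_le_div_iff₀ (by positivity) (by positivity)]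
    nlinarith [mul_le_mul_of_nonneg_left h1 ht.le]

/-- The coefficient `s_t` decays at large momenta. -/
theorem exists_abs_one_sub_theta_sq_le (hv : IsAdmissible v V) (hν : ν ∈ Ioc 0 V) :
    ∃ C : ℝ, 0 < C ∧ ∀ t, 0 < t → |1 - theta v ν t ^ 2| ≤ C / t ^ 2 := by
  obtain ⟨c, C, hc, hC, h⟩ := exists_disp_bounds hv hν
  obtain ⟨M, hM, hb⟩ := exists_abs_vhatRadial_le v
  have h0 := hv.vhat_zero_pos
  have hν0 := hν.1
  refine ⟨2 * (ν * M / vhat v 0) / c, by positivity, fun t ht => ?_⟩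
  obtain ⟨h1, -⟩ := h t ht.le
  have hw := disp_pos hv hν ht
  have hw2 := disp_sq hv hν ht.le
  have e : 1 - theta v ν t ^ 2
      = 2 * (ν * vhatRadial v t / vhat v 0) * t ^ 2
        / (disp v ν t * (2 * disp v ν t + t ^ 2)) := by
    rw [theta_sq hv hν ht]
    unfold dispRatio at hw2
    field_simp
    field_simp at hw2
    linarith
  rw [e, abs_div, abs_of_pos (by positivity : 0 < disp v ν t * (2 * disp v ν t + t ^ 2)),
    abs_mul, abs_mul, abs_div, abs_mul, abs_of_pos h0, abs_of_pos hν0,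
    abs_of_pos (by positivity : 0 < t ^ 2), abs_two, div_div, div_le_div_iff₀ (by positivity)
    (by positivity)]
  have h3 : c * t ^ 2 ≤ disp v ν t := by nlinarith
  have h4 : c * t ^ 2 * t ^ 2 ≤ disp v ν t * (2 * disp v ν t + t ^ 2) := by
    have : c * t ^ 2 * t ^ 2 ≤ disp v ν t * t ^ 2 := by gcongr
    nlinarith
  calc 2 * (ν * |vhatRadial v t| / vhat v 0) * t ^ 2 * (c * t ^ 2)
      ≤ 2 * (ν * M / vhat v 0) * t ^ 2 * (c * t ^ 2) := by gcongr; exact hb t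
    _ = 2 * (ν * M / vhat v 0) * (c * t ^ 2 * t ^ 2) := by ring
    _ ≤ _ := by gcongr

/-! ### Thermal weights -/

/-- The coefficients of the Araki--Woods operators as functions of the length of the momentum:
`(1 - e^{-βω})^{-1/2} = √(1+ρ)` for `true` and `(e^{βω} - 1)^{-1/2} = √ρ` for `false`. -/
def therm (v : E → ℝ) (ν β : ℝ) (s : Bool) (t : ℝ) : ℝ :=
  if s then (√(1 - Real.exp (-(β * disp v ν t))))⁻¹ else (√(Real.exp (β * disp v ν t) - 1))⁻¹

theorem therm_pos (hv : IsAdmissible v V) (hν : ν ∈ Ioc 0 V) (hβ : 0 < β) (s : Bool) {t : ℝ}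
    (ht : 0 < t) : 0 < therm v ν β s t := by
  have hw := mul_pos hβ (disp_pos hv hν ht)
  have h1 : 1 < Real.exp (β * disp v ν t) := Real.one_lt_exp_iff.2 hw
  have h2 : Real.exp (-(β * disp v ν t)) < 1 := by rw [← Real.exp_zero]; exact Real.exp_lt_exp.2 (by linarith)
  unfold therm
  cases s
  · simp only [Bool.false_eq_true, if_false]
    exact inv_pos.2 (Real.sqrt_pos.2 (by linarith))
  · simp only [if_true]
    exact inv_pos.2 (Real.sqrt_pos.2 (by linarith))

theorem therm_nonneg (s : Bool) (t : ℝ) : 0 ≤ therm v ν β s t := by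
  unfold therm
  split_ifs <;> positivity

theorem therm_false_sq (hv : IsAdmissible v V) (hν : ν ∈ Ioc 0 V) (hβ : 0 < β) {t : ℝ}
    (ht : 0 < t) : therm v ν β false t ^ 2 = (Real.exp (β * disp v ν t) - 1)⁻¹ := by
  have h1 : 1 < Real.exp (β * disp v ν t) := Real.one_lt_exp_iff.2 (mul_pos hβ (disp_pos hv hν ht))
  simp only [therm, Bool.false_eq_true, if_false]
  rw [inv_pow, Real.sq_sqrt (by linarith)]

theorem therm_true_eq (β : ℝ) (t : ℝ) :
    therm v ν β true t = Real.exp (β * disp v ν t / 2) * therm v ν β false t := by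
  simp only [therm, Bool.false_eq_true, if_false, if_true]
  set X := β * disp v ν t
  have h : Real.exp X - 1 = Real.exp (X / 2) ^ 2 * (1 - Real.exp (-X)) := by
    rw [← Real.exp_nat_mul, mul_sub, mul_one, ← Real.exp_add]
    congr 1
    · congr 1; push_cast; ring
    · rw [← Real.exp_zero]; congr 1; push_cast; ring
  rw [h, Real.sqrt_mul (sq_nonneg _), Real.sqrt_sq (Real.exp_pos _).le, mul_inv, ← mul_assoc,
    mul_inv_cancel₀ (Real.exp_pos _).ne', one_mul]

theorem therm_true_sq (hv : IsAdmissible v V) (hν : ν ∈ Ioc 0 V) (hβ : 0 < β) {t : ℝ}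
    (ht : 0 < t) : therm v ν β true t ^ 2 = 1 + therm v ν β false t ^ 2 := by
  have h1 : 1 < Real.exp (β * disp v ν t) := Real.one_lt_exp_iff.2 (mul_pos hβ (disp_pos hv hν ht))
  rw [therm_true_eq, mul_pow, therm_false_sq hv hν hβ ht, ← Real.exp_nat_mul]
  have : ((2 : ℕ) : ℝ) * (β * disp v ν t / 2) = β * disp v ν t := by push_cast; ring
  rw [this]
  have : Real.exp (β * disp v ν t) - 1 ≠ 0 := by linarith
  field_simp
  ring

theorem continuousOn_therm (hv : IsAdmissible v V) (hν : ν ∈ Ioc 0 V) (hβ : 0 < β) (s : Bool) :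
    ContinuousOn (therm v ν β s) (Ioi 0) := by
  have h2 := continuous_disp (ν := ν) hv
  have key : ∀ t ∈ Ioi (0 : ℝ), therm v ν β s t ≠ 0 := fun t ht => (therm_pos hv hν hβ s ht).ne'
  cases s
  · have : ContinuousOn (fun t => √(Real.exp (β * disp v ν t) - 1)) (Ioi 0) :=
      Continuous.continuousOn (by fun_prop)
    refine (this.inv₀ fun t ht h => key t ht ?_).congr fun t _ => by simp [therm]
    simp [therm, h]
  · have : ContinuousOn (fun t => √(1 - Real.exp (-(β * disp v ν t)))) (Ioi 0) :=
      Continuous.continuousOn (by fun_prop)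
    refine (this.inv₀ fun t ht h => key t ht ?_).congr fun t _ => by simp [therm]
    simp [therm, h]

theorem exists_therm_bounds (hv : IsAdmissible v V) (hν : ν ∈ Ioc 0 V) (hβ : 0 < β) :
    ∃ C : ℝ, 0 < C ∧ ∀ t, 0 < t →
      therm v ν β false t ^ 2 ≤ C * ((1 + 1 / t) / (1 + t) ^ 6) ∧
      therm v ν β true t ^ 2 ≤ C * (1 + 1 / t) := by
  obtain ⟨c, C, hc, hC, h⟩ := exists_disp_bounds hv hν
  set D := (β * c) ⁻¹ + 384 * ((β * c) ^ 4)⁻¹ with hD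
  have hβc : 0 < β * c := by positivity
  have hW : ∀ t, 0 < t → therm v ν β false t ^ 2 ≤ 128 * D * ((1 + 1 / t) / (1 + t) ^ 6) := by
    intro t ht
    have hX : β * c * (t * (1 + t)) ≤ β * disp v ν t := by
      rw [mul_assoc]; exact mul_le_mul_of_nonneg_left (h t ht.le).1 hβ.le
    set Y := β * c * (t * (1 + t)) with hY
    have hY0 : 0 < Y := by positivity
    have h1 : Y ≤ Real.exp Y - 1 := by linarith [Real.add_one_le_exp Y]
    have h4 : Y ^ 4 / 24 ≤ Real.exp Y - 1 := by
      have := Real.sum_le_exp_of_nonneg hY0.le 5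
      simp [Finset.sum_range_succ, Nat.factorial] at this
      have h3 : 0 ≤ Y + Y ^ 2 / 2 + Y ^ 3 / 6 := by positivity
      linarith
    have hexp : Real.exp Y - 1 ≤ Real.exp (β * disp v ν t) - 1 := by
      have := Real.exp_le_exp.2 hX
      linarith
    rw [therm_false_sq hv hν hβ ht]
    have hle : (Real.exp (β * disp v ν t) - 1)⁻¹ ≤ (Real.exp Y - 1)⁻¹ :=
      inv_anti₀ (lt_of_lt_of_le hY0 h1) hexp
    refine hle.trans ?_
    rcases le_total t 1 with ht1 | ht1
    · have : (Real.exp Y - 1)⁻¹ ≤ Y⁻¹ := inv_anti₀ hY0 h1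
      refine this.trans ?_
      have e1 : Y⁻¹ ≤ (β * c)⁻¹ * (1 / t) := by
        rw [hY, mul_inv, one_div]
        gcongr
        nlinarith
      have e2 : 1 / t ≤ 128 * ((1 + 1 / t) / (1 + t) ^ 6) := by
        have h6 : (1 + t) ^ 6 ≤ 2 ^ 6 := by gcongr; linarith
        rw [mul_div_assoc', le_div_iff₀ (by positivity)]
        have ht' : 0 < 1 / t := by positivity
        nlinarith
      have hD1 : (β * c)⁻¹ ≤ D := by rw [hD]; linarith [show 0 ≤ 384 * ((β * c) ^ 4)⁻¹ by positivity]
      calc Y⁻¹ ≤ (β * c)⁻¹ * (1 / t) := e1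
        _ ≤ D * (128 * ((1 + 1 / t) / (1 + t) ^ 6)) := by gcongr
        _ = _ := by ring
    · have : (Real.exp Y - 1)⁻¹ ≤ (Y ^ 4 / 24)⁻¹ := inv_anti₀ (by positivity) h4
      refine this.trans ?_
      have hD1 : 24 * ((β * c) ^ 4)⁻¹ * 16 ≤ D := by
        rw [hD]; linarith [inv_pos.2 hβc]
      have e1 : (Y ^ 4 / 24)⁻¹ ≤ 24 * ((β * c) ^ 4)⁻¹ * 16 * (1 / (1 + t) ^ 6) := by
        rw [hY, inv_div, div_eq_mul_inv, mul_pow, mul_inv, mul_assoc, mul_assoc]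
        gcongr
        rw [mul_one_div, inv_le_comm₀ (by positivity) (by positivity), inv_div,
          div_le_iff₀ (by norm_num), mul_pow]
        have : (1 + t) ^ 2 ≤ t ^ 4 * 16 := by nlinarith [sq_nonneg (t ^ 2 - 1), sq_nonneg t]
        calc (1 + t) ^ 6 = (1 + t) ^ 4 * (1 + t) ^ 2 := by ring
          _ ≤ (1 + t) ^ 4 * (t ^ 4 * 16) := by gcongr
          _ = _ := by ring
      calc (Y ^ 4 / 24)⁻¹ ≤ 24 * ((β * c) ^ 4)⁻¹ * 16 * (1 / (1 + t) ^ 6) := e1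
        _ ≤ D * ((1 + 1 / t) / (1 + t) ^ 6) := by
          gcongr
          have : 0 < 1 / t := by positivity
          linarith
        _ ≤ 128 * D * ((1 + 1 / t) / (1 + t) ^ 6) := by
          have : 0 ≤ D * ((1 + 1 / t) / (1 + t) ^ 6) := by positivity
          nlinarith
  have hD0 : 0 < D := by positivity
  refine ⟨128 * D + 1, by positivity, fun t ht => ⟨(hW t ht).trans ?_, ?_⟩⟩
  · have : 0 ≤ (1 + 1 / t) / (1 + t) ^ 6 := by positivity
    nlinarith
  · rw [therm_true_sq hv hν hβ ht]
    have h1 := hW t ht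
    have h2 : (1 + 1 / t) / (1 + t) ^ 6 ≤ 1 + 1 / t :=
      div_le_self (by positivity) (one_le_pow₀ (by linarith))
    have h3 : 1 ≤ 1 + 1 / t := by have : 0 < 1 / t := by positivity
                                  linarith
    nlinarith

/-! ### The amplitude of a three-quasiparticle process -/

/-- The sign `±1` encoded by a Boolean. -/
def sgn (t : Bool) : ℝ := if t then 1 else -1

@[simp] theorem sgn_true : sgn true = 1 := rfl
@[simp] theorem sgn_false : sgn false = -1 := by simp [sgn]
theorem sgn_not (t : Bool) : sgn (!t) = -sgn t := by cases t <;> simp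

/-- The amplitude `j`, stripped of its prefactor, as a function of the lengths of the three momenta
and of the types (created or annihilated) of the three quasiparticles. -/
def amp (v : E → ℝ) (ν : ℝ) (t₁ t₂ t₃ : Bool) (x y z : ℝ) : ℝ :=
  ((vhatRadial v x + vhatRadial v y + vhatRadial v z) * (theta v ν x * theta v ν y * theta v ν z)
    - (vhatRadial v x * theta v ν x ^ 2 * (sgn t₂ * sgn t₃)
      + vhatRadial v y * theta v ν y ^ 2 * (sgn t₁ * sgn t₃)
      + vhatRadial v z * theta v ν z ^ 2 * (sgn t₁ * sgn t₂))
      / (theta v ν x * theta v ν y * theta v ν z)) / 2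

theorem amp_not (t₁ t₂ t₃ : Bool) (x y z : ℝ) :
    amp v ν (!t₁) (!t₂) (!t₃) x y z = amp v ν t₁ t₂ t₃ x y z := by
  unfold amp
  simp only [sgn_not]
  ring

theorem amp_rotate (t₁ t₂ t₃ : Bool) (x y z : ℝ) :
    amp v ν t₂ t₃ t₁ y z x = amp v ν t₁ t₂ t₃ x y z := by
  unfold amp
  have : theta v ν y * theta v ν z * theta v ν x = theta v ν x * theta v ν y * theta v ν z := by
    ring
  rw [this]
  ring

theorem amp_swap (t₁ t₂ t₃ : Bool) (x y z : ℝ) :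
    amp v ν t₂ t₁ t₃ y x z = amp v ν t₁ t₂ t₃ x y z := by
  unfold amp
  have : theta v ν y * theta v ν x * theta v ν z = theta v ν x * theta v ν y * theta v ν z := by
    ring
  rw [this]
  ring

theorem amp_swap_right (t₁ t₂ t₃ : Bool) (x y z : ℝ) :
    amp v ν t₁ t₃ t₂ x z y = amp v ν t₁ t₂ t₃ x y z := by
  unfold amp
  have : theta v ν x * theta v ν z * theta v ν y = theta v ν x * theta v ν y * theta v ν z := by
    ring
  rw [this]
  ring

theorem jAmp_eq (hv : IsAdmissible v V) (hν : ν ∈ Ioc 0 V) {k p q : E} (hk : k ≠ 0) (hp : p ≠ 0)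
    (hq : q ≠ 0) :
    jAmp v ν k p q = √(ν / vhat v 0) * amp v ν false true true ‖k‖ ‖p‖ ‖q‖ := by
  have h1 := (theta_pos hv hν (norm_pos_iff.2 hk)).ne'
  have h2 := (theta_pos hv hν (norm_pos_iff.2 hp)).ne'
  have h3 := (theta_pos hv hν (norm_pos_iff.2 hq)).ne'
  unfold jAmp amp
  rw [bogC_eq hv hν hk, bogC_eq hv hν hp, bogC_eq hv hν hq, bogS_eq hv hν hk, bogS_eq hv hν hp,
    bogS_eq hv hν hq, vhat_eq_radial hv k, vhat_eq_radial hv p, vhat_eq_radial hv q]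
  congr 1
  simp only [sgn_true, sgn_false]
  field_simp
  ring

theorem continuousOn_amp (hv : IsAdmissible v V) (hν : ν ∈ Ioc 0 V) (t₁ t₂ t₃ : Bool) :
    ContinuousOn (fun u : ℝ × ℝ × ℝ => amp v ν t₁ t₂ t₃ u.1 u.2.1 u.2.2)
      (Ioi 0 ×ˢ Ioi 0 ×ˢ Ioi 0) := by
  have hV := continuous_vhatRadial hv
  have hθ := continuousOn_theta hv hν
  have h1 : ContinuousOn (fun u : ℝ × ℝ × ℝ => theta v ν u.1) (Ioi 0 ×ˢ Ioi 0 ×ˢ Ioi 0) :=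
    hθ.comp continuousOn_fst fun u hu => hu.1
  have h2 : ContinuousOn (fun u : ℝ × ℝ × ℝ => theta v ν u.2.1) (Ioi 0 ×ˢ Ioi 0 ×ˢ Ioi 0) :=
    hθ.comp (by fun_prop) fun u hu => hu.2.1
  have h3 : ContinuousOn (fun u : ℝ × ℝ × ℝ => theta v ν u.2.2) (Ioi 0 ×ˢ Ioi 0 ×ˢ Ioi 0) :=
    hθ.comp (by fun_prop) fun u hu => hu.2.2
  have hV1 : ContinuousOn (fun u : ℝ × ℝ × ℝ => vhatRadial v u.1) (Ioi 0 ×ˢ Ioi 0 ×ˢ Ioi 0) :=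
    Continuous.continuousOn (by fun_prop)
  have hV2 : ContinuousOn (fun u : ℝ × ℝ × ℝ => vhatRadial v u.2.1) (Ioi 0 ×ˢ Ioi 0 ×ˢ Ioi 0) :=
    Continuous.continuousOn (by fun_prop)
  have hV3 : ContinuousOn (fun u : ℝ × ℝ × ℝ => vhatRadial v u.2.2) (Ioi 0 ×ˢ Ioi 0 ×ˢ Ioi 0) :=
    Continuous.continuousOn (by fun_prop)
  unfold amp
  refine ContinuousOn.div_const (ContinuousOn.sub (by fun_prop)
    (ContinuousOn.div (by fun_prop) (by fun_prop) fun u hu => ?_)) _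
  have a1 := theta_pos hv hν hu.1
  have a2 := theta_pos hv hν hu.2.1
  have a3 := theta_pos hv hν hu.2.2
  positivity

/-- The difference of the thermal weights with which the left and the right Hamiltonian contribute
to a process. -/
def mixing (v : E → ℝ) (ν β : ℝ) (s₁ s₂ s₃ : Bool) (x y z : ℝ) : ℝ :=
  therm v ν β s₁ x * therm v ν β s₂ y * therm v ν β s₃ z
    - therm v ν β (!s₁) x * therm v ν β (!s₂) y * therm v ν β (!s₃) z

/-- The sum of the thermal weights with which the left and the right Hamiltonian contribute
to a process. -/
def mixingSum (v : E → ℝ) (ν β : ℝ) (s₁ s₂ s₃ : Bool) (x y z : ℝ) : ℝ :=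
  therm v ν β s₁ x * therm v ν β s₂ y * therm v ν β s₃ z
    + therm v ν β (!s₁) x * therm v ν β (!s₂) y * therm v ν β (!s₃) z

theorem mixing_not (s₁ s₂ s₃ : Bool) (x y z : ℝ) :
    mixing v ν β (!s₁) (!s₂) (!s₃) x y z = -mixing v ν β s₁ s₂ s₃ x y z := by
  unfold mixing
  simp only [Bool.not_not]
  ring

theorem mixing_sq_le (s₁ s₂ s₃ : Bool) (x y z : ℝ) :
    mixing v ν β s₁ s₂ s₃ x y z ^ 2 ≤ mixingSum v ν β s₁ s₂ s₃ x y z ^ 2 := by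
  have h := fun s t => therm_nonneg (v := v) (ν := ν) (β := β) s t
  have h1 := mul_nonneg (mul_nonneg (h s₁ x) (h s₂ y)) (h s₃ z)
  have h2 := mul_nonneg (mul_nonneg (h (!s₁) x) (h (!s₂) y)) (h (!s₃) z)
  unfold mixing mixingSum
  linarith [mul_nonneg h1 h2]

theorem continuousOn_mixing (hv : IsAdmissible v V) (hν : ν ∈ Ioc 0 V) (hβ : 0 < β)
    (s₁ s₂ s₃ : Bool) :
    ContinuousOn (fun u : ℝ × ℝ × ℝ => mixing v ν β s₁ s₂ s₃ u.1 u.2.1 u.2.2)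
      (Ioi 0 ×ˢ Ioi 0 ×ˢ Ioi 0) := by
  have h := continuousOn_therm hv hν hβ
  have h1 : ∀ s, ContinuousOn (fun u : ℝ × ℝ × ℝ => therm v ν β s u.1) (Ioi 0 ×ˢ Ioi 0 ×ˢ Ioi 0) :=
    fun s => (h s).comp continuousOn_fst fun u hu => hu.1
  have h2 : ∀ s, ContinuousOn (fun u : ℝ × ℝ × ℝ => therm v ν β s u.2.1)
      (Ioi 0 ×ˢ Ioi 0 ×ˢ Ioi 0) := fun s => (h s).comp (by fun_prop) fun u hu => hu.2.1
  have h3 : ∀ s, ContinuousOn (fun u : ℝ × ℝ × ℝ => therm v ν β s u.2.2)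
      (Ioi 0 ×ˢ Ioi 0 ×ˢ Ioi 0) := fun s => (h s).comp (by fun_prop) fun u hu => hu.2.2
  unfold mixing
  exact (((h1 _).mul (h2 _)).mul (h3 _)).sub (((h1 _).mul (h2 _)).mul (h3 _))

/-- The squared amplitude of a process: the integrand of the damping rates. -/
def rate (v : E → ℝ) (ν β : ℝ) (t₁ s₁ t₂ s₂ t₃ s₃ : Bool) (x y z : ℝ) : ℝ :=
  ν / vhat v 0 * (amp v ν t₁ t₂ t₃ x y z ^ 2 * mixing v ν β s₁ s₂ s₃ x y z ^ 2)

/-- The energy change in a process. -/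
def gap (v : E → ℝ) (ν : ℝ) (t₁ t₂ t₃ : Bool) (x y z : ℝ) : ℝ :=
  sgn t₁ * disp v ν x + sgn t₂ * disp v ν y + sgn t₃ * disp v ν z

theorem continuous_gap (hv : IsAdmissible v V) (t₁ t₂ t₃ : Bool) :
    Continuous (fun u : ℝ × ℝ × ℝ => gap v ν t₁ t₂ t₃ u.1 u.2.1 u.2.2) := by
  have := continuous_disp (ν := ν) hv
  unfold gap
  fun_prop

theorem continuousOn_rate (hv : IsAdmissible v V) (hν : ν ∈ Ioc 0 V) (hβ : 0 < β)
    (t₁ s₁ t₂ s₂ t₃ s₃ : Bool) :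
    ContinuousOn (fun u : ℝ × ℝ × ℝ => rate v ν β t₁ s₁ t₂ s₂ t₃ s₃ u.1 u.2.1 u.2.2)
      (Ioi 0 ×ˢ Ioi 0 ×ˢ Ioi 0) := by
  have h1 := continuousOn_amp hv hν t₁ t₂ t₃
  have h2 := continuousOn_mixing hv hν hβ s₁ s₂ s₃
  unfold rate
  fun_prop

theorem rate_nonneg (hv : IsAdmissible v V) (hν : ν ∈ Ioc 0 V) (t₁ s₁ t₂ s₂ t₃ s₃ : Bool)
    (x y z : ℝ) : 0 ≤ rate v ν β t₁ s₁ t₂ s₂ t₃ s₃ x y z := by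
  have h0 := hv.vhat_zero_pos
  have hν0 := hν.1
  unfold rate
  positivity

theorem rate_swap (t₁ s₁ t₂ s₂ t₃ s₃ : Bool) (x y z : ℝ) :
    rate v ν β t₁ s₁ t₃ s₃ t₂ s₂ x z y = rate v ν β t₁ s₁ t₂ s₂ t₃ s₃ x y z := by
  unfold rate
  rw [amp_swap_right]
  unfold mixing
  ring

theorem gap_swap (t₁ t₂ t₃ : Bool) (x y z : ℝ) :
    gap v ν t₁ t₃ t₂ x z y = gap v ν t₁ t₂ t₃ x y z := by
  unfold gap
  ring

theorem measurable_disp (hv : IsAdmissible v V) : Measurable (disp v ν) :=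
  (continuous_disp hv).measurable

theorem measurable_rate (hv : IsAdmissible v V) (t₁ s₁ t₂ s₂ t₃ s₃ : Bool) (x : ℝ) :
    Measurable (fun u : ℝ × ℝ => rate v ν β t₁ s₁ t₂ s₂ t₃ s₃ x u.1 u.2) := by
  have hd := measurable_disp (ν := ν) hv
  have hV := (continuous_vhatRadial hv).measurable
  have hθ : Measurable (theta v ν) := by unfold theta; fun_prop
  have ht : ∀ s, Measurable (therm v ν β s) := by
    intro s; unfold therm; cases s <;> simp <;> fun_prop
  unfold rate amp mixing
  fun_prop

/-! ### Bounds on amplitudes and weights -/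

/-- Only the inverse square roots of `θ(y)²` and `θ(z)²` are singular, at small momenta. -/
theorem exists_amp_sq_le (hv : IsAdmissible v V) (hν : ν ∈ Ioc 0 V) {a : ℝ} (ha : 0 < a) :
    ∃ C : ℝ, 0 < C ∧ ∀ x y z, a ≤ x → 0 < y → 0 < z → ∀ t₁ t₂ t₃,
      amp v ν t₁ t₂ t₃ x y z ^ 2 ≤ C * ((1 + 1 / y) * (1 + 1 / z)) := by
  obtain ⟨M, hM, hb⟩ := exists_abs_vhatRadial_le v
  obtain ⟨c, C, hc, hC, hθ⟩ := exists_theta_bounds hv hν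
  have hup : ∀ t, 0 < t → theta v ν t ^ 2 ≤ C := fun t ht =>
    (hθ t ht).2.trans (mul_le_of_le_one_right hC.le ((div_le_one (by positivity)).2 (by linarith)))
  have hinv : ∀ t, 0 < t → (theta v ν t ^ 2)⁻¹ ≤ c⁻¹ * (1 + 1 / t) := by
    intro t ht
    have h1 : 0 < c * (t / (1 + t)) := by positivity
    refine (inv_anti₀ h1 (hθ t ht).1).trans (le_of_eq ?_)
    field_simp
    ring
  refine ⟨9 * M ^ 2 * C ^ 3 + 9 * M ^ 2 * C ^ 2 * (c⁻¹ * (1 + 1 / a) * c⁻¹ * c⁻¹), by positivity,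
    fun x y z hx hy hz t₁ t₂ t₃ => ?_⟩
  have hx0 : 0 < x := ha.trans_le hx
  have hs : ∀ t, |sgn t| = 1 := by intro t; cases t <;> simp
  set θx := theta v ν x
  set θy := theta v ν y
  set θz := theta v ν z
  have px := theta_pos hv hν hx0
  have py := theta_pos hv hν hy
  have pz := theta_pos hv hν hz
  set A := (vhatRadial v x + vhatRadial v y + vhatRadial v z) * (θx * θy * θz) with hA
  set B := vhatRadial v x * θx ^ 2 * (sgn t₂ * sgn t₃) + vhatRadial v y * θy ^ 2 * (sgn t₁ * sgn t₃)
      + vhatRadial v z * θz ^ 2 * (sgn t₁ * sgn t₂) with hB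
  have e : amp v ν t₁ t₂ t₃ x y z = (A - B / (θx * θy * θz)) / 2 := rfl
  have hA2 : A ^ 2 ≤ 9 * M ^ 2 * C ^ 3 := by
    have h1 : |vhatRadial v x + vhatRadial v y + vhatRadial v z| ≤ 3 * M := by
      refine (abs_add_three _ _ _).trans ?_
      linarith [hb x, hb y, hb z]
    have h2 := sq_le_sq' (abs_le.1 h1).1 (abs_le.1 h1).2
    calc A ^ 2 = (vhatRadial v x + vhatRadial v y + vhatRadial v z) ^ 2
          * (θx ^ 2 * θy ^ 2 * θz ^ 2) := by rw [hA]; ring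
      _ ≤ (3 * M) ^ 2 * (C * C * C) := by
        gcongr
        exacts [hup x hx0, hup y hy, hup z hz]
      _ = _ := by ring
  have hB2 : B ^ 2 ≤ 9 * M ^ 2 * C ^ 2 := by
    have hi : ∀ t, 0 < t → ∀ s s' : Bool,
        |vhatRadial v t * theta v ν t ^ 2 * (sgn s * sgn s')| ≤ M * C := by
      intro t ht s s'
      rw [abs_mul, abs_mul, abs_mul, hs, hs, mul_one, mul_one,
        abs_of_nonneg (sq_nonneg (theta v ν t))]
      exact mul_le_mul (hb t) (hup t ht) (sq_nonneg _) hM.le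
    have h1 : |B| ≤ 3 * (M * C) := by
      refine (abs_add_three _ _ _).trans ?_
      linarith [hi x hx0 t₂ t₃, hi y hy t₁ t₃, hi z hz t₁ t₂]
    have h2 := sq_le_sq' (abs_le.1 h1).1 (abs_le.1 h1).2
    calc B ^ 2 ≤ _ := h2
      _ = _ := by ring
  have hΘ : ((θx * θy * θz) ^ 2)⁻¹
      ≤ c⁻¹ * (1 + 1 / a) * c⁻¹ * c⁻¹ * ((1 + 1 / y) * (1 + 1 / z)) := by
    have h1 : (θx ^ 2)⁻¹ ≤ c⁻¹ * (1 + 1 / a) := (hinv x hx0).trans (by gcongr)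
    calc ((θx * θy * θz) ^ 2)⁻¹ = (θx ^ 2)⁻¹ * (θy ^ 2)⁻¹ * (θz ^ 2)⁻¹ := by
          rw [mul_pow, mul_pow, mul_inv, mul_inv]
      _ ≤ (c⁻¹ * (1 + 1 / a)) * (c⁻¹ * (1 + 1 / y)) * (c⁻¹ * (1 + 1 / z)) := by
          gcongr
          exacts [hinv y hy, hinv z hz]
      _ = _ := by ring
  have hK : 1 ≤ (1 + 1 / y) * (1 + 1 / z) := by
    have h1 : 0 < 1 / y := by positivity
    have h2 : 0 < 1 / z := by positivity
    nlinarith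
  have h3 : amp v ν t₁ t₂ t₃ x y z ^ 2 ≤ A ^ 2 + B ^ 2 * ((θx * θy * θz) ^ 2)⁻¹ := by
    rw [e]
    have : B ^ 2 * ((θx * θy * θz) ^ 2)⁻¹ = (B / (θx * θy * θz)) ^ 2 := by
      rw [div_pow, div_eq_mul_inv]
    rw [this]
    generalize B / (θx * θy * θz) = b
    linarith [sq_nonneg (A + b), sq_nonneg A, sq_nonneg b]
  calc _ ≤ A ^ 2 + B ^ 2 * ((θx * θy * θz) ^ 2)⁻¹ := h3
    _ ≤ 9 * M ^ 2 * C ^ 3 * ((1 + 1 / y) * (1 + 1 / z)) + 9 * M ^ 2 * C ^ 2 *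
        (c⁻¹ * (1 + 1 / a) * c⁻¹ * c⁻¹ * ((1 + 1 / y) * (1 + 1 / z))) := by
        gcongr
        exact hA2.trans (le_mul_of_one_le_right (by positivity) hK)
    _ = _ := by ring

theorem mixingSum_sq_le (s₁ s₂ s₃ : Bool) (x y z : ℝ) :
    mixingSum v ν β s₁ s₂ s₃ x y z ^ 2 ≤
      2 * (therm v ν β s₁ x ^ 2 * therm v ν β s₂ y ^ 2 * therm v ν β s₃ z ^ 2
        + therm v ν β (!s₁) x ^ 2 * therm v ν β (!s₂) y ^ 2 * therm v ν β (!s₃) z ^ 2) := by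
  unfold mixingSum
  linarith [sq_nonneg (therm v ν β s₁ x * therm v ν β s₂ y * therm v ν β s₃ z
    - therm v ν β (!s₁) x * therm v ν β (!s₂) y * therm v ν β (!s₃) z)]

theorem exists_therm_sq_le (hv : IsAdmissible v V) (hν : ν ∈ Ioc 0 V) (hβ : 0 < β) :
    ∃ C : ℝ, 0 < C ∧ (∀ t, 0 < t → ∀ s, therm v ν β s t ^ 2 ≤ C * (1 + 1 / t)) ∧
      ∀ t, 0 < t → therm v ν β false t ^ 2 ≤ C * ((1 + 1 / t) / (1 + t) ^ 6) := by
  obtain ⟨C, hC, h⟩ := exists_therm_bounds hv hν hβ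
  refine ⟨C, hC, fun t ht s => ?_, fun t ht => (h t ht).1⟩
  cases s
  · refine (h t ht).1.trans ?_
    have : (1 + 1 / t) / (1 + t) ^ 6 ≤ 1 + 1 / t :=
      div_le_self (by positivity) (one_le_pow₀ (by linarith))
    gcongr
  · exact (h t ht).2

theorem sq_one_add_sq_le {y z b : ℝ} (hy : 0 < y) (hz : 0 < z) (hb : 0 ≤ b) (h : z ≤ y + b) :
    (1 + y ^ 2 + z ^ 2) ^ 2 ≤ (2 + b) ^ 4 * (1 + y) ^ 6 := by
  have h1 : 1 + y + z ≤ (2 + b) * (1 + y) := by linarith [mul_nonneg hb hy.le]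
  have h2 : 1 + y ^ 2 + z ^ 2 ≤ (1 + y + z) ^ 2 := by linarith [mul_pos hy hz]
  calc (1 + y ^ 2 + z ^ 2) ^ 2 ≤ ((1 + y + z) ^ 2) ^ 2 := by gcongr
    _ = (1 + y + z) ^ 4 := by ring
    _ ≤ ((2 + b) * (1 + y)) ^ 4 := by gcongr
    _ = (2 + b) ^ 4 * (1 + y) ^ 4 := by ring
    _ ≤ (2 + b) ^ 4 * (1 + y) ^ 6 := by
      have : (1 + y) ^ 4 ≤ (1 + y) ^ 6 := pow_le_pow_right₀ (by linarith) (by norm_num)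
      gcongr

/-- If the last two quasiparticles enter with the same sign, then the energy change grows at large
momenta. -/
theorem exists_le_gap_sq (hv : IsAdmissible v V) (hν : ν ∈ Ioc 0 V) (a b : ℝ) (ha : 0 < a) :
    ∃ C : ℝ, 0 < C ∧ ∀ x y z, x ∈ Icc a b → 0 < y → 0 < z → ∀ t₁ t₂,
      (1 + y ^ 2 + z ^ 2) ^ 2 ≤ C * (1 + gap v ν t₁ t₂ t₂ x y z ^ 2) := by
  obtain ⟨c, D, hc, hD, hw⟩ := exists_disp_bounds hv hν
  set c' := min 1 c with hc'
  have hc'0 : 0 < c' := by positivity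
  set W := D * (|b| * (1 + |b|)) with hW
  have hW0 : 0 ≤ W := by positivity
  refine ⟨2 * (1 + W) ^ 2 / c' ^ 2, by positivity, fun x y z hx hy hz t₁ t₂ => ?_⟩
  have hx0 : 0 < x := ha.trans_le hx.1
  have hxb : x ≤ |b| := hx.2.trans (le_abs_self b)
  have hxW : disp v ν x ≤ W := by
    refine (hw x hx0.le).2.trans ?_
    rw [hW]; gcongr
  set G := gap v ν t₁ t₂ t₂ x y z with hG
  have hsum : c' * (1 + y ^ 2 + z ^ 2) ≤ 1 + (disp v ν y + disp v ν z) := by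
    have e1 : c' ≤ 1 := min_le_left _ _
    have e2 : c' ≤ c := min_le_right _ _
    have e3 : c' * y ^ 2 ≤ disp v ν y := by
      refine le_trans ?_ (hw y hy.le).1
      have : y ^ 2 ≤ y * (1 + y) := by linarith [sq y]
      gcongr
    have e4 : c' * z ^ 2 ≤ disp v ν z := by
      refine le_trans ?_ (hw z hz.le).1
      have : z ^ 2 ≤ z * (1 + z) := by linarith [sq z]
      gcongr
    linarith
  have hgap : disp v ν y + disp v ν z ≤ |G| + W := by
    have hwx := disp_nonneg (v := v) (ν := ν) hx0.le
    have hGe : G = sgn t₁ * disp v ν x + sgn t₂ * (disp v ν y + disp v ν z) := by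
      rw [hG]; unfold gap; ring
    have : disp v ν y + disp v ν z - disp v ν x ≤ |G| := by
      rw [hGe]
      cases t₁ <;> cases t₂ <;> simp only [sgn_true, sgn_false] <;>
        first
        | exact (by linarith : _ ≤ _).trans (le_abs_self _)
        | exact (by linarith : _ ≤ _).trans (neg_le_abs _)
    linarith
  have h3 : c' * (1 + y ^ 2 + z ^ 2) ≤ (1 + W) * (1 + |G|) := by
    have := mul_nonneg hW0 (abs_nonneg G)
    linarith
  have h4 : (1 + |G|) ^ 2 ≤ 2 * (1 + G ^ 2) := by
    linarith [sq_nonneg (1 - |G|), sq_abs G]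
  rw [div_mul_eq_mul_div, le_div_iff₀ (by positivity)]
  calc (1 + y ^ 2 + z ^ 2) ^ 2 * c' ^ 2 = (c' * (1 + y ^ 2 + z ^ 2)) ^ 2 := by ring
    _ ≤ ((1 + W) * (1 + |G|)) ^ 2 := by gcongr
    _ = (1 + W) ^ 2 * (1 + |G|) ^ 2 := by ring
    _ ≤ (1 + W) ^ 2 * (2 * (1 + G ^ 2)) := by gcongr
    _ = _ := by ring

/-- The weights of processes in which the last two quasiparticles are created. Either both of them
enter the energy change with the same sign, which makes it large at large momenta, or the thermal
weights decay. -/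
theorem exists_mixingSum_sq_le (hv : IsAdmissible v V) (hν : ν ∈ Ioc 0 V) (hβ : 0 < β) {a : ℝ}
    (b : ℝ) (ha : 0 < a) :
    ∃ C : ℝ, 0 < C ∧ ∀ x y z, x ∈ Icc a b → 0 < y → 0 < z → |y - z| ≤ x → ∀ t₁ s₁ t₂ t₃,
      mixingSum v ν β s₁ t₂ t₃ x y z ^ 2 / (1 + gap v ν t₁ t₂ t₃ x y z ^ 2) ≤
        C * ((1 + 1 / y) * (1 + 1 / z) / (1 + y ^ 2 + z ^ 2) ^ 2) := by
  obtain ⟨C, hC, hT, hF⟩ := exists_therm_sq_le hv hν hβ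
  obtain ⟨D, hD, hg⟩ := exists_le_gap_sq hv hν a b ha
  set C₁ := 4 * (C * (1 + 1 / a) * C * C) with hC₁
  have hC₁0 : 0 < C₁ := by positivity
  refine ⟨C₁ * D + C₁ * (2 + |b|) ^ 4, by positivity,
    fun x y z hx hy hz hyz t₁ s₁ t₂ t₃ => ?_⟩
  have hx0 : 0 < x := ha.trans_le hx.1
  have hb0 : 0 < b := hx0.trans_le hx.2
  have hxb : x ≤ |b| := hx.2.trans (le_abs_self b)
  have hTx : ∀ s, therm v ν β s x ^ 2 ≤ C * (1 + 1 / a) := fun s =>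
    (hT x hx0 s).trans (by gcongr; exact hx.1)
  set K := (1 + 1 / y) * (1 + 1 / z) with hK
  have hK0 : 0 < K := by positivity
  set N := 1 + y ^ 2 + z ^ 2 with hN
  have hN0 : 0 < N := by positivity
  set G := gap v ν t₁ t₂ t₃ x y z with hG
  have hmix := mixingSum_sq_le (v := v) (ν := ν) (β := β) s₁ t₂ t₃ x y z
  by_cases h23 : t₂ = t₃
  · subst h23
    have h1 : mixingSum v ν β s₁ t₂ t₂ x y z ^ 2 ≤ C₁ * K := by
      refine hmix.trans ?_
      calc _ ≤ 2 * ((C * (1 + 1 / a)) * (C * (1 + 1 / y)) * (C * (1 + 1 / z))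
            + (C * (1 + 1 / a)) * (C * (1 + 1 / y)) * (C * (1 + 1 / z))) := by
            gcongr
            exacts [hTx _, hT y hy _, hT z hz _, hTx _, hT y hy _, hT z hz _]
        _ = _ := by rw [hC₁, hK]; ring
    have h5 : mixingSum v ν β s₁ t₂ t₂ x y z ^ 2 / (1 + G ^ 2) ≤ C₁ * D * (K / N ^ 2) := by
      rw [mul_div_assoc', div_le_div_iff₀ (by positivity) (by positivity)]
      calc _ ≤ C₁ * K * N ^ 2 := by gcongr
        _ ≤ C₁ * K * (D * (1 + G ^ 2)) := by gcongr; exact hg x y z hx hy hz t₁ t₂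
        _ = _ := by ring
    refine h5.trans ?_
    gcongr
    have : 0 ≤ C₁ * (2 + |b|) ^ 4 := by positivity
    linarith
  · have hyz' := abs_le.1 hyz
    have hNy : N ^ 2 ≤ (2 + |b|) ^ 4 * (1 + y) ^ 6 :=
      sq_one_add_sq_le hy hz (abs_nonneg b) (by linarith)
    have hNz : N ^ 2 ≤ (2 + |b|) ^ 4 * (1 + z) ^ 6 := by
      have := sq_one_add_sq_le hz hy (abs_nonneg b) (by linarith : y ≤ z + |b|)
      rwa [show 1 + z ^ 2 + y ^ 2 = N by rw [hN]; ring] at this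
    set B := (2 + |b|) ^ 4 with hB
    have hB0 : 0 < B := by positivity
    have hFy : therm v ν β false y ^ 2 ≤ C * ((1 + 1 / y) * (B / N ^ 2)) := by
      have h : 1 / (1 + y) ^ 6 ≤ B / N ^ 2 := by
        rw [div_le_div_iff₀ (by positivity) (by positivity), one_mul]
        exact hNy
      refine (hF y hy).trans ?_
      rw [div_eq_mul_one_div (1 + 1 / y)]
      exact mul_le_mul_of_nonneg_left (mul_le_mul_of_nonneg_left h (by positivity)) hC.le
    have hFz : therm v ν β false z ^ 2 ≤ C * ((1 + 1 / z) * (B / N ^ 2)) := by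
      have h : 1 / (1 + z) ^ 6 ≤ B / N ^ 2 := by
        rw [div_le_div_iff₀ (by positivity) (by positivity), one_mul]
        exact hNz
      refine (hF z hz).trans ?_
      rw [div_eq_mul_one_div (1 + 1 / z)]
      exact mul_le_mul_of_nonneg_left (mul_le_mul_of_nonneg_left h (by positivity)) hC.le
    have hprod : ∀ s s', s ≠ s' → therm v ν β s y ^ 2 * therm v ν β s' z ^ 2
        ≤ C * C * (K * (B / N ^ 2)) := by
      intro s s' hs
      rcases s with _ | _ <;> rcases s' with _ | _
      · exact absurd rfl hs
      · calc _ ≤ (C * ((1 + 1 / y) * (B / N ^ 2))) * (C * (1 + 1 / z)) := by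
              gcongr; exact hT z hz _
          _ = _ := by rw [hK]; ring
      · calc _ ≤ (C * (1 + 1 / y)) * (C * ((1 + 1 / z) * (B / N ^ 2))) := by
              gcongr; exact hT y hy _
          _ = _ := by rw [hK]; ring
      · exact absurd rfl hs
    have h1 : mixingSum v ν β s₁ t₂ t₃ x y z ^ 2 ≤ C₁ * B * (K / N ^ 2) := by
      refine hmix.trans ?_
      have hn : (!t₂) ≠ (!t₃) := by simpa using h23
      calc _ = 2 * (therm v ν β s₁ x ^ 2 * (therm v ν β t₂ y ^ 2 * therm v ν β t₃ z ^ 2)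
            + therm v ν β (!s₁) x ^ 2 * (therm v ν β (!t₂) y ^ 2 * therm v ν β (!t₃) z ^ 2)) := by
            ring
        _ ≤ 2 * (C * (1 + 1 / a) * (C * C * (K * (B / N ^ 2)))
            + C * (1 + 1 / a) * (C * C * (K * (B / N ^ 2)))) := by
            refine mul_le_mul_of_nonneg_left (add_le_add
              (mul_le_mul (hTx _) (hprod _ _ h23) (by positivity) (by positivity))
              (mul_le_mul (hTx _) (hprod _ _ hn) (by positivity) (by positivity))) two_pos.le
        _ = _ := by rw [hC₁]; ring
    calc _ ≤ mixingSum v ν β s₁ t₂ t₃ x y z ^ 2 :=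
          div_le_self (sq_nonneg _) (by linarith [sq_nonneg G])
      _ ≤ C₁ * B * (K / N ^ 2) := h1
      _ ≤ _ := by
        gcongr
        have : 0 ≤ C₁ * D := by positivity
        linarith

/-- The integrable function of the two momenta that dominates all processes. -/
theorem exists_envelope (hv : IsAdmissible v V) (hν : ν ∈ Ioc 0 V) (hβ : 0 < β) {a : ℝ}
    (b : ℝ) (ha : 0 < a) :
    ∃ C : ℝ, 0 < C ∧ ∀ x y z, x ∈ Icc a b → 0 < y → 0 < z → |y - z| ≤ x → x ≤ y + z →
      ∀ t₁ s₁ t₂ t₃, ν / vhat v 0 * (amp v ν t₁ t₂ t₃ x y z ^ 2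
        * mixingSum v ν β s₁ t₂ t₃ x y z ^ 2) / (1 + gap v ν t₁ t₂ t₃ x y z ^ 2) ≤
        C * ((1 / y ^ 2 + 1 / z ^ 2) / (1 + y ^ 2 + z ^ 2)) := by
  obtain ⟨C₁, hC₁, h1⟩ := exists_amp_sq_le hv hν ha
  obtain ⟨C₂, hC₂, h2⟩ := exists_mixingSum_sq_le hv hν hβ b ha
  have h0 := hv.vhat_zero_pos
  have hν0 := hν.1
  refine ⟨ν / vhat v 0 * (C₁ * C₂ * (4 * (1 + 2 / a ^ 2))), by positivity,
    fun x y z hx hy hz hyz hxyz t₁ s₁ t₂ t₃ => ?_⟩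
  have e1 := h1 x y z hx.1 hy hz t₁ t₂ t₃
  have e2 := h2 x y z hx hy hz hyz t₁ s₁ t₂ t₃
  have hS : a ^ 2 ≤ 2 * (y ^ 2 + z ^ 2) := by
    have : a ≤ y + z := hx.1.trans hxyz
    have := pow_le_pow_left₀ ha.le this 2
    linarith [sq_nonneg (y - z)]
  have hK : ((1 + 1 / y) * (1 + 1 / z)) ^ 2
      ≤ 4 * (1 + 2 / a ^ 2) * ((1 / y ^ 2 + 1 / z ^ 2) * (1 + y ^ 2 + z ^ 2)) := by
    have k1 : 1 + y ^ 2 + z ^ 2 ≤ (1 + 2 / a ^ 2) * (y ^ 2 + z ^ 2) := by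
      have : 1 ≤ 2 / a ^ 2 * (y ^ 2 + z ^ 2) := by
        rw [div_mul_eq_mul_div, le_div_iff₀ (by positivity)]; linarith
      linarith
    have k2 : (1 + y) ^ 2 * (1 + z) ^ 2 ≤ 4 * (1 + y ^ 2 + z ^ 2) ^ 2 := by
      have l1 : (1 + y) ^ 2 ≤ 2 * (1 + y ^ 2 + z ^ 2) := by linarith [sq_nonneg (1 - y), sq_nonneg z]
      have l2 : (1 + z) ^ 2 ≤ 2 * (1 + y ^ 2 + z ^ 2) := by linarith [sq_nonneg (1 - z), sq_nonneg y]
      calc _ ≤ (2 * (1 + y ^ 2 + z ^ 2)) * (2 * (1 + y ^ 2 + z ^ 2)) := by gcongr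
        _ = _ := by ring
    have k3 : (1 + y) ^ 2 * (1 + z) ^ 2
        ≤ 4 * ((1 + 2 / a ^ 2) * (y ^ 2 + z ^ 2)) * (1 + y ^ 2 + z ^ 2) := by
      refine k2.trans ?_
      calc _ = 4 * (1 + y ^ 2 + z ^ 2) * (1 + y ^ 2 + z ^ 2) := by ring
        _ ≤ _ := by gcongr
    have e3 : ((1 + 1 / y) * (1 + 1 / z)) ^ 2 = (1 + y) ^ 2 * (1 + z) ^ 2 / (y ^ 2 * z ^ 2) := by
      field_simp
      ring
    have e4 : 4 * (1 + 2 / a ^ 2) * ((1 / y ^ 2 + 1 / z ^ 2) * (1 + y ^ 2 + z ^ 2))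
        = 4 * ((1 + 2 / a ^ 2) * (y ^ 2 + z ^ 2)) * (1 + y ^ 2 + z ^ 2) / (y ^ 2 * z ^ 2) := by
      field_simp
      ring
    rw [e3, e4]
    gcongr
  set K := (1 + 1 / y) * (1 + 1 / z)
  set N := 1 + y ^ 2 + z ^ 2 with hN
  have hN0 : 0 < N := by positivity
  calc _ = ν / vhat v 0 * (amp v ν t₁ t₂ t₃ x y z ^ 2
        * (mixingSum v ν β s₁ t₂ t₃ x y z ^ 2 / (1 + gap v ν t₁ t₂ t₃ x y z ^ 2))) := by ring
    _ ≤ ν / vhat v 0 * ((C₁ * K) * (C₂ * (K / N ^ 2))) := by gcongr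
    _ = ν / vhat v 0 * (C₁ * C₂) * (K ^ 2 / N ^ 2) := by ring
    _ ≤ ν / vhat v 0 * (C₁ * C₂) * ((4 * (1 + 2 / a ^ 2) * ((1 / y ^ 2 + 1 / z ^ 2) * N)) / N ^ 2)
      := by gcongr
    _ = _ := by field_simp

/-! ### The integrands of the damping rates -/

theorem rho_eq (hv : IsAdmissible v V) (hν : ν ∈ Ioc 0 V) (hβ : 0 < β) {p : E} (hp : p ≠ 0) :
    rho v ν β p = therm v ν β false ‖p‖ ^ 2 := by
  rw [therm_false_sq hv hν hβ (norm_pos_iff.2 hp), rho, omega_eq_disp hv]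

theorem beliaev_integrand_eq (hv : IsAdmissible v V) (hν : ν ∈ Ioc 0 V) (hβ : 0 < β) {k p : E}
    (hk : k ≠ 0) (hp : p ≠ 0) (hq : p - k ≠ 0) :
    jAmp v ν k p (p - k) ^ 2 * (rho v ν β p * rho v ν β (p - k) * rho v ν β k)
      * (1 - Real.exp (β * (omega v ν p + omega v ν (p - k) + omega v ν k) / 2)) ^ 2
      = rate v ν β false true true true true true ‖k‖ ‖p‖ ‖p - k‖ := by
  have h0 := hv.vhat_zero_pos
  have hν0 := hν.1
  rw [jAmp_eq hv hν hk hp hq, rho_eq hv hν hβ hp, rho_eq hv hν hβ hq, rho_eq hv hν hβ hk,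
    omega_eq_disp hv, omega_eq_disp hv, omega_eq_disp hv, mul_pow, Real.sq_sqrt (by positivity)]
  unfold rate mixing
  simp only [Bool.not_true, therm_true_eq]
  rw [show β * (disp v ν ‖p‖ + disp v ν ‖p - k‖ + disp v ν ‖k‖) / 2
    = β * disp v ν ‖p‖ / 2 + β * disp v ν ‖p - k‖ / 2 + β * disp v ν ‖k‖ / 2 by ring,
    Real.exp_add, Real.exp_add]
  ring

theorem landau_integrand_eq (hv : IsAdmissible v V) (hν : ν ∈ Ioc 0 V) (hβ : 0 < β) {k p : E}
    (hk : k ≠ 0) (hp : p ≠ 0) (hq : p - k ≠ 0) :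
    jAmp v ν (p - k) p k ^ 2 * (rho v ν β p * rho v ν β (p - k) * rho v ν β k)
      * (Real.exp (β * (omega v ν k + omega v ν (p - k)) / 2)
          - Real.exp (β / 2 * omega v ν p)) ^ 2
      = rate v ν β false true false false true true ‖k‖ ‖p‖ ‖p - k‖ := by
  have h0 := hv.vhat_zero_pos
  have hν0 := hν.1
  rw [jAmp_eq hv hν hq hp hk, rho_eq hv hν hβ hp, rho_eq hv hν hβ hq, rho_eq hv hν hβ hk,
    omega_eq_disp hv, omega_eq_disp hv, omega_eq_disp hv, mul_pow, Real.sq_sqrt (by positivity),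
    show amp v ν false true true ‖p - k‖ ‖p‖ ‖k‖ = amp v ν false false true ‖k‖ ‖p‖ ‖p - k‖ by
      rw [← amp_not, ← amp_rotate, ← amp_swap]; rfl]
  unfold rate mixing
  simp only [Bool.not_true, Bool.not_false, therm_true_eq]
  rw [show β * (disp v ν ‖k‖ + disp v ν ‖p - k‖) / 2
    = β * disp v ν ‖p - k‖ / 2 + β * disp v ν ‖k‖ / 2 by ring,
    show β / 2 * disp v ν ‖p‖ = β * disp v ν ‖p‖ / 2 by ring, Real.exp_add]
  ring

/-! ### Ladder operators on the occupation number basis -/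

theorem Xi.opp_opp (q : Xi) : q.opp.opp = q := Subtype.ext (neg_neg _)

theorem norm_mom_opp (L : ℝ) (q : Xi) : ‖mom L q.opp.1‖ = ‖mom L q.1‖ := by
  have : mom L q.opp.1 = -mom L q.1 := by
    ext i
    simp [mom, Xi.opp]
  rw [this, norm_neg]

/-- A ladder operator changing the total momentum by a charge. It is given by its charge, by a type
(`true` if it raises the Bogoliubov energy) and by its side (`true` for left). -/
abbrev Ladder : Type := Xi × Bool × Bool

/-- The side encoded by a Boolean. -/
def sideOf (s : Bool) : Side := if s then Side.left else Side.right

namespace Ladder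

/-- The mode on which a ladder operator acts. -/
def mode (d : Ladder) : Mode := (sideOf d.2.2, if d.2.1 then d.1 else d.1.opp)

/-- Whether the ladder operator is a creation operator. -/
def isCreate (d : Ladder) : Bool := d.2.1 == d.2.2

/-- The operator itself. -/
def op (d : Ladder) : Module.End ℂ State := if d.isCreate then create d.mode else annih d.mode

/-- The effect on occupation numbers. -/
def step (d : Ladder) (n : Config) : Config :=
  if d.isCreate then n + Finsupp.single d.mode 1 else n - Finsupp.single d.mode 1

/-- The factor that the operator produces on a basis vector. -/
def weight (d : Ladder) (n : Config) : ℝ :=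
  if d.isCreate then √((n d.mode : ℝ) + 1) else √(n d.mode : ℝ)

open Classical in
/-- The change of the occupation number of a mode. -/
def delta (d : Ladder) (m : Mode) : ℤ :=
  if d.mode = m then (if d.isCreate then 1 else -1) else 0

end Ladder

open Classical in
/-- The vector of the occupation number basis. -/
def basisVec (n : Config) : State := Pi.single n 1

theorem basisVec_apply (n n' : Config) [Decidable (n' = n)] :
    basisVec n n' = if n' = n then 1 else 0 := by
  classical
  unfold basisVec
  rw [Pi.single_apply]
  congr

theorem Ladder.op_basisVec (d : Ladder) (n : Config) :
    d.op (basisVec n) = (d.weight n : ℂ) • basisVec (d.step n) := by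
  classical
  unfold Ladder.op Ladder.weight Ladder.step
  by_cases h : d.isCreate
  · simp only [h, if_true]
    funext n'
    change (√(n' d.mode : ℝ) : ℂ) * basisVec n (n' - Finsupp.single d.mode 1)
      = ((√((n d.mode : ℝ) + 1) : ℝ) : ℂ) * basisVec _ n'
    rw [basisVec_apply, basisVec_apply]
    by_cases h0 : n' d.mode = 0
    · have : n' ≠ n + Finsupp.single d.mode 1 := by
        rintro rfl; simp at h0
      simp [h0, this]
    · have h1 : n' - Finsupp.single d.mode 1 + Finsupp.single d.mode 1 = n' :=
        tsub_add_cancel_of_le (Finsupp.single_le_iff.mpr (Nat.one_le_iff_ne_zero.mpr h0))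
      by_cases h2 : n' - Finsupp.single d.mode 1 = n
      · have h3 : n' = n + Finsupp.single d.mode 1 := by rw [← h2, h1]
        simp [h3]
      · have h3 : n' ≠ n + Finsupp.single d.mode 1 := by
          rintro rfl; exact h2 (add_tsub_cancel_right _ _)
        simp [h2, h3]
  · simp only [h, if_false, Bool.false_eq_true]
    funext n'
    change (√((n' d.mode : ℝ) + 1) : ℂ) * basisVec n (n' + Finsupp.single d.mode 1)
      = ((√(n d.mode : ℝ) : ℝ) : ℂ) * basisVec _ n'
    rw [basisVec_apply, basisVec_apply]
    by_cases h2 : n' + Finsupp.single d.mode 1 = n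
    · have h3 : n' = n - Finsupp.single d.mode 1 := by rw [← h2]; exact (add_tsub_cancel_right _ _).symm
      rw [if_pos h2, if_pos h3, ← h2]
      simp
    · rw [if_neg h2]
      by_cases h0 : n d.mode = 0
      · simp [h0]
      · have h1 : n - Finsupp.single d.mode 1 + Finsupp.single d.mode 1 = n :=
          tsub_add_cancel_of_le (Finsupp.single_le_iff.mpr (Nat.one_le_iff_ne_zero.mpr h0))
        have h3 : n' ≠ n - Finsupp.single d.mode 1 := by
          rintro rfl; exact h2 h1
        simp [h3]

theorem Ladder.step_apply (d : Ladder) (n : Config) (h : d.weight n ≠ 0) (m : Mode) :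
    ((d.step n m : ℕ) : ℤ) = n m + d.delta m := by
  classical
  unfold Ladder.weight at h
  unfold Ladder.step Ladder.delta
  by_cases hc : d.isCreate
  · simp only [hc, if_true, Finsupp.add_apply, Finsupp.single_apply]
    split_ifs <;> simp
  · simp only [hc, if_false, Bool.false_eq_true, Finsupp.tsub_apply, Finsupp.single_apply] at h ⊢
    by_cases hm : d.mode = m
    · subst hm
      have : n d.mode ≠ 0 := by
        intro h0; simp [h0] at h
      simp only [if_true]
      omega
    · simp [hm]

theorem Ladder.ext_mode {d d' : Ladder} (h : d.mode = d'.mode) (hc : d.isCreate = d'.isCreate) :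
    d = d' := by
  obtain ⟨q, t, s⟩ := d
  obtain ⟨q', t', s'⟩ := d'
  have h1 := congrArg Prod.fst h
  have h2 := congrArg Prod.snd h
  simp only [Ladder.mode, Ladder.isCreate, sideOf] at h1 h2 hc
  have hs : s = s' := by cases s <;> cases s' <;> simp_all
  subst hs
  have ht : t = t' := by cases t <;> cases t' <;> cases s <;> simp_all
  subst ht
  cases t
  · simp only [Bool.false_eq_true, if_false] at h2
    rw [← Xi.opp_opp q, h2, Xi.opp_opp]
  · simp only [if_true] at h2
    rw [h2]

/-- Two ladder operators on the same mode either agree or have opposite charges. -/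
theorem Ladder.eq_or_add_eq_zero {d d' : Ladder} (h : d.mode = d'.mode) :
    d = d' ∨ d.1.1 + d'.1.1 = 0 := by
  by_cases hc : d.isCreate = d'.isCreate
  · exact Or.inl (Ladder.ext_mode h hc)
  · right
    obtain ⟨q, t, s⟩ := d
    obtain ⟨q', t', s'⟩ := d'
    have h1 := congrArg Prod.fst h
    have h2 := congrArg Prod.snd h
    simp only [Ladder.mode, Ladder.isCreate, sideOf] at h1 h2 hc
    have hs : s = s' := by cases s <;> cases s' <;> simp_all
    subst hs
    have ht : t' = !t := by cases t <;> cases t' <;> cases s <;> simp_all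
    subst ht
    cases t
    · simp only [Bool.false_eq_true, if_false, Bool.not_false, if_true] at h2
      rw [← h2]; simp [Xi.opp]
    · simp only [Bool.false_eq_true, if_false, Bool.not_true, if_true] at h2
      rw [h2]; simp [Xi.opp]

theorem create_comm (a b : Mode) : create a * create b = create b * create a := by
  classical
  refine LinearMap.ext fun f => funext fun n => ?_
  change (√(n a : ℝ) : ℂ) * ((√((n - Finsupp.single a 1 : Config) b : ℝ) : ℂ)
      * f (n - Finsupp.single a 1 - Finsupp.single b 1))
    = (√(n b : ℝ) : ℂ) * ((√((n - Finsupp.single b 1 : Config) a : ℝ) : ℂ)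
      * f (n - Finsupp.single b 1 - Finsupp.single a 1))
  by_cases h : a = b
  · subst h; rfl
  · rw [tsub_right_comm]
    simp only [Finsupp.tsub_apply, Finsupp.single_apply, h, Ne.symm h, if_false, tsub_zero]
    rw [mul_left_comm]

theorem annih_comm (a b : Mode) : annih a * annih b = annih b * annih a := by
  classical
  refine LinearMap.ext fun f => funext fun n => ?_
  change (√((n a : ℝ) + 1) : ℂ) * ((√(((n + Finsupp.single a 1 : Config) b : ℝ) + 1) : ℂ)
      * f (n + Finsupp.single a 1 + Finsupp.single b 1))
    = (√((n b : ℝ) + 1) : ℂ) * ((√(((n + Finsupp.single b 1 : Config) a : ℝ) + 1) : ℂ)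
      * f (n + Finsupp.single b 1 + Finsupp.single a 1))
  by_cases h : a = b
  · subst h; rfl
  · rw [add_right_comm]
    simp only [Finsupp.add_apply, Finsupp.single_apply, h, Ne.symm h, if_false, add_zero]
    rw [mul_left_comm]

theorem create_annih_comm {a b : Mode} (h : a ≠ b) : create a * annih b = annih b * create a := by
  classical
  refine LinearMap.ext fun f => funext fun n => ?_
  change (√(n a : ℝ) : ℂ) * ((√(((n - Finsupp.single a 1 : Config) b : ℝ) + 1) : ℂ)
      * f (n - Finsupp.single a 1 + Finsupp.single b 1))
    = (√((n b : ℝ) + 1) : ℂ) * ((√((n + Finsupp.single b 1 : Config) a : ℝ) : ℂ)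
      * f (n + Finsupp.single b 1 - Finsupp.single a 1))
  have : n + Finsupp.single b 1 - Finsupp.single a 1
      = n - Finsupp.single a 1 + Finsupp.single b 1 := by
    ext m
    simp only [Finsupp.tsub_apply, Finsupp.add_apply, Finsupp.single_apply]
    split_ifs with h1 h2
    · exact absurd (h2.trans h1.symm) h
    · simp
    · simp
    · simp
  rw [this]
  simp only [Finsupp.add_apply, Finsupp.tsub_apply, Finsupp.single_apply, h, Ne.symm h, if_false,
    tsub_zero, add_zero]
  rw [mul_left_comm]

theorem Ladder.op_comm {d d' : Ladder} (h : d.1.1 + d'.1.1 ≠ 0) : d.op * d'.op = d'.op * d.op := by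
  have key : ∀ {d d' : Ladder}, d.1.1 + d'.1.1 ≠ 0 → d.isCreate = true → d'.isCreate = false →
      d.mode ≠ d'.mode := by
    intro d d' h h1 h2 hm
    rcases Ladder.eq_or_add_eq_zero hm with rfl | h3
    · rw [h1] at h2; exact absurd h2 (by simp)
    · exact h h3
  unfold Ladder.op
  cases h1 : d.isCreate <;> cases h2 : d'.isCreate <;> simp only [if_true, if_false,
    Bool.false_eq_true]
  · exact annih_comm _ _
  · exact (create_annih_comm (key (by rwa [add_comm]) h2 h1)).symm
  · exact create_annih_comm (key h h1 h2)
  · exact create_comm _ _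

/-! ### Triples of ladder operators -/

/-- Triples of ladder operators with vanishing total charge. -/
abbrev Triple : Type :=
  {d : Ladder × Ladder × Ladder // d.1.1.1 + d.2.1.1.1 + d.2.2.1.1 = 0}

namespace Triple

/-- Cyclic rotation of a triple. -/
def rot (d : Triple) : Triple :=
  ⟨(d.1.2.1, d.1.2.2, d.1.1),
    (by abel : d.1.2.1.1.1 + d.1.2.2.1.1 + d.1.1.1.1 = _).trans d.2⟩

/-- Exchange of the first two members of a triple. -/
def swp (d : Triple) : Triple :=
  ⟨(d.1.2.1, d.1.1, d.1.2.2),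
    (by abel : d.1.2.1.1.1 + d.1.1.1.1 + d.1.2.2.1.1 = _).trans d.2⟩

theorem rot_rot_rot (d : Triple) : d.rot.rot.rot = d := rfl

/-- Cyclic rotation as an equivalence. -/
def rotEquiv : Triple ≃ Triple := ⟨rot, fun d => d.rot.rot, fun _ => rfl, fun _ => rfl⟩

/-- The exchange of the first two members as an equivalence. -/
def swpEquiv : Triple ≃ Triple := ⟨swp, swp, fun _ => rfl, fun _ => rfl⟩

theorem add_ne_zero₁₂ (d : Triple) : d.1.1.1.1 + d.1.2.1.1.1 ≠ 0 := by
  intro h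
  have := d.2
  rw [h, zero_add] at this
  exact d.1.2.2.1.2 this

theorem add_ne_zero₂₃ (d : Triple) : d.1.2.1.1.1 + d.1.2.2.1.1 ≠ 0 := d.rot.add_ne_zero₁₂

theorem add_ne_zero₃₁ (d : Triple) : d.1.2.2.1.1 + d.1.1.1.1 ≠ 0 := d.rot.rot.add_ne_zero₁₂

/-- The product of the three operators. -/
def op (d : Triple) : Module.End ℂ State := d.1.1.op * d.1.2.1.op * d.1.2.2.op

theorem op_rot (d : Triple) : d.rot.op = d.op := by
  change d.1.2.1.op * d.1.2.2.op * d.1.1.op = d.1.1.op * d.1.2.1.op * d.1.2.2.op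
  rw [mul_assoc, Ladder.op_comm d.add_ne_zero₃₁, ← mul_assoc,
    Ladder.op_comm (d' := d.1.1) (by rw [add_comm]; exact d.add_ne_zero₁₂)]

theorem op_swp (d : Triple) : d.swp.op = d.op := by
  change d.1.2.1.op * d.1.1.op * d.1.2.2.op = d.1.1.op * d.1.2.1.op * d.1.2.2.op
  rw [Ladder.op_comm (d' := d.1.1) (by rw [add_comm]; exact d.add_ne_zero₁₂)]

/-- The effect of the three operators on occupation numbers. -/
def step (d : Triple) (n : Config) : Config := d.1.1.step (d.1.2.1.step (d.1.2.2.step n))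

/-- The factor that the three operators produce on a basis vector. -/
def weight (d : Triple) (n : Config) : ℝ :=
  d.1.2.2.weight n * d.1.2.1.weight (d.1.2.2.step n)
    * d.1.1.weight (d.1.2.1.step (d.1.2.2.step n))

/-- The matrix element between two basis vectors. -/
def matEl (d : Triple) (n₀ n : Config) : ℝ :=
  open Classical in if d.step n₀ = n then d.weight n₀ else 0

theorem op_basisVec (d : Triple) (n₀ n : Config) :
    d.op (basisVec n₀) n = (d.matEl n₀ n : ℂ) := by
  classical
  have : d.op (basisVec n₀) = (d.weight n₀ : ℂ) • basisVec (d.step n₀) := by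
    change d.1.1.op (d.1.2.1.op (d.1.2.2.op (basisVec n₀))) = _
    rw [Ladder.op_basisVec, map_smul, Ladder.op_basisVec, map_smul, map_smul, Ladder.op_basisVec,
      smul_smul, smul_smul]
    unfold weight step
    push_cast
    rfl
  rw [this, Pi.smul_apply, basisVec_apply, matEl]
  by_cases h : d.step n₀ = n
  · simp [h]
  · simp [h, Ne.symm h]

theorem matEl_rot (d : Triple) (n₀ n : Config) : d.rot.matEl n₀ n = d.matEl n₀ n := by
  have := (op_basisVec d.rot n₀ n).symm.trans (by rw [op_rot, op_basisVec])
  exact_mod_cast this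

theorem matEl_swp (d : Triple) (n₀ n : Config) : d.swp.matEl n₀ n = d.matEl n₀ n := by
  have := (op_basisVec d.swp n₀ n).symm.trans (by rw [op_swp, op_basisVec])
  exact_mod_cast this

theorem weight_ne_zero {d : Triple} {n₀ n : Config} (h : d.matEl n₀ n ≠ 0) :
    d.step n₀ = n ∧ d.weight n₀ ≠ 0 := by
  unfold matEl at h
  by_cases h1 : d.step n₀ = n
  · rw [if_pos h1] at h; exact ⟨h1, h⟩
  · rw [if_neg h1] at h; exact absurd rfl h

theorem step_apply {d : Triple} {n₀ : Config} (h : d.weight n₀ ≠ 0) (m : Mode) :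
    ((d.step n₀ m : ℕ) : ℤ) = n₀ m + (d.1.1.delta m + d.1.2.1.delta m + d.1.2.2.delta m) := by
  unfold weight at h
  have h1 := left_ne_zero_of_mul (left_ne_zero_of_mul h)
  have h2 := right_ne_zero_of_mul (left_ne_zero_of_mul h)
  have h3 := right_ne_zero_of_mul h
  unfold step
  rw [Ladder.step_apply _ _ h3, Ladder.step_apply _ _ h2, Ladder.step_apply _ _ h1]
  ring

theorem eq_of_mode_eq (d : Triple) :
    (d.1.1.mode = d.1.2.1.mode → d.1.1 = d.1.2.1) ∧
    (d.1.2.1.mode = d.1.2.2.mode → d.1.2.1 = d.1.2.2) ∧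
    (d.1.2.2.mode = d.1.1.mode → d.1.2.2 = d.1.1) :=
  ⟨fun h => (Ladder.eq_or_add_eq_zero h).resolve_right d.add_ne_zero₁₂,
    fun h => (Ladder.eq_or_add_eq_zero h).resolve_right d.add_ne_zero₂₃,
    fun h => (Ladder.eq_or_add_eq_zero h).resolve_right d.add_ne_zero₃₁⟩

/-- The number of occurrences of a ladder operator in a triple can be read off the change of the
occupation numbers, since no cancellations occur. -/
theorem count_eq (d : Triple) (x : Ladder) [DecidableEq Ladder] :
    (([d.1.1, d.1.2.1, d.1.2.2].count x : ℕ) : ℤ)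
      = max 0 ((if x.isCreate then 1 else -1) *
        (d.1.1.delta x.mode + d.1.2.1.delta x.mode + d.1.2.2.delta x.mode)) := by
  obtain ⟨h12, h23, h31⟩ := d.eq_of_mode_eq
  have key : ∀ y : Ladder, (y = x ∧ (if x.isCreate then 1 else -1) * y.delta x.mode = 1) ∨
      (y ≠ x ∧ y.mode = x.mode ∧ (if x.isCreate then 1 else -1) * y.delta x.mode = -1) ∨
      (y ≠ x ∧ y.mode ≠ x.mode ∧ (if x.isCreate then 1 else -1) * y.delta x.mode = 0) := by
    intro y
    unfold Ladder.delta
    by_cases hyx : y = x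
    · left; subst hyx
      refine ⟨rfl, ?_⟩
      cases y.isCreate <;> simp
    · right
      by_cases hm : y.mode = x.mode
      · left
        refine ⟨hyx, hm, ?_⟩
        have : y.isCreate ≠ x.isCreate := fun hc => hyx (Ladder.ext_mode hm hc)
        rw [if_pos hm]
        revert this
        cases y.isCreate <;> cases x.isCreate <;> simp
      · right
        exact ⟨hyx, hm, by simp [hm]⟩
  generalize hσ : (if x.isCreate then (1 : ℤ) else -1) = σ at key ⊢
  rw [mul_add, mul_add]
  have k1 := key d.1.1
  have k2 := key d.1.2.1
  have k3 := key d.1.2.2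
  simp only [List.count_cons, List.count_nil, beq_iff_eq]
  rcases k1 with ⟨e1, f1⟩ | ⟨e1, m1, f1⟩ | ⟨e1, m1, f1⟩ <;>
  rcases k2 with ⟨e2, f2⟩ | ⟨e2, m2, f2⟩ | ⟨e2, m2, f2⟩ <;>
  rcases k3 with ⟨e3, f3⟩ | ⟨e3, m3, f3⟩ | ⟨e3, m3, f3⟩ <;>
  (rw [f1, f2, f3]; simp only [e1, e2, e3, if_true, if_false]) <;>
  first
  | (norm_num; done)
  | (exfalso; first
      | exact e2 ((h12 (by rw [e1, m2])).symm.trans e1)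
      | exact e1 ((h12 (by rw [e2, m1])).trans e2)
      | exact e3 ((h23 (by rw [e2, m3])).symm.trans e2)
      | exact e2 ((h23 (by rw [e3, m2])).trans e3)
      | exact e1 ((h31 (by rw [e3, m1])).symm.trans e3)
      | exact e3 ((h31 (by rw [e1, m3])).trans e1))

open Classical in
/-- The rearrangements of a triple. -/
def perms (d : Triple) : Finset Triple :=
  {d, d.rot, d.rot.rot, d.swp, d.swp.rot, d.swp.rot.rot}

/-- Triples connecting the same two basis vectors are rearrangements of each other. -/
theorem mem_perms {d d' : Triple} {n₀ n : Config} (h : d.matEl n₀ n ≠ 0) (h' : d'.matEl n₀ n ≠ 0) :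
    d' ∈ d.perms := by
  classical
  obtain ⟨e, w⟩ := weight_ne_zero h
  obtain ⟨e', w'⟩ := weight_ne_zero h'
  have hp : [d'.1.1, d'.1.2.1, d'.1.2.2].Perm [d.1.1, d.1.2.1, d.1.2.2] := by
    refine List.perm_iff_count.2 fun x => ?_
    have h1 := step_apply w x.mode
    have h2 := step_apply w' x.mode
    rw [e] at h1
    rw [e'] at h2
    have h3 := count_eq d x
    have h4 := count_eq d' x
    have h5 : d.1.1.delta x.mode + d.1.2.1.delta x.mode + d.1.2.2.delta x.mode
      = d'.1.1.delta x.mode + d'.1.2.1.delta x.mode + d'.1.2.2.delta x.mode := by linarith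
    rw [← h5, ← h3] at h4
    exact_mod_cast h4
  rw [← List.mem_permutations'] at hp
  simp only [List.permutations', List.permutations'Aux, List.flatMap_cons, List.flatMap_nil,
    List.map_cons, List.map_nil, List.append_nil, List.mem_append, List.mem_cons,
    List.not_mem_nil, or_false, List.cons.injEq, and_true] at hp
  unfold perms
  simp only [Finset.mem_insert, Finset.mem_singleton]
  have ext : ∀ {a b : Triple}, a.1.1 = b.1.1 → a.1.2.1 = b.1.2.1 → a.1.2.2 = b.1.2.2 → a = b :=
    fun h1 h2 h3 => Subtype.ext (Prod.ext h1 (Prod.ext h2 h3))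
  rcases hp with (h | h | h) | (h | h | h)
  all_goals
    obtain ⟨h1, h2, h3⟩ := h
    first
    | exact Or.inl (ext h1 h2 h3)
    | exact Or.inr (Or.inl (ext h1 h2 h3))
    | exact Or.inr (Or.inr (Or.inl (ext h1 h2 h3)))
    | exact Or.inr (Or.inr (Or.inr (Or.inl (ext h1 h2 h3))))
    | exact Or.inr (Or.inr (Or.inr (Or.inr (Or.inl (ext h1 h2 h3)))))
    | exact Or.inr (Or.inr (Or.inr (Or.inr (Or.inr (ext h1 h2 h3)))))

end Triple

/-! ### Expansion of the cubic term in ladder operators -/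

theorem mom_ne_zero (hL : 0 < L) (q : Xi) : mom L q.1 ≠ 0 := by
  intro h
  refine q.2 (funext fun i => ?_)
  have h1 : (mom L q.1) i = 0 := by rw [h]; rfl
  have h2 : 2 * Real.pi / L * (q.1 i : ℝ) = 0 := h1
  have h3 : 2 * Real.pi / L ≠ 0 := by have := Real.pi_pos; positivity
  exact_mod_cast (mul_eq_zero.1 h2).resolve_left h3

theorem norm_mom_pos (hL : 0 < L) (q : Xi) : 0 < ‖mom L q.1‖ := norm_pos_iff.2 (mom_ne_zero hL q)

/-- The coefficients `c` (for `true`) and `-s` (for `false`). -/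
def bogCoeff (v : E → ℝ) (ν : ℝ) (b : Bool) (x : ℝ) : ℝ :=
  (theta v ν x + sgn b * (theta v ν x)⁻¹) / 2

/-- The linear combination of ladder operators of charge `q` which represents `a^*(q)` (for
`b = true`) or `a(-q)` (for `b = false`) on the left (for `h = true`), and `a(q)` or `a^*(-q)` on
the right (for `h = false`). -/
def field (v : E → ℝ) (ν β L : ℝ) (q : Xi) (b h : Bool) : Module.End ℂ State :=
  ∑ a : Bool × Bool, ((bogCoeff v ν (a.1 == b) ‖mom L q.1‖ * therm v ν β (a.2 == h) ‖mom L q.1‖ : ℝ)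
    : ℂ) • Ladder.op (q, a)

theorem field_eq (q : Xi) (b h : Bool) :
    field v ν β L q b h =
      ((bogCoeff v ν b ‖mom L q.1‖ * therm v ν β h ‖mom L q.1‖ : ℝ) : ℂ) • create (Side.left, q)
      + ((bogCoeff v ν b ‖mom L q.1‖ * therm v ν β (!h) ‖mom L q.1‖ : ℝ) : ℂ)
        • annih (Side.right, q)
      + ((bogCoeff v ν (!b) ‖mom L q.1‖ * therm v ν β h ‖mom L q.1‖ : ℝ) : ℂ)
        • annih (Side.left, q.opp)
      + ((bogCoeff v ν (!b) ‖mom L q.1‖ * therm v ν β (!h) ‖mom L q.1‖ : ℝ) : ℂ)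
        • create (Side.right, q.opp) := by
  unfold field
  rw [Fintype.sum_prod_type]
  simp only [Fintype.sum_bool, Bool.true_beq, Bool.false_beq, Ladder.op, Ladder.isCreate,
    Ladder.mode, sideOf, beq_self_eq_true, if_true, Bool.false_eq_true, if_false,
    Bool.not_true]
  abel

theorem bogC_eq_coeff (hv : IsAdmissible v V) (hν : ν ∈ Ioc 0 V) (hL : 0 < L) (q : Xi) :
    bogC v ν (mom L q.1) = bogCoeff v ν true ‖mom L q.1‖ := by
  rw [bogC_eq hv hν (mom_ne_zero hL q), bogCoeff, sgn_true]
  ring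

theorem bogS_eq_coeff (hv : IsAdmissible v V) (hν : ν ∈ Ioc 0 V) (hL : 0 < L) (q : Xi) :
    bogS v ν (mom L q.1) = -bogCoeff v ν false ‖mom L q.1‖ := by
  rw [bogS_eq hv hν (mom_ne_zero hL q), bogCoeff, sgn_false]
  ring

theorem thermalCreate_eq (hv : IsAdmissible v V) (σ : Side) (q : Xi) :
    thermalCreate v ν β L σ q = (therm v ν β true ‖mom L q.1‖ : ℂ) • create (σ, q)
      + (therm v ν β false ‖mom L q.1‖ : ℂ) • annih (σ.swap, q) := by
  unfold thermalCreate therm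
  rw [omega_eq_disp hv]
  simp

theorem thermalAnnih_eq (hv : IsAdmissible v V) (σ : Side) (q : Xi) :
    thermalAnnih v ν β L σ q = (therm v ν β true ‖mom L q.1‖ : ℂ) • annih (σ, q)
      + (therm v ν β false ‖mom L q.1‖ : ℂ) • create (σ.swap, q) := by
  unfold thermalAnnih therm
  rw [omega_eq_disp hv]
  simp

theorem aCreate_left (hv : IsAdmissible v V) (hν : ν ∈ Ioc 0 V) (hL : 0 < L) (q : Xi) :
    aCreate v ν β L Side.left q = field v ν β L q true true := by
  rw [aCreate, thermalCreate_eq hv, thermalAnnih_eq hv, bogC_eq_coeff hv hν hL,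
    bogS_eq_coeff hv hν hL, norm_mom_opp, field_eq]
  simp only [Side.swap, Bool.not_true]
  push_cast
  module

theorem aAnnih_left (hv : IsAdmissible v V) (hν : ν ∈ Ioc 0 V) (hL : 0 < L) (q : Xi) :
    aAnnih v ν β L Side.left q = field v ν β L q.opp false true := by
  rw [aAnnih, thermalCreate_eq hv, thermalAnnih_eq hv, bogC_eq_coeff hv hν hL,
    bogS_eq_coeff hv hν hL, field_eq, norm_mom_opp, Xi.opp_opp]
  simp only [Side.swap, Bool.not_true, Bool.not_false]
  push_cast
  module

theorem aCreate_right (hv : IsAdmissible v V) (hν : ν ∈ Ioc 0 V) (hL : 0 < L) (q : Xi) :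
    aCreate v ν β L Side.right q = field v ν β L q.opp false false := by
  rw [aCreate, thermalCreate_eq hv, thermalAnnih_eq hv, bogC_eq_coeff hv hν hL,
    bogS_eq_coeff hv hν hL, field_eq, norm_mom_opp, Xi.opp_opp]
  simp only [Side.swap, Bool.not_false]
  push_cast
  module

theorem aAnnih_right (hv : IsAdmissible v V) (hν : ν ∈ Ioc 0 V) (hL : 0 < L) (q : Xi) :
    aAnnih v ν β L Side.right q = field v ν β L q true false := by
  rw [aAnnih, thermalCreate_eq hv, thermalAnnih_eq hv, bogC_eq_coeff hv hν hL,
    bogS_eq_coeff hv hν hL, norm_mom_opp, field_eq]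
  simp only [Side.swap, Bool.not_true, Bool.not_false]
  push_cast
  module

/-- Triples of nonzero lattice momenta with vanishing sum. -/
abbrev Charges : Type := {q : Xi × Xi × Xi // q.1.1 + q.2.1.1 + q.2.2.1 = 0}

/-- The triple of ladder operators with given charges, types and sides. -/
def Triple.ofCharges (q : Charges) (a b c : Bool × Bool) : Triple :=
  ⟨((q.1.1, a), (q.1.2.1, b), (q.1.2.2, c)), q.2⟩

/-- Triples of ladder operators are labelled by charges, types and sides. -/
def tripleEquiv : Charges × ((Bool × Bool) × (Bool × Bool) × (Bool × Bool)) ≃ Triple where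
  toFun x := Triple.ofCharges x.1 x.2.1 x.2.2.1 x.2.2.2
  invFun d := (⟨(d.1.1.1, d.1.2.1.1, d.1.2.2.1), d.2⟩, d.1.1.2, d.1.2.1.2, d.1.2.2.2)
  left_inv _ := rfl
  right_inv _ := rfl

/-- The charges of `a^*_{p+k} a_k a_p` on the left, in the order `-k, -p, p+k`. -/
def chargesAbsorb : CubicIndex ≃ Charges where
  toFun x := ⟨(x.1.1.opp, x.1.2.1.opp, x.1.2.2), by
    have := x.2
    simp only [Xi.opp]
    rw [this]
    abel⟩
  invFun q := ⟨(q.1.1.opp, q.1.2.1.opp, q.1.2.2), by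
    have := q.2
    simp only [Xi.opp]
    rw [← neg_add, add_comm, ← add_eq_zero_iff_eq_neg]
    refine Eq.trans ?_ this
    abel⟩
  left_inv x := by simp [Xi.opp_opp]
  right_inv x := by simp [Xi.opp_opp]

/-- The charges of `a^*_p a^*_k a_{p+k}` on the left, in the order `k, p, -(p+k)`. -/
def chargesEmit : CubicIndex ≃ Charges where
  toFun x := ⟨(x.1.1, x.1.2.1, x.1.2.2.opp), by
    have := x.2
    simp only [Xi.opp]
    rw [this]
    abel⟩
  invFun q := ⟨(q.1.1, q.1.2.1, q.1.2.2.opp), by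
    have := q.2
    simp only [Xi.opp]
    rw [eq_comm, ← add_eq_zero_iff_eq_neg]
    refine Eq.trans ?_ this
    abel⟩
  left_inv x := by simp [Xi.opp_opp]
  right_inv x := by simp [Xi.opp_opp]

theorem field_mul_field_mul_field_apply (q : Charges) (b₁ b₂ b₃ h : Bool) (n₀ n : Config) :
    (field v ν β L q.1.1 b₁ h * field v ν β L q.1.2.1 b₂ h * field v ν β L q.1.2.2 b₃ h)
      (basisVec n₀) n = ((∑ a : Bool × Bool, ∑ b : Bool × Bool, ∑ c : Bool × Bool,
      bogCoeff v ν (a.1 == b₁) ‖mom L q.1.1.1‖ * bogCoeff v ν (b.1 == b₂) ‖mom L q.1.2.1.1‖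
        * bogCoeff v ν (c.1 == b₃) ‖mom L q.1.2.2.1‖
        * (therm v ν β (a.2 == h) ‖mom L q.1.1.1‖ * therm v ν β (b.2 == h) ‖mom L q.1.2.1.1‖
        * therm v ν β (c.2 == h) ‖mom L q.1.2.2.1‖)
        * (Triple.ofCharges q a b c).matEl n₀ n : ℝ) : ℂ) := by
  have h1 : field v ν β L q.1.1 b₁ h * field v ν β L q.1.2.1 b₂ h * field v ν β L q.1.2.2 b₃ h
      = ∑ a : Bool × Bool, ∑ b : Bool × Bool, ∑ c : Bool × Bool,
      ((bogCoeff v ν (a.1 == b₁) ‖mom L q.1.1.1‖ * bogCoeff v ν (b.1 == b₂) ‖mom L q.1.2.1.1‖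
        * bogCoeff v ν (c.1 == b₃) ‖mom L q.1.2.2.1‖
        * (therm v ν β (a.2 == h) ‖mom L q.1.1.1‖ * therm v ν β (b.2 == h) ‖mom L q.1.2.1.1‖
        * therm v ν β (c.2 == h) ‖mom L q.1.2.2.1‖) : ℝ) : ℂ) • (Triple.ofCharges q a b c).op := by
    unfold field
    rw [Finset.sum_mul_sum, Finset.sum_mul]
    refine Finset.sum_congr rfl fun a _ => ?_
    rw [Finset.sum_mul]
    refine Finset.sum_congr rfl fun b _ => ?_
    rw [Finset.mul_sum]
    refine Finset.sum_congr rfl fun c _ => ?_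
    rw [smul_mul_smul_comm, smul_mul_smul_comm]
    unfold Triple.op Triple.ofCharges
    congr 1
    push_cast
    ring
  rw [h1, Complex.ofReal_sum]
  simp only [LinearMap.sum_apply, Finset.sum_apply, LinearMap.smul_apply, Pi.smul_apply,
    Triple.op_basisVec, Complex.ofReal_sum, smul_eq_mul, Complex.ofReal_mul]

/-- The coefficient with which a triple of ladder operators occurs in the cubic Liouvillean, before
symmetrization, in the terms `a^* a a` (for `b = true`) and `a^* a^* a` (for `b = false`) on the
left. -/
def kern (v : E → ℝ) (ν β L : ℝ) (b : Bool) (d : Triple) : ℝ :=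
  (L ^ (3 / 2 : ℝ))⁻¹ * (√ν * vhatRadial v ‖mom L d.1.1.1.1‖ / √(vhat v 0))
    * (bogCoeff v ν (d.1.1.2.1 == !b) ‖mom L d.1.1.1.1‖
      * bogCoeff v ν (d.1.2.1.2.1 == !b) ‖mom L d.1.2.1.1.1‖
      * bogCoeff v ν (d.1.2.2.2.1 == b) ‖mom L d.1.2.2.1.1‖
      * mixing v ν β d.1.1.2.2 d.1.2.1.2.2 d.1.2.2.2.2 ‖mom L d.1.1.1.1‖ ‖mom L d.1.2.1.1.1‖
        ‖mom L d.1.2.2.1.1‖)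

theorem sum_rotate (F : Bool × Bool → Bool × Bool → Bool × Bool → ℝ) :
    ∑ c, ∑ a, ∑ b, F a b c = ∑ a, ∑ b, ∑ c, F a b c := by
  rw [Finset.sum_comm]
  exact Finset.sum_congr rfl fun a _ => Finset.sum_comm

theorem beq_true_eq_self (a : Bool) : (a == true) = a := by cases a <;> rfl

theorem beq_false_eq_not (a : Bool) : (a == false) = !a := by cases a <;> rfl

/-- The expansion of one summand into ladder operators. The conjugate summand on the right has the
charges of the summand on the left, so that left and right terms pair up. -/
theorem cubicTerm_sub_apply (hv : IsAdmissible v V) (hν : ν ∈ Ioc 0 V) (hL : 0 < L)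
    (x : CubicIndex) (n₀ n : Config) :
    ((cubicTerm v ν β L Side.left x - cubicTerm v ν β L Side.right x) (basisVec n₀)) n
      = (((∑ a : Bool × Bool, ∑ b : Bool × Bool, ∑ c : Bool × Bool,
          kern v ν β L true (Triple.ofCharges (chargesAbsorb x) a b c)
            * (Triple.ofCharges (chargesAbsorb x) a b c).matEl n₀ n)
        + ∑ a : Bool × Bool, ∑ b : Bool × Bool, ∑ c : Bool × Bool,
          kern v ν β L false (Triple.ofCharges (chargesEmit x) a b c)
            * (Triple.ofCharges (chargesEmit x) a b c).matEl n₀ n : ℝ) : ℂ) := by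
  obtain ⟨⟨k, p, r⟩, hx⟩ := x
  simp only at hx
  have c1 : r.1 + k.opp.1 + p.opp.1 = 0 := by simp only [Xi.opp]; rw [hx]; abel
  have c2 : p.1 + k.1 + r.opp.1 = 0 := by simp only [Xi.opp]; rw [hx]; abel
  have c3 : r.opp.1 + k.1 + p.1 = 0 := by simp only [Xi.opp]; rw [hx]; abel
  have c4 : p.opp.1 + k.opp.1 + r.1 = 0 := by simp only [Xi.opp]; rw [hx]; abel
  have e1 := field_mul_field_mul_field_apply (v := v) (ν := ν) (β := β) (L := L)
    ⟨(r, k.opp, p.opp), c1⟩ true false false true n₀ n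
  have e2 := field_mul_field_mul_field_apply (v := v) (ν := ν) (β := β) (L := L)
    ⟨(p, k, r.opp), c2⟩ true true false true n₀ n
  have e3 := field_mul_field_mul_field_apply (v := v) (ν := ν) (β := β) (L := L)
    ⟨(r.opp, k, p), c3⟩ false true true false n₀ n
  have e4 := field_mul_field_mul_field_apply (v := v) (ν := ν) (β := β) (L := L)
    ⟨(p.opp, k.opp, r), c4⟩ false false true false n₀ n
  have m1 : ∀ a b c, (Triple.ofCharges ⟨(r, k.opp, p.opp), c1⟩ c a b).matEl n₀ n
      = (Triple.ofCharges (chargesAbsorb ⟨(k, p, r), hx⟩) a b c).matEl n₀ n := fun a b c => by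
    rw [← Triple.matEl_rot]; rfl
  have m2 : ∀ a b c, (Triple.ofCharges ⟨(p, k, r.opp), c2⟩ b a c).matEl n₀ n
      = (Triple.ofCharges (chargesEmit ⟨(k, p, r), hx⟩) a b c).matEl n₀ n := fun a b c => by
    rw [← Triple.matEl_swp]; rfl
  have m3 : ∀ a b c, (Triple.ofCharges ⟨(r.opp, k, p), c3⟩ c a b).matEl n₀ n
      = (Triple.ofCharges (chargesEmit ⟨(k, p, r), hx⟩) a b c).matEl n₀ n := fun a b c => by
    rw [← Triple.matEl_rot]; rfl
  have m4 : ∀ a b c, (Triple.ofCharges ⟨(p.opp, k.opp, r), c4⟩ b a c).matEl n₀ n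
      = (Triple.ofCharges (chargesAbsorb ⟨(k, p, r), hx⟩) a b c).matEl n₀ n := fun a b c => by
    rw [← Triple.matEl_swp]; rfl
  rw [sum_rotate] at e1 e3
  rw [Finset.sum_comm] at e2 e4
  simp only [m1] at e1
  simp only [m2] at e2
  simp only [m3] at e3
  simp only [m4] at e4
  simp only [cubicTerm, aCreate_left hv hν hL, aAnnih_left hv hν hL, aCreate_right hv hν hL,
    aAnnih_right hv hν hL, LinearMap.sub_apply, LinearMap.smul_apply, LinearMap.add_apply,
    Pi.sub_apply, Pi.smul_apply, Pi.add_apply, smul_eq_mul]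
  rw [e1, e2, e3, e4, ← Complex.ofReal_add, ← Complex.ofReal_mul, ← Complex.ofReal_add,
    ← Complex.ofReal_mul, ← Complex.ofReal_sub, mul_add, mul_add,
    show ∀ a b c d : ℝ, a + b - (c + d) = (a - d) + (b - c) from fun a b c d => by ring]
  congr 2
  · simp only [Finset.mul_sum, ← Finset.sum_sub_distrib]
    refine Finset.sum_congr rfl fun a _ => Finset.sum_congr rfl fun b _ =>
      Finset.sum_congr rfl fun c _ => ?_
    simp only [kern, mixing, chargesAbsorb, Triple.ofCharges, Equiv.coe_fn_mk, norm_mom_opp,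
      vhat_eq_radial hv (mom L k.1), beq_true_eq_self, beq_false_eq_not, Bool.not_true]
    ring
  · simp only [Finset.mul_sum, ← Finset.sum_sub_distrib]
    refine Finset.sum_congr rfl fun a _ => Finset.sum_congr rfl fun b _ =>
      Finset.sum_congr rfl fun c _ => ?_
    simp only [kern, mixing, chargesEmit, Triple.ofCharges, Equiv.coe_fn_mk, norm_mom_opp,
      vhat_eq_radial hv (mom L k.1), beq_true_eq_self, beq_false_eq_not, Bool.not_false]
    ring

theorem Triple.finite_matEl_ne_zero (n₀ n : Config) : {d : Triple | d.matEl n₀ n ≠ 0}.Finite := by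
  rcases Set.eq_empty_or_nonempty {d : Triple | d.matEl n₀ n ≠ 0} with h | ⟨d, hd⟩
  · rw [h]; exact Set.finite_empty
  · exact d.perms.finite_toSet.subset fun d' hd' => Triple.mem_perms hd hd'

theorem summable_mul_matEl (K : Triple → ℝ) (n₀ n : Config) :
    Summable fun d => K d * d.matEl n₀ n :=
  summable_of_hasFiniteSupport <| (Triple.finite_matEl_ne_zero n₀ n).subset fun _ hd =>
    right_ne_zero_of_mul hd

theorem hasSum_ofCharges {g : Triple → ℝ} (hg : Summable g) (f : CubicIndex ≃ Charges) :
    HasSum (fun x => ∑ a : Bool × Bool, ∑ b : Bool × Bool, ∑ c : Bool × Bool,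
      g (Triple.ofCharges (f x) a b c)) (∑' d, g d) := by
  let e : CubicIndex × ((Bool × Bool) × (Bool × Bool) × (Bool × Bool)) ≃ Triple :=
    (Equiv.prodCongr f (Equiv.refl _)).trans tripleEquiv
  have h : HasSum (g ∘ e) (∑' d, g d) := (Equiv.hasSum_iff e).2 hg.hasSum
  refine h.prod_fiberwise fun x => ?_
  have := hasSum_fintype fun y => (g ∘ e) (x, y)
  rw [Fintype.sum_prod_type] at this
  convert this using 1
  exact Finset.sum_congr rfl fun a _ => (Fintype.sum_prod_type fun y => (g ∘ e) (x, a, y)).symm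

theorem cubicLiouvillean_basisVec (hv : IsAdmissible v V) (hν : ν ∈ Ioc 0 V) (hL : 0 < L)
    (n₀ n : Config) :
    cubicLiouvillean v ν β L (basisVec n₀) n
      = ((∑' d, (kern v ν β L true d + kern v ν β L false d) * d.matEl n₀ n : ℝ) : ℂ) := by
  unfold cubicLiouvillean
  simp only [cubicTerm_sub_apply hv hν hL]
  rw [← Complex.ofReal_tsum]
  congr 1
  have h1 := summable_mul_matEl (kern v ν β L true) n₀ n
  have h2 := summable_mul_matEl (kern v ν β L false) n₀ n
  rw [((hasSum_ofCharges h1 chargesAbsorb).add (hasSum_ofCharges h2 chargesEmit)).tsum_eq,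
    ← h1.tsum_add h2]
  simp only [add_mul]

/-! ### Symmetrization -/

/-- The amplitude of a triple of ladder operators in the cubic Liouvillean. -/
def Triple.amplitude (v : E → ℝ) (ν β L : ℝ) (d : Triple) : ℝ :=
  (L ^ (3 / 2 : ℝ))⁻¹ * √(ν / vhat v 0)
    * (amp v ν d.1.1.2.1 d.1.2.1.2.1 d.1.2.2.2.1 ‖mom L d.1.1.1.1‖ ‖mom L d.1.2.1.1.1‖
        ‖mom L d.1.2.2.1.1‖
      * mixing v ν β d.1.1.2.2 d.1.2.1.2.2 d.1.2.2.2.2 ‖mom L d.1.1.1.1‖ ‖mom L d.1.2.1.1.1‖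
        ‖mom L d.1.2.2.1.1‖)

theorem Triple.amplitude_rot (d : Triple) : d.rot.amplitude v ν β L = d.amplitude v ν β L := by
  unfold Triple.amplitude Triple.rot
  simp only
  rw [amp_rotate]
  unfold mixing
  ring

theorem Triple.amplitude_swp (d : Triple) : d.swp.amplitude v ν β L = d.amplitude v ν β L := by
  unfold Triple.amplitude Triple.swp
  simp only
  rw [amp_swap]
  unfold mixing
  ring

theorem sgn_beq (a b : Bool) : sgn (a == b) = sgn a * sgn b := by cases a <;> cases b <;> simp

/-- Summing the kernel over the rearrangements of a triple produces the amplitude `j`. -/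
theorem kern_symmetrize (hv : IsAdmissible v V) (hν : ν ∈ Ioc 0 V) (hL : 0 < L) (d : Triple)
    (K : Triple → ℝ) (hK : ∀ d, K d = kern v ν β L true d + kern v ν β L false d) :
    K d + K d.rot + K d.rot.rot + K d.swp + K d.swp.rot + K d.swp.rot.rot
      = d.amplitude v ν β L := by
  simp only [hK, Triple.amplitude, kern, Triple.rot, Triple.swp, bogCoeff, sgn_beq, Bool.not_true,
    Bool.not_false, sgn_true, sgn_false, amp, mixing]
  rw [Real.sqrt_div hν.1.le]
  have hx := (theta_pos hv hν (norm_mom_pos hL d.1.1.1)).ne'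
  have hy := (theta_pos hv hν (norm_mom_pos hL d.1.2.1.1)).ne'
  have hz := (theta_pos hv hν (norm_mom_pos hL d.1.2.2.1)).ne'
  generalize theta v ν ‖mom L d.1.1.1.1‖ = θ₁ at *
  generalize theta v ν ‖mom L d.1.2.1.1.1‖ = θ₂ at *
  generalize theta v ν ‖mom L d.1.2.2.1.1‖ = θ₃ at *
  generalize ‖mom L d.1.1.1.1‖ = x
  generalize ‖mom L d.1.2.1.1.1‖ = y
  generalize ‖mom L d.1.2.2.1.1‖ = z
  generalize hA : therm v ν β d.1.1.2.2 x * therm v ν β d.1.2.1.2.2 y * therm v ν β d.1.2.2.2.2 z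
    - therm v ν β (!d.1.1.2.2) x * therm v ν β (!d.1.2.1.2.2) y * therm v ν β (!d.1.2.2.2.2) z = A
  have p1 : therm v ν β d.1.2.1.2.2 y * therm v ν β d.1.2.2.2.2 z * therm v ν β d.1.1.2.2 x
    - therm v ν β (!d.1.2.1.2.2) y * therm v ν β (!d.1.2.2.2.2) z * therm v ν β (!d.1.1.2.2) x = A
    := by rw [← hA]; ring
  have p2 : therm v ν β d.1.2.2.2.2 z * therm v ν β d.1.1.2.2 x * therm v ν β d.1.2.1.2.2 y
    - therm v ν β (!d.1.2.2.2.2) z * therm v ν β (!d.1.1.2.2) x * therm v ν β (!d.1.2.1.2.2) y = A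
    := by rw [← hA]; ring
  have p3 : therm v ν β d.1.2.1.2.2 y * therm v ν β d.1.1.2.2 x * therm v ν β d.1.2.2.2.2 z
    - therm v ν β (!d.1.2.1.2.2) y * therm v ν β (!d.1.1.2.2) x * therm v ν β (!d.1.2.2.2.2) z = A
    := by rw [← hA]; ring
  have p4 : therm v ν β d.1.1.2.2 x * therm v ν β d.1.2.2.2.2 z * therm v ν β d.1.2.1.2.2 y
    - therm v ν β (!d.1.1.2.2) x * therm v ν β (!d.1.2.2.2.2) z * therm v ν β (!d.1.2.1.2.2) y = A
    := by rw [← hA]; ring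
  have p5 : therm v ν β d.1.2.2.2.2 z * therm v ν β d.1.2.1.2.2 y * therm v ν β d.1.1.2.2 x
    - therm v ν β (!d.1.2.2.2.2) z * therm v ν β (!d.1.2.1.2.2) y * therm v ν β (!d.1.1.2.2) x = A
    := by rw [← hA]; ring
  rw [p1, p2, p3, p4, p5]
  generalize sgn d.1.1.2.1 = t₁
  generalize sgn d.1.2.1.2.1 = t₂
  generalize sgn d.1.2.2.2.1 = t₃
  generalize vhatRadial v x = V₁
  generalize vhatRadial v y = V₂
  generalize vhatRadial v z = V₃
  have hs : √(vhat v 0) ≠ 0 := (Real.sqrt_pos.2 hv.vhat_zero_pos).ne'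
  have hLs : L ^ (3 / 2 : ℝ) ≠ 0 := (Real.rpow_pos_of_pos hL _).ne'
  generalize √(vhat v 0) = r at *
  generalize L ^ (3 / 2 : ℝ) = l at *
  generalize √ν = n
  field_simp
  ring

/-- The coefficients of the cubic Liouvillean applied to a basis vector. -/
theorem cubicLiouvillean_basisVec_eq (hv : IsAdmissible v V) (hν : ν ∈ Ioc 0 V) (hL : 0 < L)
    (n₀ n : Config) :
    cubicLiouvillean v ν β L (basisVec n₀) n
      = ((∑' d : Triple, d.amplitude v ν β L / 6 * d.matEl n₀ n : ℝ) : ℂ) := by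
  rw [cubicLiouvillean_basisVec hv hν hL]
  congr 1
  set K : Triple → ℝ := fun d => kern v ν β L true d + kern v ν β L false d with hK
  have hS := summable_mul_matEl K n₀ n
  have hrot : ∀ g : Triple → ℝ, ∑' d, g (Triple.rot d) * d.matEl n₀ n
      = ∑' d, g d * d.matEl n₀ n := by
    intro g
    rw [← Equiv.tsum_eq Triple.rotEquiv fun d => g d * d.matEl n₀ n]
    exact tsum_congr fun d => by rw [← Triple.matEl_rot d]; rfl
  have hswp : ∀ g : Triple → ℝ, ∑' d, g (Triple.swp d) * d.matEl n₀ n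
      = ∑' d, g d * d.matEl n₀ n := by
    intro g
    rw [← Equiv.tsum_eq Triple.swpEquiv fun d => g d * d.matEl n₀ n]
    exact tsum_congr fun d => by rw [← Triple.matEl_swp d]; rfl
  have s := fun f : Triple → Triple => summable_mul_matEl (fun d => K (f d)) n₀ n
  have e1 := hrot K
  have e2 := (hrot fun d => K d.rot).trans e1
  have e3 := hswp K
  have e4 := (hswp fun d => K d.rot).trans e1
  have e5 := (hswp fun d => K d.rot.rot).trans e2
  have : ∀ d : Triple, d.amplitude v ν β L / 6 * d.matEl n₀ n
      = (K d * d.matEl n₀ n + K d.rot * d.matEl n₀ n + K d.rot.rot * d.matEl n₀ n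
        + K d.swp * d.matEl n₀ n + K d.swp.rot * d.matEl n₀ n
        + K d.swp.rot.rot * d.matEl n₀ n) / 6 := by
    intro d
    rw [← kern_symmetrize hv hν hL d K fun d => rfl]
    ring
  simp only [this]
  have hs := (((((hS.hasSum.add (s Triple.rot).hasSum).add
    (s fun d => d.rot.rot).hasSum).add (s Triple.swp).hasSum).add
    (s fun d => d.swp.rot).hasSum).add (s fun d => d.swp.rot.rot).hasSum).div_const 6
  refine Eq.trans ?_ hs.tsum_eq.symm
  rw [e1, e2, e3, e4, e5]
  ring

/-! ### The Golden Rule term as a sum over triples -/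

namespace Triple

theorem perms_invariant {α : Type*} {f : Triple → α} (hr : ∀ d, f (rot d) = f d)
    (hs : ∀ d, f (swp d) = f d) {d d' : Triple} (h : d' ∈ d.perms) : f d' = f d := by
  simp only [perms, Finset.mem_insert, Finset.mem_singleton] at h
  rcases h with rfl | rfl | rfl | rfl | rfl | rfl <;> simp only [hr, hs]

/-- The number of distinct rearrangements of a triple. -/
def mult (d : Triple) : ℕ := d.perms.card

theorem mult_le (d : Triple) : d.mult ≤ 6 := by
  classical
  unfold mult perms
  exact Finset.card_le_six

theorem mult_eq_six {d : Triple} (h₁ : d.1.1 ≠ d.1.2.1) (h₂ : d.1.2.1 ≠ d.1.2.2)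
    (h₃ : d.1.2.2 ≠ d.1.1) : d.mult = 6 := by
  classical
  obtain ⟨⟨a, b, c⟩, hd⟩ := d
  simp only at h₁ h₂ h₃
  unfold mult perms
  simp only [rot, swp]
  rw [Finset.card_insert_of_notMem, Finset.card_insert_of_notMem, Finset.card_insert_of_notMem,
    Finset.card_insert_of_notMem, Finset.card_insert_of_notMem, Finset.card_singleton] <;>
  simp only [Finset.mem_insert, Finset.mem_singleton, Subtype.mk.injEq, Prod.mk.injEq, not_or,
    not_and]
  all_goals grind

theorem matEl_step (d : Triple) (n₀ : Config) : d.matEl n₀ (d.step n₀) = d.weight n₀ := by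
  unfold matEl
  simp

/-- The coefficient of `L_3` between two basis vectors: only the rearrangements of one triple
contribute, all of them equally. -/
theorem tsum_amplitude_step {d : Triple} {n₀ : Config} (h : d.weight n₀ ≠ 0) :
    ∑' d' : Triple, d'.amplitude v ν β L / 6 * d'.matEl n₀ (d.step n₀)
      = d.mult / 6 * d.amplitude v ν β L * d.weight n₀ := by
  rw [tsum_eq_sum (s := d.perms)]
  · have : ∀ d' ∈ d.perms, d'.amplitude v ν β L / 6 * d'.matEl n₀ (d.step n₀)
        = d.amplitude v ν β L / 6 * d.weight n₀ := by
      intro d' hd'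
      rw [perms_invariant amplitude_rot amplitude_swp hd',
        perms_invariant (f := fun d' => d'.matEl n₀ (d.step n₀)) (fun _ => matEl_rot _ _ _)
          (fun _ => matEl_swp _ _ _) hd', matEl_step]
    rw [Finset.sum_congr rfl this, Finset.sum_const, nsmul_eq_mul, mult]
    ring
  · intro d' hd'
    have : d'.matEl n₀ (d.step n₀) = 0 := by
      by_contra h0
      exact hd' (mem_perms (by rwa [matEl_step]) h0)
    rw [this, mul_zero]

end Triple

/-- The Golden Rule term as one sum over triples. A final state is counted once for each
rearrangement of a triple leading to it; a coefficient `mult / 6` squared, divided by this number,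
leaves `mult / 36`. -/
theorem goldenRule_basisVec (hv : IsAdmissible v V) (hν : ν ∈ Ioc 0 V) (hL : 0 < L)
    (ε : ℝ) (n₀ : Config)
    (hsum : Summable fun d : Triple =>
      ((d.mult / 36 * d.amplitude v ν β L ^ 2 * d.weight n₀ ^ 2 : ℝ) : ℂ)
        * ((energy v ν L (d.step n₀) : ℂ) - Complex.I * (ε : ℂ))⁻¹) :
    GoldenRuleSummable v ν β L ε (basisVec n₀) ∧
    goldenRule v ν β L ε (basisVec n₀) = ∑' d : Triple,
      ((d.mult / 36 * d.amplitude v ν β L ^ 2 * d.weight n₀ ^ 2 : ℝ) : ℂ)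
        * ((energy v ν L (d.step n₀) : ℂ) - Complex.I * (ε : ℂ))⁻¹ := by
  set F : Triple → ℂ := fun d =>
      ((d.mult / 36 * d.amplitude v ν β L ^ 2 * d.weight n₀ ^ 2 : ℝ) : ℂ)
        * ((energy v ν L (d.step n₀) : ℂ) - Complex.I * (ε : ℂ))⁻¹ with hF
  set c : Config → ℝ := fun n => ∑' d : Triple, d.amplitude v ν β L / 6 * d.matEl n₀ n with hc
  have hterm : ∀ n, (starRingEnd ℂ) (cubicLiouvillean v ν β L (basisVec n₀) n) *
      bogResolvent v ν L ε (cubicLiouvillean v ν β L (basisVec n₀)) n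
      = ∑' d : ((fun d => Triple.step d n₀) ⁻¹' {n} : Set Triple), F d := by
    intro n
    unfold bogResolvent
    rw [cubicLiouvillean_basisVec_eq hv hν hL, Complex.conj_ofReal]
    change (c n : ℂ) * (_ * (c n : ℂ)) = _
    have h1 : ∀ d : ((fun d => Triple.step d n₀) ⁻¹' {n} : Set Triple), F d
        = ((d.1.amplitude v ν β L / 6 * d.1.matEl n₀ n : ℝ) : ℂ)
          * (((energy v ν L n : ℂ) - Complex.I * (ε : ℂ))⁻¹ * (c n : ℂ)) := by
      rintro ⟨d, hd⟩
      have hd' : d.step n₀ = n := hd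
      subst hd'
      simp only [hF, Triple.matEl_step]
      by_cases h : d.weight n₀ = 0
      · simp [h]
      · rw [hc]
        simp only [Triple.tsum_amplitude_step h]
        push_cast
        ring
    rw [tsum_congr h1, tsum_mul_right, ← Complex.ofReal_tsum,
      tsum_subtype_eq_of_support_subset (f := fun d : Triple =>
        d.amplitude v ν β L / 6 * d.matEl n₀ n)]
    intro d hd
    exact (Triple.weight_ne_zero (right_ne_zero_of_mul hd)).1
  have h := hsum.hasSum.tsum_fiberwise fun d => Triple.step d n₀
  constructor
  · unfold GoldenRuleSummable
    simp only [hterm]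
    exact h.summable
  · unfold goldenRule braket
    simp only [hterm]
    exact h.tsum_eq

/-! ### Energies -/

theorem energy_add_single (n : Config) (m : Mode) :
    energy v ν L (n + Finsupp.single m 1)
      = energy v ν L n + m.1.sign * omega v ν (mom L m.2.1) := by
  classical
  unfold energy
  rw [Finsupp.sum_add_index' (by simp) (by intros; push_cast; ring), Finsupp.sum_single_index]
  · simp
  · simp

theorem Ladder.energy_step (hv : IsAdmissible v V) (d : Ladder) (n : Config)
    (h : d.weight n ≠ 0) :
    energy v ν L (d.step n) = energy v ν L n + sgn d.2.1 * disp v ν ‖mom L d.1.1‖ := by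
  have hω : omega v ν (mom L d.mode.2.1) = disp v ν ‖mom L d.1.1‖ := by
    rw [omega_eq_disp hv]
    unfold Ladder.mode
    cases d.2.1
    · simp only [Bool.false_eq_true, if_false]; rw [norm_mom_opp]
    · rfl
  unfold Ladder.weight at h
  unfold Ladder.step
  by_cases hc : d.isCreate
  · simp only [hc, if_true]
    rw [energy_add_single, hω]
    have : d.mode.1.sign = sgn d.2.1 := by
      unfold Ladder.isCreate at hc
      unfold Ladder.mode sideOf
      revert hc
      cases d.2.1 <;> cases d.2.2 <;> simp [Side.sign]
    rw [this]
  · simp only [hc, if_false, Bool.false_eq_true] at h ⊢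
    have h0 : n d.mode ≠ 0 := by
      intro h0; simp [h0] at h
    have h1 : n - Finsupp.single d.mode 1 + Finsupp.single d.mode 1 = n :=
      tsub_add_cancel_of_le (Finsupp.single_le_iff.mpr (Nat.one_le_iff_ne_zero.mpr h0))
    have h2 := energy_add_single (v := v) (ν := ν) (L := L) (n - Finsupp.single d.mode 1) d.mode
    rw [h1, hω] at h2
    have : d.mode.1.sign = -sgn d.2.1 := by
      unfold Ladder.isCreate at hc
      unfold Ladder.mode sideOf
      revert hc
      cases d.2.1 <;> cases d.2.2 <;> simp [Side.sign]
    rw [this] at h2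
    linarith

/-- The energy change of a triple of ladder operators. -/
def Triple.gap (v : E → ℝ) (ν L : ℝ) (d : Triple) : ℝ :=
  BoseGas.gap v ν d.1.1.2.1 d.1.2.1.2.1 d.1.2.2.2.1 ‖mom L d.1.1.1.1‖ ‖mom L d.1.2.1.1.1‖
    ‖mom L d.1.2.2.1.1‖

theorem Triple.energy_step (hv : IsAdmissible v V) (d : Triple) (n : Config)
    (h : d.weight n ≠ 0) :
    energy v ν L (d.step n) = energy v ν L n + d.gap v ν L := by
  unfold Triple.weight at h
  have h1 := left_ne_zero_of_mul (left_ne_zero_of_mul h)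
  have h2 := right_ne_zero_of_mul (left_ne_zero_of_mul h)
  have h3 := right_ne_zero_of_mul h
  unfold Triple.step Triple.gap BoseGas.gap
  rw [Ladder.energy_step hv _ _ h3, Ladder.energy_step hv _ _ h2, Ladder.energy_step hv _ _ h1]
  ring

/-! ### The vacuum and the quasiparticle state as basis vectors -/

/-- The occupation numbers of a quasiparticle of momentum `k` on both sides. -/
def pairConfig (k : Xi) : Config :=
  Finsupp.single (Side.left, k) 1 + Finsupp.single (Side.right, k) 1

theorem vac_eq : vac = basisVec 0 := rfl

theorem quasi_eq (k : Xi) : quasi k = basisVec (pairConfig k) := by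
  classical
  have h1 := Ladder.op_basisVec (k.opp, false, false) 0
  have h2 := Ladder.op_basisVec (k, true, true) (Finsupp.single (Side.right, k) 1)
  simp only [Ladder.op, Ladder.isCreate, Ladder.mode, Ladder.weight, Ladder.step, sideOf,
    Xi.opp_opp, beq_self_eq_true, if_true, Bool.false_eq_true, if_false, zero_add,
    Finsupp.zero_apply, Nat.cast_zero, Real.sqrt_one, Complex.ofReal_one, one_smul] at h1 h2
  unfold quasi pairConfig
  rw [vac_eq, h1, h2]
  have : (Finsupp.single (Side.right, k) 1 : Config) (Side.left, k) = 0 := by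
    rw [Finsupp.single_apply, if_neg]; simp
  rw [this]
  simp [add_comm]

theorem energy_zero : energy v ν L 0 = 0 := by simp [energy]

theorem energy_pairConfig (k : Xi) : energy v ν L (pairConfig k) = 0 := by
  unfold pairConfig
  rw [energy_add_single, ← zero_add (Finsupp.single (Side.left, k) 1), energy_add_single,
    energy_zero]
  simp [Side.sign]

/-! ### The Feynman--Hellmann terms vanish -/

/-- The exchange of the two sides on modes. -/
def swapMode : Mode ≃ Mode where
  toFun m := (m.1.swap, m.2)
  invFun m := (m.1.swap, m.2)
  left_inv m := by obtain ⟨_ | _, k⟩ := m <;> rfl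
  right_inv m := by obtain ⟨_ | _, k⟩ := m <;> rfl

/-- The exchange of the two sides on occupation numbers. -/
def swapConfig (n : Config) : Config := Finsupp.equivMapDomain swapMode n

theorem swapConfig_apply (n : Config) (m : Mode) : swapConfig n m = n (swapMode m) := rfl

/-- The exchange of the two sides on states. -/
def swapState : State →ₗ[ℂ] State where
  toFun f := fun n => f (swapConfig n)
  map_add' _ _ := rfl
  map_smul' _ _ := rfl

theorem swapMode_swapMode (m : Mode) : swapMode (swapMode m) = m := swapMode.left_inv m

theorem swapConfig_add_single (n : Config) (m : Mode) :
    swapConfig (n + Finsupp.single (swapMode m) 1) = swapConfig n + Finsupp.single m 1 := by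
  classical
  ext m'
  simp only [swapConfig_apply, Finsupp.add_apply, Finsupp.single_apply, EmbeddingLike.apply_eq_iff_eq]

theorem swapConfig_sub_single (n : Config) (m : Mode) :
    swapConfig (n - Finsupp.single (swapMode m) 1) = swapConfig n - Finsupp.single m 1 := by
  classical
  ext m'
  simp only [swapConfig_apply, Finsupp.tsub_apply, Finsupp.single_apply, EmbeddingLike.apply_eq_iff_eq]

theorem swapMode_mk (σ : Side) (q : Xi) : swapMode (σ, q) = (σ.swap, q) := rfl

theorem swapState_create (m : Mode) (f : State) :
    swapState (create m f) = create (swapMode m) (swapState f) := by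
  funext n
  change (√(swapConfig n m : ℝ) : ℂ) * f (swapConfig n - Finsupp.single m 1)
    = (√(n (swapMode m) : ℝ) : ℂ) * f (swapConfig (n - Finsupp.single (swapMode m) 1))
  rw [swapConfig_apply, swapConfig_sub_single]

theorem swapState_annih (m : Mode) (f : State) :
    swapState (annih m f) = annih (swapMode m) (swapState f) := by
  funext n
  change (√((swapConfig n m : ℝ) + 1) : ℂ) * f (swapConfig n + Finsupp.single m 1)
    = (√((n (swapMode m) : ℝ) + 1) : ℂ) * f (swapConfig (n + Finsupp.single (swapMode m) 1))
  rw [swapConfig_apply, swapConfig_add_single]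

theorem swapState_thermalCreate (σ : Side) (q : Xi) (f : State) :
    swapState (thermalCreate v ν β L σ q f) = thermalCreate v ν β L σ.swap q (swapState f) := by
  unfold thermalCreate
  rw [LinearMap.add_apply, LinearMap.add_apply, map_add, LinearMap.smul_apply,
    LinearMap.smul_apply, LinearMap.smul_apply, LinearMap.smul_apply, map_smul, map_smul,
    swapState_create, swapState_annih, swapMode_mk, swapMode_mk]

theorem swapState_thermalAnnih (σ : Side) (q : Xi) (f : State) :
    swapState (thermalAnnih v ν β L σ q f) = thermalAnnih v ν β L σ.swap q (swapState f) := by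
  unfold thermalAnnih
  rw [LinearMap.add_apply, LinearMap.add_apply, map_add, LinearMap.smul_apply,
    LinearMap.smul_apply, LinearMap.smul_apply, LinearMap.smul_apply, map_smul, map_smul,
    swapState_create, swapState_annih, swapMode_mk, swapMode_mk]

theorem swapState_aCreate (σ : Side) (q : Xi) (f : State) :
    swapState (aCreate v ν β L σ q f) = aCreate v ν β L σ.swap q (swapState f) := by
  unfold aCreate
  rw [LinearMap.sub_apply, LinearMap.sub_apply, map_sub, LinearMap.smul_apply,
    LinearMap.smul_apply, LinearMap.smul_apply, LinearMap.smul_apply, map_smul, map_smul,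
    swapState_thermalCreate, swapState_thermalAnnih]

theorem swapState_aAnnih (σ : Side) (q : Xi) (f : State) :
    swapState (aAnnih v ν β L σ q f) = aAnnih v ν β L σ.swap q (swapState f) := by
  unfold aAnnih
  rw [LinearMap.sub_apply, LinearMap.sub_apply, map_sub, LinearMap.smul_apply,
    LinearMap.smul_apply, LinearMap.smul_apply, LinearMap.smul_apply, map_smul, map_smul,
    swapState_thermalCreate, swapState_thermalAnnih]

theorem swapState_quarticTerm (x : QuarticIndex) (f : State) :
    swapState (quarticTerm v ν β L Side.left x f) = quarticTerm v ν β L Side.right x (swapState f)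
    := by
  unfold quarticTerm
  rw [LinearMap.smul_apply, LinearMap.smul_apply, map_smul]
  simp only [Module.End.mul_apply]
  rw [swapState_aCreate, swapState_aCreate, swapState_aAnnih, swapState_aAnnih,
    show Side.left.swap = Side.right from rfl]

theorem swapState_basisVec {n₀ : Config} (h : swapConfig n₀ = n₀) :
    swapState (basisVec n₀) = basisVec n₀ := by
  classical
  funext n
  change basisVec n₀ (swapConfig n) = basisVec n₀ n
  have h2 : swapConfig (swapConfig n) = n := by
    ext m; rw [swapConfig_apply, swapConfig_apply, swapMode_swapMode]
  rw [basisVec_apply, basisVec_apply]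
  by_cases h1 : n = n₀
  · rw [h1, h]
  · rw [if_neg h1, if_neg]
    intro h3
    exact h1 (by rw [← h2, h3, h])

/-- On a state which is symmetric under the exchange of the two sides, the left and the right part
of the quartic Liouvillean have the same diagonal matrix element. -/
theorem feynmanHellmann_basisVec {n₀ : Config} (h : swapConfig n₀ = n₀) :
    feynmanHellmann v ν β L (basisVec n₀) = 0 := by
  classical
  unfold feynmanHellmann braket
  rw [tsum_eq_single n₀]
  · have : quarticLiouvillean v ν β L (basisVec n₀) n₀ = 0 := by
      unfold quarticLiouvillean
      refine (tsum_congr fun x => ?_).trans tsum_zero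
      have h1 := congrFun (swapState_quarticTerm (v := v) (ν := ν) (β := β) (L := L) x
        (basisVec n₀)) n₀
      rw [swapState_basisVec h] at h1
      change quarticTerm v ν β L Side.left x (basisVec n₀) (swapConfig n₀) = _ at h1
      rw [h] at h1
      rw [LinearMap.sub_apply, Pi.sub_apply, h1, sub_self]
    rw [this, mul_zero]
  · intro n hn
    rw [basisVec_apply, if_neg hn]
    simp

theorem swapConfig_zero : swapConfig 0 = 0 := by
  ext m; simp [swapConfig_apply]

theorem swapConfig_pairConfig (k : Xi) : swapConfig (pairConfig k) = pairConfig k := by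
  classical
  ext m
  obtain ⟨_ | _, q⟩ := m <;>
  simp [swapConfig_apply, pairConfig, Finsupp.single_apply, swapMode, Side.swap]

theorem shiftBracket_eq (ε : ℝ) (k : Xi) :
    shiftBracket v ν β ε L k
      = goldenRule v ν β L ε (basisVec 0) - goldenRule v ν β L ε (basisVec (pairConfig k)) := by
  unfold shiftBracket
  rw [vac_eq, quasi_eq, feynmanHellmann_basisVec swapConfig_zero,
    feynmanHellmann_basisVec (swapConfig_pairConfig k)]
  ring

/-! ### Lattice sums -/

theorem norm_mom_sq (L : ℝ) (m : Fin 3 → ℤ) :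
    ‖mom L m‖ ^ 2 = (2 * Real.pi / L) ^ 2 * ((∑ i, (m i).natAbs ^ 2 : ℕ) : ℝ) := by
  rw [EuclideanSpace.norm_sq_eq]
  push_cast
  rw [Finset.mul_sum]
  refine Finset.sum_congr rfl fun i _ => ?_
  have h : (mom L m) i = 2 * Real.pi / L * (m i : ℝ) := rfl
  rw [h, Real.norm_eq_abs, sq_abs, mul_pow, Nat.cast_natAbs, Int.cast_abs, sq_abs]

theorem summable_inv_norm_mom_pow (hL : 0 < L) : Summable fun q : Xi => 1 / ‖mom L q.1‖ ^ 4 := by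
  set Λ : Submodule ℤ (Fin 3 → ℝ) := Submodule.span ℤ (range (Pi.basisFun ℝ (Fin 3))) with hΛ
  have hrank : Module.finrank ℤ Λ < 4 := by
    rw [ZLattice.rank ℝ Λ]; simp
  have hs := ZLattice.summable_norm_pow_inv Λ 4 hrank
  have hmem : ∀ m : Fin 3 → ℤ, (fun i => (m i : ℝ)) ∈ Λ := by
    intro m
    rw [hΛ, Module.Basis.mem_span_iff_repr_mem]
    intro i
    exact ⟨m i, by simp⟩
  set f : Xi → Λ := fun q => ⟨fun i => (q.1 i : ℝ), hmem q.1⟩ with hf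
  have hinj : Function.Injective f := by
    intro q q' h
    refine Subtype.ext (funext fun i => ?_)
    have h2 : (q.1 i : ℝ) = q'.1 i := congrFun (congrArg Subtype.val h) i
    exact_mod_cast h2
  have hl : 0 < 2 * Real.pi / L := by have := Real.pi_pos; positivity
  refine Summable.of_nonneg_of_le (fun q => by positivity) (fun q => ?_)
    ((hs.comp_injective hinj).mul_left (1 / (2 * Real.pi / L) ^ 4))
  change _ ≤ 1 / (2 * Real.pi / L) ^ 4 * ‖f q‖⁻¹ ^ 4
  have hle : 2 * Real.pi / L * ‖f q‖ ≤ ‖mom L q.1‖ := by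
    have h1 : ‖(mom L q.1).ofLp‖ ≤ ‖mom L q.1‖ := by
      rw [pi_norm_le_iff_of_nonneg (norm_nonneg _)]
      exact fun i => PiLp.norm_apply_le _ i
    refine le_trans (le_of_eq ?_) h1
    have h2 : (mom L q.1).ofLp = (2 * Real.pi / L) • (f q : Fin 3 → ℝ) := by
      funext i; simp [mom, hf]
    rw [h2, norm_smul, Real.norm_of_nonneg hl.le, Submodule.coe_norm]
  have hq0 : 0 < ‖f q‖ := by
    rw [norm_pos_iff]
    intro h
    refine q.2 (funext fun i => ?_)
    have h2 : (q.1 i : ℝ) = 0 := congrFun (congrArg Subtype.val h) i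
    exact_mod_cast h2
  rw [inv_pow, ← one_div, one_div_mul_one_div, ← mul_pow]
  gcongr

/-- There are at most `18 (n + 1)` lattice points on the sphere of radius `√n`. -/
theorem card_sphere_le (n : ℕ) (s : Finset (Fin 3 → ℤ))
    (hs : ∀ m ∈ s, ∑ i, (m i).natAbs ^ 2 = n) : (s.card : ℝ) ≤ 18 * (n + 1) := by
  classical
  set R : ℤ := (Nat.sqrt n : ℤ) with hR
  -- a point is determined by two coordinates and the sign of the third
  set B : Finset (ℤ × ℤ × Bool) :=
    Finset.Icc (-R) R ×ˢ Finset.Icc (-R) R ×ˢ Finset.univ with hB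
  have hcard : s.card ≤ B.card := by
    refine Finset.card_le_card_of_injOn (fun m => (m 0, m 1, decide (0 ≤ m 2))) ?_ ?_
    · intro m hm
      have h := hs m hm
      rw [Fin.sum_univ_three] at h
      have h0 : (m 0).natAbs ≤ Nat.sqrt n := Nat.le_sqrt'.2 (by omega)
      have h1 : (m 1).natAbs ≤ Nat.sqrt n := Nat.le_sqrt'.2 (by omega)
      simp only [hB, Finset.coe_product, Set.mem_prod, Finset.mem_coe, Finset.mem_Icc,
        Finset.mem_univ, and_true]
      omega
    · intro m hm m' hm' he
      have h := hs m hm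
      have h' := hs m' hm'
      rw [Fin.sum_univ_three] at h h'
      simp only [Prod.mk.injEq, decide_eq_decide] at he
      obtain ⟨e0, e1, e2⟩ := he
      rw [e0, e1] at h
      have h3 : (m 2).natAbs ^ 2 = (m' 2).natAbs ^ 2 := by omega
      have h4 : (m 2).natAbs = (m' 2).natAbs := Nat.pow_left_injective (by norm_num) h3
      funext i
      fin_cases i
      · exact e0
      · exact e1
      · change m 2 = m' 2
        omega
  have hB' : (B.card : ℝ) = (2 * (Nat.sqrt n : ℝ) + 1) ^ 2 * 2 := by
    rw [hB, Finset.card_product, Finset.card_product, Int.card_Icc]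
    have : (R + 1 - -R).toNat = 2 * Nat.sqrt n + 1 := by omega
    rw [this]
    simp
    ring
  have h1 : (Nat.sqrt n : ℝ) ^ 2 ≤ n := by exact_mod_cast Nat.sqrt_le' n
  have h2 : (s.card : ℝ) ≤ B.card := by exact_mod_cast hcard
  rw [hB'] at h2
  linarith [sq_nonneg ((Nat.sqrt n : ℝ) - 1)]

theorem summable_normSq {φ : ℕ → ℝ} (h0 : ∀ n, 0 ≤ φ n)
    (h : Summable fun n : ℕ => ((n : ℝ) + 1) * φ n) :
    Summable fun m : Fin 3 → ℤ => φ (∑ i, (m i).natAbs ^ 2) := by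
  classical
  refine summable_of_sum_le (c := 18 * ∑' n : ℕ, ((n : ℝ) + 1) * φ n) (fun m => h0 _) fun s => ?_
  set N : (Fin 3 → ℤ) → ℕ := fun m => ∑ i, (m i).natAbs ^ 2 with hN
  rw [← Finset.sum_fiberwise_of_maps_to (t := s.image N)
    (fun m hm => Finset.mem_image_of_mem N hm)]
  have h1 : ∀ n ∈ s.image N, ∑ m ∈ s with N m = n, φ (N m) ≤ 18 * (((n : ℝ) + 1) * φ n) := by
    intro n _
    have : ∑ m ∈ s with N m = n, φ (N m) = ((s.filter fun m => N m = n).card : ℝ) * φ n := by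
      rw [← nsmul_eq_mul, ← Finset.sum_const]
      exact Finset.sum_congr rfl fun m hm => by rw [(Finset.mem_filter.1 hm).2]
    rw [this, ← mul_assoc]
    exact mul_le_mul_of_nonneg_right
      (card_sphere_le n _ fun m hm => (Finset.mem_filter.1 hm).2) (h0 n)
  refine (Finset.sum_le_sum h1).trans ?_
  rw [← Finset.mul_sum]
  have := h.sum_le_tsum (s.image N) fun n _ => mul_nonneg (by positivity) (h0 n)
  linarith

/-! ### Decay of the transformed potential along the lattice -/

theorem integrableOn_sq_mul_vhatRadial_sq (hv : IsAdmissible v V) :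
    IntegrableOn (fun t : ℝ => t ^ 2 * vhatRadial v t ^ 2) (Ioi 0) := by
  have h := hv.vhat_memLp.integrable_sq
  have h1 : (fun p : E => vhat v p ^ 2) = fun p => (fun t => vhatRadial v t ^ 2) ‖p‖ := by
    funext p; simp only; rw [vhat_eq_radial hv]
  rw [h1, integrable_fun_norm_addHaar volume (f := fun t => vhatRadial v t ^ 2)] at h
  simpa using h

/-- The lower limit of `slopeFun` bounds the decrease of `v̂` at large momenta. -/
theorem exists_monotoneOn_vhatRadial_add (hv : IsAdmissible v V) (hν : ν ∈ Ioc 0 V) :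
    ∃ C₀ : ℝ, 0 < C₀ ∧ ∃ T : ℝ, 1 ≤ T ∧ ∀ C, C₀ ≤ C →
      MonotoneOn (fun t => vhatRadial v t + C * t ^ 2 / 2) (Ici T) := by
  obtain ⟨M, hM, hb⟩ := exists_abs_vhatRadial_le v
  have h0 := hv.vhat_zero_pos
  have hν0 := hν.1
  obtain ⟨c, hc, hev⟩ := hv.liminf_pos ν hν
  obtain ⟨T, hT⟩ := eventually_atTop.1 hev
  refine ⟨vhat v 0 / ν + 2 * M, by positivity, max T 1, le_max_right _ _, fun C hC => ?_⟩
  have hC0 : 0 < C := lt_of_lt_of_le (by positivity) hC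
  have hd : ∀ t, HasDerivAt (fun t => vhatRadial v t + C * t ^ 2 / 2)
      (deriv (vhatRadial v) t + C * t) t := by
    intro t
    refine ((hasDerivAt_vhatRadial hv t).add
      ((((hasDerivAt_id t).pow 2).const_mul C).div_const 2)).congr_deriv ?_
    simp
    ring
  refine monotoneOn_of_deriv_nonneg (convex_Ici _) (fun t _ => (hd t).continuousAt.continuousWithinAt)
    (fun t _ => (hd t).differentiableAt.differentiableWithinAt) fun t ht => ?_
  rw [interior_Ici, mem_Ioi, max_lt_iff] at ht
  obtain ⟨ht1, ht2⟩ := ht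
  rw [(hd t).deriv]
  have h1 : 0 ≤ slopeFun v ν t := hc.le.trans (hT t ht1.le)
  have h2 := (abs_le.1 (hb t)).2
  have ht0 : 0 < t := by linarith
  have h3 : slopeFun v ν t * (2 * vhat v 0 / t) = t * (vhat v 0 / ν) + 2 * vhatRadial v t / t
      + deriv (vhatRadial v) t := by
    unfold slopeFun
    field_simp
  have h4 : 0 ≤ slopeFun v ν t * (2 * vhat v 0 / t) := mul_nonneg h1 (by positivity)
  have h5 : 2 * vhatRadial v t / t ≤ 2 * M * t := by
    rw [div_le_iff₀ ht0]
    have : 1 ≤ t * t := by nlinarith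
    nlinarith
  have h6 : (vhat v 0 / ν + 2 * M) * t ≤ C * t := by gcongr
  linarith

theorem le_integral_sq_mul_sq {f : ℝ → ℝ} (hf : Continuous f) {a s r : ℝ} (hs : 0 ≤ s)
    (hsr : s ≤ r) (ha : 0 ≤ a) (h : ∀ t ∈ Icc s r, a ≤ |f t|) :
    a ^ 2 * (s * ((r ^ 2 - s ^ 2) / 2)) ≤ ∫ t in s..r, t ^ 2 * f t ^ 2 := by
  have h1 : ∫ t in s..r, a ^ 2 * s * t = a ^ 2 * (s * ((r ^ 2 - s ^ 2) / 2)) := by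
    rw [intervalIntegral.integral_const_mul, integral_id]; ring
  rw [← h1]
  refine intervalIntegral.integral_mono_on hsr (Continuous.intervalIntegrable (by fun_prop) _ _)
    (Continuous.intervalIntegrable (by fun_prop) _ _) fun t ht => ?_
  have h2 : a ^ 2 ≤ f t ^ 2 := by
    rw [← sq_abs (f t)]; exact pow_le_pow_left₀ ha (h t ht) 2
  have h3 : s * t ≤ t ^ 2 := by nlinarith [ht.1]
  calc a ^ 2 * s * t = s * t * a ^ 2 := by ring
    _ ≤ t ^ 2 * f t ^ 2 := by
      apply mul_le_mul h3 h2 (sq_nonneg _) (sq_nonneg _)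

/-- Between consecutive spheres of lattice points `v̂` cannot change much in one direction, so that
its cube at a sphere is bounded by the integral of its square over the two adjacent shells. -/
theorem cube_le_integral {f : ℝ → ℝ} (hf : Continuous f) {C T r r₁ r₂ : ℝ} (hC : 0 < C)
    (hmono : MonotoneOn (fun t => f t + C * t ^ 2 / 2) (Ici T)) (hT : 0 ≤ T) (h₁ : T ≤ r₁)
    (hr₁ : r₁ ≤ r) (hr₂ : r ≤ r₂) (h₁' : |f r| / C ≤ r ^ 2 - r₁ ^ 2)
    (h₂' : |f r| / C ≤ r₂ ^ 2 - r ^ 2) :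
    |f r| ^ 3 * r₁ ≤ 8 * C * ∫ t in r₁..r₂, t ^ 2 * f t ^ 2 := by
  have hint : ∀ a b, IntervalIntegrable (fun t => t ^ 2 * f t ^ 2) volume a b :=
    fun a b => Continuous.intervalIntegrable (by fun_prop) _ _
  have hsub : ∀ a b, r₁ ≤ a → a ≤ b → b ≤ r₂ →
      ∫ t in a..b, t ^ 2 * f t ^ 2 ≤ ∫ t in r₁..r₂, t ^ 2 * f t ^ 2 := by
    intro a b h1 h2 h3
    exact intervalIntegral.integral_mono_interval h1 h2 h3
      (Eventually.of_forall fun t => by positivity) (hint _ _)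
  set a := |f r| with ha
  have ha0 : 0 ≤ a := abs_nonneg _
  have hr₁0 : 0 ≤ r₁ := hT.trans h₁
  rcases le_total 0 (f r) with hpos | hneg
  · set s := √(r ^ 2 + a / C) with hs
    have hs2 : s ^ 2 = r ^ 2 + a / C := Real.sq_sqrt (by positivity)
    have hrs : r ≤ s := Real.le_sqrt_of_sq_le (by linarith [div_nonneg ha0 hC.le])
    have hsr : s ≤ r₂ := by
      rw [hs]; exact Real.sqrt_le_iff.2 ⟨by linarith, by linarith⟩
    -- from `r` on up to `s`, the value has not yet dropped to one half
    have hlow : ∀ t ∈ Icc r s, a / 2 ≤ |f t| := by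
      intro t ht
      have h1 := hmono (show T ≤ r by linarith) (show T ≤ t by linarith [ht.1]) ht.1
      simp only at h1
      have h2 : t ^ 2 ≤ r ^ 2 + a / C := by
        rw [← hs2]; exact pow_le_pow_left₀ (by linarith [ht.1]) ht.2 2
      have h3 : C * t ^ 2 ≤ C * r ^ 2 + a := by
        have := mul_le_mul_of_nonneg_left h2 hC.le
        rwa [mul_add, mul_div_cancel₀ _ hC.ne'] at this
      rw [abs_of_nonneg hpos] at ha
      refine le_trans ?_ (le_abs_self _)
      linarith
    have h4 := le_integral_sq_mul_sq hf (show 0 ≤ r by linarith) hrs (by positivity) hlow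
    have h5 := h4.trans (hsub r s hr₁ hrs hsr)
    rw [hs2, add_sub_cancel_left] at h5
    have h6 : a ^ 3 * r = 8 * C * ((a / 2) ^ 2 * (r * (a / C / 2))) := by field_simp; ring
    calc a ^ 3 * r₁ ≤ a ^ 3 * r := by gcongr
      _ = _ := h6
      _ ≤ _ := by gcongr
  · set s := √(r ^ 2 - a / C) with hs
    have hs2 : s ^ 2 = r ^ 2 - a / C := Real.sq_sqrt (by nlinarith [sq_nonneg r₁])
    have hrs : r₁ ≤ s := Real.le_sqrt_of_sq_le (by linarith)
    have hsr : s ≤ r := by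
      rw [hs]; exact Real.sqrt_le_iff.2 ⟨by linarith, by linarith [div_nonneg ha0 hC.le]⟩
    -- from `r` down to `s`, the value has not yet risen to one half
    have hlow : ∀ t ∈ Icc s r, a / 2 ≤ |f t| := by
      intro t ht
      have h1 := hmono (show T ≤ t by linarith [ht.1]) (show T ≤ r by linarith) ht.2
      simp only at h1
      have h2 : r ^ 2 - a / C ≤ t ^ 2 := by
        rw [← hs2]; exact pow_le_pow_left₀ (Real.sqrt_nonneg _) ht.1 2
      have h3 : C * r ^ 2 - a ≤ C * t ^ 2 := by
        have := mul_le_mul_of_nonneg_left h2 hC.le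
        rwa [mul_sub, mul_div_cancel₀ _ hC.ne'] at this
      rw [abs_of_nonpos hneg] at ha
      refine le_trans ?_ (neg_le_abs _)
      linarith
    have h4 := le_integral_sq_mul_sq hf (show 0 ≤ s by linarith) hsr (by positivity) hlow
    have h5 := h4.trans (hsub s r hrs hsr hr₂)
    rw [hs2, sub_sub_cancel] at h5
    have h6 : a ^ 3 * s = 8 * C * ((a / 2) ^ 2 * (s * (a / C / 2))) := by field_simp; ring
    calc a ^ 3 * r₁ ≤ a ^ 3 * s := by gcongr
      _ = _ := h6
      _ ≤ _ := by gcongr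

/-- Comparison with the convergent integral of `t² v̂(t)²`: the value at a sphere is compared with
the adjacent shell outside it where `v̂` is positive, and inside it where `v̂` is negative. -/
theorem summable_sqrt_mul_cube (hv : IsAdmissible v V) (hν : ν ∈ Ioc 0 V) {l : ℝ} (hl : 0 < l) :
    Summable fun n : ℕ => √n * |vhatRadial v (l * √n)| ^ 3 := by
  obtain ⟨M, hM, hb⟩ := exists_abs_vhatRadial_le v
  obtain ⟨C₀, hC₀, T, hT, hmono⟩ := exists_monotoneOn_vhatRadial_add hv hν
  set C := max C₀ (M / l ^ 2) with hC
  have hC0 : 0 < C := lt_max_of_lt_left hC₀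
  set F : ℝ → ℝ := fun t => t ^ 2 * vhatRadial v t ^ 2 with hF
  have hcont : Continuous F := by
    have := continuous_vhatRadial hv
    rw [hF]; fun_prop
  have hint : ∀ a b, IntervalIntegrable F volume a b := fun a b => hcont.intervalIntegrable _ _
  set r : ℕ → ℝ := fun n => l * √n with hr
  have hrmono : Monotone r := fun a b h => by
    simp only [hr]
    gcongr
  have hr0 : ∀ n, 0 ≤ r n := fun n => by positivity
  have hr2 : ∀ n, r n ^ 2 = l ^ 2 * n := fun n => by
    simp only [hr]
    rw [mul_pow, Real.sq_sqrt (Nat.cast_nonneg n)]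
  have hsummable : Summable fun n => ∫ t in r n..r (n + 1), F t := by
    refine summable_of_sum_range_le (c := ∫ t in Ioi 0, F t) (fun n => ?_) fun n => ?_
    · exact intervalIntegral.integral_nonneg (hrmono (Nat.le_succ n)) fun t _ => by positivity
    · rw [intervalIntegral.sum_integral_adjacent_intervals fun k _ => hint _ _]
      rw [intervalIntegral.integral_of_le (hrmono (Nat.zero_le n))]
      refine setIntegral_mono_set (integrableOn_sq_mul_vhatRadial_sq hv)
        (Eventually.of_forall fun t => by positivity)
        (Eventually.of_forall fun t ht => lt_of_le_of_lt (hr0 0) ht.1)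
  obtain ⟨N, hN⟩ : ∃ N : ℕ, T ≤ r N := by
    obtain ⟨N, hN⟩ := exists_nat_ge ((T / l) ^ 2)
    refine ⟨N, ?_⟩
    have : T / l ≤ √N := Real.le_sqrt_of_sq_le hN
    rw [div_le_iff₀ hl] at this
    simp only [hr]
    linarith
  rw [← summable_nat_add_iff (N + 1)]
  have hs1 := (summable_nat_add_iff N).2 hsummable
  have hs2 := (summable_nat_add_iff (N + 1)).2 hsummable
  refine Summable.of_nonneg_of_le (fun n => by positivity) (fun n => ?_)
    ((hs1.add hs2).mul_left (16 * C / l))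
  have hk : ∀ k : ℕ, |vhatRadial v (r k)| / C ≤ l ^ 2 := by
    intro k
    rw [div_le_iff₀ hC0]
    have : M / l ^ 2 ≤ C := le_max_right _ _
    rw [div_le_iff₀ (by positivity)] at this
    linarith [hb (r k)]
  have key := cube_le_integral (continuous_vhatRadial hv) hC0 (hmono C (le_max_left _ _))
    (by linarith) (hN.trans (hrmono (Nat.le_add_left N n))) (hrmono (Nat.le_succ (n + N)))
    (hrmono (Nat.le_succ (n + N + 1)))
    (by rw [hr2, hr2]; push_cast; linarith [hk (n + N + 1)])
    (by rw [hr2, hr2]; push_cast; linarith [hk (n + N + 1)])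
  rw [← intervalIntegral.integral_add_adjacent_intervals (hint _ (r (n + N + 1))) (hint _ _)] at key
  have hN1 : 1 ≤ n + N := by
    by_contra h
    have : n + N = 0 := by omega
    have h0 : N = 0 := by omega
    rw [h0] at hN
    have : r 0 = 0 := by simp [hr]
    linarith
  have hsq : √((n + (N + 1) : ℕ) : ℝ) ≤ 2 * √((n + N : ℕ) : ℝ) := by
    rw [show (2 : ℝ) = √4 by rw [show (4 : ℝ) = 2 ^ 2 by norm_num, Real.sqrt_sq (by norm_num)],
      ← Real.sqrt_mul (by norm_num)]
    refine Real.sqrt_le_sqrt ?_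
    have : (1 : ℝ) ≤ ((n + N : ℕ) : ℝ) := by exact_mod_cast hN1
    push_cast at this ⊢
    linarith
  have e : √((n + (N + 1) : ℕ) : ℝ) * |vhatRadial v (l * √((n + (N + 1) : ℕ) : ℝ))| ^ 3
      ≤ 2 / l * (|vhatRadial v (r (n + N + 1))| ^ 3 * r (n + N)) := by
    have h1 : 2 / l * (|vhatRadial v (r (n + N + 1))| ^ 3 * r (n + N))
      = 2 * √((n + N : ℕ) : ℝ) * |vhatRadial v (l * √((n + (N + 1) : ℕ) : ℝ))| ^ 3 := by
      simp only [hr]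
      rw [show n + N + 1 = n + (N + 1) from rfl]
      field_simp
    rw [h1]
    gcongr
  refine e.trans ?_
  have h2 := mul_le_mul_of_nonneg_left key (show 0 ≤ 2 / l by positivity)
  refine h2.trans (le_of_eq ?_)
  rw [show n + (N + 1) = n + N + 1 from rfl]
  ring

/-- The squared matrix elements of the interaction decay with the momentum at this rate. -/
def decay (v : E → ℝ) (t : ℝ) : ℝ := vhatRadial v t ^ 2 / t ^ 2 + 1 / t ^ 4

theorem decay_nonneg (t : ℝ) : 0 ≤ decay v t := by unfold decay; positivity

/-- A sphere of radius `√n` carries `O(n)` lattice points, which is more than square integrability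
of `v̂` alone could sum; the one-sided bound on the derivative of `v̂` supplies what is missing. -/
theorem summable_decay (hv : IsAdmissible v V) (hν : ν ∈ Ioc 0 V) (hL : 0 < L) :
    Summable fun q : Xi => decay v ‖mom L q.1‖ := by
  have hl : 0 < 2 * Real.pi / L := by have := Real.pi_pos; positivity
  set l := 2 * Real.pi / L with hl'
  have h1 := summable_inv_norm_mom_pow hL
  obtain ⟨φ, hφ⟩ : ∃ φ : ℕ → ℝ, ∀ n : ℕ, φ n = |vhatRadial v (l * √n)| ^ 3 / (l * √n) :=
    ⟨_, fun _ => rfl⟩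
  have h2 : Summable fun m : Fin 3 → ℤ => φ (∑ i, (m i).natAbs ^ 2) := by
    refine summable_normSq (fun n => by rw [hφ]; positivity) ?_
    simp only [hφ]
    refine Summable.of_nonneg_of_le (fun n => by positivity) (fun n => ?_)
      ((summable_sqrt_mul_cube hv hν hl).mul_left (2 / l))
    rcases Nat.eq_zero_or_pos n with rfl | hn
    · simp
    · have hn' : (1 : ℝ) ≤ n := by exact_mod_cast hn
      have hs : 0 < √(n : ℝ) := Real.sqrt_pos.2 (by linarith)
      have hs2 := Real.sq_sqrt (show (0 : ℝ) ≤ n by linarith)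
      rw [mul_div_assoc', div_le_iff₀ (by positivity)]
      have : 2 / l * (√(n : ℝ) * |vhatRadial v (l * √n)| ^ 3) * (l * √n)
        = 2 * √(n : ℝ) ^ 2 * |vhatRadial v (l * √n)| ^ 3 := by field_simp
      rw [this, hs2]
      gcongr
      linarith
  have h3 := h2.comp_injective (Subtype.val_injective (p := fun m : Fin 3 → ℤ => m ≠ 0))
  refine Summable.of_nonneg_of_le (fun q => decay_nonneg _) (fun q => ?_)
    ((h1.mul_left 2).add h3)
  have hq := norm_mom_pos hL q
  have hx : ‖mom L q.1‖ = l * √((∑ i, (q.1 i).natAbs ^ 2 : ℕ) : ℝ) := by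
    have := norm_mom_sq L q.1
    rw [← Real.sqrt_sq hq.le, this, Real.sqrt_mul (sq_nonneg _), Real.sqrt_sq hl.le]
  simp only [Function.comp]
  rw [hφ, ← hx]
  set x := ‖mom L q.1‖ with hx'
  unfold decay
  have : vhatRadial v x ^ 2 / x ^ 2 ≤ 1 / x ^ 4 + |vhatRadial v x| ^ 3 / x := by
    rw [← sq_abs (vhatRadial v x)]
    set a := |vhatRadial v x|
    have ha : 0 ≤ a := abs_nonneg _
    rw [div_add_div _ _ (by positivity) (by positivity), div_le_div_iff₀ (by positivity)
      (by positivity)]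
    rcases le_total (a * x) 1 with h | h
    · have : (a * x) ^ 2 ≤ 1 := pow_le_one₀ (by positivity) h
      have h5 : 0 ≤ x ^ 6 * a ^ 3 := by positivity
      nlinarith [mul_le_mul_of_nonneg_left this (show 0 ≤ x ^ 3 by positivity)]
    · have h5 : 0 ≤ x ^ 3 := by positivity
      nlinarith [mul_le_mul_of_nonneg_left h (show 0 ≤ a ^ 2 * x ^ 5 by positivity)]
  linarith

/-! ### The Golden Rule summands on the lattice -/

theorem mixingSum_not (s₁ s₂ s₃ : Bool) (x y z : ℝ) :
    mixingSum v ν β (!s₁) (!s₂) (!s₃) x y z = mixingSum v ν β s₁ s₂ s₃ x y z := by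
  unfold mixingSum
  simp only [Bool.not_not]
  ring

/-- The regularized contribution of a process, up to constants. -/
def strength (v : E → ℝ) (ν β : ℝ) (t₁ t₂ t₃ : Bool) (x y z : ℝ) : ℝ :=
  amp v ν t₁ t₂ t₃ x y z ^ 2 * mixingSum v ν β t₁ t₂ t₃ x y z ^ 2 / (1 + |gap v ν t₁ t₂ t₃ x y z|)

theorem strength_rotate (t₁ t₂ t₃ : Bool) (x y z : ℝ) :
    strength v ν β t₂ t₃ t₁ y z x = strength v ν β t₁ t₂ t₃ x y z := by
  have h1 : gap v ν t₂ t₃ t₁ y z x = gap v ν t₁ t₂ t₃ x y z := by unfold gap; ring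
  have h2 : mixingSum v ν β t₂ t₃ t₁ y z x = mixingSum v ν β t₁ t₂ t₃ x y z := by
    unfold mixingSum; ring
  unfold strength
  rw [amp_rotate, h1, h2]

theorem strength_not (t₁ t₂ t₃ : Bool) (x y z : ℝ) :
    strength v ν β (!t₁) (!t₂) (!t₃) x y z = strength v ν β t₁ t₂ t₃ x y z := by
  have h1 : gap v ν (!t₁) (!t₂) (!t₃) x y z = -gap v ν t₁ t₂ t₃ x y z := by
    unfold gap; simp only [sgn_not]; ring
  unfold strength
  rw [amp_not, h1, mixingSum_not, abs_neg]

/-- A bracket in the amplitude is small at large momenta if the two types agree. -/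
def bracketBound (t₂ t₃ : Bool) (y z : ℝ) : ℝ := if t₂ = t₃ then 1 / y ^ 4 + 1 / z ^ 4 else 1

theorem exists_theta_sq_bounds (hv : IsAdmissible v V) (hν : ν ∈ Ioc 0 V) {m : ℝ} (hm : 0 < m) :
    ∃ a A : ℝ, 0 < a ∧ 0 < A ∧ ∀ t, m ≤ t → a ≤ theta v ν t ^ 2 ∧ theta v ν t ^ 2 ≤ A := by
  obtain ⟨c, C, hc, hC, h⟩ := exists_theta_bounds hv hν
  refine ⟨c * (m / (1 + m)), C, by positivity, hC, fun t ht => ?_⟩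
  have ht0 := hm.trans_le ht
  obtain ⟨h1, h2⟩ := h t ht0
  refine ⟨le_trans ?_ h1, h2.trans ?_⟩
  · gcongr ?_ * ?_
    rw [div_le_div_iff₀ (by positivity) (by positivity)]
    nlinarith
  · exact mul_le_of_le_one_right hC.le ((div_le_one (by positivity)).2 (by linarith))

theorem exists_bracket_sq_le (hv : IsAdmissible v V) (hν : ν ∈ Ioc 0 V) {m : ℝ} (hm : 0 < m) :
    ∃ C : ℝ, 0 < C ∧ ∀ y z, m ≤ y → m ≤ z → ∀ t₂ t₃,
      (theta v ν y * theta v ν z - sgn t₂ * sgn t₃ / (theta v ν y * theta v ν z)) ^ 2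
        ≤ C * bracketBound t₂ t₃ y z := by
  obtain ⟨a, A, ha, hA, h⟩ := exists_theta_sq_bounds hv hν hm
  obtain ⟨D, hD, hd⟩ := exists_abs_one_sub_theta_sq_le hv hν
  set C₁ := 2 * (1 + A ^ 2) * D ^ 2 / a ^ 2 with hC₁
  set C₂ := 2 * (A ^ 2 + 1 / a ^ 2) with hC₂
  have hC₁0 : 0 < C₁ := by positivity
  have hC₂0 : 0 < C₂ := by positivity
  refine ⟨C₁ + C₂, by positivity, fun y z hy hz t₂ t₃ => ?_⟩
  have hy0 := hm.trans_le hy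
  have hz0 := hm.trans_le hz
  obtain ⟨ay, Ay⟩ := h y hy
  obtain ⟨az, Az⟩ := h z hz
  have dy := hd y hy0
  have dz := hd z hz0
  have ty := theta_pos hv hν hy0
  have tz := theta_pos hv hν hz0
  set p := theta v ν y
  set q := theta v ν z
  have hpq0 : 0 < p * q := by positivity
  have hpqa : a ^ 2 ≤ (p * q) ^ 2 := by
    rw [mul_pow, sq a]; exact mul_le_mul ay az ha.le (by positivity)
  have hpqA : (p * q) ^ 2 ≤ A ^ 2 := by
    rw [mul_pow, sq A]; exact mul_le_mul Ay Az (by positivity) hA.le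
  by_cases ht : t₂ = t₃
  · subst ht
    have hs : sgn t₂ * sgn t₂ = 1 := by cases t₂ <;> simp
    rw [hs]
    simp only [bracketBound, if_true]
    have e : p * q - 1 / (p * q) = ((p ^ 2 - 1) * q ^ 2 + (q ^ 2 - 1)) / (p * q) := by
      field_simp; ring
    rw [e, div_pow]
    have h1 : (p ^ 2 - 1) ^ 2 ≤ D ^ 2 * (1 / y ^ 4) := by
      have : |1 - p ^ 2| ^ 2 ≤ (D / y ^ 2) ^ 2 := pow_le_pow_left₀ (abs_nonneg _) dy 2
      rw [sq_abs] at this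
      calc (p ^ 2 - 1) ^ 2 = (1 - p ^ 2) ^ 2 := by ring
        _ ≤ _ := this
        _ = _ := by field_simp
    have h2 : (q ^ 2 - 1) ^ 2 ≤ D ^ 2 * (1 / z ^ 4) := by
      have : |1 - q ^ 2| ^ 2 ≤ (D / z ^ 2) ^ 2 := pow_le_pow_left₀ (abs_nonneg _) dz 2
      rw [sq_abs] at this
      calc (q ^ 2 - 1) ^ 2 = (1 - q ^ 2) ^ 2 := by ring
        _ ≤ _ := this
        _ = _ := by field_simp
    have h3 : (q ^ 2) ^ 2 ≤ A ^ 2 := pow_le_pow_left₀ (by positivity) Az 2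
    have hnum : ((p ^ 2 - 1) * q ^ 2 + (q ^ 2 - 1)) ^ 2
        ≤ 2 * (1 + A ^ 2) * D ^ 2 * (1 / y ^ 4 + 1 / z ^ 4) := by
      have e1 : ((p ^ 2 - 1) * q ^ 2 + (q ^ 2 - 1)) ^ 2
          ≤ 2 * ((p ^ 2 - 1) ^ 2 * (q ^ 2) ^ 2) + 2 * (q ^ 2 - 1) ^ 2 := by
        linarith [sq_nonneg ((p ^ 2 - 1) * q ^ 2 - (q ^ 2 - 1))]
      have e2 : (p ^ 2 - 1) ^ 2 * (q ^ 2) ^ 2 ≤ D ^ 2 * (1 / y ^ 4) * A ^ 2 := by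
        apply mul_le_mul h1 h3 (by positivity) (by positivity)
      have e3 : 0 ≤ D ^ 2 * (1 / y ^ 4) := by positivity
      have e4 : 0 ≤ A ^ 2 * (D ^ 2 * (1 / z ^ 4)) := by positivity
      linarith
    calc _ ≤ 2 * (1 + A ^ 2) * D ^ 2 * (1 / y ^ 4 + 1 / z ^ 4) / a ^ 2 := by
          apply div_le_div₀ (by positivity) hnum (by positivity) hpqa
      _ = C₁ * (1 / y ^ 4 + 1 / z ^ 4) := by rw [hC₁]; ring
      _ ≤ (C₁ + C₂) * (1 / y ^ 4 + 1 / z ^ 4) := by gcongr; linarith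
  · simp only [bracketBound, ht, if_false]
    have hs : (sgn t₂ * sgn t₃) ^ 2 = 1 := by cases t₂ <;> cases t₃ <;> simp
    have e1 : (p * q - sgn t₂ * sgn t₃ / (p * q)) ^ 2
        ≤ 2 * (p * q) ^ 2 + 2 * (sgn t₂ * sgn t₃ / (p * q)) ^ 2 := by
      linarith [sq_nonneg (p * q + sgn t₂ * sgn t₃ / (p * q))]
    have e2 : (sgn t₂ * sgn t₃ / (p * q)) ^ 2 ≤ 1 / a ^ 2 := by
      rw [div_pow, hs]
      exact one_div_le_one_div_of_le (by positivity) hpqa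
    linarith

theorem exists_amp_sq_le_bracketBound (hv : IsAdmissible v V) (hν : ν ∈ Ioc 0 V) {m : ℝ}
    (hm : 0 < m) : ∃ C : ℝ, 0 < C ∧ ∀ x y z, m ≤ x → m ≤ y → m ≤ z → ∀ t₁ t₂ t₃,
      amp v ν t₁ t₂ t₃ x y z ^ 2 ≤ C * (vhatRadial v x ^ 2 * bracketBound t₂ t₃ y z
        + vhatRadial v y ^ 2 * bracketBound t₃ t₁ z x
        + vhatRadial v z ^ 2 * bracketBound t₁ t₂ x y) := by
  obtain ⟨a, A, ha, hA, h⟩ := exists_theta_sq_bounds hv hν hm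
  obtain ⟨D, hD, hd⟩ := exists_bracket_sq_le hv hν hm
  refine ⟨A * D, by positivity, fun x y z hx hy hz t₁ t₂ t₃ => ?_⟩
  have tx := theta_pos hv hν (hm.trans_le hx)
  have ty := theta_pos hv hν (hm.trans_le hy)
  have tz := theta_pos hv hν (hm.trans_le hz)
  have dx := hd y z hy hz t₂ t₃
  have dy := hd z x hz hx t₃ t₁
  have dz := hd x y hx hy t₁ t₂
  have ax := (h x hx).2
  have ay := (h y hy).2
  have az := (h z hz).2
  have e : amp v ν t₁ t₂ t₃ x y z = (vhatRadial v x * (theta v ν x *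
        (theta v ν y * theta v ν z - sgn t₂ * sgn t₃ / (theta v ν y * theta v ν z)))
      + vhatRadial v y * (theta v ν y *
        (theta v ν z * theta v ν x - sgn t₃ * sgn t₁ / (theta v ν z * theta v ν x)))
      + vhatRadial v z * (theta v ν z *
        (theta v ν x * theta v ν y - sgn t₁ * sgn t₂ / (theta v ν x * theta v ν y)))) / 2 := by
    unfold amp; field_simp; ring
  rw [e]
  generalize theta v ν y * theta v ν z - sgn t₂ * sgn t₃ / (theta v ν y * theta v ν z) = X at dx
  generalize theta v ν z * theta v ν x - sgn t₃ * sgn t₁ / (theta v ν z * theta v ν x) = Y at dy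
  generalize theta v ν x * theta v ν y - sgn t₁ * sgn t₂ / (theta v ν x * theta v ν y) = Z at dz
  have key : ∀ W t B X : ℝ, t ^ 2 ≤ A → X ^ 2 ≤ D * B →
      (W * (t * X)) ^ 2 ≤ A * D * (W ^ 2 * B) := by
    intro W t B X h1 h2
    have h3 : t ^ 2 * X ^ 2 ≤ A * (D * B) := mul_le_mul h1 h2 (sq_nonneg _) hA.le
    calc (W * (t * X)) ^ 2 = W ^ 2 * (t ^ 2 * X ^ 2) := by ring
      _ ≤ W ^ 2 * (A * (D * B)) := by gcongr
      _ = _ := by ring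
  have kx := key (vhatRadial v x) _ _ _ ax dx
  have ky := key (vhatRadial v y) _ _ _ ay dy
  have kz := key (vhatRadial v z) _ _ _ az dz
  generalize vhatRadial v x * (theta v ν x * X) = P at kx
  generalize vhatRadial v y * (theta v ν y * Y) = Q at ky
  generalize vhatRadial v z * (theta v ν z * Z) = R at kz
  have : ((P + Q + R) / 2) ^ 2 ≤ P ^ 2 + Q ^ 2 + R ^ 2 := by
    linarith [sq_nonneg (P - Q), sq_nonneg (Q - R), sq_nonneg (P - R), sq_nonneg P, sq_nonneg Q,
      sq_nonneg R]
  linarith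

/-- The bounds on the lattice, with a common constant. -/
theorem exists_lattice_bounds (hv : IsAdmissible v V) (hν : ν ∈ Ioc 0 V) (hβ : 0 < β) {m : ℝ}
    (hm : 0 < m) : ∃ K : ℝ, 1 ≤ K ∧ ∀ t, m ≤ t →
      vhatRadial v t ^ 2 ≤ K * (vhatRadial v t ^ 2 / t ^ 2) * (1 + disp v ν t) ∧
      therm v ν β true t ^ 2 ≤ K ∧
      therm v ν β false t ^ 2 * (1 + disp v ν t) ≤ K ∧
      therm v ν β false t ^ 2 * (1 + disp v ν t) ≤ K * (1 / t ^ 4) := by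
  obtain ⟨c, C, hc, hC, hw⟩ := exists_disp_bounds hv hν
  obtain ⟨B, hB, hT, hF⟩ := exists_therm_sq_le hv hν hβ
  set K₁ := B * (1 + 1 / m) * (1 / m ^ 2 + C * (1 / m + 1)) with hK₁
  have hK₁0 : 0 < K₁ := by positivity
  have hinv : 0 < 1 / m := by positivity
  refine ⟨1 + 1 / c + B * (1 + 1 / m) + K₁ + K₁ / m ^ 4, ?_, fun t ht => ?_⟩
  · have : 0 ≤ 1 / c + B * (1 + 1 / m) + K₁ + K₁ / m ^ 4 := by positivity
    linarith
  have ht0 := hm.trans_le ht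
  obtain ⟨h1, h2⟩ := hw t ht0.le
  have hti : 1 / t ≤ 1 / m := one_div_le_one_div_of_le hm ht
  have hti0 : 0 < 1 / t := by positivity
  have hkey : therm v ν β false t ^ 2 * (1 + disp v ν t) ≤ K₁ * (1 / t ^ 4) := by
    have e1 : therm v ν β false t ^ 2 ≤ B * (1 + 1 / m) * (1 / t ^ 6) := by
      refine (hF t ht0).trans ?_
      rw [mul_assoc, ← mul_div_assoc (1 + 1 / m), mul_one]
      gcongr
      linarith
    have e2 : 1 + disp v ν t ≤ (1 / m ^ 2 + C * (1 / m + 1)) * t ^ 2 := by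
      have e3 : 1 ≤ 1 / m * t := by rw [one_div, inv_mul_eq_div, le_div_iff₀ hm]; linarith
      have e4 : 1 ≤ 1 / m ^ 2 * t ^ 2 := by
        have : 1 ≤ (1 / m * t) ^ 2 := one_le_pow₀ e3
        rwa [mul_pow, div_pow, one_pow] at this
      have e5 : t * (1 + t) ≤ (1 / m + 1) * t ^ 2 := by
        have := mul_le_mul_of_nonneg_left e3 ht0.le
        linarith
      have := mul_le_mul_of_nonneg_left e5 hC.le
      linarith
    calc therm v ν β false t ^ 2 * (1 + disp v ν t)
        ≤ B * (1 + 1 / m) * (1 / t ^ 6) * ((1 / m ^ 2 + C * (1 / m + 1)) * t ^ 2) :=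
          mul_le_mul e1 e2 (by linarith [disp_nonneg (v := v) (ν := ν) ht0.le]) (by positivity)
      _ = K₁ * (1 / t ^ 4) := by rw [hK₁]; field_simp
  have hK4 : K₁ * (1 / t ^ 4) ≤ K₁ / m ^ 4 := by
    rw [mul_one_div]
    gcongr
  refine ⟨?_, ?_, ?_, ?_⟩
  · have e : t ^ 2 ≤ 1 / c * (1 + disp v ν t) := by
      rw [one_div, inv_mul_eq_div, le_div_iff₀ hc]
      have : c * t ^ 2 ≤ c * (t * (1 + t)) := by gcongr; nlinarith
      linarith
    have e2 : vhatRadial v t ^ 2 = vhatRadial v t ^ 2 / t ^ 2 * t ^ 2 := by field_simp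
    have e3 : t ^ 2 ≤ (1 + 1 / c + B * (1 + 1 / m) + K₁ + K₁ / m ^ 4) * (1 + disp v ν t) := by
      refine e.trans ?_
      have : 0 ≤ (1 + B * (1 + 1 / m) + K₁ + K₁ / m ^ 4) * (1 + disp v ν t) :=
        mul_nonneg (by positivity) (by linarith [disp_nonneg (v := v) (ν := ν) ht0.le])
      linarith
    have := mul_le_mul_of_nonneg_left e3 (show 0 ≤ vhatRadial v t ^ 2 / t ^ 2 by positivity)
    linarith
  · have := hT t ht0 true
    have h3 : B * (1 + 1 / t) ≤ B * (1 + 1 / m) := by gcongr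
    have : 0 ≤ 1 / c + K₁ + K₁ / m ^ 4 := by positivity
    linarith
  · have : 0 ≤ 1 + 1 / c + B * (1 + 1 / m) + K₁ := by positivity
    linarith
  · refine hkey.trans ?_
    gcongr
    have : 0 ≤ 1 + 1 / c + B * (1 + 1 / m) + K₁ / m ^ 4 := by positivity
    linarith

/-- The estimate behind `exists_strength_le` for two created and one annihilated quasiparticle. -/
theorem strength_aux {K G Vx Vy Vz px py pz qx qy qz wx wy wz Dx Dy Dz : ℝ} (hK : 1 ≤ K)
    (hG : 1 ≤ G) (hpx : 0 ≤ px) (hpy : 0 ≤ py) (hpz : 0 ≤ pz) (hqx : 0 ≤ qx) (hqy : 0 ≤ qy)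
    (hqz : 0 ≤ qz) (hwx : 0 ≤ wx) (hwy : 0 ≤ wy) (hwz : 0 ≤ wz) (hDx : 1 ≤ Dx) (hDy : 1 ≤ Dy)
    (hVx : Vx ≤ K * px * Dx) (hVy : Vy ≤ K * py * Dy) (hVz : Vz ≤ K * pz * Dz)
    (hx : wx * Dx ≤ K) (hy : wy * Dy ≤ K) (hz : wz * Dz ≤ K) (hx' : wx * Dx ≤ K * qx)
    (hy' : wy * Dy ≤ K * qy) (hz' : wz * Dz ≤ K * qz) (h1 : Dx ≤ G * Dz) (h2 : Dy ≤ G * Dz)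
    (h3 : Dz ≤ G * (Dx * Dy)) :
    (Vx + Vy + Vz * (qx + qy)) * (wz + wx * wy) ≤
      2 * K ^ 3 * G * ((px + qx) * (py + qy) + (py + qy) * (pz + qz) + (pz + qz) * (px + qx)) := by
  have hK0 : 0 ≤ K := by linarith
  have hG0 : 0 ≤ G := by linarith
  have hK23 : K ^ 2 ≤ K ^ 3 := pow_le_pow_right₀ hK (by norm_num)
  have hq : 0 ≤ qx + qy := by positivity
  -- the factor `D` produced by `V` is absorbed by a thermal weight, at the price of `G`
  have wle : ∀ w D B : ℝ, 0 ≤ w → 1 ≤ D → w * D ≤ B → w ≤ B := by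
    intro w D B hw hD h
    nlinarith
  have a1 : ∀ V p D, 0 ≤ p → 1 ≤ D → V ≤ K * p * D → D ≤ G * Dz → V * wz ≤ K ^ 3 * G * (p * qz) := by
    intro V p D hp hD hV hDD
    calc V * wz ≤ (K * p * (G * Dz)) * wz := by
          apply mul_le_mul_of_nonneg_right (hV.trans _) hwz
          gcongr
      _ = K * G * p * (wz * Dz) := by ring
      _ ≤ K * G * p * (K * qz) := by gcongr
      _ = K ^ 2 * (G * (p * qz)) := by ring
      _ ≤ K ^ 3 * (G * (p * qz)) := by gcongr
      _ = _ := by ring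
  have a2 : ∀ V p D w w' D' q', 0 ≤ p → 0 ≤ w → 0 ≤ w' → 0 ≤ q' → 1 ≤ D' → V ≤ K * p * D →
      w * D ≤ K → w' * D' ≤ K * q' → V * (w * w') ≤ K ^ 3 * G * (p * q') := by
    intro V p D w w' D' q' hp hw hw' hq' hD' hV h h'
    have h'' : w' ≤ K * q' := wle _ _ _ hw' hD' h'
    calc V * (w * w') ≤ (K * p * D) * (w * w') := by gcongr
      _ = K * p * (w * D) * w' := by ring
      _ ≤ K * p * K * (K * q') := by gcongr
      _ = K ^ 3 * 1 * (p * q') := by ring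
      _ ≤ K ^ 3 * G * (p * q') := by gcongr
  have b1 := a1 Vx px Dx hpx hDx hVx h1
  have b2 := a1 Vy py Dy hpy hDy hVy h2
  have b3 := a2 Vx px Dx wx wy Dy qy hpx hwx hwy hqy hDy hVx hx hy'
  have b4 := a2 Vy py Dy wy wx Dx qx hpy hwy hwx hqx hDx hVy hy hx'
  have b5 : Vz * (qx + qy) * wz ≤ K ^ 3 * G * (pz * (qx + qy)) := by
    calc Vz * (qx + qy) * wz ≤ K * pz * Dz * (qx + qy) * wz := by gcongr
      _ = K * pz * (qx + qy) * (wz * Dz) := by ring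
      _ ≤ K * pz * (qx + qy) * K := by gcongr
      _ = K ^ 2 * 1 * (pz * (qx + qy)) := by ring
      _ ≤ K ^ 3 * G * (pz * (qx + qy)) := by gcongr
  have b6 : Vz * (qx + qy) * (wx * wy) ≤ K ^ 3 * G * (pz * (qx + qy)) := by
    calc Vz * (qx + qy) * (wx * wy) ≤ K * pz * (G * (Dx * Dy)) * (qx + qy) * (wx * wy) := by
          gcongr
          exact hVz.trans (by gcongr)
      _ = K * G * (pz * (qx + qy)) * ((wx * Dx) * (wy * Dy)) := by ring
      _ ≤ K * G * (pz * (qx + qy)) * (K * K) := by gcongr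
      _ = _ := by ring
  have e : (Vx + Vy + Vz * (qx + qy)) * (wz + wx * wy) = Vx * wz + Vy * wz + Vx * (wx * wy)
      + Vy * (wy * wx) + Vz * (qx + qy) * wz + Vz * (qx + qy) * (wx * wy) := by ring
  have hKG : 0 ≤ K ^ 3 * G := by positivity
  have f : px * qz + py * qz + px * qy + py * qx + pz * (qx + qy) + pz * (qx + qy) ≤
      2 * ((px + qx) * (py + qy) + (py + qy) * (pz + qz) + (pz + qz) * (px + qx)) := by
    have : 0 ≤ px * py := by positivity
    have : 0 ≤ px * pz := by positivity
    have : 0 ≤ py * pz := by positivity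
    have : 0 ≤ qx * qy := by positivity
    have : 0 ≤ qx * qz := by positivity
    have : 0 ≤ qy * qz := by positivity
    have : 0 ≤ px * qz := by positivity
    have : 0 ≤ px * qy := by positivity
    have : 0 ≤ py * qz := by positivity
    have : 0 ≤ py * qx := by positivity
    linarith
  have := mul_le_mul_of_nonneg_left f hKG
  rw [e]
  linarith

/-- Each summand is controlled by products of decaying functions of two of the three momenta, which
can be summed over the lattice independently. -/
theorem exists_strength_le (hv : IsAdmissible v V) (hν : ν ∈ Ioc 0 V) (hβ : 0 < β) {m : ℝ}
    (hm : 0 < m) : ∃ C : ℝ, 0 < C ∧ ∀ x y z, m ≤ x → m ≤ y → m ≤ z → ∀ t₁ t₂ t₃,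
      strength v ν β t₁ t₂ t₃ x y z ≤
        C * (decay v x * decay v y + decay v y * decay v z + decay v z * decay v x) := by
  obtain ⟨A, hA, ha⟩ := exists_amp_sq_le_bracketBound hv hν hm
  obtain ⟨K, hK, hk⟩ := exists_lattice_bounds hv hν hβ hm
  have hK0 : 0 < K := by linarith
  have hK2 : K ^ 2 ≤ K ^ 3 := pow_le_pow_right₀ hK (by norm_num)
  have hwK : ∀ t, m ≤ t → therm v ν β false t ^ 2 ≤ K := by
    intro t ht
    have := (hk t ht).2.2.1
    have h0 := disp_nonneg (v := v) (ν := ν) (hm.trans_le ht).le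
    nlinarith [sq_nonneg (therm v ν β false t)]
  have allTrue : ∀ x y z, m ≤ x → m ≤ y → m ≤ z → strength v ν β true true true x y z ≤
      8 * A * K ^ 6 * (decay v x * decay v y + decay v y * decay v z + decay v z * decay v x) := by
    intro x y z hx hy hz
    obtain ⟨x1, x2, x3, x4⟩ := hk x hx
    obtain ⟨y1, y2, y3, y4⟩ := hk y hy
    obtain ⟨z1, z2, z3, z4⟩ := hk z hz
    have dx := disp_nonneg (v := v) (ν := ν) (hm.trans_le hx).le
    have dy := disp_nonneg (v := v) (ν := ν) (hm.trans_le hy).le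
    have dz := disp_nonneg (v := v) (ν := ν) (hm.trans_le hz).le
    have h1 := ha x y z hx hy hz true true true
    simp only [bracketBound, if_true] at h1
    have h2 : mixingSum v ν β true true true x y z ^ 2 ≤ 4 * K ^ 3 := by
      refine (mixingSum_sq_le _ _ _ _ _ _).trans ?_
      have e1 : therm v ν β true x ^ 2 * therm v ν β true y ^ 2 * therm v ν β true z ^ 2
          ≤ K * K * K := by gcongr
      have e2 : therm v ν β false x ^ 2 * therm v ν β false y ^ 2 * therm v ν β false z ^ 2
          ≤ K * K * K := by gcongr <;> exact hwK _ (by assumption)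
      simp only [Bool.not_true]
      linarith
    unfold strength
    have hg : gap v ν true true true x y z = disp v ν x + disp v ν y + disp v ν z := by
      unfold gap; simp
    rw [hg, abs_of_nonneg (by linarith), div_le_iff₀ (by linarith)]
    set G := 1 + (disp v ν x + disp v ν y + disp v ν z) with hG
    have hG1 : 1 ≤ G := by linarith
    have term : ∀ Vi p D q, 0 ≤ p → 0 ≤ q → D ≤ G → Vi ≤ K * p * D → Vi * q ≤ K * G * (p * q) := by
      intro Vi p D q hp hq hD hVi
      calc Vi * q ≤ K * p * G * q := by
            apply mul_le_mul_of_nonneg_right (hVi.trans _) hq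
            gcongr
        _ = _ := by ring
    have tx := term _ _ _ (1 / y ^ 4 + 1 / z ^ 4) (by positivity) (by positivity) (by linarith) x1
    have ty := term _ _ _ (1 / z ^ 4 + 1 / x ^ 4) (by positivity) (by positivity) (by linarith) y1
    have tz := term _ _ _ (1 / x ^ 4 + 1 / y ^ 4) (by positivity) (by positivity) (by linarith) z1
    have hsum : vhatRadial v x ^ 2 / x ^ 2 * (1 / y ^ 4 + 1 / z ^ 4)
        + vhatRadial v y ^ 2 / y ^ 2 * (1 / z ^ 4 + 1 / x ^ 4)
        + vhatRadial v z ^ 2 / z ^ 2 * (1 / x ^ 4 + 1 / y ^ 4)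
        ≤ decay v x * decay v y + decay v y * decay v z + decay v z * decay v x := by
      unfold decay
      have : 0 ≤ vhatRadial v x ^ 2 / x ^ 2 * (vhatRadial v y ^ 2 / y ^ 2) := by positivity
      have : 0 ≤ vhatRadial v y ^ 2 / y ^ 2 * (vhatRadial v z ^ 2 / z ^ 2) := by positivity
      have : 0 ≤ vhatRadial v z ^ 2 / z ^ 2 * (vhatRadial v x ^ 2 / x ^ 2) := by positivity
      have : 0 ≤ 1 / x ^ 4 * (1 / y ^ 4) := by positivity
      have : 0 ≤ 1 / y ^ 4 * (1 / z ^ 4) := by positivity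
      have : 0 ≤ 1 / z ^ 4 * (1 / x ^ 4) := by positivity
      linarith
    set Δ := decay v x * decay v y + decay v y * decay v z + decay v z * decay v x with hΔ
    have hΔ0 : 0 ≤ Δ := by
      have := decay_nonneg (v := v) x
      have := decay_nonneg (v := v) y
      have := decay_nonneg (v := v) z
      positivity
    have h3 : amp v ν true true true x y z ^ 2 ≤ A * (K * G * Δ) := by
      refine h1.trans (mul_le_mul_of_nonneg_left ?_ hA.le)
      have := mul_le_mul_of_nonneg_left hsum (show 0 ≤ K * G by positivity)
      linarith
    calc amp v ν true true true x y z ^ 2 * mixingSum v ν β true true true x y z ^ 2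
        ≤ A * (K * G * Δ) * (4 * K ^ 3) := mul_le_mul h3 h2 (sq_nonneg _) (by positivity)
      _ = 4 * (A * K ^ 4 * G * Δ) := by ring
      _ ≤ 8 * (A * K ^ 6 * G * Δ) := by
        have : A * K ^ 4 * G * Δ ≤ A * K ^ 6 * G * Δ := by
          gcongr
          norm_num
        have : 0 ≤ A * K ^ 6 * G * Δ := by positivity
        linarith
      _ = _ := by ring
  have twoTrue : ∀ x y z, m ≤ x → m ≤ y → m ≤ z → strength v ν β true true false x y z ≤
      8 * A * K ^ 6 * (decay v x * decay v y + decay v y * decay v z + decay v z * decay v x) := by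
    intro x y z hx hy hz
    obtain ⟨x1, x2, x3, x4⟩ := hk x hx
    obtain ⟨y1, y2, y3, y4⟩ := hk y hy
    obtain ⟨z1, z2, z3, z4⟩ := hk z hz
    have dx := disp_nonneg (v := v) (ν := ν) (hm.trans_le hx).le
    have dy := disp_nonneg (v := v) (ν := ν) (hm.trans_le hy).le
    have dz := disp_nonneg (v := v) (ν := ν) (hm.trans_le hz).le
    have h1 := ha x y z hx hy hz true true false
    simp only [bracketBound, Bool.true_eq_false, Bool.false_eq_true, if_false, if_true, mul_one]
      at h1
    have h2 : mixingSum v ν β true true false x y z ^ 2 ≤ 2 * K ^ 2 * (therm v ν β false z ^ 2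
        + therm v ν β false x ^ 2 * therm v ν β false y ^ 2) := by
      refine (mixingSum_sq_le _ _ _ _ _ _).trans ?_
      simp only [Bool.not_true, Bool.not_false]
      have e1 : therm v ν β true x ^ 2 * therm v ν β true y ^ 2 * therm v ν β false z ^ 2
          ≤ K * K * therm v ν β false z ^ 2 := by gcongr
      have e2 : therm v ν β false x ^ 2 * therm v ν β false y ^ 2 * therm v ν β true z ^ 2
          ≤ therm v ν β false x ^ 2 * therm v ν β false y ^ 2 * (K * K) := by
        gcongr
        exact z2.trans (by nlinarith)
      linarith
    unfold strength
    have hg : gap v ν true true false x y z = disp v ν x + disp v ν y - disp v ν z := by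
      unfold gap; simp; ring
    rw [hg, div_le_iff₀ (by positivity)]
    set G := 1 + |disp v ν x + disp v ν y - disp v ν z| with hG
    have hG1 : 0 ≤ G - 1 := by rw [hG, add_sub_cancel_left]; exact abs_nonneg _
    have hg1 : disp v ν x + disp v ν y - disp v ν z ≤ G - 1 := by
      rw [hG, add_sub_cancel_left]; exact le_abs_self _
    have hg2 : disp v ν z - disp v ν x - disp v ν y ≤ G - 1 := by
      rw [hG, add_sub_cancel_left]; refine le_trans (le_of_eq ?_) (neg_le_abs _); ring
    have h3 := strength_aux (K := K) (G := G) (Vx := vhatRadial v x ^ 2)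
      (Vy := vhatRadial v y ^ 2) (Vz := vhatRadial v z ^ 2)
      (px := vhatRadial v x ^ 2 / x ^ 2) (py := vhatRadial v y ^ 2 / y ^ 2)
      (pz := vhatRadial v z ^ 2 / z ^ 2) (qx := 1 / x ^ 4) (qy := 1 / y ^ 4) (qz := 1 / z ^ 4)
      (wx := therm v ν β false x ^ 2) (wy := therm v ν β false y ^ 2)
      (wz := therm v ν β false z ^ 2) (Dx := 1 + disp v ν x) (Dy := 1 + disp v ν y)
      (Dz := 1 + disp v ν z) hK (by linarith) (by positivity) (by positivity) (by positivity)
      (by positivity) (by positivity) (by positivity) (by positivity) (by positivity)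
      (by positivity) (by linarith) (by linarith) x1 y1 z1 x3 y3 z3 x4 y4 z4
      (by linarith [mul_nonneg hG1 dz]) (by linarith [mul_nonneg hG1 dz])
      (by linarith [mul_nonneg hG1 dx, mul_nonneg hG1 dy, mul_nonneg dx dy,
        mul_nonneg hG1 (mul_nonneg dx dy)])
    change _ ≤ 2 * K ^ 3 * G * (decay v x * decay v y + decay v y * decay v z
      + decay v z * decay v x) at h3
    set Δ := decay v x * decay v y + decay v y * decay v z + decay v z * decay v x with hΔ
    have hΔ0 : 0 ≤ Δ := by
      have := decay_nonneg (v := v) x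
      have := decay_nonneg (v := v) y
      have := decay_nonneg (v := v) z
      positivity
    set S := vhatRadial v x ^ 2 + vhatRadial v y ^ 2
      + vhatRadial v z ^ 2 * (1 / x ^ 4 + 1 / y ^ 4) with hS
    set W := therm v ν β false z ^ 2 + therm v ν β false x ^ 2 * therm v ν β false y ^ 2 with hW
    have hG0 : 0 ≤ G := by linarith
    calc amp v ν true true false x y z ^ 2 * mixingSum v ν β true true false x y z ^ 2
        ≤ A * S * (2 * K ^ 2 * W) := mul_le_mul h1 h2 (sq_nonneg _) (by positivity)
      _ = 2 * A * K ^ 2 * (S * W) := by ring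
      _ ≤ 2 * A * K ^ 2 * (2 * K ^ 3 * G * Δ) := by gcongr
      _ = 4 * (A * K ^ 5 * G * Δ) := by ring
      _ ≤ 8 * (A * K ^ 6 * G * Δ) := by
        have : A * K ^ 5 * G * Δ ≤ A * K ^ 6 * G * Δ := by
          gcongr
          norm_num
        have : 0 ≤ A * K ^ 6 * G * Δ := by positivity
        linarith
      _ = _ := by ring
  refine ⟨8 * A * K ^ 6, by positivity, fun x y z hx hy hz t₁ t₂ t₃ => ?_⟩
  set Δ := decay v x * decay v y + decay v y * decay v z + decay v z * decay v x with hΔ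
  have hTTF := twoTrue x y z hx hy hz
  have hFTT : strength v ν β false true true x y z ≤ 8 * A * K ^ 6 * Δ := by
    rw [← strength_rotate]
    refine (twoTrue y z x hy hz hx).trans (le_of_eq ?_)
    rw [hΔ]; ring
  have hTFT : strength v ν β true false true x y z ≤ 8 * A * K ^ 6 * Δ := by
    rw [← strength_rotate, ← strength_rotate]
    refine (twoTrue z x y hz hx hy).trans (le_of_eq ?_)
    rw [hΔ]; ring
  cases t₁ <;> cases t₂ <;> cases t₃
  · rw [← strength_not]; exact allTrue x y z hx hy hz
  · rw [← strength_not]; exact hTTF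
  · rw [← strength_not]; exact hTFT
  · exact hFTT
  · rw [← strength_not]; exact hFTT
  · exact hTFT
  · exact hTTF
  · exact allTrue x y z hx hy hz

/-! ### Absolute convergence of the Golden Rule series -/

theorem le_norm_mom (hL : 0 < L) (q : Xi) : 2 * Real.pi / L ≤ ‖mom L q.1‖ := by
  have hl : 0 < 2 * Real.pi / L := by have := Real.pi_pos; positivity
  refine (sq_le_sq₀ hl.le (norm_nonneg _)).1 ?_
  rw [norm_mom_sq]
  have : 1 ≤ ∑ i, (q.1 i).natAbs ^ 2 := by
    by_contra h
    have h0 : ∑ i, (q.1 i).natAbs ^ 2 = 0 := by omega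
    refine q.2 (funext fun i => ?_)
    have := (Finset.sum_eq_zero_iff.1 h0) i (Finset.mem_univ i)
    simpa using this
  have h2 : (1 : ℝ) ≤ ((∑ i, (q.1 i).natAbs ^ 2 : ℕ) : ℝ) := by exact_mod_cast this
  exact le_mul_of_one_le_right (sq_nonneg _) h2

theorem Ladder.weight_sq_le {d : Ladder} {n : Config} {N : ℝ} (h : ∀ m, (n m : ℝ) ≤ N) :
    d.weight n ^ 2 ≤ N + 1 := by
  have := h d.mode
  unfold Ladder.weight
  split_ifs
  · rw [Real.sq_sqrt (by positivity)]; linarith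
  · rw [Real.sq_sqrt (by positivity)]; linarith

theorem Ladder.step_le {d : Ladder} {n : Config} {N : ℝ} (h : ∀ m, (n m : ℝ) ≤ N) (m : Mode) :
    (d.step n m : ℝ) ≤ N + 1 := by
  classical
  have := h m
  unfold Ladder.step
  split_ifs
  · rw [Finsupp.add_apply, Finsupp.single_apply]
    push_cast
    split_ifs <;> simp <;> linarith
  · rw [Finsupp.tsub_apply]
    have : ((n m - Finsupp.single d.mode 1 m : ℕ) : ℝ) ≤ (n m : ℝ) := by
      exact_mod_cast Nat.sub_le _ _
    linarith

theorem Triple.weight_sq_le {d : Triple} {n : Config} {N : ℝ} (h : ∀ m, (n m : ℝ) ≤ N) :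
    d.weight n ^ 2 ≤ (N + 3) ^ 3 := by
  have hN : 0 ≤ N := le_trans (Nat.cast_nonneg _) (h d.1.1.mode)
  have h1 := Ladder.weight_sq_le (d := d.1.2.2) h
  have s1 := Ladder.step_le (d := d.1.2.2) h
  have h2 := Ladder.weight_sq_le (d := d.1.2.1) s1
  have s2 := Ladder.step_le (d := d.1.2.1) s1
  have h3 := Ladder.weight_sq_le (d := d.1.1) s2
  unfold Triple.weight
  rw [mul_pow, mul_pow]
  calc _ ≤ (N + 1) * (N + 1 + 1) * (N + 1 + 1 + 1) := by gcongr
    _ ≤ (N + 3) * (N + 3) * (N + 3) :=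
      mul_le_mul (mul_le_mul (by linarith) (by linarith) (by linarith) (by linarith))
        (by linarith) (by linarith) (by positivity)
    _ = _ := by ring

theorem exists_config_le (n : Config) : ∃ N : ℝ, ∀ m, (n m : ℝ) ≤ N := by
  refine ⟨∑ m ∈ n.support, (n m : ℝ), fun m => ?_⟩
  by_cases h : m ∈ n.support
  · exact Finset.single_le_sum (f := fun m => (n m : ℝ)) (fun _ _ => Nat.cast_nonneg _) h
  · rw [Finsupp.notMem_support_iff.1 h]
    exact (by simpa using Finset.sum_nonneg fun _ _ => Nat.cast_nonneg _)

/-- An annihilation operator in a triple acts on a mode which is occupied from the start. -/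
theorem Triple.isCreate_or_occupied {d : Triple} {n : Config} (h : d.weight n ≠ 0) :
    (d.1.1.isCreate = true ∨ n d.1.1.mode ≠ 0) ∧ (d.1.2.1.isCreate = true ∨ n d.1.2.1.mode ≠ 0) ∧
      (d.1.2.2.isCreate = true ∨ n d.1.2.2.mode ≠ 0) := by
  classical
  obtain ⟨h12, h23, h31⟩ := d.eq_of_mode_eq
  have key : ∀ x : Ladder, (x = d.1.1 ∨ x = d.1.2.1 ∨ x = d.1.2.2) →
      (d.1.1.mode = x.mode → d.1.1 = x) → (d.1.2.1.mode = x.mode → d.1.2.1 = x) →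
      (d.1.2.2.mode = x.mode → d.1.2.2 = x) → (x.isCreate = true ∨ n x.mode ≠ 0) := by
    intro x hx e1 e2 e3
    by_contra hc
    simp only [not_or, Bool.not_eq_true, not_not] at hc
    obtain ⟨hc, hn⟩ := hc
    have hstep := Triple.step_apply h x.mode
    have hd : ∀ y : Ladder, (y.mode = x.mode → y = x) → y.delta x.mode = if y = x then -1 else 0 := by
      intro y hy
      unfold Ladder.delta
      by_cases hm : y.mode = x.mode
      · rw [if_pos hm, if_pos (hy hm), hy hm, hc]; simp
      · rw [if_neg hm, if_neg]
        rintro rfl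
        exact hm rfl
    rw [hd _ e1, hd _ e2, hd _ e3, hn] at hstep
    have h0 : (0 : ℤ) ≤ (d.step n x.mode : ℕ) := Int.natCast_nonneg _
    rw [hstep] at h0
    revert h0
    rcases hx with hx | hx | hx
    all_goals
      rw [← hx, if_pos rfl]
      split_ifs <;> simp
  exact ⟨key _ (Or.inl rfl) (fun _ => rfl) (fun e => (h12 e.symm).symm) h31,
    key _ (Or.inr (Or.inl rfl)) h12 (fun _ => rfl) (fun e => (h23 e.symm).symm),
    key _ (Or.inr (Or.inr rfl)) (fun e => (h31 e.symm).symm) h23 (fun _ => rfl)⟩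

theorem Ladder.norm_mom_mode (d : Ladder) (L : ℝ) : ‖mom L d.mode.2.1‖ = ‖mom L d.1.1‖ := by
  unfold Ladder.mode
  cases d.2.1
  · simp only [Bool.false_eq_true, if_false]; exact norm_mom_opp L _
  · rfl

/-- Both thermal weights are comparable at bounded momenta. -/
theorem exists_therm_le_therm (hv : IsAdmissible v V) (hν : ν ∈ Ioc 0 V) (hβ : 0 < β) {m : ℝ}
    (hm : 0 < m) (R : ℝ) : ∃ C : ℝ, 1 ≤ C ∧ ∀ t, m ≤ t → t ≤ R → ∀ s s',
      therm v ν β s t ≤ C * therm v ν β s' t := by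
  obtain ⟨c, D, hc, hD, h⟩ := exists_disp_bounds hv hν
  refine ⟨Real.exp (β * (D * (|R| * (1 + |R|))) / 2), Real.one_le_exp (by positivity),
    fun t ht htR s s' => ?_⟩
  have ht0 := hm.trans_le ht
  have htR' : t ≤ |R| := htR.trans (le_abs_self R)
  have h1 : β * disp v ν t ≤ β * (D * (|R| * (1 + |R|))) := by
    gcongr
    exact (h t ht0.le).2.trans (by gcongr)
  have hexp : Real.exp (β * disp v ν t / 2) ≤ Real.exp (β * (D * (|R| * (1 + |R|))) / 2) :=
    Real.exp_le_exp.2 (by linarith)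
  have hW := therm_nonneg (v := v) (ν := ν) (β := β) false t
  have hge1 : 1 ≤ Real.exp (β * (D * (|R| * (1 + |R|))) / 2) := Real.one_le_exp (by positivity)
  have hU : therm v ν β false t ≤ therm v ν β true t := by
    rw [therm_true_eq]
    exact le_mul_of_one_le_left hW
      (Real.one_le_exp (by have := disp_nonneg (v := v) (ν := ν) ht0.le; positivity))
  have hU0 := hW.trans hU
  have hUW : therm v ν β true t ≤
      Real.exp (β * (D * (|R| * (1 + |R|))) / 2) * therm v ν β false t := by
    rw [therm_true_eq]; gcongr
  cases s <;> cases s'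
  · exact le_mul_of_one_le_left hW hge1
  · exact hU.trans (le_mul_of_one_le_left hU0 hge1)
  · exact hUW
  · exact le_mul_of_one_le_left hU0 hge1

/-- The contribution of a triple to the Golden Rule term of a basis vector. -/
def goldenTerm (v : E → ℝ) (ν β L ε : ℝ) (n₀ : Config) (d : Triple) : ℂ :=
  ((d.mult / 36 * d.amplitude v ν β L ^ 2 * d.weight n₀ ^ 2 : ℝ) : ℂ)
    * ((energy v ν L (d.step n₀) : ℂ) - Complex.I * (ε : ℂ))⁻¹

theorem norm_inv_sub_le {ε : ℝ} (hε : 0 < ε) (x : ℝ) :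
    ‖((x : ℂ) - Complex.I * (ε : ℂ))⁻¹‖ ≤ (1 + 1 / ε) / (1 + |x|) := by
  have h1 : |x| ≤ ‖(x : ℂ) - Complex.I * (ε : ℂ)‖ := by
    simpa using Complex.abs_re_le_norm ((x : ℂ) - Complex.I * (ε : ℂ))
  have h2 : ε ≤ ‖(x : ℂ) - Complex.I * (ε : ℂ)‖ := by
    have := Complex.abs_im_le_norm ((x : ℂ) - Complex.I * (ε : ℂ))
    simpa [abs_of_pos hε] using this
  set r := ‖(x : ℂ) - Complex.I * (ε : ℂ)‖
  have hr : 0 < r := hε.trans_le h2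
  rw [norm_inv, le_div_iff₀ (by positivity), inv_mul_le_iff₀ hr]
  have : 1 ≤ r * (1 / ε) := by rw [mul_one_div, le_div_iff₀ hε]; linarith
  linarith

theorem summable_decay_triple (hv : IsAdmissible v V) (hν : ν ∈ Ioc 0 V) (hL : 0 < L) :
    Summable fun d : Triple => decay v ‖mom L d.1.1.1.1‖ * decay v ‖mom L d.1.2.1.1.1‖
      + decay v ‖mom L d.1.2.1.1.1‖ * decay v ‖mom L d.1.2.2.1.1‖
      + decay v ‖mom L d.1.2.2.1.1‖ * decay v ‖mom L d.1.1.1.1‖ := by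
  have h := summable_decay hv hν hL
  have h0 : ∀ q : Xi, 0 ≤ decay v ‖mom L q.1‖ := fun q => decay_nonneg _
  have h2 := h.mul_of_nonneg h h0 h0
  have h3 : Summable fun _ : (Bool × Bool) × (Bool × Bool) × (Bool × Bool) => (1 : ℝ) :=
    .of_finite
  have h4 := h2.mul_of_nonneg h3 (fun x => mul_nonneg (h0 _) (h0 _)) fun _ => zero_le_one
  set f : Triple → (Xi × Xi) × (Bool × Bool) × (Bool × Bool) × (Bool × Bool) :=
    fun d => ((d.1.1.1, d.1.2.1.1), d.1.1.2, d.1.2.1.2, d.1.2.2.2) with hf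
  have hinj : Function.Injective f := by
    rintro ⟨⟨⟨a, a'⟩, ⟨b, b'⟩, ⟨c, c'⟩⟩, hd⟩ ⟨⟨⟨x, x'⟩, ⟨y, y'⟩, ⟨z, z'⟩⟩, hd'⟩ he
    simp only [hf, Prod.mk.injEq] at he hd hd'
    obtain ⟨⟨rfl, rfl⟩, rfl, rfl, rfl⟩ := he
    have : c = z := Subtype.ext (add_left_cancel (hd.trans hd'.symm))
    subst this
    rfl
  have h5 : Summable fun d : Triple =>
      decay v ‖mom L d.1.1.1.1‖ * decay v ‖mom L d.1.2.1.1.1‖ := by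
    simpa [Function.comp_def, hf] using h4.comp_injective hinj
  exact (h5.add (Triple.rotEquiv.summable_iff.2 h5)).add
    (Triple.rotEquiv.symm.summable_iff.2 h5)

theorem exists_mixing_sq_le (hv : IsAdmissible v V) (hν : ν ∈ Ioc 0 V) (hβ : 0 < β) {m : ℝ}
    (hm : 0 < m) (R : ℝ) : ∃ C : ℝ, 0 < C ∧ ∀ x y z, m ≤ x → m ≤ y → m ≤ z →
      ∀ t₁ s₁ t₂ s₂ t₃ s₃, (t₁ = s₁ ∨ x ≤ R) → (t₂ = s₂ ∨ y ≤ R) → (t₃ = s₃ ∨ z ≤ R) →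
      mixing v ν β s₁ s₂ s₃ x y z ^ 2 ≤ C * mixingSum v ν β t₁ t₂ t₃ x y z ^ 2 := by
  obtain ⟨C, hC, h⟩ := exists_therm_le_therm hv hν hβ hm R
  have key : ∀ x, m ≤ x → ∀ t s, (t = s ∨ x ≤ R) →
      therm v ν β s x ≤ C * therm v ν β t x ∧ therm v ν β (!s) x ≤ C * therm v ν β (!t) x := by
    rintro x hx t s (rfl | hR)
    · exact ⟨le_mul_of_one_le_left (therm_nonneg _ _) hC,
        le_mul_of_one_le_left (therm_nonneg _ _) hC⟩
    · exact ⟨h x hx hR _ _, h x hx hR _ _⟩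
  refine ⟨(C ^ 3) ^ 2, by positivity, fun x y z hx hy hz t₁ s₁ t₂ s₂ t₃ s₃ h₁ h₂ h₃ => ?_⟩
  refine (mixing_sq_le _ _ _ _ _ _).trans ?_
  rw [← mul_pow]
  have hn := fun s t => therm_nonneg (v := v) (ν := ν) (β := β) s t
  obtain ⟨a1, b1⟩ := key x hx _ _ h₁
  obtain ⟨a2, b2⟩ := key y hy _ _ h₂
  obtain ⟨a3, b3⟩ := key z hz _ _ h₃
  have hC0 : 0 ≤ C := by linarith
  have prod : ∀ a b c a' b' c' : ℝ, 0 ≤ a → 0 ≤ b → 0 ≤ c → 0 ≤ a' → 0 ≤ b' → 0 ≤ c' →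
      a ≤ C * a' → b ≤ C * b' → c ≤ C * c' → a * b * c ≤ C ^ 3 * (a' * b' * c') := by
    intro a b c a' b' c' _ _ _ _ _ _ ha hb hc
    calc a * b * c ≤ (C * a') * (C * b') * (C * c') := by gcongr
      _ = _ := by ring
  have e1 := prod _ _ _ _ _ _ (hn s₁ x) (hn s₂ y) (hn s₃ z) (hn t₁ x) (hn t₂ y) (hn t₃ z) a1 a2 a3
  have e2 := prod _ _ _ _ _ _ (hn (!s₁) x) (hn (!s₂) y) (hn (!s₃) z) (hn (!t₁) x) (hn (!t₂) y)
    (hn (!t₃) z) b1 b2 b3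
  unfold mixingSum
  refine pow_le_pow_left₀ ?_ (by linarith) 2
  have := mul_nonneg (mul_nonneg (hn s₁ x) (hn s₂ y)) (hn s₃ z)
  have := mul_nonneg (mul_nonneg (hn (!s₁) x) (hn (!s₂) y)) (hn (!s₃) z)
  linarith

theorem Triple.amplitude_sq (hv : IsAdmissible v V) (hν : ν ∈ Ioc 0 V) (hL : 0 < L) (d : Triple) :
    d.amplitude v ν β L ^ 2 = (L ^ 3)⁻¹ * rate v ν β d.1.1.2.1 d.1.1.2.2 d.1.2.1.2.1 d.1.2.1.2.2
      d.1.2.2.2.1 d.1.2.2.2.2 ‖mom L d.1.1.1.1‖ ‖mom L d.1.2.1.1.1‖ ‖mom L d.1.2.2.1.1‖ := by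
  have h0 := hv.vhat_zero_pos
  have hν0 := hν.1
  have hL3 : ((L ^ (3 / 2 : ℝ))⁻¹) ^ 2 = (L ^ 3)⁻¹ := by
    rw [inv_pow, ← Real.rpow_natCast, ← Real.rpow_mul hL.le]
    norm_num
  unfold Triple.amplitude rate
  rw [mul_pow, mul_pow, hL3, Real.sq_sqrt (by positivity)]
  ring

/-- The ladder operators which create a quasiparticle or act at bounded momentum. -/
def Ladder.Tame (L R : ℝ) (x : Ladder) : Prop := x.2.1 = x.2.2 ∨ ‖mom L x.1.1‖ ≤ R

/-- A triple all of whose members are tame. -/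
def Triple.Tame (L R : ℝ) (d : Triple) : Prop :=
  d.1.1.Tame L R ∧ d.1.2.1.Tame L R ∧ d.1.2.2.Tame L R

open Classical in
/-- At bounded momenta an annihilated quasiparticle costs no more than a created one, which reduces
the sum to `exists_strength_le`. -/
theorem summable_tame (hv : IsAdmissible v V) (hν : ν ∈ Ioc 0 V) (hβ : 0 < β) (hL : 0 < L)
    (R : ℝ) : Summable fun d : Triple => if d.Tame L R then
      d.amplitude v ν β L ^ 2 / (1 + |d.gap v ν L|) else 0 := by
  have h0 := hv.vhat_zero_pos
  have hν0 := hν.1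
  have hl : 0 < 2 * Real.pi / L := by have := Real.pi_pos; positivity
  obtain ⟨C₁, hC₁, h1⟩ := exists_mixing_sq_le hv hν hβ hl R
  obtain ⟨C₂, hC₂, h2⟩ := exists_strength_le hv hν hβ hl
  refine Summable.of_nonneg_of_le (fun d => by split_ifs <;> positivity) (fun d => ?_)
    ((summable_decay_triple hv hν hL).mul_left ((L ^ 3)⁻¹ * (ν / vhat v 0) * C₁ * C₂))
  have hstr := h2 _ _ _ (le_norm_mom hL d.1.1.1) (le_norm_mom hL d.1.2.1.1)
    (le_norm_mom hL d.1.2.2.1) d.1.1.2.1 d.1.2.1.2.1 d.1.2.2.2.1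
  set Δ := decay v ‖mom L d.1.1.1.1‖ * decay v ‖mom L d.1.2.1.1.1‖
      + decay v ‖mom L d.1.2.1.1.1‖ * decay v ‖mom L d.1.2.2.1.1‖
      + decay v ‖mom L d.1.2.2.1.1‖ * decay v ‖mom L d.1.1.1.1‖ with hΔ
  have hΔ0 : 0 ≤ Δ := by
    have h := fun t => decay_nonneg (v := v) t
    have := mul_nonneg (h ‖mom L d.1.1.1.1‖) (h ‖mom L d.1.2.1.1.1‖)
    have := mul_nonneg (h ‖mom L d.1.2.1.1.1‖) (h ‖mom L d.1.2.2.1.1‖)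
    have := mul_nonneg (h ‖mom L d.1.2.2.1.1‖) (h ‖mom L d.1.1.1.1‖)
    linarith
  split_ifs with hd
  swap
  · positivity
  obtain ⟨o1, o2, o3⟩ := hd
  have hmix := h1 _ _ _ (le_norm_mom hL d.1.1.1) (le_norm_mom hL d.1.2.1.1)
    (le_norm_mom hL d.1.2.2.1) _ _ _ _ _ _ o1 o2 o3
  rw [Triple.amplitude_sq hv hν hL]
  set A := amp v ν d.1.1.2.1 d.1.2.1.2.1 d.1.2.2.2.1 ‖mom L d.1.1.1.1‖ ‖mom L d.1.2.1.1.1‖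
    ‖mom L d.1.2.2.1.1‖ ^ 2 with hA
  set S := mixingSum v ν β d.1.1.2.1 d.1.2.1.2.1 d.1.2.2.2.1 ‖mom L d.1.1.1.1‖ ‖mom L d.1.2.1.1.1‖
    ‖mom L d.1.2.2.1.1‖ ^ 2 with hS
  have hrate : rate v ν β d.1.1.2.1 d.1.1.2.2 d.1.2.1.2.1 d.1.2.1.2.2 d.1.2.2.2.1 d.1.2.2.2.2
      ‖mom L d.1.1.1.1‖ ‖mom L d.1.2.1.1.1‖ ‖mom L d.1.2.2.1.1‖
      ≤ ν / vhat v 0 * (A * (C₁ * S)) := by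
    unfold rate
    gcongr
  have hstr' : A * S / (1 + |d.gap v ν L|) ≤ C₂ * Δ := hstr
  calc _ ≤ (L ^ 3)⁻¹ * (ν / vhat v 0 * (A * (C₁ * S))) / (1 + |d.gap v ν L|) := by gcongr
    _ = (L ^ 3)⁻¹ * (ν / vhat v 0) * C₁ * (A * S / (1 + |d.gap v ν L|)) := by ring
    _ ≤ (L ^ 3)⁻¹ * (ν / vhat v 0) * C₁ * (C₂ * Δ) := by gcongr
    _ = _ := by ring

/-- Annihilation operators only act on the finitely many occupied modes. -/
theorem exists_tame (L : ℝ) (n₀ : Config) :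
    ∃ R, ∀ d : Triple, d.weight n₀ ≠ 0 → d.Tame L R := by
  set R := ∑ m ∈ n₀.support, ‖mom L m.2.1‖ with hR
  have hocc : ∀ x : Ladder, x.isCreate = true ∨ n₀ x.mode ≠ 0 → x.Tame L R := by
    rintro x (h | h)
    · left; unfold Ladder.isCreate at h; exact eq_of_beq h
    · right
      rw [← Ladder.norm_mom_mode]
      exact Finset.single_le_sum (f := fun m : Mode => ‖mom L m.2.1‖) (fun _ _ => norm_nonneg _)
        (Finsupp.mem_support_iff.2 h)
  refine ⟨R, fun d hw => ?_⟩
  obtain ⟨o1, o2, o3⟩ := Triple.isCreate_or_occupied hw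
  exact ⟨hocc _ o1, hocc _ o2, hocc _ o3⟩

theorem summable_goldenTerm (hv : IsAdmissible v V) (hν : ν ∈ Ioc 0 V) (hβ : 0 < β) (hL : 0 < L)
    {ε : ℝ} (hε : 0 < ε) {n₀ : Config} (hE : energy v ν L n₀ = 0) :
    Summable (goldenTerm v ν β L ε n₀) := by
  classical
  obtain ⟨N, hN⟩ := exists_config_le n₀
  obtain ⟨R, hR⟩ := exists_tame L n₀
  have hN0 : 0 ≤ N := le_trans (Nat.cast_nonneg _) (hN (Side.left, ⟨fun _ => 1, by
    intro h; have := congrFun h 0; simp at this⟩))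
  refine Summable.of_norm_bounded ((summable_tame hv hν hβ hL R).mul_left
    ((N + 3) ^ 3 * (1 + 1 / ε))) fun d => ?_
  unfold goldenTerm
  by_cases hw : d.weight n₀ = 0
  · rw [hw]
    simp only [ne_eq, OfNat.ofNat_ne_zero, not_false_eq_true, zero_pow, mul_zero,
      Complex.ofReal_zero, zero_mul, norm_zero]
    split_ifs <;> positivity
  rw [if_pos (hR d hw), norm_mul, Complex.norm_real, Real.norm_of_nonneg (by positivity),
    Triple.energy_step hv d n₀ hw, hE, zero_add]
  have hres := norm_inv_sub_le hε (d.gap v ν L)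
  have hwt := Triple.weight_sq_le (d := d) hN
  have hmult : (d.mult : ℝ) / 36 ≤ 1 := by
    have : (d.mult : ℝ) ≤ 6 := by exact_mod_cast d.mult_le
    linarith
  calc _ ≤ 1 * d.amplitude v ν β L ^ 2 * (N + 3) ^ 3
        * ((1 + 1 / ε) / (1 + |d.gap v ν L|)) := by gcongr
    _ = _ := by ring

/-- The resolvent matrix elements converge absolutely. -/
theorem goldenRuleSummable (hv : IsAdmissible v V) (hν : ν ∈ Ioc 0 V) (hβ : 0 < β) (hL : 0 < L)
    {ε : ℝ} (hε : 0 < ε) {n₀ : Config} (hE : energy v ν L n₀ = 0) :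
    GoldenRuleSummable v ν β L ε (basisVec n₀) :=
  (goldenRule_basisVec hv hν hL ε n₀ (summable_goldenTerm hv hν hβ hL hε hE)).1

theorem goldenRule_eq_tsum (hv : IsAdmissible v V) (hν : ν ∈ Ioc 0 V) (hβ : 0 < β) (hL : 0 < L)
    {ε : ℝ} (hε : 0 < ε) {n₀ : Config} (hE : energy v ν L n₀ = 0) :
    goldenRule v ν β L ε (basisVec n₀) = ∑' d, goldenTerm v ν β L ε n₀ d :=
  (goldenRule_basisVec hv hν hL ε n₀ (summable_goldenTerm hv hν hβ hL hε hE)).2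

/-! ### The difference of the two Golden Rule terms -/

/-- The imaginary part of the resolvent function `(x - iε)⁻¹`. -/
def lorentz (ε x : ℝ) : ℝ := ε / (x ^ 2 + ε ^ 2)

theorem lorentz_nonneg {ε : ℝ} (hε : 0 < ε) (x : ℝ) : 0 ≤ lorentz ε x := by
  unfold lorentz; positivity

theorem lorentz_eq_im (ε x : ℝ) : lorentz ε x = (((x : ℂ) - Complex.I * (ε : ℂ))⁻¹).im := by
  rw [Complex.inv_im]
  simp [lorentz, Complex.normSq_apply, sq]

theorem lorentz_le {ε : ℝ} (hε : 0 < ε) (x : ℝ) : lorentz ε x ≤ (1 + 1 / ε) / (1 + |x|) := by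
  rw [lorentz_eq_im]
  exact (le_abs_self _).trans ((Complex.abs_im_le_norm _).trans (norm_inv_sub_le hε x))

theorem lorentz_le_inv {ε : ℝ} (hε : 0 < ε) (x : ℝ) : lorentz ε x ≤ 1 / ε := by
  unfold lorentz
  rw [div_le_div_iff₀ (by positivity) hε]
  nlinarith [sq_nonneg x]

theorem lorentz_neg (ε x : ℝ) : lorentz ε (-x) = lorentz ε x := by simp [lorentz]

/-- The real parts of the resolvent cancel between opposite energies. -/
theorem inv_sub_add_inv_neg (ε x : ℝ) :
    ((x : ℂ) - Complex.I * (ε : ℂ))⁻¹ + (((-x : ℝ) : ℂ) - Complex.I * (ε : ℂ))⁻¹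
      = Complex.I * ((2 * lorentz ε x : ℝ) : ℂ) := by
  apply Complex.ext
  · simp [Complex.inv_re, Complex.normSq_apply]
    ring
  · rw [Complex.add_im, ← lorentz_eq_im, ← lorentz_eq_im, lorentz_neg]
    simp
    ring

namespace Ladder

/-- The modular conjugate of a ladder operator: the same operator on the other side. -/
def flip (x : Ladder) : Ladder := (x.1.opp, !x.2.1, !x.2.2)

theorem flip_flip (x : Ladder) : x.flip.flip = x := by
  simp [flip, Xi.opp_opp]

theorem flip_mode (x : Ladder) : x.flip.mode = swapMode x.mode := by
  obtain ⟨q, _ | _, _ | _⟩ := x <;> simp [flip, mode, sideOf, swapMode, Side.swap, Xi.opp_opp]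

theorem flip_isCreate (x : Ladder) : x.flip.isCreate = x.isCreate := by
  obtain ⟨q, _ | _, _ | _⟩ := x <;> rfl

theorem weight_flip (x : Ladder) (n : Config) : x.flip.weight (swapConfig n) = x.weight n := by
  unfold weight
  rw [flip_isCreate, flip_mode, swapConfig_apply, swapMode_swapMode]

theorem step_flip (x : Ladder) (n : Config) : x.flip.step (swapConfig n) = swapConfig (x.step n) := by
  unfold step
  rw [flip_isCreate, flip_mode, ← swapConfig_add_single, ← swapConfig_sub_single,
    swapMode_swapMode]
  split_ifs <;> rfl

end Ladder

namespace Triple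

/-- The modular conjugate of a triple. -/
def flip (d : Triple) : Triple :=
  ⟨(d.1.1.flip, d.1.2.1.flip, d.1.2.2.flip), by
    change -d.1.1.1.1 + -d.1.2.1.1.1 + -d.1.2.2.1.1 = 0
    rw [← neg_add, ← neg_add, d.2, neg_zero]⟩

theorem flip_flip (d : Triple) : d.flip.flip = d :=
  Subtype.ext (Prod.ext (Ladder.flip_flip _) (Prod.ext (Ladder.flip_flip _) (Ladder.flip_flip _)))

/-- Modular conjugation as an equivalence. -/
def flipEquiv : Triple ≃ Triple := ⟨flip, flip, flip_flip, flip_flip⟩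

theorem weight_flip (d : Triple) (n : Config) : d.flip.weight (swapConfig n) = d.weight n := by
  unfold weight
  change d.1.2.2.flip.weight _ * d.1.2.1.flip.weight (d.1.2.2.flip.step _)
    * d.1.1.flip.weight (d.1.2.1.flip.step (d.1.2.2.flip.step _)) = _
  rw [Ladder.step_flip, Ladder.step_flip, Ladder.weight_flip, Ladder.weight_flip,
    Ladder.weight_flip]

theorem amplitude_flip (d : Triple) : d.flip.amplitude v ν β L = -d.amplitude v ν β L := by
  unfold amplitude flip Ladder.flip
  simp only [norm_mom_opp, amp_not, mixing_not]
  ring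

theorem gap_flip (d : Triple) : d.flip.gap v ν L = -d.gap v ν L := by
  unfold gap flip Ladder.flip BoseGas.gap
  simp only [norm_mom_opp, sgn_not]
  ring

theorem mult_flip (d : Triple) : d.flip.mult = d.mult := by
  classical
  have : d.flip.perms = d.perms.image flip := by
    unfold perms
    simp only [Finset.image_insert, Finset.image_singleton]
    rfl
  unfold mult
  rw [this]
  exact Finset.card_image_of_injective _ flipEquiv.injective

theorem mult_rot (d : Triple) : d.rot.mult = d.mult := by
  classical
  have : d.rot.perms = d.perms := by
    unfold perms
    rw [show d.rot.rot.rot = d from rfl, show d.rot.swp = d.swp.rot.rot from rfl,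
      show d.swp.rot.rot.rot = d.swp from rfl]
    ext x
    simp only [Finset.mem_insert, Finset.mem_singleton]
    tauto
  unfold mult
  rw [this]

theorem weight_rot (d : Triple) (n : Config) : d.rot.weight n = d.weight n := by
  have key : ∀ d : Triple, d.weight n ≠ 0 → d.rot.weight n = d.weight n := by
    intro d h
    have h1 := matEl_rot d n (d.step n)
    rw [matEl_step] at h1
    have h2 : d.rot.matEl n (d.step n) ≠ 0 := by rwa [h1]
    have h3 := (weight_ne_zero h2).1
    rw [← h1, ← h3, matEl_step]
  by_cases h : d.weight n = 0
  · by_contra hne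
    have h1 : d.rot.weight n ≠ 0 := by rw [h] at hne; exact hne
    have h2 := key _ h1
    have h3 := key d.rot.rot (by rwa [h2])
    rw [rot_rot_rot, h2, h] at h3
    exact h1 h3.symm
  · exact key d h

theorem gap_rot (d : Triple) : d.rot.gap v ν L = d.gap v ν L := by
  unfold gap rot BoseGas.gap
  ring

end Triple

/-- The strength with which a triple contributes at regularization `ε`, up to combinatorial
factors. -/
def lorentzTerm (v : E → ℝ) (ν β L ε : ℝ) (d : Triple) : ℝ :=
  d.amplitude v ν β L ^ 2 * lorentz ε (d.gap v ν L)

theorem lorentzTerm_nonneg {ε : ℝ} (hε : 0 < ε) (d : Triple) : 0 ≤ lorentzTerm v ν β L ε d :=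
  mul_nonneg (sq_nonneg _) (lorentz_nonneg hε _)

theorem lorentzTerm_rot (ε : ℝ) (d : Triple) :
    lorentzTerm v ν β L ε d.rot = lorentzTerm v ν β L ε d := by
  unfold lorentzTerm; rw [Triple.amplitude_rot, Triple.gap_rot]

/-- On states which are invariant under modular conjugation, the Golden Rule term is imaginary. -/
theorem goldenRule_eq (hv : IsAdmissible v V) (hν : ν ∈ Ioc 0 V) (hβ : 0 < β) (hL : 0 < L)
    {ε : ℝ} (hε : 0 < ε) {n₀ : Config} (hE : energy v ν L n₀ = 0) (hn : swapConfig n₀ = n₀) :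
    HasSum (fun d : Triple => ((d.mult / 36 * d.weight n₀ ^ 2 * lorentzTerm v ν β L ε d : ℝ) : ℂ))
      (-Complex.I * goldenRule v ν β L ε (basisVec n₀)) := by
  have hs := summable_goldenTerm hv hν hβ hL hε hE
  rw [goldenRule_eq_tsum hv hν hβ hL hε hE]
  have h1 := hs.hasSum
  have h2 := (Triple.flipEquiv.hasSum_iff).2 h1
  have h3 := (h1.add h2).mul_left (-Complex.I / 2)
  have h4 : ∀ d : Triple, -Complex.I / 2 * (goldenTerm v ν β L ε n₀ d
      + goldenTerm v ν β L ε n₀ d.flip)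
      = ((d.mult / 36 * d.weight n₀ ^ 2 * lorentzTerm v ν β L ε d : ℝ) : ℂ) := by
    intro d
    unfold goldenTerm
    have hw : d.flip.weight n₀ = d.weight n₀ := by
      conv_lhs => rw [← hn]
      exact Triple.weight_flip d n₀
    by_cases h0 : d.weight n₀ = 0
    · rw [hw, h0]; simp
    · rw [Triple.energy_step hv d.flip n₀ (by rwa [hw]), Triple.energy_step hv d n₀ h0, hE,
        Triple.gap_flip, Triple.amplitude_flip, Triple.mult_flip, hw, zero_add, zero_add, neg_sq,
        ← mul_add, inv_sub_add_inv_neg]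
      unfold lorentzTerm
      push_cast
      linear_combination (-(d.mult / 36 * d.amplitude v ν β L ^ 2 * d.weight n₀ ^ 2
        * lorentz ε (d.gap v ν L) : ℂ)) * Complex.I_sq
  have h5 : -Complex.I / 2 * (∑' d, goldenTerm v ν β L ε n₀ d + ∑' d, goldenTerm v ν β L ε n₀ d)
      = -Complex.I * ∑' d, goldenTerm v ν β L ε n₀ d := by ring
  rw [h5] at h3
  exact h3.congr_fun fun d => (h4 d).symm

/-! ### Ladder operators that feel the quasiparticle -/

theorem pairConfig_apply (k : Xi) (m : Mode) [Decidable (m.2 = k)] :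
    pairConfig k m = if m.2 = k then 1 else 0 := by
  classical
  obtain ⟨_ | _, q⟩ := m <;>
  · simp only [pairConfig, Finsupp.add_apply, Finsupp.single_apply, Prod.mk.injEq]
    by_cases h : q = k
    · simp [h]
    · simp [h, Ne.symm h]

theorem Ladder.weight_sq_zero (x : Ladder) :
    x.weight 0 ^ 2 = if x.isCreate then 1 else 0 := by
  unfold Ladder.weight
  split_ifs <;> simp

open Classical in
theorem Ladder.weight_sq_pairConfig (x : Ladder) (k : Xi) :
    x.weight (pairConfig k) ^ 2 = x.weight 0 ^ 2 + if x.mode.2 = k then 1 else 0 := by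
  rw [Ladder.weight_sq_zero]
  unfold Ladder.weight
  rw [pairConfig_apply]
  split_ifs
  · rw [Real.sq_sqrt (by positivity)]; norm_num
  · simp
  · simp
  · simp

theorem Ladder.weight_congr {x : Ladder} {n n' : Config} (h : n x.mode = n' x.mode) :
    x.weight n = x.weight n' := by
  unfold Ladder.weight; rw [h]

theorem Ladder.step_congr {x : Ladder} {n n' : Config} {m : Mode} (h : n m = n' m) :
    x.step n m = x.step n' m := by
  unfold Ladder.step
  split_ifs
  · rw [Finsupp.add_apply, Finsupp.add_apply, h]
  · rw [Finsupp.tsub_apply, Finsupp.tsub_apply, h]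

theorem Ladder.step_of_ne {x : Ladder} {n : Config} {m : Mode} (h : x.mode ≠ m) :
    x.step n m = n m := by
  classical
  unfold Ladder.step
  split_ifs
  · rw [Finsupp.add_apply, Finsupp.single_apply, if_neg h, add_zero]
  · rw [Finsupp.tsub_apply, Finsupp.single_apply, if_neg h, tsub_zero]

namespace Triple

theorem weight_congr {d : Triple} {n n' : Config} (h₁ : n d.1.1.mode = n' d.1.1.mode)
    (h₂ : n d.1.2.1.mode = n' d.1.2.1.mode) (h₃ : n d.1.2.2.mode = n' d.1.2.2.mode) :
    d.weight n = d.weight n' := by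
  unfold weight
  rw [Ladder.weight_congr h₃, Ladder.weight_congr (x := d.1.2.1) (Ladder.step_congr h₂),
    Ladder.weight_congr (x := d.1.1) (Ladder.step_congr (Ladder.step_congr h₁))]

theorem weight_of_ne {d : Triple} (n : Config) (h₁ : d.1.1.mode ≠ d.1.2.1.mode)
    (h₂ : d.1.2.1.mode ≠ d.1.2.2.mode) (h₃ : d.1.2.2.mode ≠ d.1.1.mode) :
    d.weight n = d.1.2.2.weight n * d.1.2.1.weight n * d.1.1.weight n := by
  unfold weight
  rw [Ladder.weight_congr (x := d.1.2.1) (Ladder.step_of_ne (Ne.symm h₂)),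
    Ladder.weight_congr (x := d.1.1) (n := d.1.2.1.step _)
      ((Ladder.step_of_ne (Ne.symm h₁)).trans (Ladder.step_of_ne h₃))]

/-- The first member acts on a mode of momentum `k`, and the others create quasiparticles. -/
def Hit (k : Xi) (d : Triple) : Prop :=
  d.1.1.mode.2 = k ∧ d.1.2.1.isCreate = true ∧ d.1.2.2.isCreate = true

/-- The momenta which are parallel to `k` and comparable to it, and which can occur in resonant
triples. -/
def parallel (k : Xi) : Finset (Fin 3 → ℤ) :=
  {k.1, -k.1, 2 • k.1, -(2 • k.1), 4 • k.1, -(4 • k.1)}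

/-- All charges of the triple are multiples of the charge `k` by `±1/2`, `±1` or `±2`. -/
def Exceptional (k : Xi) (d : Triple) : Prop :=
  2 • d.1.1.1.1 ∈ parallel k ∧ 2 • d.1.2.1.1.1 ∈ parallel k ∧ 2 • d.1.2.2.1.1 ∈ parallel k

theorem Exceptional.rot {k : Xi} {d : Triple} (h : Exceptional k d.rot) : Exceptional k d :=
  ⟨h.2.2, h.1, h.2.1⟩

end Triple

theorem Ladder.charge_of_mode_eq {x : Ladder} {k : Xi} (h : x.mode.2 = k) :
    x.1.1 = k.1 ∨ x.1.1 = -k.1 := by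
  subst h
  obtain ⟨q, t, s⟩ := x
  cases t
  · right; simp [Ladder.mode, Xi.opp]
  · left; simp [Ladder.mode]

namespace Triple

theorem exceptional_of_charge {k : Xi} {d : Triple} (h₁ : d.1.1.1.1 = k.1 ∨ d.1.1.1.1 = -k.1)
    (h₂ : d.1.2.1.1.1 = k.1 ∨ d.1.2.1.1.1 = -k.1) : Exceptional k d := by
  have h0 := d.2
  have h3 : d.1.2.2.1.1 = -(d.1.1.1.1 + d.1.2.1.1.1) := (neg_eq_of_add_eq_zero_right h0).symm
  have hne := d.1.2.2.1.2
  unfold Exceptional parallel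
  simp only [Finset.mem_insert, Finset.mem_singleton]
  rw [h3] at hne ⊢
  rcases h₁ with h₁ | h₁ <;> rcases h₂ with h₂ | h₂ <;> rw [h₁, h₂] at hne ⊢
  · refine ⟨?_, ?_, ?_⟩
    · tauto
    · tauto
    · right; right; right; right; right; module
  · exact absurd (by rw [add_neg_cancel, neg_zero]) hne
  · exact absurd (by rw [neg_add_cancel, neg_zero]) hne
  · refine ⟨?_, ?_, ?_⟩
    · right; right; right; left; module
    · right; right; right; left; module
    · right; right; right; right; left; module

/-- In a triple which is not exceptional, at most one member feels the quasiparticle. -/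
theorem ne_of_not_exceptional {k : Xi} {d : Triple} (h : ¬Exceptional k d)
    (hk : d.1.1.mode.2 = k) :
    d.1.2.1.mode.2 ≠ k ∧ d.1.2.2.mode.2 ≠ k ∧ d.1.2.1.mode ≠ d.1.2.2.mode := by
  have hc := Ladder.charge_of_mode_eq hk
  refine ⟨fun h2 => h (exceptional_of_charge hc (Ladder.charge_of_mode_eq h2)), fun h2 => h ?_,
    fun h2 => h ?_⟩
  · exact Exceptional.rot (Exceptional.rot
      (exceptional_of_charge (d := d.rot.rot) (Ladder.charge_of_mode_eq h2) hc))
  · have h3 := d.eq_of_mode_eq.2.1 h2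
    have h0 := d.2
    rw [← h3] at h0
    have h4 : 2 • d.1.2.1.1.1 = -d.1.1.1.1 := by
      rw [two_nsmul]; exact (neg_eq_of_add_eq_zero_right (by rw [← add_assoc]; exact h0)).symm
    unfold Exceptional parallel
    rw [← h3, h4]
    simp only [Finset.mem_insert, Finset.mem_singleton]
    rcases hc with hc | hc <;> rw [hc]
    · refine ⟨?_, ?_, ?_⟩ <;> tauto
    · rw [neg_neg]
      refine ⟨?_, ?_, ?_⟩
      · right; right; right; left; module
      · tauto
      · tauto

open Classical in
/-- How a triple contributes to the difference of the Golden Rule terms of the quasiparticle state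
and of the vacuum, compared with the number of its members which feel the quasiparticle. -/
def defect (k : Xi) (d : Triple) : ℝ :=
  d.mult / 36 * (d.weight (pairConfig k) ^ 2 - d.weight 0 ^ 2)
    - 1 / 6 * ((if d.Hit k then 1 else 0) + (if d.rot.Hit k then 1 else 0)
      + (if d.rot.rot.Hit k then 1 else 0))

theorem defect_rot (k : Xi) (d : Triple) : d.rot.defect k = d.defect k := by
  unfold defect
  rw [mult_rot, weight_rot, weight_rot, rot_rot_rot]
  ring

theorem defect_eq_zero_of_mode_eq {k : Xi} {d : Triple} (h : ¬Exceptional k d)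
    (hk : d.1.1.mode.2 = k) : d.defect k = 0 := by
  classical
  obtain ⟨h2, h3, h23⟩ := ne_of_not_exceptional h hk
  have h12 : d.1.1.mode ≠ d.1.2.1.mode := fun e => h2 (by rw [← e, hk])
  have h31 : d.1.2.2.mode ≠ d.1.1.mode := fun e => h3 (by rw [e, hk])
  have hm : d.mult = 6 := mult_eq_six (fun e => h12 (by rw [e])) (fun e => h23 (by rw [e]))
    (fun e => h31 (by rw [e]))
  have n2 : ¬d.rot.Hit k := fun e => h2 e.1
  have n3 : ¬d.rot.rot.Hit k := fun e => h3 e.1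
  unfold defect
  rw [if_neg n2, if_neg n3, hm, weight_of_ne _ h12 h23 h31, weight_of_ne _ h12 h23 h31, mul_pow,
    mul_pow, mul_pow, mul_pow, Ladder.weight_sq_pairConfig, Ladder.weight_sq_pairConfig,
    Ladder.weight_sq_pairConfig, if_pos hk, if_neg h2, if_neg h3, Ladder.weight_sq_zero,
    Ladder.weight_sq_zero, Ladder.weight_sq_zero]
  unfold Hit
  by_cases c2 : d.1.2.1.isCreate = true <;> by_cases c3 : d.1.2.2.isCreate = true <;>
    simp [hk, c2, c3]
  norm_num

theorem defect_eq_zero {k : Xi} {d : Triple} (h : ¬Exceptional k d) : d.defect k = 0 := by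
  classical
  by_cases h1 : d.1.1.mode.2 = k
  · exact defect_eq_zero_of_mode_eq h h1
  by_cases h2 : d.1.2.1.mode.2 = k
  · rw [← defect_rot]
    exact defect_eq_zero_of_mode_eq (fun e => h e.rot) h2
  by_cases h3 : d.1.2.2.mode.2 = k
  · rw [← defect_rot, ← defect_rot]
    exact defect_eq_zero_of_mode_eq (fun e => h e.rot.rot) h3
  have hw : d.weight (pairConfig k) = d.weight 0 := by
    refine weight_congr ?_ ?_ ?_ <;> rw [pairConfig_apply, if_neg (by assumption)] <;> rfl
  have n1 : ¬d.Hit k := fun e => h1 e.1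
  have n2 : ¬d.rot.Hit k := fun e => h2 e.1
  have n3 : ¬d.rot.rot.Hit k := fun e => h3 e.1
  unfold defect
  rw [hw, if_neg n1, if_neg n2, if_neg n3]
  ring

theorem abs_defect_le (k : Xi) (d : Triple) : |d.defect k| ≤ 12 := by
  classical
  have h1 : d.weight (pairConfig k) ^ 2 ≤ (1 + 3) ^ 3 := by
    refine weight_sq_le fun m => ?_
    rw [pairConfig_apply]
    split_ifs <;> simp
  have h2 : d.weight 0 ^ 2 ≤ (1 + 3) ^ 3 := weight_sq_le fun m => by simp
  have h3 : (d.mult : ℝ) ≤ 6 := by exact_mod_cast d.mult_le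
  have h4 : (0 : ℝ) ≤ d.mult := Nat.cast_nonneg _
  have h5 : |d.mult / 36 * (d.weight (pairConfig k) ^ 2 - d.weight 0 ^ 2)| ≤ 11 := by
    rw [abs_mul, abs_of_nonneg (by positivity)]
    have : |d.weight (pairConfig k) ^ 2 - d.weight 0 ^ 2| ≤ 64 :=
      abs_le.2 ⟨by linarith [sq_nonneg (d.weight (pairConfig k))],
        by linarith [sq_nonneg (d.weight 0)]⟩
    calc (d.mult : ℝ) / 36 * _ ≤ 6 / 36 * 64 := by gcongr
      _ ≤ 11 := by norm_num
  unfold defect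
  rw [abs_le] at h5 ⊢
  have ind : ∀ p : Prop, (0 : ℝ) ≤ (if p then 1 else 0) ∧ (if p then (1 : ℝ) else 0) ≤ 1 := by
    intro p; split_ifs <;> simp
  constructor <;>
  linarith [(ind (d.Hit k)).1, (ind (d.Hit k)).2, (ind (d.rot.Hit k)).1, (ind (d.rot.Hit k)).2,
    (ind (d.rot.rot.Hit k)).1, (ind (d.rot.rot.Hit k)).2, h5.1, h5.2]

open Classical in
theorem summable_hit (hv : IsAdmissible v V) (hν : ν ∈ Ioc 0 V) (hβ : 0 < β) (hL : 0 < L)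
    {ε : ℝ} (hε : 0 < ε) (k : Xi) :
    Summable fun d : Triple => if d.Hit k then lorentzTerm v ν β L ε d else 0 := by
  refine Summable.of_nonneg_of_le (fun d => ?_) (fun d => ?_)
    ((summable_tame hv hν hβ hL ‖mom L k.1‖).mul_left (1 + 1 / ε))
  · split_ifs
    · exact lorentzTerm_nonneg hε _
    · exact le_rfl
  · by_cases h : d.Hit k
    · have ht : d.Tame L ‖mom L k.1‖ := by
        refine ⟨Or.inr ?_, Or.inl (eq_of_beq h.2.1), Or.inl (eq_of_beq h.2.2)⟩
        rw [← Ladder.norm_mom_mode, h.1]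
      rw [if_pos h, if_pos ht]
      unfold lorentzTerm
      calc _ ≤ d.amplitude v ν β L ^ 2 * ((1 + 1 / ε) / (1 + |d.gap v ν L|)) := by
            gcongr; exact lorentz_le hε _
        _ = _ := by ring
    · rw [if_neg h]
      split_ifs <;> positivity

end Triple

open Classical in
/-- The finite volume shift: a sum over the triples which feel the quasiparticle with their first
member, and a correction by exceptional triples. -/
theorem shiftBracket_eq_tsum (hv : IsAdmissible v V) (hν : ν ∈ Ioc 0 V) (hβ : 0 < β) (hL : 0 < L)
    {ε : ℝ} (hε : 0 < ε) (k : Xi) :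
    shiftBracket v ν β ε L k = -Complex.I *
      (((1 / 2 * ∑' d : Triple, if d.Hit k then lorentzTerm v ν β L ε d else 0)
        + ∑' d : Triple, d.defect k * lorentzTerm v ν β L ε d : ℝ) : ℂ) := by
  have h1 := goldenRule_eq hv hν hβ hL hε (energy_pairConfig k) (swapConfig_pairConfig k)
  have h0 := goldenRule_eq hv hν hβ hL hε (energy_zero (v := v) (ν := ν) (L := L)) swapConfig_zero
  have hH := Triple.summable_hit hv hν hβ hL hε k
  have e1 : ∑' d : Triple, (if d.rot.Hit k then lorentzTerm v ν β L ε d else 0)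
      = ∑' d : Triple, if d.Hit k then lorentzTerm v ν β L ε d else 0 := by
    rw [← Triple.rotEquiv.tsum_eq fun d : Triple =>
      if d.Hit k then lorentzTerm v ν β L ε d else 0]
    exact tsum_congr fun d => by rw [← lorentzTerm_rot]; rfl
  have s1 : Summable fun d : Triple => if d.rot.Hit k then lorentzTerm v ν β L ε d else 0 := by
    refine (Triple.rotEquiv.summable_iff.2 hH).congr fun d => ?_
    rw [← lorentzTerm_rot]; rfl
  have e2 : ∑' d : Triple, (if d.rot.rot.Hit k then lorentzTerm v ν β L ε d else 0)
      = ∑' d : Triple, if d.Hit k then lorentzTerm v ν β L ε d else 0 := by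
    rw [← e1, ← Triple.rotEquiv.tsum_eq fun d : Triple =>
      if d.rot.Hit k then lorentzTerm v ν β L ε d else 0]
    exact tsum_congr fun d => by rw [← lorentzTerm_rot]; rfl
  have s2 : Summable fun d : Triple => if d.rot.rot.Hit k then lorentzTerm v ν β L ε d else 0 := by
    refine (Triple.rotEquiv.summable_iff.2 s1).congr fun d => ?_
    rw [← lorentzTerm_rot]; rfl
  have hsum := h1.sub h0
  simp only [← Complex.ofReal_sub] at hsum
  have hsr : Summable fun d : Triple => d.mult / 36 * d.weight (pairConfig k) ^ 2
      * lorentzTerm v ν β L ε d - d.mult / 36 * d.weight 0 ^ 2 * lorentzTerm v ν β L ε d :=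
    Complex.summable_ofReal.1 hsum.summable
  have e3 := hsum.tsum_eq
  rw [← Complex.ofReal_tsum] at e3
  have hdef : ∀ d : Triple, d.defect k * lorentzTerm v ν β L ε d
      = (d.mult / 36 * d.weight (pairConfig k) ^ 2
      * lorentzTerm v ν β L ε d - d.mult / 36 * d.weight 0 ^ 2 * lorentzTerm v ν β L ε d)
      - 1 / 6 * ((if d.Hit k then lorentzTerm v ν β L ε d else 0)
        + (if d.rot.Hit k then lorentzTerm v ν β L ε d else 0)
        + (if d.rot.rot.Hit k then lorentzTerm v ν β L ε d else 0)) := by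
    intro d
    unfold Triple.defect
    split_ifs <;> ring
  have e4 : ∑' d : Triple, d.defect k * lorentzTerm v ν β L ε d
      = (∑' d : Triple, (d.mult / 36 * d.weight (pairConfig k) ^ 2
      * lorentzTerm v ν β L ε d - d.mult / 36 * d.weight 0 ^ 2 * lorentzTerm v ν β L ε d))
      - 1 / 2 * ∑' d : Triple, if d.Hit k then lorentzTerm v ν β L ε d else 0 := by
    simp_rw [hdef]
    rw [hsr.tsum_sub (((hH.add s1).add s2).mul_left _), tsum_mul_left,
      (hH.add s1).tsum_add s2, hH.tsum_add s1, e1, e2]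
    ring
  rw [e4, add_sub_cancel, e3, shiftBracket_eq]
  linear_combination (-(goldenRule v ν β L ε (basisVec (pairConfig k))
    - goldenRule v ν β L ε (basisVec 0))) * Complex.I_sq

/-! ### Exceptional triples are negligible in the thermodynamic limit -/

theorem exists_rate_le (hv : IsAdmissible v V) (hν : ν ∈ Ioc 0 V) (hβ : 0 < β) {a : ℝ}
    (ha : 0 < a) : ∃ C : ℝ, 0 < C ∧ ∀ x y z, a ≤ x → a ≤ y → a ≤ z → ∀ t₁ s₁ t₂ s₂ t₃ s₃,
      rate v ν β t₁ s₁ t₂ s₂ t₃ s₃ x y z ≤ C := by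
  obtain ⟨A, hA, h1⟩ := exists_amp_sq_le hv hν ha
  obtain ⟨B, hB, h2, -⟩ := exists_therm_sq_le hv hν hβ
  have h0 := hv.vhat_zero_pos
  have hν0 := hν.1
  refine ⟨ν / vhat v 0 * (A * ((1 + 1 / a) * (1 + 1 / a)) * (4 * (B * (1 + 1 / a)) ^ 3)),
    by positivity, fun x y z hx hy hz t₁ s₁ t₂ s₂ t₃ s₃ => ?_⟩
  have hx0 := ha.trans_le hx
  have hy0 := ha.trans_le hy
  have hz0 := ha.trans_le hz
  have hinv : ∀ t, a ≤ t → 1 / t ≤ 1 / a := fun t ht => one_div_le_one_div_of_le ha ht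
  have e1 : amp v ν t₁ t₂ t₃ x y z ^ 2 ≤ A * ((1 + 1 / a) * (1 + 1 / a)) := by
    refine (h1 x y z hx hy0 hz0 _ _ _).trans ?_
    have := hinv y hy
    have := hinv z hz
    gcongr
  have e2 : ∀ t, a ≤ t → ∀ s, therm v ν β s t ^ 2 ≤ B * (1 + 1 / a) := by
    intro t ht s
    refine (h2 t (ha.trans_le ht) s).trans ?_
    have := hinv t ht
    gcongr
  have e3 : ∀ s₁ s₂ s₃, therm v ν β s₁ x ^ 2 * therm v ν β s₂ y ^ 2 * therm v ν β s₃ z ^ 2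
      ≤ (B * (1 + 1 / a)) ^ 3 := by
    intro s₁ s₂ s₃
    calc _ ≤ (B * (1 + 1 / a)) * (B * (1 + 1 / a)) * (B * (1 + 1 / a)) := by
          gcongr
          · exact e2 x hx _
          · exact e2 y hy _
          · exact e2 z hz _
      _ = _ := by ring
  have e4 : mixing v ν β s₁ s₂ s₃ x y z ^ 2 ≤ 4 * (B * (1 + 1 / a)) ^ 3 := by
    refine (mixing_sq_le _ _ _ _ _ _).trans ((mixingSum_sq_le _ _ _ _ _ _).trans ?_)
    linarith [e3 s₁ s₂ s₃, e3 (!s₁) (!s₂) (!s₃)]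
  unfold rate
  gcongr

theorem mom_nsmul (L : ℝ) (n : ℕ) (m : Fin 3 → ℤ) : mom L (n • m) = (n : ℝ) • mom L m := by
  ext i
  simp [mom]
  ring

theorem mom_neg (L : ℝ) (m : Fin 3 → ℤ) : mom L (-m) = -mom L m := by
  ext i
  simp [mom]

theorem mom_sub (L : ℝ) (m m' : Fin 3 → ℤ) : mom L (m - m') = mom L m - mom L m' := by
  ext i
  simp [mom]
  ring

theorem norm_mom_nsmul (L : ℝ) (n : ℕ) (m : Fin 3 → ℤ) : ‖mom L (n • m)‖ = n * ‖mom L m‖ := by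
  rw [mom_nsmul, norm_smul, Real.norm_of_nonneg (Nat.cast_nonneg n)]

theorem norm_mom_of_parallel {k q : Xi} (h : 2 • q.1 ∈ Triple.parallel k) (L : ℝ) :
    ‖mom L k.1‖ / 2 ≤ ‖mom L q.1‖ := by
  have h2 := norm_mom_nsmul L 2 q.1
  have h0 := norm_nonneg (mom L k.1)
  unfold Triple.parallel at h
  simp only [Finset.mem_insert, Finset.mem_singleton] at h
  rcases h with h | h | h | h | h | h <;> rw [h] at h2 <;>
    (try rw [mom_neg, norm_neg] at h2) <;> (try rw [norm_mom_nsmul] at h2) <;>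
    push_cast at h2 <;> linarith

/-- There are at most `24 ^ 3` exceptional triples. -/
theorem exists_exceptional_finset (k : Xi) :
    ∃ S : Finset Triple, S.card ≤ 24 ^ 3 ∧ ∀ d, d ∈ S ↔ d.Exceptional k := by
  classical
  have hinj : Function.Injective fun q : Xi => 2 • q.1 := by
    intro q q' h
    refine Subtype.ext (funext fun i => ?_)
    have := congrFun h i
    simp only [Pi.smul_apply, nsmul_eq_mul, Nat.cast_ofNat] at this
    omega
  set T : Finset Xi := (Triple.parallel k).preimage (fun q : Xi => 2 • q.1) hinj.injOn with hT
  have hTcard : T.card ≤ 6 := by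
    have hP : (Triple.parallel k).card ≤ 6 := Finset.card_le_six
    refine (Finset.card_le_card_of_injOn (fun q : Xi => 2 • q.1) (fun q hq => ?_)
      hinj.injOn).trans hP
    have hq' : q ∈ T := hq
    rw [hT, Finset.mem_preimage] at hq'
    exact hq'
  set F : Finset Ladder := T ×ˢ Finset.univ with hF
  have hFcard : F.card ≤ 24 := by
    rw [hF, Finset.card_product, show (Finset.univ : Finset (Bool × Bool)).card = 4 from rfl]
    omega
  refine ⟨(F ×ˢ F ×ˢ F).subtype _, ?_, fun d => ?_⟩
  · refine (Finset.card_subtype _ _).le.trans ((Finset.card_filter_le _ _).trans ?_)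
    rw [Finset.card_product F (F ×ˢ F), Finset.card_product F F]
    calc F.card * (F.card * F.card) ≤ 24 * (24 * 24) := by gcongr
      _ = _ := by norm_num
  · simp only [Finset.mem_subtype, Finset.mem_product, hF, hT, Finset.mem_preimage,
      Finset.mem_univ, and_true, Triple.Exceptional]

theorem eventually_thermodynamicLimit {k : E} (hk : k ≠ 0) :
    ∀ᶠ x : ℝ × Xi in thermodynamicLimit k, 0 < x.1 ∧
      ‖k‖ / 2 ≤ ‖mom x.1 x.2.1‖ ∧ ‖mom x.1 x.2.1‖ ≤ 2 * ‖k‖ := by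
  have hk0 : 0 < ‖k‖ := norm_pos_iff.2 hk
  have h1 : Tendsto (fun x : ℝ × Xi => x.1) (thermodynamicLimit k) atTop :=
    tendsto_comap.mono_left inf_le_left
  have h2 : Tendsto (fun x : ℝ × Xi => ‖mom x.1 x.2.1‖) (thermodynamicLimit k) (𝓝 ‖k‖) :=
    (tendsto_comap.mono_left inf_le_right).norm
  filter_upwards [h1.eventually_gt_atTop 0, h2.eventually_const_le (by linarith : ‖k‖ / 2 < ‖k‖),
    h2.eventually_le_const (by linarith : ‖k‖ < 2 * ‖k‖)] with x a b c
  exact ⟨a, b, c⟩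

/-- Only boundedly many triples contribute, and the amplitude of each carries a factor `L ^ (-3)`.
-/
theorem tendsto_tsum_defect (hv : IsAdmissible v V) (hν : ν ∈ Ioc 0 V) (hβ : 0 < β) {ε : ℝ}
    (hε : 0 < ε) {k : E} (hk : k ≠ 0) :
    Tendsto (fun x : ℝ × Xi => ∑' d : Triple, d.defect x.2 * lorentzTerm v ν β x.1 ε d)
      (thermodynamicLimit k) (𝓝 0) := by
  have hk0 : 0 < ‖k‖ := norm_pos_iff.2 hk
  obtain ⟨C, hC, hrate⟩ := exists_rate_le hv hν hβ (show 0 < ‖k‖ / 4 by positivity)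
  have h1 : Tendsto (fun x : ℝ × Xi => x.1) (thermodynamicLimit k) atTop :=
    tendsto_comap.mono_left inf_le_left
  have h2 : Tendsto (fun x : ℝ × Xi => (24 ^ 3 : ℝ) * (12 * (C * (1 / ε))) * (x.1 ^ 3)⁻¹)
      (thermodynamicLimit k) (𝓝 0) := by
    have h3 : Tendsto (fun L : ℝ => (L ^ 3)⁻¹) atTop (𝓝 0) :=
      tendsto_inv_atTop_zero.comp (tendsto_pow_atTop (by norm_num))
    simpa using (h3.comp h1).const_mul ((24 ^ 3 : ℝ) * (12 * (C * (1 / ε))))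
  refine squeeze_zero_norm' ?_ h2
  filter_upwards [eventually_thermodynamicLimit hk] with x hx
  obtain ⟨L, κ⟩ := x
  obtain ⟨hL, hlow, -⟩ := hx
  simp only at hL hlow ⊢
  obtain ⟨S, hS, hmem⟩ := exists_exceptional_finset κ
  rw [tsum_eq_sum (s := S) fun d hd => by
    rw [Triple.defect_eq_zero (fun h => hd ((hmem d).2 h)), zero_mul]]
  have hterm : ∀ d ∈ S, ‖d.defect κ * lorentzTerm v ν β L ε d‖
      ≤ 12 * ((L ^ 3)⁻¹ * C * (1 / ε)) := by
    intro d hd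
    obtain ⟨p1, p2, p3⟩ := (hmem d).1 hd
    have hle : ∀ q : Xi, 2 • q.1 ∈ Triple.parallel κ → ‖k‖ / 4 ≤ ‖mom L q.1‖ := by
      intro q hq
      have := norm_mom_of_parallel hq L
      linarith
    rw [norm_mul, Real.norm_eq_abs, Real.norm_of_nonneg (lorentzTerm_nonneg hε _)]
    unfold lorentzTerm
    rw [Triple.amplitude_sq hv hν hL]
    have hr := hrate _ _ _ (hle _ p1) (hle _ p2) (hle _ p3) d.1.1.2.1 d.1.1.2.2 d.1.2.1.2.1
      d.1.2.1.2.2 d.1.2.2.2.1 d.1.2.2.2.2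
    have hr0 := rate_nonneg hv hν (β := β) d.1.1.2.1 d.1.1.2.2 d.1.2.1.2.1 d.1.2.1.2.2
      d.1.2.2.2.1 d.1.2.2.2.2 ‖mom L d.1.1.1.1‖ ‖mom L d.1.2.1.1.1‖ ‖mom L d.1.2.2.1.1‖
    have hl := lorentz_le_inv hε (d.gap v ν L)
    have hl0 := lorentz_nonneg hε (d.gap v ν L)
    have hd := d.abs_defect_le κ
    gcongr
  refine (norm_sum_le_of_le S hterm).trans ?_
  rw [Finset.sum_const, nsmul_eq_mul]
  have hS' : (S.card : ℝ) ≤ 24 ^ 3 := by exact_mod_cast hS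
  calc (S.card : ℝ) * (12 * ((L ^ 3)⁻¹ * C * (1 / ε)))
      ≤ 24 ^ 3 * (12 * ((L ^ 3)⁻¹ * C * (1 / ε))) := by gcongr
    _ = _ := by ring

/-! ### The remaining sum as a sum over lattice momenta -/

/-- The integrand of the regularized damping rates. -/
def channel (v : E → ℝ) (ν β ε : ℝ) (t₁ s₁ t₂ t₃ : Bool) (x y z : ℝ) : ℝ :=
  rate v ν β t₁ s₁ t₂ t₂ t₃ t₃ x y z * lorentz ε (gap v ν t₁ t₂ t₃ x y z)

/-- A charge or its opposite. -/
def Xi.signed (t : Bool) (q : Xi) : Xi := if t then q else q.opp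

theorem Xi.signed_signed (t : Bool) (q : Xi) : Xi.signed t (Xi.signed t q) = q := by
  cases t
  · exact Xi.opp_opp q
  · rfl

theorem norm_mom_signed (L : ℝ) (t : Bool) (q : Xi) : ‖mom L (Xi.signed t q).1‖ = ‖mom L q.1‖ := by
  cases t
  · exact norm_mom_opp L q
  · rfl

theorem Xi.signed_val (t : Bool) (q : Xi) : (Xi.signed t q).1 = if t then q.1 else -q.1 := by
  cases t <;> rfl

/-- Lattice momenta at which neither of two quasiparticles with total momentum `k` has momentum
zero. -/
abbrev Splitting (k : Xi) : Type := {m : Fin 3 → ℤ // m ≠ 0 ∧ m ≠ k.1}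

/-- The triples in which the first member feels the quasiparticle and the others create. -/
def hitTriple (k : Xi) (b : (Bool × Bool × Bool × Bool) × Splitting k) : Triple :=
  ⟨((Xi.signed b.1.1 k, b.1.1, b.1.2.1),
    (Xi.signed (!b.1.1) ⟨b.2.1, b.2.2.1⟩, b.1.2.2.1, b.1.2.2.1),
    (Xi.signed b.1.1 ⟨b.2.1 - k.1, sub_ne_zero.2 b.2.2.2⟩, b.1.2.2.2, b.1.2.2.2)), by
    obtain ⟨⟨t, -⟩, m, -⟩ := b
    cases t
    · change -k.1 + m + -(m - k.1) = 0; abel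
    · change k.1 + -m + (m - k.1) = 0; abel⟩

theorem hitTriple_injective (k : Xi) : Function.Injective (hitTriple k) := by
  rintro ⟨⟨t₁, s₁, t₂, t₃⟩, m⟩ ⟨⟨t₁', s₁', t₂', t₃'⟩, m'⟩ h
  have h1 := congrArg (fun d : Triple => d.1.1.2) h
  have h2 := congrArg (fun d : Triple => d.1.2.1.2.1) h
  have h3 := congrArg (fun d : Triple => d.1.2.2.2.1) h
  have h4 := congrArg (fun d : Triple => d.1.2.1.1) h
  simp only [hitTriple, Prod.mk.injEq] at h1 h2 h3 h4
  obtain ⟨rfl, rfl⟩ := h1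
  subst h2
  subst h3
  have h5 := congrArg (Xi.signed (!t₁)) h4
  rw [Xi.signed_signed, Xi.signed_signed] at h5
  have h6 : m = m' := Subtype.ext (Subtype.mk.inj h5)
  rw [h6]

theorem hitTriple_hit (k : Xi) (b : (Bool × Bool × Bool × Bool) × Splitting k) :
    (hitTriple k b).Hit k := by
  obtain ⟨⟨t, s, t₂, t₃⟩, m⟩ := b
  refine ⟨?_, ?_, ?_⟩
  · cases t
    · exact Xi.opp_opp k
    · rfl
  · cases t₂ <;> rfl
  · cases t₃ <;> rfl

theorem exists_hitTriple_eq {k : Xi} {d : Triple} (h : d.Hit k) : ∃ b, hitTriple k b = d := by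
  obtain ⟨h1, h2, h3⟩ := h
  obtain ⟨⟨⟨q₁, t₁, s₁⟩, ⟨q₂, t₂, s₂⟩, ⟨q₃, t₃, s₃⟩⟩, hd⟩ := d
  simp only [Ladder.isCreate, beq_iff_eq] at h1 h2 h3 hd
  subst h2
  subst h3
  have hq : Xi.signed t₁ q₁ = k := by
    cases t₁ <;> exact h1
  subst hq
  set m := (Xi.signed (!t₁) q₂).1 with hm
  have hm0 : m ≠ 0 := (Xi.signed (!t₁) q₂).2
  have hmk : m - (Xi.signed t₁ q₁).1 = (Xi.signed t₁ q₃).1 := by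
    have e : q₃.1 = -(q₁.1 + q₂.1) := (neg_eq_of_add_eq_zero_right hd).symm
    rw [hm, Xi.signed_val, Xi.signed_val, Xi.signed_val, e]
    cases t₁
    · simp
      abel
    · simp
      abel
  have hmk0 : m ≠ (Xi.signed t₁ q₁).1 := fun e => (Xi.signed t₁ q₃).2 (by rw [← hmk, e, sub_self])
  refine ⟨((t₁, s₁, t₂, t₃), ⟨m, hm0, hmk0⟩), Subtype.ext ?_⟩
  have e2 : Xi.signed (!t₁) ⟨m, hm0⟩ = q₂ := Xi.signed_signed _ _
  have e3 : Xi.signed t₁ ⟨m - (Xi.signed t₁ q₁).1, sub_ne_zero.2 hmk0⟩ = q₃ := by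
    have : (⟨m - (Xi.signed t₁ q₁).1, sub_ne_zero.2 hmk0⟩ : Xi) = Xi.signed t₁ q₃ :=
      Subtype.ext hmk
    rw [this, Xi.signed_signed]
  unfold hitTriple
  simp only
  rw [e2, e3, Xi.signed_signed]

theorem lorentzTerm_hitTriple (hv : IsAdmissible v V) (hν : ν ∈ Ioc 0 V) (hL : 0 < L) (ε : ℝ)
    (k : Xi) (b : (Bool × Bool × Bool × Bool) × Splitting k) :
    lorentzTerm v ν β L ε (hitTriple k b) = (L ^ 3)⁻¹ * channel v ν β ε b.1.1 b.1.2.1 b.1.2.2.1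
      b.1.2.2.2 ‖mom L k.1‖ ‖mom L b.2.1‖ ‖mom L b.2.1 - mom L k.1‖ := by
  unfold lorentzTerm channel
  rw [Triple.amplitude_sq hv hν hL]
  unfold Triple.gap hitTriple
  simp only [norm_mom_signed, mom_sub]
  ring

open Classical in
theorem tsum_hit_eq (hv : IsAdmissible v V) (hν : ν ∈ Ioc 0 V) (hβ : 0 < β) (hL : 0 < L)
    {ε : ℝ} (hε : 0 < ε) (k : Xi) :
    ∑' d : Triple, (if d.Hit k then lorentzTerm v ν β L ε d else 0)
      = ∑ b : Bool × Bool × Bool × Bool, ∑' m : Splitting k,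
        (L ^ 3)⁻¹ * channel v ν β ε b.1 b.2.1 b.2.2.1 b.2.2.2
          ‖mom L k.1‖ ‖mom L m.1‖ ‖mom L m.1 - mom L k.1‖ := by
  have hs := Triple.summable_hit hv hν hβ hL hε k
  have hs' := hs.comp_injective (hitTriple_injective k)
  have hprod := hs'.tsum_prod
  simp only [Function.comp_apply] at hprod
  rw [← (hitTriple_injective k).tsum_eq]
  · rw [← tsum_fintype (L := SummationFilter.unconditional _), hprod]
    refine tsum_congr fun b => tsum_congr fun m => ?_
    rw [if_pos (hitTriple_hit k _), lorentzTerm_hitTriple hv hν hL]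
  · intro d hd
    by_cases h : d.Hit k
    · exact exists_hitTriple_eq h
    · exact absurd (if_neg h) hd

/-! ### Sums over the lattice as integrals of step functions -/

/-- The lattice label of the cell of side `l` that contains the point `p`. -/
def cellIndex (l : ℝ) (p : E) : Fin 3 → ℤ := fun i => ⌊p i / l⌋

theorem measurable_cellIndex (l : ℝ) : Measurable (cellIndex l) := by
  refine measurable_pi_iff.2 fun i => Int.measurable_floor.comp ?_
  fun_prop

theorem measurable_comp_cellIndex (l : ℝ) (F : (Fin 3 → ℤ) → ℝ) :
    Measurable fun p => F (cellIndex l p) :=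
  (measurable_of_countable F).comp (measurable_cellIndex l)

theorem volume_cell {l : ℝ} (hl : 0 < l) (m : Fin 3 → ℤ) :
    volume {p : E | cellIndex l p = m} = ENNReal.ofReal (l ^ 3) := by
  have h1 : {p : E | cellIndex l p = m} = (fun p : E => p.ofLp) ⁻¹'
      (Set.pi univ fun i => Ico (l * m i) (l * (m i + 1))) := by
    ext p
    simp only [mem_ofPred_eq, mem_preimage, Set.mem_pi, mem_univ, forall_true_left, mem_Ico]
    rw [funext_iff]
    refine forall_congr' fun i => ?_
    unfold cellIndex
    rw [Int.floor_eq_iff, le_div_iff₀ hl, div_lt_iff₀ hl, mul_comm l, mul_comm l]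
  rw [h1, (PiLp.volume_preserving_ofLp (Fin 3)).measure_preimage
    (MeasurableSet.univ_pi fun i => measurableSet_Ico).nullMeasurableSet, volume_pi_pi]
  simp only [Real.volume_Ico]
  have : ∀ i, l * ((m i : ℝ) + 1) - l * m i = l := fun i => by ring
  simp only [this, Finset.prod_const, Finset.card_univ, Fintype.card_fin]
  rw [ENNReal.ofReal_pow hl.le]

theorem hasSum_integral_comp_cellIndex {l : ℝ} (hl : 0 < l) {F : (Fin 3 → ℤ) → ℝ}
    (h : Integrable fun p => F (cellIndex l p)) :
    HasSum (fun m => l ^ 3 * F m) (∫ p, F (cellIndex l p)) := by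
  have hu : ⋃ m, {p : E | cellIndex l p = m} = univ := by
    ext p; simp
  have hm : ∀ m, MeasurableSet {p : E | cellIndex l p = m} :=
    fun m => measurable_cellIndex l (measurableSet_singleton m)
  have h1 := hasSum_integral_iUnion (f := fun p => F (cellIndex l p)) (μ := volume) hm
    (fun m m' hne => Set.disjoint_left.2 fun p hp hp' => hne (hp.symm.trans hp'))
    h.integrableOn
  rw [hu, setIntegral_univ] at h1
  refine h1.congr_fun fun m => ?_
  rw [setIntegral_congr_fun (hm m) (g := fun _ => F m) (fun p hp => by
    simp only [mem_ofPred_eq] at hp; simp only [hp]), setIntegral_const, measureReal_def,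
    volume_cell hl, ENNReal.toReal_ofReal (by positivity), smul_eq_mul]

theorem norm_sub_mom_cellIndex_le (hL : 0 < L) (p : E) :
    ‖p - mom L (cellIndex (2 * Real.pi / L) p)‖ ≤ 2 * (2 * Real.pi / L) := by
  have hl : 0 < 2 * Real.pi / L := by have := Real.pi_pos; positivity
  set l := 2 * Real.pi / L with hl'
  refine abs_le_of_sq_le_sq' ?_ (by positivity) |>.2
  rw [EuclideanSpace.norm_sq_eq]
  have h : ∀ i, ‖(p - mom L (cellIndex l p)) i‖ ^ 2 ≤ l ^ 2 := by
    intro i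
    have e : (p - mom L (cellIndex l p)) i = l * (p i / l - ⌊p i / l⌋) := by
      simp only [mom, cellIndex, PiLp.sub_apply]
      rw [mul_sub, mul_div_cancel₀ _ hl.ne']
    rw [e, Real.norm_eq_abs, sq_abs, mul_pow]
    have h1 := Int.fract_nonneg (p i / l)
    have h2 := (Int.fract_lt_one (p i / l)).le
    unfold Int.fract at h1 h2
    exact mul_le_of_le_one_right (sq_nonneg _) (pow_le_one₀ h1 h2)
  calc _ ≤ ∑ _i : Fin 3, l ^ 2 := Finset.sum_le_sum fun i _ => h i
    _ = 3 * l ^ 2 := by simp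
    _ ≤ (2 * l) ^ 2 := by nlinarith [sq_nonneg l]

theorem integrable_envelope : Integrable fun p : E => 1 / (‖p‖ ^ 2 * (1 + ‖p‖ ^ 2)) := by
  rw [integrable_fun_norm_addHaar volume (f := fun t : ℝ => 1 / (t ^ 2 * (1 + t ^ 2)))]
  refine (integrable_inv_one_add_sq.integrableOn (s := Ioi (0 : ℝ))).congr_fun (fun t ht => ?_)
    measurableSet_Ioi
  have ht : 0 < t := ht
  simp
  field_simp

open Classical in
/-- Convergence of Riemann sums for integrands which are continuous away from vanishing momenta and
dominated by an integrable function of the first of the two momenta. -/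
theorem tendsto_lattice_sum {ψ : ℝ → ℝ → ℝ → ℝ}
    (hψ : ContinuousOn (fun u : ℝ × ℝ × ℝ => ψ u.1 u.2.1 u.2.2) (Ioi 0 ×ˢ Ioi 0 ×ˢ Ioi 0))
    {k : E} (hk : k ≠ 0) {C : ℝ} (hC : 0 ≤ C)
    (hbound : ∀ x y z, x ∈ Icc (‖k‖ / 2) (2 * ‖k‖) → 0 < y → 0 < z → |y - z| ≤ x → x ≤ y + z →
      |ψ x y z| ≤ C * (1 / (y ^ 2 * (1 + y ^ 2)))) :
    Tendsto (fun x : ℝ × Xi => ∑' m : Splitting x.2, (x.1 ^ 3)⁻¹ *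
      ψ ‖mom x.1 x.2.1‖ ‖mom x.1 m.1‖ ‖mom x.1 m.1 - mom x.1 x.2.1‖) (thermodynamicLimit k)
      (𝓝 (((2 * Real.pi) ^ 3)⁻¹ * ∫ p : E, ψ ‖k‖ ‖p‖ ‖p - k‖)) := by
  have hπ := Real.pi_pos
  have hk0 : 0 < ‖k‖ := norm_pos_iff.2 hk
  set F : ℝ × Xi → (Fin 3 → ℤ) → ℝ := fun x m => if m ≠ 0 ∧ m ≠ x.2.1 then
    ψ ‖mom x.1 x.2.1‖ ‖mom x.1 m‖ ‖mom x.1 m - mom x.1 x.2.1‖ else 0 with hF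
  have hpos : ∀ x : ℝ × Xi, 0 < x.1 → ∀ m : Fin 3 → ℤ, m ≠ 0 → 2 * Real.pi / x.1 ≤ ‖mom x.1 m‖ :=
    fun x hx m hm => le_norm_mom hx ⟨m, hm⟩
  have hne : ∀ᵐ p : E, p ≠ 0 ∧ p ≠ k :=
    (Measure.ae_ne volume 0).and (Measure.ae_ne volume k)
  have hdom : ∀ᶠ x in thermodynamicLimit k, ∀ᵐ p : E,
      ‖F x (cellIndex (2 * Real.pi / x.1) p)‖ ≤ C * 81 * (1 / (‖p‖ ^ 2 * (1 + ‖p‖ ^ 2))) := by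
    filter_upwards [eventually_thermodynamicLimit hk] with x hx
    filter_upwards [hne] with p hp
    obtain ⟨hL, hx1, hx2⟩ := hx
    set m := cellIndex (2 * Real.pi / x.1) p with hm
    have hp0 : 0 < ‖p‖ := norm_pos_iff.2 hp.1
    simp only [hF]
    split_ifs with h
    · have hl : 0 < 2 * Real.pi / x.1 := by positivity
      have h1 := hpos x hL m h.1
      have h2 : 0 < ‖mom x.1 m - mom x.1 x.2.1‖ := by
        rw [← mom_sub]
        exact hl.trans_le (hpos x hL _ (sub_ne_zero.2 h.2))
      have h3 := norm_sub_mom_cellIndex_le hL p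
      rw [← hm] at h3
      have hy : 0 < ‖mom x.1 m‖ := hl.trans_le h1
      have h4 : ‖p‖ ≤ 3 * ‖mom x.1 m‖ := by
        have := norm_le_norm_add_norm_sub' p (mom x.1 m)
        linarith
      have h5 := hbound ‖mom x.1 x.2.1‖ ‖mom x.1 m‖ ‖mom x.1 m - mom x.1 x.2.1‖ ⟨hx1, hx2⟩ hy h2
        (by
          refine (abs_norm_sub_norm_le _ _).trans (le_of_eq ?_)
          congr 1; abel)
        (by
          have := norm_sub_le (mom x.1 m) (mom x.1 m - mom x.1 x.2.1)
          rwa [sub_sub_cancel] at this)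
      refine h5.trans ?_
      rw [mul_assoc]
      refine mul_le_mul_of_nonneg_left ?_ hC
      rw [mul_one_div, div_le_div_iff₀ (by positivity) (by positivity)]
      set y := ‖mom x.1 m‖
      set r := ‖p‖
      have h6 : r ^ 2 ≤ 9 * y ^ 2 := by nlinarith
      calc 1 * (r ^ 2 * (1 + r ^ 2)) ≤ 1 * ((9 * y ^ 2) * (9 * (1 + y ^ 2))) := by
            gcongr
            linarith
        _ = _ := by ring
    · rw [norm_zero]; positivity
  have hmeas : ∀ x : ℝ × Xi, AEStronglyMeasurable
      (fun p : E => F x (cellIndex (2 * Real.pi / x.1) p)) volume :=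
    fun x => (measurable_comp_cellIndex _ _).aestronglyMeasurable
  have hgint : Integrable fun p : E => C * 81 * (1 / (‖p‖ ^ 2 * (1 + ‖p‖ ^ 2))) :=
    integrable_envelope.const_mul _
  have hL1 : Tendsto (fun x : ℝ × Xi => x.1) (thermodynamicLimit k) atTop :=
    tendsto_comap.mono_left inf_le_left
  have hk1 : Tendsto (fun x : ℝ × Xi => mom x.1 x.2.1) (thermodynamicLimit k) (𝓝 k) :=
    tendsto_comap.mono_left inf_le_right
  have hl0 : Tendsto (fun x : ℝ × Xi => 2 * (2 * Real.pi / x.1)) (thermodynamicLimit k) (𝓝 0) := by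
    have := (tendsto_const_nhds (x := 2 * Real.pi)).div_atTop hL1
    simpa using this.const_mul 2
  have hlim : ∀ᵐ p : E, Tendsto (fun x => F x (cellIndex (2 * Real.pi / x.1) p))
      (thermodynamicLimit k) (𝓝 (ψ ‖k‖ ‖p‖ ‖p - k‖)) := by
    filter_upwards [hne] with p hp
    have hm : Tendsto (fun x : ℝ × Xi => mom x.1 (cellIndex (2 * Real.pi / x.1) p))
        (thermodynamicLimit k) (𝓝 p) := by
      rw [tendsto_iff_norm_sub_tendsto_zero]
      refine squeeze_zero' (Eventually.of_forall fun x => norm_nonneg _) ?_ hl0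
      filter_upwards [hL1.eventually_gt_atTop 0] with x hx
      rw [norm_sub_rev]
      exact norm_sub_mom_cellIndex_le hx p
    have hmem : (‖k‖, ‖p‖, ‖p - k‖) ∈ (Ioi 0 ×ˢ Ioi 0 ×ˢ Ioi 0 : Set (ℝ × ℝ × ℝ)) :=
      ⟨hk0, norm_pos_iff.2 hp.1, norm_pos_iff.2 (sub_ne_zero.2 hp.2)⟩
    have hopen : IsOpen (Ioi 0 ×ˢ Ioi 0 ×ˢ Ioi 0 : Set (ℝ × ℝ × ℝ)) :=
      isOpen_Ioi.prod (isOpen_Ioi.prod isOpen_Ioi)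
    have hc := (hψ.continuousAt (hopen.mem_nhds hmem)).tendsto
    have hu := hk1.norm.prodMk_nhds (hm.norm.prodMk_nhds (hm.sub hk1).norm)
    refine (hc.comp hu).congr' ?_
    filter_upwards [hm.eventually_ne hp.1, (hm.sub hk1).eventually_ne (sub_ne_zero.2 hp.2)]
      with x h1 h2
    simp only [hF, Function.comp]
    rw [if_pos]
    refine ⟨fun h => h1 ?_, fun h => h2 ?_⟩
    · rw [h]; ext i; simp [mom]
    · rw [h, sub_self]
  have hcg : (thermodynamicLimit k).IsCountablyGenerated := by
    unfold thermodynamicLimit; infer_instance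
  have hconv := tendsto_integral_filter_of_dominated_convergence _
    (Eventually.of_forall hmeas) hdom hgint hlim
  refine (hconv.const_mul ((2 * Real.pi) ^ 3)⁻¹).congr' ?_
  filter_upwards [hdom, eventually_thermodynamicLimit hk] with x hx hx'
  have hL := hx'.1
  have hl : 0 < 2 * Real.pi / x.1 := by positivity
  have hint : Integrable fun p : E => F x (cellIndex (2 * Real.pi / x.1) p) :=
    hgint.mono' (hmeas x) hx
  have hs := hasSum_integral_comp_cellIndex hl hint
  have hs2 := (hs.mul_left ((2 * Real.pi) ^ 3)⁻¹).tsum_eq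
  rw [← hs2]
  have hsub := tsum_subtype {m : Fin 3 → ℤ | m ≠ 0 ∧ m ≠ x.2.1} fun m => (x.1 ^ 3)⁻¹ *
      ψ ‖mom x.1 x.2.1‖ ‖mom x.1 m‖ ‖mom x.1 m - mom x.1 x.2.1‖
  refine Eq.trans ?_ hsub.symm
  refine tsum_congr fun m => ?_
  simp only [hF, Set.indicator_apply, mem_ofPred_eq]
  split_ifs
  · field_simp
  · simp

/-- The sum over lattice momenta is unchanged if the two created quasiparticles are exchanged. -/
theorem tsum_splitting_swap (L : ℝ) (k : Xi) (ψ : ℝ → ℝ → ℝ) :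
    ∑' m : Splitting k, ψ ‖mom L m.1 - mom L k.1‖ ‖mom L m.1‖
      = ∑' m : Splitting k, ψ ‖mom L m.1‖ ‖mom L m.1 - mom L k.1‖ := by
  let e : Splitting k ≃ Splitting k :=
    { toFun := fun m => ⟨k.1 - m.1, sub_ne_zero.2 (Ne.symm m.2.2), fun h => m.2.1 (by simpa using h)⟩
      invFun := fun m => ⟨k.1 - m.1, sub_ne_zero.2 (Ne.symm m.2.2), fun h => m.2.1 (by simpa using h)⟩
      left_inv := fun m => Subtype.ext (sub_sub_cancel _ _)
      right_inv := fun m => Subtype.ext (sub_sub_cancel _ _) }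
  rw [← e.tsum_eq]
  refine tsum_congr fun m => ?_
  change ψ ‖mom L (k.1 - m.1) - mom L k.1‖ ‖mom L (k.1 - m.1)‖ = _
  rw [mom_sub, sub_sub_cancel_left, norm_neg, norm_sub_rev]

/-! ### The thermodynamic limit of the shift at fixed regularization -/

/-- An upper bound for the rates of a process which does not vanish on the energy shell. -/
def majorant (v : E → ℝ) (ν β : ℝ) (t₁ s₁ t₂ t₃ : Bool) (x y z : ℝ) : ℝ :=
  ν / vhat v 0 * (amp v ν t₁ t₂ t₃ x y z ^ 2 * mixingSum v ν β s₁ t₂ t₃ x y z ^ 2)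

theorem majorant_nonneg (hv : IsAdmissible v V) (hν : ν ∈ Ioc 0 V) (t₁ s₁ t₂ t₃ : Bool)
    (x y z : ℝ) : 0 ≤ majorant v ν β t₁ s₁ t₂ t₃ x y z := by
  have h0 := hv.vhat_zero_pos
  have hν0 := hν.1
  unfold majorant
  positivity

theorem rate_le_majorant (hv : IsAdmissible v V) (hν : ν ∈ Ioc 0 V) (t₁ s₁ t₂ t₃ : Bool)
    (x y z : ℝ) : rate v ν β t₁ s₁ t₂ t₂ t₃ t₃ x y z ≤ majorant v ν β t₁ s₁ t₂ t₃ x y z := by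
  have h0 := hv.vhat_zero_pos
  have hν0 := hν.1
  have := mixing_sq_le (v := v) (ν := ν) (β := β) s₁ t₂ t₃ x y z
  unfold rate majorant
  gcongr

theorem measurable_majorant (hv : IsAdmissible v V) (t₁ s₁ t₂ t₃ : Bool) (x : ℝ) :
    Measurable (fun u : ℝ × ℝ => majorant v ν β t₁ s₁ t₂ t₃ x u.1 u.2) := by
  have hd := measurable_disp (ν := ν) hv
  have hV := (continuous_vhatRadial hv).measurable
  have hθ : Measurable (theta v ν) := by unfold theta; fun_prop
  have ht : ∀ s, Measurable (therm v ν β s) := by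
    intro s; unfold therm; cases s <;> simp <;> fun_prop
  unfold majorant amp mixingSum
  fun_prop

theorem measurable_gap (hv : IsAdmissible v V) (t₁ t₂ t₃ : Bool) (x : ℝ) :
    Measurable (fun u : ℝ × ℝ => gap v ν t₁ t₂ t₃ x u.1 u.2) := by
  have hd := measurable_disp (ν := ν) hv
  unfold gap
  fun_prop

theorem measurable_norm_pair (k : E) : Measurable fun p : E => (‖p‖, ‖p - k‖) := by fun_prop

theorem integrable_majorant_div (hv : IsAdmissible v V) (hν : ν ∈ Ioc 0 V) (hβ : 0 < β) {k : E}
    (hk : k ≠ 0) (t₁ s₁ t₂ t₃ : Bool) :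
    Integrable fun p : E => majorant v ν β t₁ s₁ t₂ t₃ ‖k‖ ‖p‖ ‖p - k‖
      / (1 + gap v ν t₁ t₂ t₃ ‖k‖ ‖p‖ ‖p - k‖ ^ 2) := by
  have hk0 : 0 < ‖k‖ := norm_pos_iff.2 hk
  obtain ⟨C, hC, h⟩ := exists_envelope hv hν hβ ‖k‖ hk0
  have hdom : Integrable fun p : E => C * (1 / (‖p‖ ^ 2 * (1 + ‖p‖ ^ 2))
      + 1 / (‖p - k‖ ^ 2 * (1 + ‖p - k‖ ^ 2))) :=
    (integrable_envelope.add (integrable_envelope.comp_sub_right k)).const_mul C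
  have hm : Measurable fun p : E => majorant v ν β t₁ s₁ t₂ t₃ ‖k‖ ‖p‖ ‖p - k‖
      / (1 + gap v ν t₁ t₂ t₃ ‖k‖ ‖p‖ ‖p - k‖ ^ 2) :=
    ((measurable_majorant hv t₁ s₁ t₂ t₃ ‖k‖).comp (measurable_norm_pair k)).div
      (measurable_const.add (((measurable_gap hv t₁ t₂ t₃ ‖k‖).comp
        (measurable_norm_pair k)).pow_const 2))
  refine hdom.mono' hm.aestronglyMeasurable ?_
  filter_upwards [Measure.ae_ne volume (0 : E), Measure.ae_ne volume k] with p hp hpk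
  have hy : 0 < ‖p‖ := norm_pos_iff.2 hp
  have hz : 0 < ‖p - k‖ := norm_pos_iff.2 (sub_ne_zero.2 hpk)
  have hnn := majorant_nonneg (β := β) hv hν t₁ s₁ t₂ t₃ ‖k‖ ‖p‖ ‖p - k‖
  rw [Real.norm_of_nonneg (by positivity)]
  refine (h ‖k‖ ‖p‖ ‖p - k‖ ⟨le_rfl, le_rfl⟩ hy hz ?_ ?_ t₁ s₁ t₂ t₃).trans ?_
  · refine (abs_norm_sub_norm_le _ _).trans (le_of_eq ?_)
    congr 1; abel
  · have := norm_sub_le p (p - k)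
    rwa [sub_sub_cancel] at this
  · refine mul_le_mul_of_nonneg_left ?_ hC.le
    rw [add_div, div_div, div_div]
    have hy2 := sq_nonneg ‖p‖
    have hz2 := sq_nonneg ‖p - k‖
    exact add_le_add
      (one_div_le_one_div_of_le (by positivity)
        (mul_le_mul_of_nonneg_left (by linarith) hy2))
      (one_div_le_one_div_of_le (by positivity)
        (mul_le_mul_of_nonneg_left (by linarith) hz2))

theorem channel_swap (ε : ℝ) (t₁ s₁ t₂ t₃ : Bool) (x y z : ℝ) :
    channel v ν β ε t₁ s₁ t₃ t₂ x z y = channel v ν β ε t₁ s₁ t₂ t₃ x y z := by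
  unfold channel
  rw [rate_swap, gap_swap]

theorem channel_not (ε : ℝ) (t₁ s₁ t₂ t₃ : Bool) (x y z : ℝ) :
    channel v ν β ε (!t₁) (!s₁) (!t₂) (!t₃) x y z = channel v ν β ε t₁ s₁ t₂ t₃ x y z := by
  have : gap v ν (!t₁) (!t₂) (!t₃) x y z = -gap v ν t₁ t₂ t₃ x y z := by
    unfold gap; simp only [sgn_not]; ring
  unfold channel rate
  rw [amp_not, mixing_not, neg_sq, this, lorentz_neg]

theorem channel_nonneg (hv : IsAdmissible v V) (hν : ν ∈ Ioc 0 V) {ε : ℝ} (hε : 0 < ε)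
    (t₁ s₁ t₂ t₃ : Bool) (x y z : ℝ) : 0 ≤ channel v ν β ε t₁ s₁ t₂ t₃ x y z :=
  mul_nonneg (rate_nonneg hv hν _ _ _ _ _ _ _ _ _) (lorentz_nonneg hε _)

theorem lorentz_le_sq {ε : ℝ} (hε : 0 < ε) (x : ℝ) : lorentz ε x ≤ (ε + 1 / ε) / (1 + x ^ 2) := by
  unfold lorentz
  rw [div_le_div_iff₀ (by positivity) (by positivity)]
  have h1 : 1 / ε * (x ^ 2 + ε ^ 2) = x ^ 2 / ε + ε := by field_simp
  have h2 : 0 ≤ x ^ 2 / ε := by positivity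
  have h3 : 0 ≤ ε * ε ^ 2 := by positivity
  rw [add_mul, h1]
  linarith

theorem channel_le (hv : IsAdmissible v V) (hν : ν ∈ Ioc 0 V) {ε : ℝ} (hε : 0 < ε)
    (t₁ s₁ t₂ t₃ : Bool) (x y z : ℝ) : channel v ν β ε t₁ s₁ t₂ t₃ x y z ≤
      (ε + 1 / ε) * (majorant v ν β t₁ s₁ t₂ t₃ x y z / (1 + gap v ν t₁ t₂ t₃ x y z ^ 2)) := by
  have h1 := rate_le_majorant (β := β) hv hν t₁ s₁ t₂ t₃ x y z
  have h2 := lorentz_le_sq hε (gap v ν t₁ t₂ t₃ x y z)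
  have h3 := lorentz_nonneg hε (gap v ν t₁ t₂ t₃ x y z)
  have h4 := majorant_nonneg (β := β) hv hν t₁ s₁ t₂ t₃ x y z
  calc _ ≤ majorant v ν β t₁ s₁ t₂ t₃ x y z
        * ((ε + 1 / ε) / (1 + gap v ν t₁ t₂ t₃ x y z ^ 2)) := by unfold channel; gcongr
    _ = _ := by ring

theorem measurable_channel (hv : IsAdmissible v V) (ε : ℝ) (t₁ s₁ t₂ t₃ : Bool) (k : E) :
    Measurable fun p : E => channel v ν β ε t₁ s₁ t₂ t₃ ‖k‖ ‖p‖ ‖p - k‖ := by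
  have h1 := (measurable_rate (β := β) (ν := ν) hv t₁ s₁ t₂ t₂ t₃ t₃ ‖k‖).comp
    (measurable_norm_pair k)
  have h2 := (measurable_gap (ν := ν) hv t₁ t₂ t₃ ‖k‖).comp (measurable_norm_pair k)
  unfold channel lorentz
  exact h1.mul (measurable_const.div ((h2.pow_const 2).add measurable_const))

theorem integrable_channel (hv : IsAdmissible v V) (hν : ν ∈ Ioc 0 V) (hβ : 0 < β) {ε : ℝ}
    (hε : 0 < ε) {k : E} (hk : k ≠ 0) (t₁ s₁ t₂ t₃ : Bool) :
    Integrable fun p : E => channel v ν β ε t₁ s₁ t₂ t₃ ‖k‖ ‖p‖ ‖p - k‖ := by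
  refine ((integrable_majorant_div hv hν hβ hk t₁ s₁ t₂ t₃).const_mul (ε + 1 / ε)).mono'
    (measurable_channel hv ε t₁ s₁ t₂ t₃ k).aestronglyMeasurable (Eventually.of_forall fun p => ?_)
  rw [Real.norm_of_nonneg (channel_nonneg hv hν hε _ _ _ _ _ _ _)]
  exact channel_le hv hν hε _ _ _ _ _ _ _

/-- The part of a channel which is not singular where the second created quasiparticle has small
momentum. -/
def halfChannel (v : E → ℝ) (ν β ε : ℝ) (t₁ s₁ t₂ t₃ : Bool) (x y z : ℝ) : ℝ :=
  channel v ν β ε t₁ s₁ t₂ t₃ x y z * (z ^ 2 / (y ^ 2 + z ^ 2))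

theorem halfChannel_add (ε : ℝ) (t₁ s₁ t₂ t₃ : Bool) {x y z : ℝ} (hy : 0 < y) :
    halfChannel v ν β ε t₁ s₁ t₂ t₃ x y z + halfChannel v ν β ε t₁ s₁ t₃ t₂ x z y
      = channel v ν β ε t₁ s₁ t₂ t₃ x y z := by
  unfold halfChannel
  rw [channel_swap, ← mul_add]
  have : 0 < y ^ 2 + z ^ 2 := by positivity
  have h : z ^ 2 / (y ^ 2 + z ^ 2) + y ^ 2 / (z ^ 2 + y ^ 2) = 1 := by
    rw [add_comm (z ^ 2) (y ^ 2), ← add_div, add_comm (z ^ 2), div_self this.ne']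
  rw [h, mul_one]

theorem halfChannel_nonneg (hv : IsAdmissible v V) (hν : ν ∈ Ioc 0 V) {ε : ℝ} (hε : 0 < ε)
    (t₁ s₁ t₂ t₃ : Bool) (x y z : ℝ) : 0 ≤ halfChannel v ν β ε t₁ s₁ t₂ t₃ x y z :=
  mul_nonneg (channel_nonneg hv hν hε _ _ _ _ _ _ _) (by positivity)

theorem halfChannel_le_channel (hv : IsAdmissible v V) (hν : ν ∈ Ioc 0 V) {ε : ℝ} (hε : 0 < ε)
    (t₁ s₁ t₂ t₃ : Bool) (x y z : ℝ) :
    halfChannel v ν β ε t₁ s₁ t₂ t₃ x y z ≤ channel v ν β ε t₁ s₁ t₂ t₃ x y z := by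
  refine mul_le_of_le_one_right (channel_nonneg hv hν hε _ _ _ _ _ _ _) ?_
  refine div_le_one_of_le₀ ?_ (by positivity)
  linarith [sq_nonneg y]

theorem continuousOn_halfChannel (hv : IsAdmissible v V) (hν : ν ∈ Ioc 0 V) (hβ : 0 < β) {ε : ℝ}
    (hε : 0 < ε) (t₁ s₁ t₂ t₃ : Bool) :
    ContinuousOn (fun u : ℝ × ℝ × ℝ => halfChannel v ν β ε t₁ s₁ t₂ t₃ u.1 u.2.1 u.2.2)
      (Ioi 0 ×ˢ Ioi 0 ×ˢ Ioi 0) := by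
  have h1 := continuousOn_rate hv hν hβ t₁ s₁ t₂ t₂ t₃ t₃
  have h2 := continuous_gap (ν := ν) hv t₁ t₂ t₃
  unfold halfChannel channel lorentz
  refine (h1.mul (Continuous.continuousOn ?_)).mul (ContinuousOn.div (by fun_prop) (by fun_prop)
    fun u hu => ?_)
  · exact continuous_const.div (by fun_prop) fun u => by positivity
  · have : 0 < u.2.1 := hu.2.1
    positivity

theorem exists_halfChannel_le (hv : IsAdmissible v V) (hν : ν ∈ Ioc 0 V) (hβ : 0 < β) {ε : ℝ}
    (hε : 0 < ε) {a : ℝ} (b : ℝ) (ha : 0 < a) (t₁ s₁ t₂ t₃ : Bool) :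
    ∃ C : ℝ, 0 ≤ C ∧ ∀ x y z, x ∈ Icc a b → 0 < y → 0 < z → |y - z| ≤ x → x ≤ y + z →
      |halfChannel v ν β ε t₁ s₁ t₂ t₃ x y z| ≤ C * (1 / (y ^ 2 * (1 + y ^ 2))) := by
  obtain ⟨C, hC, h⟩ := exists_envelope hv hν hβ b ha
  refine ⟨(ε + 1 / ε) * C, by positivity, fun x y z hx hy hz h1 h2 => ?_⟩
  rw [abs_of_nonneg (halfChannel_nonneg hv hν hε _ _ _ _ _ _ _)]
  have e1 := channel_le (β := β) hv hν hε t₁ s₁ t₂ t₃ x y z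
  have e2 : majorant v ν β t₁ s₁ t₂ t₃ x y z / (1 + gap v ν t₁ t₂ t₃ x y z ^ 2)
      ≤ C * ((1 / y ^ 2 + 1 / z ^ 2) / (1 + y ^ 2 + z ^ 2)) := h x y z hx hy hz h1 h2 t₁ s₁ t₂ t₃
  unfold halfChannel
  calc _ ≤ ((ε + 1 / ε) * (C * ((1 / y ^ 2 + 1 / z ^ 2) / (1 + y ^ 2 + z ^ 2))))
        * (z ^ 2 / (y ^ 2 + z ^ 2)) := by
        refine mul_le_mul_of_nonneg_right (e1.trans ?_) (by positivity)
        gcongr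
    _ = (ε + 1 / ε) * C * (1 / (y ^ 2 * (1 + y ^ 2 + z ^ 2))) := by
        field_simp
        ring
    _ ≤ _ := by
        refine mul_le_mul_of_nonneg_left ?_ (by positivity)
        exact one_div_le_one_div_of_le (by positivity)
          (mul_le_mul_of_nonneg_left (by linarith [sq_nonneg z]) (sq_nonneg y))

theorem summable_channel (hv : IsAdmissible v V) (hν : ν ∈ Ioc 0 V) (hβ : 0 < β) (hL : 0 < L)
    {ε : ℝ} (hε : 0 < ε) (k : Xi) (t₁ s₁ t₂ t₃ : Bool) :
    Summable fun m : Splitting k => (L ^ 3)⁻¹ * channel v ν β ε t₁ s₁ t₂ t₃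
      ‖mom L k.1‖ ‖mom L m.1‖ ‖mom L m.1 - mom L k.1‖ := by
  classical
  have hs := (Triple.summable_hit hv hν hβ hL hε k).comp_injective (hitTriple_injective k)
  have hs' := hs.comp_injective (Prod.mk_right_injective (t₁, s₁, t₂, t₃))
  refine hs'.congr fun m => ?_
  simp only [Function.comp_apply]
  rw [if_pos (hitTriple_hit k _), lorentzTerm_hitTriple hv hν hL]

/-- A channel is singular where either of the two momenta vanishes. It is the sum of a half singular
only at the first one and of the reflection of such a half. -/
theorem tendsto_tsum_channel (hv : IsAdmissible v V) (hν : ν ∈ Ioc 0 V) (hβ : 0 < β) {ε : ℝ}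
    (hε : 0 < ε) {k : E} (hk : k ≠ 0) (t₁ s₁ t₂ t₃ : Bool) :
    Tendsto (fun x : ℝ × Xi => ∑' m : Splitting x.2, (x.1 ^ 3)⁻¹ * channel v ν β ε t₁ s₁ t₂ t₃
      ‖mom x.1 x.2.1‖ ‖mom x.1 m.1‖ ‖mom x.1 m.1 - mom x.1 x.2.1‖) (thermodynamicLimit k)
      (𝓝 (((2 * Real.pi) ^ 3)⁻¹ *
        ∫ p : E, channel v ν β ε t₁ s₁ t₂ t₃ ‖k‖ ‖p‖ ‖p - k‖)) := by
  have hk0 : 0 < ‖k‖ := norm_pos_iff.2 hk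
  have lim : ∀ t₂ t₃, Tendsto (fun x : ℝ × Xi => ∑' m : Splitting x.2, (x.1 ^ 3)⁻¹ *
      halfChannel v ν β ε t₁ s₁ t₂ t₃ ‖mom x.1 x.2.1‖ ‖mom x.1 m.1‖ ‖mom x.1 m.1 - mom x.1 x.2.1‖)
      (thermodynamicLimit k) (𝓝 (((2 * Real.pi) ^ 3)⁻¹ *
        ∫ p : E, halfChannel v ν β ε t₁ s₁ t₂ t₃ ‖k‖ ‖p‖ ‖p - k‖)) := by
    intro t₂ t₃
    obtain ⟨C, hC, h⟩ := exists_halfChannel_le hv hν hβ hε (2 * ‖k‖)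
      (show 0 < ‖k‖ / 2 by positivity) t₁ s₁ t₂ t₃
    exact tendsto_lattice_sum (continuousOn_halfChannel hv hν hβ hε t₁ s₁ t₂ t₃) hk hC h
  have hmeas : ∀ t₂ t₃, Measurable fun p : E =>
      halfChannel v ν β ε t₁ s₁ t₂ t₃ ‖k‖ ‖p‖ ‖p - k‖ := by
    intro t₂ t₃
    have := measurable_channel (β := β) (ν := ν) hv ε t₁ s₁ t₂ t₃ k
    unfold halfChannel
    fun_prop
  have hint : ∀ t₂ t₃, Integrable fun p : E =>
      halfChannel v ν β ε t₁ s₁ t₂ t₃ ‖k‖ ‖p‖ ‖p - k‖ := by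
    intro t₂ t₃
    refine (integrable_channel hv hν hβ hε hk t₁ s₁ t₂ t₃).mono'
      (hmeas t₂ t₃).aestronglyMeasurable (Eventually.of_forall fun p => ?_)
    rw [Real.norm_of_nonneg (halfChannel_nonneg hv hν hε _ _ _ _ _ _ _)]
    exact halfChannel_le_channel hv hν hε _ _ _ _ _ _ _
  have hrefl : ∀ p : E, (fun p : E => halfChannel v ν β ε t₁ s₁ t₃ t₂ ‖k‖ ‖p‖ ‖p - k‖) (k - p)
      = halfChannel v ν β ε t₁ s₁ t₃ t₂ ‖k‖ ‖p - k‖ ‖p‖ := by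
    intro p
    simp only [sub_sub_cancel_left, norm_neg]
    rw [norm_sub_rev k p]
  have hI : ∫ p : E, channel v ν β ε t₁ s₁ t₂ t₃ ‖k‖ ‖p‖ ‖p - k‖
      = (∫ p : E, halfChannel v ν β ε t₁ s₁ t₂ t₃ ‖k‖ ‖p‖ ‖p - k‖)
        + ∫ p : E, halfChannel v ν β ε t₁ s₁ t₃ t₂ ‖k‖ ‖p‖ ‖p - k‖ := by
    rw [← integral_sub_left_eq_self
      (fun p : E => halfChannel v ν β ε t₁ s₁ t₃ t₂ ‖k‖ ‖p‖ ‖p - k‖) volume k]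
    have hint2 := (hint t₃ t₂).comp_sub_left k
    simp only [hrefl] at hint2 ⊢
    rw [← integral_add (hint t₂ t₃) hint2]
    refine integral_congr_ae ?_
    filter_upwards [Measure.ae_ne volume (0 : E)] with p hp
    exact (halfChannel_add ε t₁ s₁ t₂ t₃ (norm_pos_iff.2 hp)).symm
  rw [hI, mul_add]
  refine ((lim t₂ t₃).add (lim t₃ t₂)).congr' ?_
  filter_upwards [eventually_thermodynamicLimit hk] with x hx
  obtain ⟨L, κ⟩ := x
  have hL : 0 < L := hx.1
  simp only
  have hs : ∀ t₂ t₃, Summable fun m : Splitting κ => (L ^ 3)⁻¹ * halfChannel v ν β ε t₁ s₁ t₂ t₃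
      ‖mom L κ.1‖ ‖mom L m.1‖ ‖mom L m.1 - mom L κ.1‖ := by
    intro t₂ t₃
    refine Summable.of_nonneg_of_le (fun m => mul_nonneg (by positivity)
      (halfChannel_nonneg hv hν hε _ _ _ _ _ _ _)) (fun m => ?_)
      (summable_channel hv hν hβ hL hε κ t₁ s₁ t₂ t₃)
    exact mul_le_mul_of_nonneg_left (halfChannel_le_channel hv hν hε _ _ _ _ _ _ _) (by positivity)
  have hswap := tsum_splitting_swap L κ fun y z => (L ^ 3)⁻¹ *
    halfChannel v ν β ε t₁ s₁ t₃ t₂ ‖mom L κ.1‖ y z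
  have hs2 : Summable fun m : Splitting κ => (L ^ 3)⁻¹ * halfChannel v ν β ε t₁ s₁ t₃ t₂
      ‖mom L κ.1‖ ‖mom L m.1 - mom L κ.1‖ ‖mom L m.1‖ := by
    refine Summable.of_nonneg_of_le (fun m => mul_nonneg (by positivity)
      (halfChannel_nonneg hv hν hε _ _ _ _ _ _ _)) (fun m => ?_)
      (summable_channel hv hν hβ hL hε κ t₁ s₁ t₂ t₃)
    rw [← channel_swap]
    exact mul_le_mul_of_nonneg_left (halfChannel_le_channel hv hν hε _ _ _ _ _ _ _) (by positivity)
  rw [← hswap, ← (hs t₂ t₃).tsum_add hs2]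
  refine tsum_congr fun m => ?_
  rw [← mul_add, halfChannel_add _ _ _ _ _ (norm_mom_pos hL ⟨m.1, m.2.1⟩)]

/-- The shift in infinite volume, regularized by `ε`. -/
theorem tendsto_shiftBracket (hv : IsAdmissible v V) (hν : ν ∈ Ioc 0 V) (hβ : 0 < β) {ε : ℝ}
    (hε : 0 < ε) {k : E} (hk : k ≠ 0) :
    Tendsto (fun x : ℝ × Xi => shiftBracket v ν β ε x.1 x.2) (thermodynamicLimit k)
      (𝓝 (-Complex.I * ((1 / 2 * ∑ b : Bool × Bool × Bool × Bool, ((2 * Real.pi) ^ 3)⁻¹ *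
        ∫ p : E, channel v ν β ε b.1 b.2.1 b.2.2.1 b.2.2.2 ‖k‖ ‖p‖ ‖p - k‖ : ℝ) : ℂ))) := by
  classical
  have h1 := tendsto_finsetSum (Finset.univ : Finset (Bool × Bool × Bool × Bool)) fun b _ =>
    tendsto_tsum_channel hv hν hβ hε hk b.1 b.2.1 b.2.2.1 b.2.2.2
  have h2 := ((h1.const_mul (1 / 2)).add (tendsto_tsum_defect hv hν hβ hε hk))
  rw [add_zero] at h2
  refine ((Complex.continuous_ofReal.continuousAt.tendsto.comp h2).const_mul (-Complex.I)).congr' ?_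
  filter_upwards [eventually_thermodynamicLimit hk] with x hx
  rw [shiftBracket_eq_tsum hv hν hβ hx.1 hε, tsum_hit_eq hv hν hβ hx.1 hε]
  rfl

/-! ### Lorentzians and windows -/

theorem hasDerivAt_neg_inv_one_add_sq (r : ℝ) :
    HasDerivAt (fun r : ℝ => -(1 + r ^ 2)⁻¹) (2 * r / (1 + r ^ 2) ^ 2) r := by
  have h1 : HasDerivAt (fun r : ℝ => 1 + r ^ 2) (2 * r) r := by
    simpa using (hasDerivAt_pow 2 r).const_add 1
  refine (h1.inv (by positivity)).neg.congr_deriv ?_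
  ring

theorem tendsto_neg_inv_one_add_sq :
    Tendsto (fun r : ℝ => -(1 + r ^ 2)⁻¹) atTop (𝓝 0) := by
  have : Tendsto (fun r : ℝ => 1 + r ^ 2) atTop atTop :=
    tendsto_atTop_add_const_left _ _ (tendsto_pow_atTop two_ne_zero)
  simpa using this.inv_tendsto_atTop.neg

theorem integrableOn_layer {a : ℝ} (ha : 0 ≤ a) :
    IntegrableOn (fun r : ℝ => 2 * r / (1 + r ^ 2) ^ 2) (Ioi a) :=
  integrableOn_Ioi_deriv_of_nonneg' (fun r _ => hasDerivAt_neg_inv_one_add_sq r)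
    (fun r (hr : a < r) => by have := ha.trans_lt hr; positivity) tendsto_neg_inv_one_add_sq

theorem integral_layer {a : ℝ} (ha : 0 ≤ a) :
    ∫ r in Ioi a, 2 * r / (1 + r ^ 2) ^ 2 = (1 + a ^ 2)⁻¹ := by
  rw [integral_Ioi_of_hasDerivAt_of_nonneg' (fun r _ => hasDerivAt_neg_inv_one_add_sq r)
    (fun r (hr : a < r) => by have := ha.trans_lt hr; positivity) tendsto_neg_inv_one_add_sq]
  ring

theorem hasDerivAt_two_arctan_sub (r : ℝ) :
    HasDerivAt (fun r : ℝ => 2 * Real.arctan r - 2 * r * (1 + r ^ 2)⁻¹)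
      (2 * r / (1 + r ^ 2) ^ 2 * (2 * r)) r := by
  have h1 : HasDerivAt (fun r : ℝ => 1 + r ^ 2) (2 * r) r := by
    simpa using (hasDerivAt_pow 2 r).const_add 1
  have h2 : HasDerivAt (fun r : ℝ => 2 * r) 2 r := by simpa using (hasDerivAt_id r).const_mul 2
  have h3 := h1.inv (show 1 + r ^ 2 ≠ 0 by positivity)
  refine (((Real.hasDerivAt_arctan r).const_mul 2).sub (h2.mul h3)).congr_deriv ?_
  simp only [Pi.inv_apply]
  field_simp
  ring

theorem tendsto_two_arctan_sub :
    Tendsto (fun r : ℝ => 2 * Real.arctan r - 2 * r * (1 + r ^ 2)⁻¹) atTop (𝓝 Real.pi) := by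
  have h1 : Tendsto (fun r : ℝ => 2 * Real.arctan r) atTop (𝓝 (2 * (Real.pi / 2))) :=
    ((Real.tendsto_arctan_atTop).mono_right nhdsWithin_le_nhds).const_mul 2
  have h2 : Tendsto (fun r : ℝ => 2 * r * (1 + r ^ 2)⁻¹) atTop (𝓝 0) := by
    have h3 : Tendsto (fun r : ℝ => 2 * r⁻¹) atTop (𝓝 (2 * 0)) :=
      tendsto_inv_atTop_zero.const_mul 2
    rw [mul_zero] at h3
    refine squeeze_zero' ?_ ?_ h3
    · filter_upwards [eventually_gt_atTop 0] with r hr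
      positivity
    · filter_upwards [eventually_gt_atTop 0] with r hr
      rw [mul_assoc]
      refine mul_le_mul_of_nonneg_left ?_ zero_le_two
      rw [← div_eq_mul_inv, div_le_iff₀ (by positivity)]
      field_simp
      linarith
  have := h1.sub h2
  rwa [sub_zero, mul_div_cancel₀ _ (two_ne_zero' ℝ)] at this

theorem integrableOn_layer_mul :
    IntegrableOn (fun r : ℝ => 2 * r / (1 + r ^ 2) ^ 2 * (2 * r)) (Ioi 0) :=
  integrableOn_Ioi_deriv_of_nonneg' (fun r _ => hasDerivAt_two_arctan_sub r)
    (fun r (hr : 0 < r) => by positivity) tendsto_two_arctan_sub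

theorem integral_layer_mul :
    ∫ r in Ioi (0 : ℝ), 2 * r / (1 + r ^ 2) ^ 2 * (2 * r) = Real.pi := by
  rw [integral_Ioi_of_hasDerivAt_of_nonneg' (fun r _ => hasDerivAt_two_arctan_sub r)
    (fun r (hr : 0 < r) => by positivity) tendsto_two_arctan_sub]
  simp

/-- A Lorentzian is a superposition of windows: `lorentz ε x` is the integral of the weight
`2r / (1 + r²)²` over those `r` for which `x` lies in the window of half-width `ε r`. -/
theorem lorentz_eq_integral {ε : ℝ} (hε : 0 < ε) (x : ℝ) :
    lorentz ε x = ε⁻¹ * ∫ r in Ioi (0 : ℝ),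
      {r : ℝ | |x| < ε * r}.indicator (fun r => 2 * r / (1 + r ^ 2) ^ 2) r := by
  have hset : {r : ℝ | |x| < ε * r} = Ioi (|x| / ε) := by
    ext r
    simp only [mem_ofPred_eq, mem_Ioi]
    rw [div_lt_iff₀ hε, mul_comm]
  have hx : 0 ≤ |x| / ε := by positivity
  rw [hset, setIntegral_indicator measurableSet_Ioi, Ioi_inter_Ioi, max_eq_right hx,
    integral_layer hx, div_pow, sq_abs]
  unfold lorentz
  field_simp
  ring

section

variable {α : Type*} [MeasurableSpace α] {μ : Measure α} {F g : α → ℝ}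

theorem integrableOn_window (hF : Measurable F) (hg : Measurable g) (h0 : ∀ p, 0 ≤ F p)
    (hint : Integrable (fun p => F p / (1 + g p ^ 2)) μ) (η : ℝ) :
    IntegrableOn F {p | |g p| < η} μ := by
  refine ((hint.const_mul (1 + η ^ 2)).integrableOn (s := {p | |g p| < η})).mono'
    hF.aestronglyMeasurable ?_
  filter_upwards [ae_restrict_mem (measurableSet_lt hg.abs measurable_const)] with p hp
  rw [Real.norm_of_nonneg (h0 p), mul_div_assoc', le_div_iff₀ (by positivity), mul_comm]
  have : g p ^ 2 ≤ η ^ 2 := sq_le_sq' (abs_lt.1 hp).1.le (abs_lt.1 hp).2.le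
  exact mul_le_mul_of_nonneg_right (by linarith) (h0 p)

theorem setIntegral_lorentz [SFinite μ] (hF : Measurable F) (hg : Measurable g)
    (h0 : ∀ p, 0 ≤ F p) {η ε : ℝ} (hε : 0 < ε) (hint : IntegrableOn F {p | |g p| < η} μ) :
    ∫ p in {p | |g p| < η}, F p * lorentz ε (g p) ∂μ = ∫ r in Ioi (0 : ℝ),
      2 * r / (1 + r ^ 2) ^ 2 * (ε⁻¹ * ∫ p in {p | |g p| < min (ε * r) η}, F p ∂μ) := by
  have hS : MeasurableSet {p | |g p| < η} := measurableSet_lt hg.abs measurable_const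
  have e1 : ∀ p, F p * lorentz ε (g p) = ∫ r in Ioi (0 : ℝ), ε⁻¹ * (F p *
      {r : ℝ | |g p| < ε * r}.indicator (fun r => 2 * r / (1 + r ^ 2) ^ 2) r) := by
    intro p
    rw [integral_const_mul, integral_const_mul, lorentz_eq_integral hε]
    ring
  simp_rw [e1]
  rw [integral_integral_swap]
  · refine integral_congr_ae (Eventually.of_forall fun r => ?_)
    simp only
    rw [integral_const_mul, mul_left_comm]
    congr 1
    have hT : MeasurableSet {p | |g p| < ε * r} := measurableSet_lt hg.abs measurable_const
    have e2 : {p | |g p| < min (ε * r) η} = {p | |g p| < η} ∩ {p | |g p| < ε * r} := by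
      ext p
      simp only [mem_ofPred_eq, mem_inter_iff, lt_min_iff, and_comm]
    rw [e2, ← setIntegral_indicator hT, ← integral_const_mul]
    refine integral_congr_ae (Eventually.of_forall fun p => ?_)
    by_cases hp : |g p| < ε * r
    · simp [indicator, hp]; ring
    · simp [indicator, hp]
  · have hw : IntegrableOn (fun r : ℝ => 2 * r / (1 + r ^ 2) ^ 2) (Ioi 0) :=
      integrableOn_layer le_rfl
    have hset : MeasurableSet {u : α × ℝ | |g u.1| < ε * u.2} :=
      measurableSet_lt (hg.comp measurable_fst).abs (measurable_snd.const_mul ε)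
    have hm : Measurable fun u : α × ℝ => ε⁻¹ * (F u.1 *
        {u : α × ℝ | |g u.1| < ε * u.2}.indicator (fun u => 2 * u.2 / (1 + u.2 ^ 2) ^ 2) u) := by
      have h1 : Measurable fun u : α × ℝ => 2 * u.2 / (1 + u.2 ^ 2) ^ 2 := by fun_prop
      exact ((hF.comp measurable_fst).mul (h1.indicator hset)).const_mul _
    refine ((hint.mul_prod hw).const_mul ε⁻¹).mono' hm.aestronglyMeasurable ?_
    have hpos : ∀ᵐ u : α × ℝ ∂(μ.restrict {p | |g p| < η}).prod (volume.restrict (Ioi 0)),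
        u.2 ∈ Ioi (0 : ℝ) :=
      (Measure.quasiMeasurePreserving_snd).ae (ae_restrict_mem measurableSet_Ioi)
    filter_upwards [hpos] with u hu
    have hu' : 0 < u.2 := hu
    have hw0 : 0 ≤ 2 * u.2 / (1 + u.2 ^ 2) ^ 2 := by positivity
    have hi0 : 0 ≤ {u : α × ℝ | |g u.1| < ε * u.2}.indicator
        (fun u => 2 * u.2 / (1 + u.2 ^ 2) ^ 2) u := by
      by_cases h : |g u.1| < ε * u.2
      · simpa [indicator, h] using hw0
      · simp [indicator, h]
    have hi1 : {u : α × ℝ | |g u.1| < ε * u.2}.indicator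
        (fun u => 2 * u.2 / (1 + u.2 ^ 2) ^ 2) u ≤ 2 * u.2 / (1 + u.2 ^ 2) ^ 2 := by
      by_cases h : |g u.1| < ε * u.2
      · simp [indicator, h]
      · simpa [indicator, h] using hw0
    change ‖ε⁻¹ * (F u.1 * {u : α × ℝ | |g u.1| < ε * u.2}.indicator
      (fun u => 2 * u.2 / (1 + u.2 ^ 2) ^ 2) u)‖ ≤ _
    rw [Real.norm_of_nonneg (mul_nonneg (by positivity) (mul_nonneg (h0 _) hi0))]
    exact mul_le_mul_of_nonneg_left (mul_le_mul_of_nonneg_left hi1 (h0 _)) (by positivity)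

theorem lorentz_le_of_le_abs {ε a x : ℝ} (hε : 0 < ε) (ha : 0 < a) (h : a ≤ |x|) :
    lorentz ε x ≤ ε * ((1 + 1 / a ^ 2) / (1 + x ^ 2)) := by
  have h2 : a ^ 2 ≤ x ^ 2 := by rw [← sq_abs x]; gcongr
  have h3 : 0 < x ^ 2 := lt_of_lt_of_le (by positivity) h2
  unfold lorentz
  rw [div_eq_mul_inv]
  refine mul_le_mul_of_nonneg_left ?_ hε.le
  rw [inv_eq_one_div, div_le_div_iff₀ (by positivity) (by positivity)]
  have h5 : 1 ≤ 1 / a ^ 2 * x ^ 2 := by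
    rw [one_div_mul_eq_div, one_le_div (by positivity)]; exact h2
  have h6 : 0 ≤ (1 + 1 / a ^ 2) * ε ^ 2 := by positivity
  rw [mul_add, add_mul]
  linarith

/-- If `∫ F δ(g)` exists in the sense of shrinking windows, then it also exists in the sense of
Lorentzians, with the value multiplied by the total mass `π` of the Lorentzian. -/
theorem tendsto_integral_lorentz [SFinite μ] (hF : Measurable F) (hg : Measurable g)
    (h0 : ∀ p, 0 ≤ F p) (hint : Integrable (fun p => F p / (1 + g p ^ 2)) μ) {γ : ℝ}
    (h : Tendsto (fun η : ℝ => (2 * η)⁻¹ * ∫ p in {p | |g p| < η}, F p ∂μ) (𝓝[>] 0) (𝓝 γ)) :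
    Tendsto (fun ε => ∫ p, F p * lorentz ε (g p) ∂μ) (𝓝[>] 0) (𝓝 (Real.pi * γ)) := by
  set Φ : ℝ → ℝ := fun η => ∫ p in {p | |g p| < η}, F p ∂μ with hΦ
  have hw := integrableOn_window hF hg h0 hint
  have hΦ0 : ∀ η, 0 ≤ Φ η := fun η => integral_nonneg h0
  have hmono : Monotone Φ := fun a b hab => setIntegral_mono_set (hw b)
    (Eventually.of_forall h0) (Eventually.of_forall fun p (hp : |g p| < a) => hp.trans_le hab)
  have hev : ∀ᶠ η in 𝓝[>] (0 : ℝ), Φ η ≤ 2 * η * (γ + 1) := by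
    filter_upwards [h.eventually_lt_const (lt_add_one γ), self_mem_nhdsWithin] with η h1 h2
    have h2' : 0 < η := h2
    rw [inv_mul_eq_div, div_lt_iff₀ (by positivity)] at h1
    linarith
  obtain ⟨η₁, hη₁, hb⟩ : ∃ η₁ : ℝ, 0 < η₁ ∧ ∀ η, 0 < η → η ≤ η₁ → Φ η ≤ 2 * η * (γ + 1) := by
    obtain ⟨u, hu, hsub⟩ := mem_nhdsGT_iff_exists_Ioo_subset.1 hev
    have hu0 : (0 : ℝ) < u := hu
    exact ⟨u / 2, by positivity, fun η h1 h2 => hsub ⟨h1, by linarith⟩⟩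
  have hγ : 0 ≤ γ + 1 := by
    have := (hΦ0 η₁).trans (hb η₁ hη₁ le_rfl)
    by_contra hneg
    have := mul_neg_of_pos_of_neg (show 0 < 2 * η₁ by positivity) (not_le.1 hneg)
    linarith
  have hS : MeasurableSet {p | |g p| < η₁} := measurableSet_lt hg.abs measurable_const
  -- the contribution of the window, by the layer decomposition of the Lorentzian
  have near : Tendsto (fun ε => ∫ p in {p | |g p| < η₁}, F p * lorentz ε (g p) ∂μ) (𝓝[>] 0)
      (𝓝 (Real.pi * γ)) := by
    have e : Real.pi * γ = ∫ r in Ioi (0 : ℝ), 2 * r / (1 + r ^ 2) ^ 2 * (2 * r * γ) := by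
      rw [← integral_layer_mul, ← integral_mul_const]
      exact integral_congr_ae (Eventually.of_forall fun r => by ring)
    rw [e]
    have key : Tendsto (fun ε => ∫ r in Ioi (0 : ℝ),
        2 * r / (1 + r ^ 2) ^ 2 * (ε⁻¹ * Φ (min (ε * r) η₁))) (𝓝[>] 0)
        (𝓝 (∫ r in Ioi (0 : ℝ), 2 * r / (1 + r ^ 2) ^ 2 * (2 * r * γ))) := by
      refine tendsto_integral_filter_of_dominated_convergence
        (fun r => 2 * r / (1 + r ^ 2) ^ 2 * (2 * r) * (γ + 1)) ?_ ?_ ?_ ?_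
      · refine Eventually.of_forall fun ε => Measurable.aestronglyMeasurable ?_
        have : Measurable Φ := hmono.measurable
        fun_prop
      · filter_upwards [self_mem_nhdsWithin] with ε hε
        have hε' : 0 < ε := hε
        filter_upwards [ae_restrict_mem measurableSet_Ioi] with r hr
        have hr' : 0 < r := hr
        have hm0 : 0 < min (ε * r) η₁ := lt_min (by positivity) hη₁
        rw [Real.norm_of_nonneg (mul_nonneg (by positivity)
          (mul_nonneg (by positivity) (hΦ0 _))), mul_assoc (2 * r / (1 + r ^ 2) ^ 2)]
        refine mul_le_mul_of_nonneg_left ?_ (by positivity)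
        rw [inv_mul_le_iff₀ hε']
        refine (hb _ hm0 (min_le_right _ _)).trans ?_
        have := mul_le_mul_of_nonneg_right (min_le_left (ε * r) η₁) hγ
        linarith
      · exact integrableOn_layer_mul.mul_const _
      · filter_upwards [ae_restrict_mem measurableSet_Ioi] with r hr
        have hr' : 0 < r := hr
        refine Tendsto.const_mul _ ?_
        have t0 : Tendsto (fun ε : ℝ => ε * r) (𝓝[>] 0) (𝓝 0) := by
          have : Tendsto (fun ε : ℝ => ε * r) (𝓝 0) (𝓝 (0 * r)) :=
            (continuous_id.mul continuous_const).tendsto 0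
          rw [zero_mul] at this
          exact this.mono_left nhdsWithin_le_nhds
        have t1 : Tendsto (fun ε : ℝ => ε * r) (𝓝[>] 0) (𝓝[>] 0) := by
          refine tendsto_nhdsWithin_iff.2 ⟨t0, ?_⟩
          filter_upwards [self_mem_nhdsWithin] with ε hε
          exact mul_pos hε hr'
        refine ((h.comp t1).const_mul (2 * r)).congr' ?_
        filter_upwards [self_mem_nhdsWithin, t0.eventually_lt_const hη₁] with ε hε h1
        have hε' : 0 < ε := hε
        simp only [Function.comp_apply]
        rw [min_eq_left h1.le]
        field_simp
        rfl
    refine key.congr' ?_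
    filter_upwards [self_mem_nhdsWithin] with ε hε
    exact (setIntegral_lorentz hF hg h0 hε (hw η₁)).symm
  have hdom : ∀ ε : ℝ, 0 < ε → ∀ p ∈ {p | |g p| < η₁}ᶜ, F p * lorentz ε (g p)
      ≤ ε * ((1 + 1 / η₁ ^ 2) * (F p / (1 + g p ^ 2))) := by
    intro ε hε p hp
    calc _ ≤ F p * (ε * ((1 + 1 / η₁ ^ 2) / (1 + g p ^ 2))) :=
          mul_le_mul_of_nonneg_left (lorentz_le_of_le_abs hε hη₁ (not_lt.1 hp)) (h0 p)
      _ = _ := by ring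
  have hml : ∀ ε, Measurable fun p => F p * lorentz ε (g p) := by
    intro ε; unfold lorentz; fun_prop
  have hfar : ∀ ε : ℝ, 0 < ε → IntegrableOn (fun p => F p * lorentz ε (g p))
      {p | |g p| < η₁}ᶜ μ := by
    intro ε hε
    refine (((hint.const_mul (1 + 1 / η₁ ^ 2)).const_mul ε).integrableOn).mono'
      (hml ε).aestronglyMeasurable ?_
    filter_upwards [ae_restrict_mem hS.compl] with p hp
    rw [Real.norm_of_nonneg (mul_nonneg (h0 p) (lorentz_nonneg hε _))]
    exact hdom ε hε p hp
  have far : Tendsto (fun ε => ∫ p in {p | |g p| < η₁}ᶜ, F p * lorentz ε (g p) ∂μ) (𝓝[>] 0)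
      (𝓝 0) := by
    have hz : Tendsto (fun ε : ℝ => ε * ∫ p in {p | |g p| < η₁}ᶜ,
        (1 + 1 / η₁ ^ 2) * (F p / (1 + g p ^ 2)) ∂μ) (𝓝[>] 0) (𝓝 0) := by
      generalize ∫ p in {p | |g p| < η₁}ᶜ, (1 + 1 / η₁ ^ 2) * (F p / (1 + g p ^ 2)) ∂μ = c
      have : Tendsto (fun ε : ℝ => ε * c) (𝓝 0) (𝓝 (0 * c)) :=
        (continuous_id.mul continuous_const).tendsto 0
      rw [zero_mul] at this
      exact this.mono_left nhdsWithin_le_nhds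
    refine squeeze_zero' ?_ ?_ hz
    · filter_upwards [self_mem_nhdsWithin] with ε hε
      exact integral_nonneg fun p => mul_nonneg (h0 p) (lorentz_nonneg hε _)
    · filter_upwards [self_mem_nhdsWithin] with ε hε
      rw [← integral_const_mul]
      refine setIntegral_mono_on (hfar ε hε) ?_ hS.compl (hdom ε hε)
      exact ((hint.const_mul (1 + 1 / η₁ ^ 2)).const_mul ε).integrableOn
  have := near.add far
  rw [add_zero] at this
  refine this.congr' ?_
  filter_upwards [self_mem_nhdsWithin] with ε hε
  have hε' : 0 < ε := hε
  refine integral_add_compl hS ?_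
  have hnear : IntegrableOn (fun p => F p * lorentz ε (g p)) {p | |g p| < η₁} μ := by
    refine ((hw η₁).mul_const (1 / ε)).mono' (hml ε).aestronglyMeasurable
      (Eventually.of_forall fun p => ?_)
    rw [Real.norm_of_nonneg (mul_nonneg (h0 p) (lorentz_nonneg hε _))]
    exact mul_le_mul_of_nonneg_left (lorentz_le_inv hε' _) (h0 p)
  rw [← integrableOn_univ, ← union_compl_self {p | |g p| < η₁}]
  exact hnear.union (hfar ε hε)

end

/-! ### Removal of the regularization -/

theorem sub_sq_le_of_eq_exp_mul {P Q x : ℝ} (hQ : 0 ≤ Q) (h : P = Real.exp x * Q) :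
    (P - Q) ^ 2 ≤ x ^ 2 * (P + Q) ^ 2 := by
  have hP : 0 ≤ P := h ▸ mul_nonneg (Real.exp_pos x).le hQ
  have hQ' : Q = Real.exp (-x) * P := by
    rw [h, ← mul_assoc, ← Real.exp_add, neg_add_cancel, Real.exp_zero, one_mul]
  rw [← mul_pow]
  refine sq_le_sq.2 ?_
  rw [abs_mul, abs_of_nonneg (add_nonneg hP hQ)]
  have hx := abs_nonneg x
  refine abs_sub_le_iff.2 ⟨?_, ?_⟩
  · have h1 : 1 - Real.exp (-x) ≤ |x| := by linarith [Real.add_one_le_exp (-x), le_abs_self x]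
    have h2 := mul_le_mul_of_nonneg_right h1 hP
    have h3 := mul_nonneg hx hQ
    linarith
  · have h1 : 1 - Real.exp x ≤ |x| := by linarith [Real.add_one_le_exp x, neg_le_abs x]
    have h2 := mul_le_mul_of_nonneg_right h1 hQ
    have h3 := mul_nonneg hx hP
    linarith

theorem therm_eq_exp_mul_not (s : Bool) (t : ℝ) :
    therm v ν β s t = Real.exp (β / 2 * (sgn s * disp v ν t)) * therm v ν β (!s) t := by
  cases s
  · rw [Bool.not_false, therm_true_eq, ← mul_assoc, ← Real.exp_add]
    simp only [sgn_false]
    rw [show β / 2 * (-1 * disp v ν t) + β * disp v ν t / 2 = 0 by ring, Real.exp_zero, one_mul]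
  · rw [therm_true_eq]
    simp only [sgn_true, Bool.not_true]
    congr 2
    ring

/-- Detailed balance: on the energy shell of a process in which all three operators create, the
contributions of the left and the right Hamiltonian cancel. -/
theorem mixing_sq_le_gap (t₁ t₂ t₃ : Bool) (x y z : ℝ) :
    mixing v ν β t₁ t₂ t₃ x y z ^ 2
      ≤ (β / 2 * gap v ν t₁ t₂ t₃ x y z) ^ 2 * mixingSum v ν β t₁ t₂ t₃ x y z ^ 2 := by
  unfold mixing mixingSum
  refine sub_sq_le_of_eq_exp_mul (mul_nonneg (mul_nonneg (therm_nonneg _ _) (therm_nonneg _ _))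
    (therm_nonneg _ _)) ?_
  rw [therm_eq_exp_mul_not t₁, therm_eq_exp_mul_not t₂, therm_eq_exp_mul_not t₃]
  unfold gap
  rw [mul_add, mul_add, Real.exp_add, Real.exp_add]
  ring

theorem rate_le_gap (hv : IsAdmissible v V) (hν : ν ∈ Ioc 0 V) (t₁ t₂ t₃ : Bool) (x y z : ℝ) :
    rate v ν β t₁ t₁ t₂ t₂ t₃ t₃ x y z ≤ (β / 2 * gap v ν t₁ t₂ t₃ x y z) ^ 2
      * majorant v ν β t₁ t₁ t₂ t₃ x y z := by
  have h0 := hv.vhat_zero_pos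
  have hν0 := hν.1
  have h := mixing_sq_le_gap (v := v) (ν := ν) (β := β) t₁ t₂ t₃ x y z
  unfold rate majorant
  rw [mul_left_comm ((β / 2 * gap v ν t₁ t₂ t₃ x y z) ^ 2)]
  refine mul_le_mul_of_nonneg_left ?_ (by positivity)
  rw [mul_left_comm]
  exact mul_le_mul_of_nonneg_left h (sq_nonneg _)

theorem tendsto_channel_zero (hv : IsAdmissible v V) (hν : ν ∈ Ioc 0 V) (hβ : 0 < β) {k : E}
    (hk : k ≠ 0) (t₁ s₁ t₂ t₃ : Bool) {C : ℝ}
    (h : ∀ ε : ℝ, 0 < ε → ∀ y z, 0 ≤ y → 0 ≤ z → channel v ν β ε t₁ s₁ t₂ t₃ ‖k‖ y z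
      ≤ ε * (C * (majorant v ν β t₁ s₁ t₂ t₃ ‖k‖ y z / (1 + gap v ν t₁ t₂ t₃ ‖k‖ y z ^ 2)))) :
    Tendsto (fun ε => ∫ p : E, channel v ν β ε t₁ s₁ t₂ t₃ ‖k‖ ‖p‖ ‖p - k‖) (𝓝[>] 0) (𝓝 0) := by
  have hi := (integrable_majorant_div hv hν hβ hk t₁ s₁ t₂ t₃).const_mul C
  have hz : Tendsto (fun ε : ℝ => ε * ∫ p : E, C * (majorant v ν β t₁ s₁ t₂ t₃ ‖k‖ ‖p‖ ‖p - k‖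
      / (1 + gap v ν t₁ t₂ t₃ ‖k‖ ‖p‖ ‖p - k‖ ^ 2))) (𝓝[>] 0) (𝓝 0) := by
    generalize ∫ p : E, C * (majorant v ν β t₁ s₁ t₂ t₃ ‖k‖ ‖p‖ ‖p - k‖
      / (1 + gap v ν t₁ t₂ t₃ ‖k‖ ‖p‖ ‖p - k‖ ^ 2)) = c
    have : Tendsto (fun ε : ℝ => ε * c) (𝓝 0) (𝓝 (0 * c)) :=
      (continuous_id.mul continuous_const).tendsto 0
    rw [zero_mul] at this
    exact this.mono_left nhdsWithin_le_nhds
  refine squeeze_zero' ?_ ?_ hz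
  · filter_upwards [self_mem_nhdsWithin] with ε hε
    exact integral_nonneg fun p => channel_nonneg hv hν hε _ _ _ _ _ _ _
  · filter_upwards [self_mem_nhdsWithin] with ε hε
    rw [← integral_const_mul]
    exact integral_mono (integrable_channel hv hν hβ hε hk _ _ _ _) (hi.const_mul ε)
      fun p => h ε hε _ _ (norm_nonneg _) (norm_nonneg _)

/-- Processes which create a further quasiparticle of momentum `k` do not contribute. -/
theorem tendsto_channel_same (hv : IsAdmissible v V) (hν : ν ∈ Ioc 0 V) (hβ : 0 < β) {k : E}
    (hk : k ≠ 0) (t₁ t₂ t₃ : Bool) :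
    Tendsto (fun ε => ∫ p : E, channel v ν β ε t₁ t₁ t₂ t₃ ‖k‖ ‖p‖ ‖p - k‖) (𝓝[>] 0) (𝓝 0) := by
  refine tendsto_channel_zero hv hν hβ hk t₁ t₁ t₂ t₃ (C := 2 + β ^ 2 / 2) ?_
  intro ε hε y z _ _
  have hm := majorant_nonneg (β := β) hv hν t₁ t₁ t₂ t₃ ‖k‖ y z
  have h1 := rate_le_majorant (β := β) hv hν t₁ t₁ t₂ t₃ ‖k‖ y z
  have h2 := rate_le_gap (β := β) hv hν t₁ t₂ t₃ ‖k‖ y z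
  unfold channel
  set M := majorant v ν β t₁ t₁ t₂ t₃ ‖k‖ y z
  set g := gap v ν t₁ t₂ t₃ ‖k‖ y z
  have hl := lorentz_nonneg hε g
  rw [mul_div_assoc', mul_div_assoc', le_div_iff₀ (by positivity)]
  rcases le_total 1 |g| with hg | hg
  · have h3 := lorentz_le_of_le_abs hε one_pos hg
    have h4 : lorentz ε g * (1 + g ^ 2) ≤ ε * 2 := by
      rw [mul_div_assoc', le_div_iff₀ (by positivity)] at h3
      linarith
    calc _ = rate v ν β t₁ t₁ t₂ t₂ t₃ t₃ ‖k‖ y z * (lorentz ε g * (1 + g ^ 2)) := by ring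
      _ ≤ M * (ε * 2) := mul_le_mul h1 h4 (by positivity) hm
      _ ≤ _ := by
        have : 0 ≤ ε * (β ^ 2 / 2 * M) := by positivity
        linarith
  · have h3 : g ^ 2 ≤ 1 := by rw [← sq_abs]; exact pow_le_one₀ (abs_nonneg _) hg
    have h4 : g ^ 2 * lorentz ε g ≤ ε := by
      unfold lorentz
      rw [mul_div_assoc', div_le_iff₀ (by positivity), mul_comm]
      refine mul_le_mul_of_nonneg_left ?_ hε.le
      linarith [sq_nonneg ε]
    calc _ ≤ (β / 2 * g) ^ 2 * M * lorentz ε g * 2 :=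
          mul_le_mul (mul_le_mul_of_nonneg_right h2 hl) (by linarith) (by positivity)
            (by positivity)
      _ = β ^ 2 / 2 * M * (g ^ 2 * lorentz ε g) := by ring
      _ ≤ β ^ 2 / 2 * M * ε := mul_le_mul_of_nonneg_left h4 (by positivity)
      _ ≤ _ := by
        have : 0 ≤ ε * (2 * M) := by positivity
        linarith

/-- Processes in which all three operators lower the Bogoliubov energy are not resonant. -/
theorem tendsto_channel_nonresonant (hv : IsAdmissible v V) (hν : ν ∈ Ioc 0 V) (hβ : 0 < β) {k : E}
    (hk : k ≠ 0) (s₁ : Bool) :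
    Tendsto (fun ε => ∫ p : E, channel v ν β ε false s₁ false false ‖k‖ ‖p‖ ‖p - k‖) (𝓝[>] 0)
      (𝓝 0) := by
  have hw := disp_pos hv hν (norm_pos_iff.2 hk)
  refine tendsto_channel_zero hv hν hβ hk false s₁ false false
    (C := 1 + 1 / disp v ν ‖k‖ ^ 2) ?_
  intro ε hε y z hy hz
  have hm := majorant_nonneg (β := β) hv hν false s₁ false false ‖k‖ y z
  have h1 := rate_le_majorant (β := β) hv hν false s₁ false false ‖k‖ y z
  have hg : disp v ν ‖k‖ ≤ |gap v ν false false false ‖k‖ y z| := by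
    refine le_trans ?_ (neg_le_abs _)
    have h2 := disp_nonneg (v := v) (ν := ν) hy
    have h3 := disp_nonneg (v := v) (ν := ν) hz
    unfold gap
    simp only [sgn_false]
    linarith
  have h3 := lorentz_le_of_le_abs hε hw hg
  unfold channel
  calc _ ≤ majorant v ν β false s₁ false false ‖k‖ y z * (ε * ((1 + 1 / disp v ν ‖k‖ ^ 2)
        / (1 + gap v ν false false false ‖k‖ y z ^ 2))) :=
        mul_le_mul h1 h3 (lorentz_nonneg hε _) hm
    _ = _ := by ring

/-- The integral of a rate over the energy shell. -/
def IsShellIntegral (v : E → ℝ) (ν β : ℝ) (t₁ s₁ t₂ t₃ : Bool) (k : E) (γ : ℝ) : Prop :=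
  Tendsto (fun η : ℝ => (2 * η)⁻¹ * ∫ p in {p : E | |gap v ν t₁ t₂ t₃ ‖k‖ ‖p‖ ‖p - k‖| < η},
    rate v ν β t₁ s₁ t₂ t₂ t₃ t₃ ‖k‖ ‖p‖ ‖p - k‖) (𝓝[>] 0) (𝓝 γ)

theorem measurable_rate_norm (hv : IsAdmissible v V) (t₁ s₁ t₂ t₃ : Bool) (k : E) :
    Measurable fun p : E => rate v ν β t₁ s₁ t₂ t₂ t₃ t₃ ‖k‖ ‖p‖ ‖p - k‖ := by
  have h := (measurable_rate (β := β) (ν := ν) hv t₁ s₁ t₂ t₂ t₃ t₃ ‖k‖).comp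
    (measurable_norm_pair k)
  exact h

theorem measurable_gap_norm (hv : IsAdmissible v V) (t₁ t₂ t₃ : Bool) (k : E) :
    Measurable fun p : E => gap v ν t₁ t₂ t₃ ‖k‖ ‖p‖ ‖p - k‖ := by
  have h := (measurable_gap (ν := ν) hv t₁ t₂ t₃ ‖k‖).comp (measurable_norm_pair k)
  exact h

theorem integrable_rate_div (hv : IsAdmissible v V) (hν : ν ∈ Ioc 0 V) (hβ : 0 < β) {k : E}
    (hk : k ≠ 0) (t₁ s₁ t₂ t₃ : Bool) :
    Integrable fun p : E => rate v ν β t₁ s₁ t₂ t₂ t₃ t₃ ‖k‖ ‖p‖ ‖p - k‖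
      / (1 + gap v ν t₁ t₂ t₃ ‖k‖ ‖p‖ ‖p - k‖ ^ 2) := by
  refine (integrable_majorant_div hv hν hβ hk t₁ s₁ t₂ t₃).mono'
    ((measurable_rate_norm hv _ _ _ _ _).div
      (((measurable_gap_norm hv _ _ _ _).pow_const 2).const_add 1)).aestronglyMeasurable
    (Eventually.of_forall fun p => ?_)
  rw [Real.norm_of_nonneg (div_nonneg (rate_nonneg hv hν _ _ _ _ _ _ _ _ _) (by positivity))]
  exact div_le_div_of_nonneg_right (rate_le_majorant hv hν _ _ _ _ _ _ _) (by positivity)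

theorem IsShellIntegral.tendsto_channel (hv : IsAdmissible v V) (hν : ν ∈ Ioc 0 V) (hβ : 0 < β)
    {k : E} (hk : k ≠ 0) {t₁ s₁ t₂ t₃ : Bool} {γ : ℝ} (h : IsShellIntegral v ν β t₁ s₁ t₂ t₃ k γ) :
    Tendsto (fun ε => ∫ p : E, channel v ν β ε t₁ s₁ t₂ t₃ ‖k‖ ‖p‖ ‖p - k‖) (𝓝[>] 0)
      (𝓝 (Real.pi * γ)) :=
  tendsto_integral_lorentz (measurable_rate_norm hv _ _ _ _ _) (measurable_gap_norm hv _ _ _ _)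
    (fun _ => rate_nonneg hv hν _ _ _ _ _ _ _ _ _) (integrable_rate_div hv hν hβ hk _ _ _ _) h

theorem integral_channel_swap (ε : ℝ) (t₁ s₁ t₂ t₃ : Bool) (k : E) :
    ∫ p : E, channel v ν β ε t₁ s₁ t₃ t₂ ‖k‖ ‖p‖ ‖p - k‖
      = ∫ p : E, channel v ν β ε t₁ s₁ t₂ t₃ ‖k‖ ‖p‖ ‖p - k‖ := by
  rw [← integral_sub_left_eq_self _ volume k]
  refine integral_congr_ae (Eventually.of_forall fun p => ?_)
  simp only
  rw [sub_sub_cancel_left, norm_neg, norm_sub_rev k p, channel_swap]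

theorem ae_ne_zero_and_ne (k : E) : ∀ᵐ p : E, p ≠ 0 ∧ p - k ≠ 0 := by
  filter_upwards [Measure.ae_ne volume (0 : E), Measure.ae_ne volume k] with p h1 h2
  exact ⟨h1, sub_ne_zero.2 h2⟩

/-- A rate given by a delta integral is, up to its prefactor, the integral of a process over its
energy shell. -/
theorem hasDeltaIntegral_iff (hv : IsAdmissible v V) (hν : ν ∈ Ioc 0 V) (hβ : 0 < β) {k : E}
    (hk : k ≠ 0) {t₁ s₁ t₂ t₃ : Bool} {c : ℝ} (hc : c ≠ 0) {F g : E → ℝ}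
    (hF : ∀ p : E, p ≠ 0 → p - k ≠ 0 → F p = c * rate v ν β t₁ s₁ t₂ t₂ t₃ t₃ ‖k‖ ‖p‖ ‖p - k‖)
    (hg : ∀ p, |g p| = |gap v ν t₁ t₂ t₃ ‖k‖ ‖p‖ ‖p - k‖|) {γ : ℝ} :
    HasDeltaIntegral F g (c * γ) ↔ IsShellIntegral v ν β t₁ s₁ t₂ t₃ k γ := by
  have hae : F =ᵐ[volume] fun p => c * rate v ν β t₁ s₁ t₂ t₂ t₃ t₃ ‖k‖ ‖p‖ ‖p - k‖ := by
    filter_upwards [ae_ne_zero_and_ne k] with p hp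
    exact hF p hp.1 hp.2
  have hw := integrableOn_window (measurable_rate_norm (β := β) hv t₁ s₁ t₂ t₃ k)
    (measurable_gap_norm hv t₁ t₂ t₃ k) (fun _ => rate_nonneg hv hν _ _ _ _ _ _ _ _ _)
    (integrable_rate_div hv hν hβ hk t₁ s₁ t₂ t₃)
  have hint : ∀ η : ℝ, (2 * η)⁻¹ * ∫ p in {p : E | |gap v ν t₁ t₂ t₃ ‖k‖ ‖p‖ ‖p - k‖| < η}, F p
      = c * ((2 * η)⁻¹ * ∫ p in {p : E | |gap v ν t₁ t₂ t₃ ‖k‖ ‖p‖ ‖p - k‖| < η},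
        rate v ν β t₁ s₁ t₂ t₂ t₃ t₃ ‖k‖ ‖p‖ ‖p - k‖) := by
    intro η
    rw [integral_congr_ae (ae_restrict_of_ae hae), integral_const_mul]
    ring
  unfold HasDeltaIntegral IsShellIntegral
  simp_rw [hg, hint]
  constructor
  · rintro ⟨-, h⟩
    have := h.const_mul c⁻¹
    simpa only [inv_mul_cancel_left₀ hc] using this
  · intro h
    refine ⟨Eventually.of_forall fun η => ?_, h.const_mul c⟩
    exact ((hw η).const_mul c).congr (ae_restrict_of_ae (hae.mono fun p hp => hp.symm))

theorem isBeliaevRate_iff (hv : IsAdmissible v V) (hν : ν ∈ Ioc 0 V) (hβ : 0 < β) {k : E}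
    (hk : k ≠ 0) {γ : ℝ} : IsBeliaevRate v ν β k (Real.pi / 2 * ((2 * Real.pi) ^ 3)⁻¹ * γ)
      ↔ IsShellIntegral v ν β false true true true k γ := by
  refine hasDeltaIntegral_iff hv hν hβ hk (by positivity) (fun p hp hq => ?_) fun p => ?_
  · rw [beliaev_integrand_eq hv hν hβ hk hp hq]
  · rw [omega_eq_disp hv, omega_eq_disp hv, omega_eq_disp hv]
    unfold gap
    simp only [sgn_true, sgn_false]
    congr 1
    ring

theorem isLandauRate_iff (hv : IsAdmissible v V) (hν : ν ∈ Ioc 0 V) (hβ : 0 < β) {k : E}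
    (hk : k ≠ 0) {γ : ℝ} : IsLandauRate v ν β k (Real.pi * ((2 * Real.pi) ^ 3)⁻¹ * γ)
      ↔ IsShellIntegral v ν β false true false true k γ := by
  refine hasDeltaIntegral_iff hv hν hβ hk (by positivity) (fun p hp hq => ?_) fun p => ?_
  · rw [landau_integrand_eq hv hν hβ hk hp hq]
  · rw [omega_eq_disp hv, omega_eq_disp hv, omega_eq_disp hv, ← abs_neg]
    unfold gap
    simp only [sgn_true, sgn_false]
    congr 1
    ring

/-- The eigenvalue shift in terms of the damping rates. -/
theorem isEigenvalueShift (hv : IsAdmissible v V) (hν : ν ∈ Ioc 0 V) (hβ : 0 < β) {k : E}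
    (hk : k ≠ 0) {γB γL : ℝ} (hB : IsBeliaevRate v ν β k γB) (hL : IsLandauRate v ν β k γL) :
    IsEigenvalueShift v ν β k (-2 * Complex.I * ((γB : ℂ) + (γL : ℂ))) := by
  have hπ := Real.pi_pos
  obtain ⟨b, rfl⟩ : ∃ b, γB = Real.pi / 2 * ((2 * Real.pi) ^ 3)⁻¹ * b :=
    ⟨γB / (Real.pi / 2 * ((2 * Real.pi) ^ 3)⁻¹), by field_simp⟩
  obtain ⟨l, rfl⟩ : ∃ l, γL = Real.pi * ((2 * Real.pi) ^ 3)⁻¹ * l :=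
    ⟨γL / (Real.pi * ((2 * Real.pi) ^ 3)⁻¹), by field_simp⟩
  have tB := ((isBeliaevRate_iff hv hν hβ hk).1 hB).tendsto_channel hv hν hβ hk
  have tL := ((isLandauRate_iff hv hν hβ hk).1 hL).tendsto_channel hv hν hβ hk
  have tL' : Tendsto (fun ε => ∫ p : E, channel v ν β ε false true true false ‖k‖ ‖p‖ ‖p - k‖)
      (𝓝[>] 0) (𝓝 (Real.pi * l)) := by
    simp_rw [integral_channel_swap _ false true false true]
    exact tL
  have tN := tendsto_channel_nonresonant hv hν hβ hk true
  have tS := tendsto_channel_same hv hν hβ hk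
  refine ⟨_, fun ε hε => tendsto_shiftBracket hv hν hβ hε hk, ?_⟩
  have hflip : ∀ (ε : ℝ) (s₁ t₂ t₃ : Bool),
      ∫ p : E, channel v ν β ε true s₁ t₂ t₃ ‖k‖ ‖p‖ ‖p - k‖
        = ∫ p : E, channel v ν β ε false (!s₁) (!t₂) (!t₃) ‖k‖ ‖p‖ ‖p - k‖ := by
    intro ε s₁ t₂ t₃
    refine integral_congr_ae (Eventually.of_forall fun p => ?_)
    exact (channel_not ε true s₁ t₂ t₃ _ _ _).symm
  have hsum : Tendsto (fun ε => 1 / 2 * ∑ b : Bool × Bool × Bool × Bool, ((2 * Real.pi) ^ 3)⁻¹ *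
      ∫ p : E, channel v ν β ε b.1 b.2.1 b.2.2.1 b.2.2.2 ‖k‖ ‖p‖ ‖p - k‖) (𝓝[>] 0)
      (𝓝 (2 * (Real.pi / 2 * ((2 * Real.pi) ^ 3)⁻¹ * b + Real.pi * ((2 * Real.pi) ^ 3)⁻¹ * l))) := by
    have h := (((((tB.add tL).add tL').add tN).add ((((tS false false false).add
      (tS false false true)).add (tS false true false)).add (tS false true true))).const_mul
        ((2 * Real.pi) ^ 3)⁻¹)
    have e : ((2 * Real.pi) ^ 3)⁻¹ * (Real.pi * b + Real.pi * l + Real.pi * l + 0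
        + (0 + 0 + 0 + 0)) = 2 * (Real.pi / 2 * ((2 * Real.pi) ^ 3)⁻¹ * b
          + Real.pi * ((2 * Real.pi) ^ 3)⁻¹ * l) := by ring
    rw [e] at h
    refine h.congr fun ε => ?_
    simp only [Fintype.sum_prod_type, Fintype.sum_bool, hflip, Bool.not_true, Bool.not_false]
    ring
  have := (Complex.continuous_ofReal.continuousAt.tendsto.comp hsum).const_mul (-Complex.I)
  have e : -2 * Complex.I * (((Real.pi / 2 * ((2 * Real.pi) ^ 3)⁻¹ * b : ℝ) : ℂ)
      + ((Real.pi * ((2 * Real.pi) ^ 3)⁻¹ * l : ℝ) : ℂ)) = -Complex.I * ((2 * (Real.pi / 2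
        * ((2 * Real.pi) ^ 3)⁻¹ * b + Real.pi * ((2 * Real.pi) ^ 3)⁻¹ * l) : ℝ) : ℂ) := by
    push_cast
    ring
  rw [e]
  exact this

/-! ### Bipolar coordinates -/

open scoped ENNReal

theorem lintegral_plane {f : ℝ → ℝ≥0∞} (hf : Measurable f) :
    ∫⁻ w : ℝ × ℝ, f (w.1 ^ 2 + w.2 ^ 2)
      = ENNReal.ofReal (2 * Real.pi) * ∫⁻ r in Ioi (0 : ℝ), ENNReal.ofReal r * f (r ^ 2) := by
  rw [← lintegral_comp_polarCoord_symm]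
  have h1 : ∀ p : ℝ × ℝ, ENNReal.ofReal p.1 • f ((polarCoord.symm p).1 ^ 2
      + (polarCoord.symm p).2 ^ 2) = ENNReal.ofReal p.1 * f (p.1 ^ 2) := by
    intro p
    rw [smul_eq_mul]
    congr 2
    simp only [polarCoord_symm_apply]
    rw [mul_pow, mul_pow, ← mul_add, Real.cos_sq_add_sin_sq, mul_one]
  simp_rw [h1]
  rw [polarCoord_target, Measure.volume_eq_prod, ← Measure.prod_restrict, lintegral_prod_symm]
  · simp only [lintegral_const, Measure.restrict_apply_univ, Real.volume_Ioo]
    rw [mul_comm]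
    congr 2
    ring
  · exact Measurable.aemeasurable (by fun_prop)

theorem lintegral_shift_sq (a : ℝ) (f : ℝ → ℝ≥0∞) :
    ∫⁻ r in Ioi (0 : ℝ), ENNReal.ofReal r * f √(a ^ 2 + r ^ 2)
      = ∫⁻ y in Ioi |a|, ENNReal.ofReal y * f y := by
  have himg : (fun r : ℝ => √(a ^ 2 + r ^ 2)) '' Ioi 0 = Ioi |a| := by
    ext y
    simp only [mem_image, mem_Ioi]
    constructor
    · rintro ⟨r, hr, rfl⟩
      rw [← Real.sqrt_sq_eq_abs]
      exact Real.sqrt_lt_sqrt (sq_nonneg _) (by linarith [pow_pos hr 2])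
    · intro hy
      have hy0 := (abs_nonneg a).trans_lt hy
      have h2 : a ^ 2 < y ^ 2 := by rw [← sq_abs]; gcongr
      refine ⟨√(y ^ 2 - a ^ 2), Real.sqrt_pos.2 (by linarith), ?_⟩
      rw [Real.sq_sqrt (by linarith), add_sub_cancel, Real.sqrt_sq hy0.le]
  have hinj : InjOn (fun r : ℝ => √(a ^ 2 + r ^ 2)) (Ioi 0) := by
    intro r hr s hs h
    have hr : 0 < r := hr
    have hs : 0 < s := hs
    have h' := (Real.sqrt_inj (by positivity) (by positivity)).1 h
    exact (pow_left_inj₀ hr.le hs.le two_ne_zero).1 (by linarith)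
  rw [← himg, lintegral_image_eq_lintegral_abs_deriv_mul measurableSet_Ioi
    (f' := fun r => r / √(a ^ 2 + r ^ 2)) (fun r hr => ?_) hinj]
  · refine setLIntegral_congr_fun measurableSet_Ioi fun r hr => ?_
    have hr : 0 < r := hr
    have hs : 0 < √(a ^ 2 + r ^ 2) := Real.sqrt_pos.2 (by positivity)
    rw [← mul_assoc, ← ENNReal.ofReal_mul (abs_nonneg _), abs_of_pos (by positivity),
      div_mul_cancel₀ _ hs.ne']
  · have hr : 0 < r := hr
    have h1 : HasDerivAt (fun r : ℝ => a ^ 2 + r ^ 2) (2 * r) r := by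
      simpa using (hasDerivAt_pow 2 r).const_add (a ^ 2)
    refine ((h1.sqrt (by positivity)).congr_deriv ?_).hasDerivWithinAt
    rw [mul_div_mul_left _ _ two_ne_zero]

theorem lintegral_law_of_cosines {κ y : ℝ} (hκ : 0 < κ) (hy : 0 < y) (f : ℝ → ℝ≥0∞) :
    ∫⁻ a in Ioo (-y) y, f √(y ^ 2 - 2 * a * κ + κ ^ 2)
      = ∫⁻ z in Ioo |y - κ| (y + κ), ENNReal.ofReal (z / κ) * f z := by
  have hpos : ∀ z ∈ Ioo |y - κ| (y + κ), 0 < z := fun z hz => (abs_nonneg _).trans_lt hz.1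
  have hinj : InjOn (fun z : ℝ => (y ^ 2 + κ ^ 2 - z ^ 2) / (2 * κ)) (Ioo |y - κ| (y + κ)) := by
    intro z hz w hw h
    simp only at h
    rw [div_left_inj' (by positivity)] at h
    exact (pow_left_inj₀ (hpos z hz).le (hpos w hw).le two_ne_zero).1 (by linarith)
  have himg : (fun z : ℝ => (y ^ 2 + κ ^ 2 - z ^ 2) / (2 * κ)) '' Ioo |y - κ| (y + κ)
      = Ioo (-y) y := by
    ext a
    simp only [mem_image, mem_Ioo]
    constructor
    · rintro ⟨z, hz, rfl⟩
      have hz0 := hpos z hz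
      have h1 : (y - κ) ^ 2 < z ^ 2 := by rw [← sq_abs (y - κ)]; exact pow_lt_pow_left₀ hz.1 (abs_nonneg _) two_ne_zero
      have h2 : z ^ 2 < (y + κ) ^ 2 := pow_lt_pow_left₀ hz.2 hz0.le two_ne_zero
      rw [lt_div_iff₀ (by positivity), div_lt_iff₀ (by positivity)]
      constructor <;> linarith
    · rintro ⟨h1, h2⟩
      have m1 := mul_lt_mul_of_pos_right h1 hκ
      have m2 := mul_lt_mul_of_pos_right h2 hκ
      have e1 : (y - κ) ^ 2 < y ^ 2 - 2 * a * κ + κ ^ 2 := by linarith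
      have e2 : y ^ 2 - 2 * a * κ + κ ^ 2 < (y + κ) ^ 2 := by linarith
      refine ⟨√(y ^ 2 - 2 * a * κ + κ ^ 2), ⟨?_, ?_⟩, ?_⟩
      · rw [← Real.sqrt_sq_eq_abs]
        exact Real.sqrt_lt_sqrt (sq_nonneg _) e1
      · exact (Real.sqrt_lt' (by positivity)).2 e2
      · rw [Real.sq_sqrt ((sq_nonneg _).trans e1.le)]
        field_simp
        ring
  rw [← himg, lintegral_image_eq_lintegral_abs_deriv_mul measurableSet_Ioo
    (f' := fun z => -(z / κ)) (fun z hz => ?_) hinj]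
  · refine setLIntegral_congr_fun measurableSet_Ioo fun z hz => ?_
    have hz0 := hpos z hz
    have e : y ^ 2 - 2 * ((y ^ 2 + κ ^ 2 - z ^ 2) / (2 * κ)) * κ + κ ^ 2 = z ^ 2 := by
      field_simp
      ring
    rw [e, Real.sqrt_sq hz0.le, abs_neg, abs_of_pos (by positivity)]
  · have h1 : HasDerivAt (fun z : ℝ => y ^ 2 + κ ^ 2 - z ^ 2) (-(2 * z)) z := by
      simpa using (hasDerivAt_pow 2 z).const_sub (y ^ 2 + κ ^ 2)
    refine ((h1.div_const (2 * κ)).congr_deriv ?_).hasDerivWithinAt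
    field_simp

/-- The integral of a function of the distances to the origin and to the point `κ e₁`. -/
theorem lintegral_bipolar_single {κ : ℝ} (hκ : 0 < κ) {G : ℝ × ℝ → ℝ≥0∞} (hG : Measurable G) :
    ∫⁻ p : E, G (‖p‖, ‖p - κ • EuclideanSpace.single (0 : Fin 3) (1 : ℝ)‖)
      = ENNReal.ofReal (2 * Real.pi) * ∫⁻ y in Ioi (0 : ℝ), ENNReal.ofReal y *
        ∫⁻ z in Ioo |y - κ| (y + κ), ENNReal.ofReal (z / κ) * G (y, z) := by
  set h : ℝ × (ℝ × ℝ) → ℝ≥0∞ := fun u => G (√(u.1 ^ 2 + (u.2.1 ^ 2 + u.2.2 ^ 2)),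
    √((u.1 - κ) ^ 2 + (u.2.1 ^ 2 + u.2.2 ^ 2))) with hh
  have hm : Measurable h := by fun_prop
  have hpres : MeasurePreserving (fun p : E => (p 0, (p 1, p 2))) := by
    have h1 := PiLp.volume_preserving_ofLp (Fin 3)
    have h2 := volume_preserving_piFinSuccAbove (fun _ : Fin 3 => ℝ) 0
    have h3 := (MeasurePreserving.id (volume : Measure ℝ)).prod (volume_preserving_finTwoArrow ℝ)
    exact h3.comp (h2.comp h1)
  have e1 : ∀ p : E, G (‖p‖, ‖p - κ • EuclideanSpace.single (0 : Fin 3) (1 : ℝ)‖)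
      = h (p 0, (p 1, p 2)) := by
    intro p
    simp only [hh, EuclideanSpace.norm_eq, Fin.sum_univ_three, Real.norm_eq_abs, sq_abs,
      PiLp.sub_apply, PiLp.smul_apply, PiLp.single_apply]
    simp [add_assoc]
  simp_rw [e1]
  rw [hpres.lintegral_comp hm, Measure.volume_eq_prod, lintegral_prod _ hm.aemeasurable]
  have e2 : ∀ a : ℝ, ∫⁻ w : ℝ × ℝ, h (a, w) = ENNReal.ofReal (2 * Real.pi) *
      ∫⁻ y in Ioi (0 : ℝ), {u : ℝ × ℝ | |u.1| < u.2}.indicator (fun u => ENNReal.ofReal u.2 *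
        G (u.2, √(u.2 ^ 2 - 2 * u.1 * κ + κ ^ 2))) (a, y) := by
    intro a
    have h1 : ∀ w : ℝ × ℝ, h (a, w) = (fun s => G (√(a ^ 2 + s), √((a - κ) ^ 2 + s)))
        (w.1 ^ 2 + w.2 ^ 2) := fun w => rfl
    simp_rw [h1]
    rw [lintegral_plane (f := fun s => G (√(a ^ 2 + s), √((a - κ) ^ 2 + s))) (by fun_prop)]
    have h2 : ∀ r : ℝ, G (√(a ^ 2 + r ^ 2), √((a - κ) ^ 2 + r ^ 2))
        = (fun y => G (y, √(y ^ 2 - 2 * a * κ + κ ^ 2))) √(a ^ 2 + r ^ 2) := by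
      intro r
      simp only
      rw [Real.sq_sqrt (by positivity)]
      congr 3
      ring
    simp_rw [h2]
    rw [lintegral_shift_sq a fun y => G (y, √(y ^ 2 - 2 * a * κ + κ ^ 2)),
      ← lintegral_indicator measurableSet_Ioi, ← lintegral_indicator measurableSet_Ioi]
    congr 1
    refine lintegral_congr fun y => ?_
    by_cases hy : |a| < y
    · have hy0 : 0 < y := (abs_nonneg a).trans_lt hy
      simp [indicator, hy, hy0]
    · simp [indicator, hy]
  simp_rw [e2]
  rw [lintegral_const_mul' _ _ ENNReal.ofReal_ne_top]
  congr 1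
  have hset : MeasurableSet {u : ℝ × ℝ | |u.1| < u.2} :=
    measurableSet_lt measurable_fst.abs measurable_snd
  have hmeas : Measurable ({u : ℝ × ℝ | |u.1| < u.2}.indicator (fun u => ENNReal.ofReal u.2 *
      G (u.2, √(u.2 ^ 2 - 2 * u.1 * κ + κ ^ 2)))) := by
    refine Measurable.indicator ?_ hset
    fun_prop
  rw [lintegral_lintegral_swap (f := fun a y => {u : ℝ × ℝ | |u.1| < u.2}.indicator
    (fun u => ENNReal.ofReal u.2 * G (u.2, √(u.2 ^ 2 - 2 * u.1 * κ + κ ^ 2))) (a, y))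
    hmeas.aemeasurable]
  refine setLIntegral_congr_fun measurableSet_Ioi fun y hy => ?_
  have hy0 : 0 < y := hy
  rw [← lintegral_law_of_cosines hκ hy0 fun z => G (y, z),
    ← lintegral_const_mul' _ _ ENNReal.ofReal_ne_top, ← lintegral_indicator measurableSet_Ioo]
  refine lintegral_congr fun a => ?_
  by_cases ha : |a| < y
  · simp [indicator, ha, abs_lt.1 ha]
  · have : ¬(-y < a ∧ a < y) := fun h => ha (abs_lt.2 h)
    simp [indicator, ha, this]

/-- The integral of a function of the distances to the origin and to another point. -/
theorem lintegral_bipolar {k : E} (hk : k ≠ 0) {G : ℝ × ℝ → ℝ≥0∞} (hG : Measurable G) :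
    ∫⁻ p : E, G (‖p‖, ‖p - k‖)
      = ENNReal.ofReal (2 * Real.pi) * ∫⁻ y in Ioi (0 : ℝ), ENNReal.ofReal y *
        ∫⁻ z in Ioo |y - ‖k‖| (y + ‖k‖), ENNReal.ofReal (z / ‖k‖) * G (y, z) := by
  have hk0 : 0 < ‖k‖ := norm_pos_iff.2 hk
  have h : ‖k‖ = ‖‖k‖ • EuclideanSpace.single (0 : Fin 3) (1 : ℝ)‖ := by
    rw [norm_smul]; simp
  have hR := Submodule.reflection_sub h
  set R := ((ℝ ∙ (k - ‖k‖ • EuclideanSpace.single (0 : Fin 3) (1 : ℝ)))ᗮ).reflection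
  have e := (LinearIsometryEquiv.measurePreserving R).lintegral_comp (f := fun p : E =>
    G (‖p‖, ‖p - ‖k‖ • EuclideanSpace.single (0 : Fin 3) (1 : ℝ)‖)) (by fun_prop)
  rw [← lintegral_bipolar_single hk0 hG, ← e]
  refine lintegral_congr fun p => ?_
  rw [LinearIsometryEquiv.norm_map, ← hR, ← map_sub, LinearIsometryEquiv.norm_map]

/-! ### Windows around a level of a function with finitely many stationary points -/

section

variable {w w' : ℝ → ℝ} {Z : Finset ℝ}

/-- On a stretch between two consecutive stationary points, the function takes no value twice. -/
theorem injOn_stretch (hd : ∀ t, 0 < t → HasDerivAt w (w' t) t)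
    (hZ : ∀ t, 0 < t → w' t = 0 → t ∈ Z) (i : ℕ) :
    InjOn w {t | 0 < t ∧ (Z.filter (· < t)).card = i} := by
  have key : ∀ x y, 0 < x → x < y → w x = w y →
      (Z.filter (· < x)).card < (Z.filter (· < y)).card := by
    intro x y hx hxy h
    obtain ⟨c, hc, h0⟩ := exists_hasDerivAt_eq_zero hxy
      (fun t ht => (hd t (hx.trans_le ht.1)).continuousAt.continuousWithinAt) h
      fun t ht => hd t (hx.trans ht.1)
    refine Finset.card_lt_card (Finset.ssubset_iff_of_subset ?_ |>.2 ⟨c, ?_, ?_⟩)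
    · intro t ht
      rw [Finset.mem_filter] at ht ⊢
      exact ⟨ht.1, ht.2.trans hxy⟩
    · exact Finset.mem_filter.2 ⟨hZ c (hx.trans hc.1) h0, hc.2⟩
    · intro hc'
      exact absurd (Finset.mem_filter.1 hc').2 (not_lt.2 hc.1.le)
  rintro x ⟨hx, hi⟩ y ⟨hy, hj⟩ h
  rcases lt_trichotomy x y with hxy | hxy | hxy
  · have := key x y hx hxy h; omega
  · exact hxy
  · have := key y x hy hxy h.symm; omega

/-- By Rolle's theorem, at most one point of the level lies between two consecutive stationary
points. -/
theorem finite_level (hd : ∀ t, 0 < t → HasDerivAt w (w' t) t)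
    (hZ : ∀ t, 0 < t → w' t = 0 → t ∈ Z) (c : ℝ) : {t | 0 < t ∧ w t = c}.Finite := by
  refine Set.Finite.of_injOn (f := fun t => (Z.filter (· < t)).card)
    (t := ↑(Finset.range (Z.card + 1))) (fun t _ => ?_) ?_ (Finset.finite_toSet _)
  · simpa using Nat.lt_succ_of_le (Finset.card_filter_le Z (· < t))
  · intro x hx y hy h
    exact injOn_stretch hd hZ _ ⟨hx.1, rfl⟩ ⟨hy.1, h.symm⟩ (hx.2.trans hy.2.symm)

/-- The variation of a function within a window is bounded by the width of the window, times the
number of stretches. -/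
theorem lintegral_abs_deriv_window_le (hw : Continuous w)
    (hd : ∀ t, 0 < t → HasDerivAt w (w' t) t) (hZ : ∀ t, 0 < t → w' t = 0 → t ∈ Z) (c η : ℝ) :
    ∫⁻ z in {z | 0 < z ∧ |w z - c| < η}, ENNReal.ofReal |w' z|
      ≤ (Z.card + 1) * ENNReal.ofReal (2 * η) := by
  set P : Fin (Z.card + 1) → Set ℝ := fun i =>
    {t | 0 < t ∧ (Z.filter (· < t)).card = i} ∩ {z | |w z - c| < η} with hP
  have hcover : {z | 0 < z ∧ |w z - c| < η} ⊆ ⋃ i, P i := by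
    rintro z ⟨hz, hz'⟩
    exact mem_iUnion.2 ⟨⟨(Z.filter (· < z)).card, Nat.lt_succ_of_le (Finset.card_filter_le _ _)⟩,
      ⟨hz, rfl⟩, hz'⟩
  have hwin : MeasurableSet {z | |w z - c| < η} :=
    measurableSet_lt (hw.measurable.sub_const c).abs measurable_const
  have hmeas : ∀ i, MeasurableSet (P i) := by
    intro i
    have hmono : Monotone fun t : ℝ => (Z.filter (· < t)).card := fun s t hst =>
      Finset.card_le_card fun x hx => by
        rw [Finset.mem_filter] at hx ⊢
        exact ⟨hx.1, hx.2.trans_le hst⟩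
    have h1 : ((fun t : ℝ => (Z.filter (· < t)).card) ⁻¹' {(i : ℕ)}).OrdConnected :=
      Set.ordConnected_singleton.preimage_mono hmono
    exact ((measurableSet_Ioi (a := (0 : ℝ))).inter h1.measurableSet).inter hwin
  have hone : ∀ i, ∫⁻ z in P i, ENNReal.ofReal |w' z| ≤ ENNReal.ofReal (2 * η) := by
    intro i
    have h := lintegral_image_eq_lintegral_abs_deriv_mul (hmeas i)
      (fun x hx => (hd x hx.1.1).hasDerivWithinAt)
      ((injOn_stretch hd hZ i).mono inter_subset_left) (fun _ => 1)
    simp only [mul_one, setLIntegral_one] at h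
    rw [← h]
    calc volume (w '' P i) ≤ volume (Ioo (c - η) (c + η)) := by
          refine measure_mono ?_
          rintro _ ⟨z, hz, rfl⟩
          have hz2 : |w z - c| < η := hz.2
          have := abs_lt.1 hz2
          exact ⟨by linarith, by linarith⟩
      _ = ENNReal.ofReal (2 * η) := by
          rw [Real.volume_Ioo]
          congr 1
          ring
  calc _ ≤ ∫⁻ z in ⋃ i, P i, ENNReal.ofReal |w' z| := lintegral_mono_set hcover
    _ ≤ ∑' i, ∫⁻ z in P i, ENNReal.ofReal |w' z| := lintegral_iUnion_le _ _
    _ = ∑ i, ∫⁻ z in P i, ENNReal.ofReal |w' z| := tsum_fintype _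
    _ ≤ ∑ _i : Fin (Z.card + 1), ENNReal.ofReal (2 * η) := Finset.sum_le_sum fun i _ => hone i
    _ = _ := by simp

end

/-- The contribution of a transversal crossing of a level; only one-sided limits of the integrand
are needed. -/
theorem exists_tendsto_window_crossing {w f : ℝ → ℝ} {a d M c₀ lr ll : ℝ} {U : Set ℝ}
    (hw : Measurable w) (hda : HasDerivAt w d a) (hf : Measurable f) (hM : ∀ z, |f z| ≤ M)
    (hr : Tendsto f (𝓝[>] a) (𝓝 lr)) (hl : Tendsto f (𝓝[<] a) (𝓝 ll))
    (hUm : MeasurableSet U) (hU : U ∈ 𝓝 a) (hc : 0 < c₀)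
    (hUc : ∀ z ∈ U, c₀ * |z - a| ≤ |w z - w a|) (hd : d ≠ 0) :
    ∃ l, Tendsto (fun η : ℝ => (2 * η)⁻¹ * ∫ z in U ∩ {z | |w z - w a| < η}, f z) (𝓝[>] 0)
      (𝓝 l) := by
  set S : ℝ → Set ℝ := fun η => U ∩ {z | |w z - w a| < η} with hS
  have hSm : ∀ η, MeasurableSet (S η) := fun η =>
    hUm.inter (measurableSet_lt (hw.sub_const _).abs measurable_const)
  -- rescale the variable by the width of the window
  have hscale : ∀ η : ℝ, 0 < η → (2 * η)⁻¹ * ∫ z in S η, f z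
      = ∫ s : ℝ, 2⁻¹ * (S η).indicator f (a + η * s) := by
    intro η hη
    have h1 := Measure.integral_comp_mul_left (fun z => (S η).indicator f (a + z)) η
    rw [integral_const_mul, h1, integral_add_left_eq_self, integral_indicator (hSm η),
      abs_of_pos (inv_pos.2 hη), smul_eq_mul, mul_inv, mul_assoc]
  refine ⟨∫ s : ℝ, 2⁻¹ * {s : ℝ | |d * s| < 1}.indicator (fun s => if 0 < s then lr else ll) s, ?_⟩
  have key : Tendsto (fun η : ℝ => ∫ s : ℝ, 2⁻¹ * (S η).indicator f (a + η * s)) (𝓝[>] 0)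
      (𝓝 (∫ s : ℝ, 2⁻¹ * {s : ℝ | |d * s| < 1}.indicator
        (fun s => if 0 < s then lr else ll) s)) := by
    refine tendsto_integral_filter_of_dominated_convergence
      ((Icc (-c₀⁻¹) c₀⁻¹).indicator fun _ => 2⁻¹ * M) ?_ ?_ ?_ ?_
    · exact Eventually.of_forall fun η => Measurable.aestronglyMeasurable
        (((hf.indicator (hSm η)).comp (by fun_prop)).const_mul _)
    · filter_upwards [self_mem_nhdsWithin] with η hη
      have hη : 0 < η := hη
      refine Eventually.of_forall fun s => ?_
      by_cases hs : a + η * s ∈ S η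
      · have h1 := (hUc _ hs.1).trans hs.2.le
        rw [add_sub_cancel_left, abs_mul, abs_of_pos hη] at h1
        have h2 : |s| ≤ c₀⁻¹ := by
          rw [← one_div, le_div_iff₀ hc]
          refine le_of_mul_le_mul_left ?_ hη
          linarith
        rw [indicator_of_mem hs, indicator_of_mem (show s ∈ Icc (-c₀⁻¹) c₀⁻¹ from abs_le.1 h2), norm_mul,
          Real.norm_of_nonneg (by norm_num : (0 : ℝ) ≤ 2⁻¹)]
        exact mul_le_mul_of_nonneg_left (hM _) (by norm_num)
      · rw [indicator_of_notMem hs, mul_zero, norm_zero]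
        have hM0 : 0 ≤ M := (abs_nonneg _).trans (hM 0)
        exact indicator_nonneg (fun _ _ => by positivity) _
    · exact (integrable_indicator_iff measurableSet_Icc).2 (integrableOn_const (by simp) enorm_ne_top)
    · filter_upwards [Measure.ae_ne volume (0 : ℝ), Measure.ae_ne volume (1 / d),
        Measure.ae_ne volume (-(1 / d))] with s h0 h1 h2
      refine Tendsto.const_mul _ ?_
      have hlin : HasDerivAt (fun η : ℝ => a + η * s) s 0 := by
        simpa using ((hasDerivAt_id (0 : ℝ)).mul_const s).const_add a
      have ha0 : a + 0 * s = a := by ring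
      have hdq : Tendsto (fun η : ℝ => |η⁻¹ * (w (a + η * s) - w a)|) (𝓝[>] 0) (𝓝 |d * s|) := by
        have hda' : HasDerivAt w d (a + 0 * s) := by rwa [ha0]
        have := (hda'.comp (0 : ℝ) hlin).tendsto_slope_zero_right
        simp only [Function.comp_apply, zero_add, smul_eq_mul, zero_mul, add_zero] at this
        exact this.abs
      have hta : Tendsto (fun η : ℝ => a + η * s) (𝓝[>] 0) (𝓝 a) := by
        have := hlin.continuousAt.tendsto
        rw [ha0] at this
        exact this.mono_left nhdsWithin_le_nhds
      have hmem : ∀ η : ℝ, 0 < η → (|w (a + η * s) - w a| < η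
          ↔ |η⁻¹ * (w (a + η * s) - w a)| < 1) := by
        intro η hη
        rw [abs_mul, abs_of_pos (inv_pos.2 hη), inv_mul_lt_iff₀ hη, mul_one]
      have hne : |d * s| ≠ 1 := by
        intro h
        rcases eq_or_eq_neg_of_abs_eq h with h | h
        · exact h1 (by rw [eq_div_iff hd, mul_comm, h])
        · exact h2 (by rw [← neg_div, eq_div_iff hd, mul_comm, h])
      rcases lt_or_gt_of_ne hne with hlt | hgt
      · rw [indicator_of_mem (show s ∈ {s : ℝ | |d * s| < 1} from hlt)]
        have hf' : Tendsto (fun η : ℝ => f (a + η * s)) (𝓝[>] 0)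
            (𝓝 (if 0 < s then lr else ll)) := by
          rcases lt_or_gt_of_ne h0 with hs | hs
          · rw [if_neg hs.not_gt]
            refine hl.comp (tendsto_nhdsWithin_iff.2 ⟨hta, ?_⟩)
            filter_upwards [self_mem_nhdsWithin] with η hη
            have := mul_neg_of_pos_of_neg hη hs
            exact show a + η * s < a by linarith
          · rw [if_pos hs]
            refine hr.comp (tendsto_nhdsWithin_iff.2 ⟨hta, ?_⟩)
            filter_upwards [self_mem_nhdsWithin] with η hη
            have := mul_pos hη hs
            exact show a < a + η * s by linarith
        refine hf'.congr' ?_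
        filter_upwards [self_mem_nhdsWithin, hdq.eventually_lt_const hlt,
          hta.eventually hU] with η hη h3 h4
        rw [indicator_of_mem]
        exact ⟨h4, (hmem η hη).2 h3⟩
      · rw [indicator_of_notMem (show s ∉ {s : ℝ | |d * s| < 1} from not_lt.2 hgt.le)]
        refine tendsto_const_nhds.congr' ?_
        filter_upwards [self_mem_nhdsWithin, hdq.eventually_const_lt hgt] with η hη h3
        rw [indicator_of_notMem]
        exact fun h => absurd ((hmem η hη).1 h.2) (not_lt.2 h3.le)
  refine key.congr' ?_
  filter_upwards [self_mem_nhdsWithin] with η hη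
  exact (hscale η hη).symm

theorem exists_nhds_le_abs_sub {w : ℝ → ℝ} {a d : ℝ} (hda : HasDerivAt w d a) (hd : d ≠ 0) :
    ∀ᶠ z in 𝓝 a, |d| / 2 * |z - a| ≤ |w z - w a| := by
  have hd' := abs_pos.2 hd
  filter_upwards [(hasDerivAt_iff_isLittleO.1 hda).def (half_pos hd')] with z hz
  simp only [smul_eq_mul, Real.norm_eq_abs] at hz
  have h1 := abs_sub_abs_le_abs_sub ((z - a) * d) (w z - w a)
  rw [abs_sub_comm (w z - w a)] at hz
  rw [abs_mul] at h1
  linarith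

/-- The window limit over a compact interval on which the level is crossed transversally. -/
theorem exists_tendsto_window_Icc {w w' f : ℝ → ℝ} {A B c : ℝ} (hAB : A < B) (hw : Continuous w)
    (hd : ∀ z ∈ Icc A B, HasDerivAt w (w' z) z) (hf : Measurable f) (hfc : ContinuousOn f (Icc A B))
    (hfin : {z | z ∈ Icc A B ∧ w z = c}.Finite)
    (hreg : ∀ z ∈ Icc A B, w z = c → w' z ≠ 0) :
    ∃ l, Tendsto (fun η : ℝ => (2 * η)⁻¹ * ∫ z in Icc A B ∩ {z | |w z - c| < η}, f z) (𝓝[>] 0)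
      (𝓝 l) := by
  set F := (Icc A B).indicator f with hF
  have hFm : Measurable F := hf.indicator measurableSet_Icc
  obtain ⟨M, hM⟩ := isCompact_Icc.exists_bound_of_continuousOn hfc
  have hM0 : 0 ≤ M := (norm_nonneg _).trans (hM A ⟨le_rfl, hAB.le⟩)
  have hFM : ∀ z, |F z| ≤ M := by
    intro z
    by_cases hz : z ∈ Icc A B
    · rw [hF, indicator_of_mem hz]; exact hM z hz
    · rw [hF, indicator_of_notMem hz, abs_zero]; exact hM0
  have hFi : Integrable F := by
    rw [hF, integrable_indicator_iff measurableSet_Icc]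
    exact hfc.integrableOn_Icc
  -- a crossing may lie at an endpoint, where the truncated integrand jumps to zero
  have hright : ∀ a ∈ Icc A B, ∃ l, Tendsto F (𝓝[>] a) (𝓝 l) := by
    intro a ha
    rcases ha.2.lt_or_eq with h | h
    · refine ⟨f a, ((hfc a ha).mono_left ?_).congr' ?_⟩
      · rw [← nhdsWithin_Ioc_eq_nhdsGT h]
        exact nhdsWithin_mono _ fun z hz => ⟨ha.1.trans hz.1.le, hz.2⟩
      · filter_upwards [Ioc_mem_nhdsGT h] with z hz
        rw [hF, indicator_of_mem (show z ∈ Icc A B from ⟨ha.1.trans hz.1.le, hz.2⟩)]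
    · refine ⟨0, tendsto_const_nhds.congr' ?_⟩
      filter_upwards [self_mem_nhdsWithin] with z hz
      have hz : a < z := hz
      rw [hF, indicator_of_notMem fun h' : z ∈ Icc A B => absurd h'.2 (by linarith)]
  have hleft : ∀ a ∈ Icc A B, ∃ l, Tendsto F (𝓝[<] a) (𝓝 l) := by
    intro a ha
    rcases ha.1.lt_or_eq with h | h
    · refine ⟨f a, ((hfc a ha).mono_left ?_).congr' ?_⟩
      · rw [← nhdsWithin_Ico_eq_nhdsLT h]
        exact nhdsWithin_mono _ fun z hz => ⟨hz.1, hz.2.le.trans ha.2⟩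
      · filter_upwards [Ico_mem_nhdsLT h] with z hz
        rw [hF, indicator_of_mem (show z ∈ Icc A B from ⟨hz.1, hz.2.le.trans ha.2⟩)]
    · refine ⟨0, tendsto_const_nhds.congr' ?_⟩
      filter_upwards [self_mem_nhdsWithin] with z hz
      have hz : z < a := hz
      rw [hF, indicator_of_notMem fun h' : z ∈ Icc A B => absurd h'.1 (by linarith)]
  obtain ⟨U, hU, hUd⟩ := hfin.t2_separation
  set T := hfin.toFinset with hT
  have hTmem : ∀ a, a ∈ T ↔ a ∈ Icc A B ∧ w a = c := fun a => by simp [hT]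
  have hW : ∀ a, ∃ W : Set ℝ, a ∈ T → a ∈ W ∧ IsOpen W ∧ W ⊆ U a ∧
      ∀ z ∈ W, |w' a| / 2 * |z - a| ≤ |w z - w a| := by
    intro a
    by_cases ha : a ∈ T
    · obtain ⟨h1, h2⟩ := (hTmem a).1 ha
      obtain ⟨W, hW1, hW2, hW3⟩ := eventually_nhds_iff.1
        (exists_nhds_le_abs_sub (hd a h1) (hreg a h1 h2))
      exact ⟨W ∩ U a, fun _ => ⟨⟨hW3, (hU a).1⟩, hW2.inter (hU a).2, inter_subset_right,
        fun z hz => hW1 z hz.1⟩⟩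
    · exact ⟨∅, fun h => absurd h ha⟩
  choose W hW using hW
  have hlim : ∀ a, ∃ l, a ∈ T → Tendsto (fun η : ℝ => (2 * η)⁻¹ *
      ∫ z in W a ∩ {z | |w z - c| < η}, F z) (𝓝[>] 0) (𝓝 l) := by
    intro a
    by_cases ha : a ∈ T
    · obtain ⟨h1, h2⟩ := (hTmem a).1 ha
      obtain ⟨g1, g2, -, g4⟩ := hW a ha
      obtain ⟨lr, hlr⟩ := hright a h1
      obtain ⟨ll, hll⟩ := hleft a h1
      have h3 := hreg a h1 h2
      obtain ⟨l, hl⟩ := exists_tendsto_window_crossing hw.measurable (hd a h1) hFm hFM hlr hll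
        g2.measurableSet (g2.mem_nhds g1) (half_pos (abs_pos.2 h3)) g4 h3
      rw [h2] at hl
      exact ⟨l, fun _ => hl⟩
    · exact ⟨0, fun h => absurd h ha⟩
  choose l hl using hlim
  refine ⟨∑ a ∈ T, l a, (tendsto_finsetSum T fun a ha => hl a ha).congr' ?_⟩
  -- away from the crossings the function keeps a distance from the level
  have hK : IsCompact (Icc A B \ ⋃ a ∈ T, W a) :=
    isCompact_Icc.diff (isOpen_biUnion fun a ha => (hW a ha).2.1)
  obtain ⟨η₁, hη₁, hmin⟩ := hK.exists_forall_le' (f := fun z => |w z - c|)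
    (hw.sub continuous_const).abs.continuousOn (a := 0) (by
      rintro z ⟨hz, hz'⟩
      refine abs_pos.2 (sub_ne_zero.2 fun h => hz' ?_)
      have hzT := (hTmem z).2 ⟨hz, h⟩
      exact mem_biUnion hzT (hW z hzT).1)
  have hwin : ∀ η, MeasurableSet {z | |w z - c| < η} := fun η =>
    measurableSet_lt (hw.measurable.sub_const c).abs measurable_const
  filter_upwards [self_mem_nhdsWithin, (nhdsWithin_le_nhds (Iio_mem_nhds hη₁) : Iio η₁ ∈ 𝓝[>] (0 : ℝ))]
    with η hη hη'
  have hη' : η < η₁ := hη'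
  rw [← Finset.mul_sum, ← integral_biUnion_finset T (fun a ha => (hW a ha).2.1.measurableSet.inter
    (hwin η)) ?_ fun a _ => hFi.integrableOn]
  · congr 1
    rw [inter_comm (Icc A B), ← setIntegral_indicator measurableSet_Icc]
    refine (setIntegral_eq_of_subset_of_forall_sdiff_eq_zero (hwin η) ?_ ?_).symm
    · exact iUnion₂_subset fun a _ => inter_subset_right
    · rintro z ⟨hz, hz'⟩
      refine indicator_of_notMem (fun hzI => ?_) _
      by_cases h : z ∈ ⋃ a ∈ T, W a
      · obtain ⟨a, ha, hza⟩ := mem_iUnion₂.1 h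
        exact hz' (mem_biUnion ha ⟨hza, hz⟩)
      · exact absurd (hmin z ⟨hzI, h⟩) (not_le.2 (lt_trans hz hη'))
  · intro a ha b hb hab
    have := hUd ((hTmem a).1 ha) ((hTmem b).1 hb) hab
    exact this.mono (inter_subset_left.trans (hW a ha).2.2.1)
      (inter_subset_left.trans (hW b hb).2.2.1)

/-! ### Integration over the energy shell by slices -/

/-- The values of `(‖p‖, ‖p - k‖)` for `‖k‖ = κ`, up to a null set: the two lengths and `κ` satisfy
the strict triangle inequalities. -/
def triangleRegion (κ : ℝ) : Set (ℝ × ℝ) :=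
  {u | 0 < u.1 ∧ |u.1 - κ| < u.2 ∧ u.2 < u.1 + κ}

theorem measurableSet_triangleRegion (κ : ℝ) : MeasurableSet (triangleRegion κ) :=
  (measurableSet_lt measurable_const measurable_fst).inter
    ((measurableSet_lt (measurable_fst.sub_const κ).abs measurable_snd).inter
      (measurableSet_lt measurable_snd (measurable_fst.add_const κ)))

theorem swap_mem_triangleRegion {κ : ℝ} {u : ℝ × ℝ} :
    u.swap ∈ triangleRegion κ ↔ u ∈ triangleRegion κ := by
  simp only [triangleRegion, mem_ofPred_eq, Prod.fst_swap, Prod.snd_swap, abs_lt]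
  constructor <;> rintro ⟨h1, ⟨h2, h3⟩, h4⟩ <;> refine ⟨?_, ⟨?_, ?_⟩, ?_⟩ <;> linarith

theorem mem_triangleRegion_snd_pos {κ : ℝ} {u : ℝ × ℝ} (h : u ∈ triangleRegion κ) : 0 < u.2 :=
  (abs_nonneg _).trans_lt h.2.1

theorem lintegral_triangleRegion {k : E} (hk : k ≠ 0) {G : ℝ × ℝ → ℝ} (hG : Measurable G) :
    ∫⁻ p : E, ENNReal.ofReal (G (‖p‖, ‖p - k‖)) = ENNReal.ofReal (2 * Real.pi / ‖k‖) *
      ∫⁻ u : ℝ × ℝ, ENNReal.ofReal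
        ((triangleRegion ‖k‖).indicator (fun u => u.1 * u.2 * G u) u) := by
  have hk0 : 0 < ‖k‖ := norm_pos_iff.2 hk
  have hm : Measurable ((triangleRegion ‖k‖).indicator (fun u => u.1 * u.2 * G u)) :=
    Measurable.indicator (by fun_prop) (measurableSet_triangleRegion _)
  have e : ENNReal.ofReal (2 * Real.pi / ‖k‖)
      = ENNReal.ofReal (2 * Real.pi) * ENNReal.ofReal ‖k‖⁻¹ := by
    rw [div_eq_mul_inv, ENNReal.ofReal_mul (by positivity)]
  rw [lintegral_bipolar hk (G := fun u => ENNReal.ofReal (G u)) (by fun_prop),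
    Measure.volume_eq_prod, lintegral_prod _ hm.ennreal_ofReal.aemeasurable, e, mul_assoc]
  congr 1
  rw [← lintegral_const_mul' _ _ ENNReal.ofReal_ne_top, ← lintegral_indicator measurableSet_Ioi]
  refine lintegral_congr fun y => ?_
  rw [← lintegral_const_mul' _ _ ENNReal.ofReal_ne_top]
  by_cases hy : 0 < y
  · rw [indicator_of_mem (show y ∈ Ioi (0 : ℝ) from hy),
      ← lintegral_const_mul' _ _ ENNReal.ofReal_ne_top, ← lintegral_indicator measurableSet_Ioo]
    refine lintegral_congr fun z => ?_
    by_cases hz : z ∈ Ioo |y - ‖k‖| (y + ‖k‖)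
    · have hz0 : 0 < z := (abs_nonneg _).trans_lt hz.1
      rw [indicator_of_mem hz, indicator_of_mem (show (y, z) ∈ triangleRegion ‖k‖ from ⟨hy, hz⟩),
        ← ENNReal.ofReal_mul (by positivity), ← ENNReal.ofReal_mul (by positivity),
        ← ENNReal.ofReal_mul (by positivity)]
      congr 1
      ring
    · rw [indicator_of_notMem hz, indicator_of_notMem fun h : (y, z) ∈ triangleRegion ‖k‖ => hz h.2]
      simp
  · rw [indicator_of_notMem (show y ∉ Ioi (0 : ℝ) from hy)]
    simp only [triangleRegion, indicator, mem_ofPred_eq, hy, false_and, if_false]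
    simp

theorem integral_triangleRegion {k : E} (hk : k ≠ 0) {G : ℝ × ℝ → ℝ} (hG : Measurable G)
    (h0 : ∀ u, 0 ≤ G u) (hint : Integrable fun p : E => G (‖p‖, ‖p - k‖)) :
    Integrable ((triangleRegion ‖k‖).indicator fun u => u.1 * u.2 * G u) ∧
      ∫ p : E, G (‖p‖, ‖p - k‖) = 2 * Real.pi / ‖k‖ *
        ∫ u, (triangleRegion ‖k‖).indicator (fun u => u.1 * u.2 * G u) u := by
  have hk0 : 0 < ‖k‖ := norm_pos_iff.2 hk
  have hπ := Real.pi_pos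
  have hm : Measurable ((triangleRegion ‖k‖).indicator (fun u => u.1 * u.2 * G u)) :=
    Measurable.indicator (by fun_prop) (measurableSet_triangleRegion _)
  have hnn : ∀ u, 0 ≤ (triangleRegion ‖k‖).indicator (fun u => u.1 * u.2 * G u) u := fun u =>
    indicator_nonneg (fun u hu => mul_nonneg
      (mul_nonneg hu.1.le (mem_triangleRegion_snd_pos hu).le) (h0 u)) u
  have e := lintegral_triangleRegion hk hG
  constructor
  · refine ⟨hm.aestronglyMeasurable, (hasFiniteIntegral_iff_ofReal (Eventually.of_forall hnn)).2 ?_⟩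
    have h1 := (hasFiniteIntegral_iff_ofReal (Eventually.of_forall fun p : E =>
      h0 (‖p‖, ‖p - k‖))).1 hint.2
    rw [e] at h1
    refine (ENNReal.mul_lt_top_iff.1 h1).elim (fun h => h.2) ?_
    rintro (h | h)
    · exact absurd (ENNReal.ofReal_eq_zero.1 h) (not_le.2 (by positivity))
    · rw [h]; exact ENNReal.zero_lt_top
  · rw [integral_eq_lintegral_of_nonneg_ae (Eventually.of_forall fun p : E => h0 (‖p‖, ‖p - k‖))
      hint.1, e, integral_eq_lintegral_of_nonneg_ae (Eventually.of_forall hnn)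
      hm.aestronglyMeasurable, ENNReal.toReal_mul, ENNReal.toReal_ofReal (by positivity)]

/-- The window limit of a double integral, if the window is cut out in the second variable and the
integrand is controlled by the derivative in that variable. -/
theorem exists_tendsto_slices {w w' : ℝ → ℝ} {Z : Finset ℝ} (hw : Continuous w)
    (hd : ∀ t, 0 < t → HasDerivAt w (w' t) t) (hZ : ∀ t, 0 < t → w' t = 0 → t ∈ Z) {κ : ℝ}
    (hκ : 0 < κ) {c : ℝ → ℝ} (hc : Measurable c) {H : ℝ × ℝ → ℝ} (hH : Measurable H) {Y : Set ℝ}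
    (hY : Y.Finite) (hcont : ∀ y, 0 < y → y ∉ Y → ContinuousOn (fun z => H (y, z)) (Ioi 0))
    (hreg : ∀ y, 0 < y → y ∉ Y → ∀ z, 0 < z → w z = c y → w' z ≠ 0) {B : ℝ → ℝ}
    (hB : IntegrableOn B (Ioi 0)) (hB0 : ∀ y, 0 < y → 0 ≤ B y) {η₀ : ℝ} (hη₀ : 0 < η₀)
    (hbound : ∀ u ∈ triangleRegion κ, |w u.2 - c u.1| < η₀ → |H u| ≤ |w' u.2| * B u.1) :
    ∃ l, Tendsto (fun η : ℝ => (2 * η)⁻¹ * ∫ y in Ioi (0 : ℝ),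
      ∫ z in Ioo |y - κ| (y + κ) ∩ {z | |w z - c y| < η}, H (y, z)) (𝓝[>] 0) (𝓝 l) := by
  have hwin : ∀ y η, MeasurableSet {z | |w z - c y| < η} := fun y η =>
    measurableSet_lt (hw.measurable.sub_const _).abs measurable_const
  -- for almost every `y`, the slice crosses the level transversally in a compact interval
  have hslice : ∀ y, ∃ l, (0 < y ∧ y ∉ Y ∧ y ≠ κ) → Tendsto (fun η : ℝ => (2 * η)⁻¹ *
      ∫ z in Ioo |y - κ| (y + κ) ∩ {z | |w z - c y| < η}, H (y, z)) (𝓝[>] 0) (𝓝 l) := by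
    intro y
    by_cases hy : 0 < y ∧ y ∉ Y ∧ y ≠ κ
    · obtain ⟨hy0, hyY, hyκ⟩ := hy
      have hA : 0 < |y - κ| := abs_pos.2 (sub_ne_zero.2 hyκ)
      have hAB : |y - κ| < y + κ := abs_lt.2 ⟨by linarith, by linarith⟩
      have hpos : ∀ z ∈ Icc |y - κ| (y + κ), 0 < z := fun z hz => hA.trans_le hz.1
      obtain ⟨l, hl⟩ := exists_tendsto_window_Icc (c := c y) hAB hw (fun z hz => hd z (hpos z hz))
        (f := fun z => H (y, z)) (by fun_prop) ((hcont y hy0 hyY).mono fun z hz => hpos z hz)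
        ((finite_level hd hZ (c y)).subset fun z hz => ⟨hpos z hz.1, hz.2⟩)
        fun z hz => hreg y hy0 hyY z (hpos z hz)
      refine ⟨l, fun _ => hl.congr fun η => ?_⟩
      congr 1
      exact setIntegral_congr_set ((Ioo_ae_eq_Icc.symm).inter (ae_eq_refl _))
    · exact ⟨0, fun h => absurd h hy⟩
  choose l hl using hslice
  refine ⟨∫ y in Ioi (0 : ℝ), l y, ?_⟩
  suffices h : Tendsto (fun η : ℝ => ∫ y in Ioi (0 : ℝ), (2 * η)⁻¹ *
      ∫ z in Ioo |y - κ| (y + κ) ∩ {z | |w z - c y| < η}, H (y, z)) (𝓝[>] 0)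
      (𝓝 (∫ y in Ioi (0 : ℝ), l y)) from h.congr fun η => integral_const_mul _ _
  refine tendsto_integral_filter_of_dominated_convergence (fun y => (Z.card + 1) * B y)
    ?_ ?_ (hB.const_mul _) ?_
  · refine Eventually.of_forall fun η => ?_
    set S : Set (ℝ × ℝ) := {u | |u.1 - κ| < u.2 ∧ u.2 < u.1 + κ ∧ |w u.2 - c u.1| < η} with hS
    have hSm : MeasurableSet S :=
      (measurableSet_lt (measurable_fst.sub_const κ).abs measurable_snd).inter
        ((measurableSet_lt measurable_snd (measurable_fst.add_const κ)).inter
        (measurableSet_lt ((hw.measurable.comp measurable_snd).sub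
          (hc.comp measurable_fst)).abs measurable_const))
    have h1 : ∀ y, ∫ z in Ioo |y - κ| (y + κ) ∩ {z | |w z - c y| < η}, H (y, z)
        = ∫ z, S.indicator H (y, z) := by
      intro y
      rw [← integral_indicator (measurableSet_Ioo.inter (hwin y η))]
      refine integral_congr_ae (Eventually.of_forall fun z => ?_)
      simp only [indicator, hS, mem_inter_iff, mem_Ioo, mem_ofPred_eq, and_assoc]
    simp_rw [h1]
    exact ((hH.indicator hSm).stronglyMeasurable.integral_prod_right'.aestronglyMeasurable).const_mul _
  · filter_upwards [self_mem_nhdsWithin,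
      (nhdsWithin_le_nhds (Iio_mem_nhds hη₀) : Iio η₀ ∈ 𝓝[>] (0 : ℝ))] with η hη hη'
    have hη : 0 < η := hη
    have hη' : η < η₀ := hη'
    filter_upwards [ae_restrict_mem measurableSet_Ioi] with y hy
    have hy : 0 < y := hy
    have hBy := hB0 y hy
    have hset := measurableSet_Ioo.inter (hwin y η) (s₁ := Ioo |y - κ| (y + κ))
    -- uniformly in the window, since its variation is at most `(Z.card + 1) * 2η`
    have hle : ∫⁻ z in Ioo |y - κ| (y + κ) ∩ {z | |w z - c y| < η}, ENNReal.ofReal ‖H (y, z)‖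
        ≤ ENNReal.ofReal ((Z.card + 1) * (2 * η) * B y) := by
      calc _ ≤ ∫⁻ z in Ioo |y - κ| (y + κ) ∩ {z | |w z - c y| < η},
            ENNReal.ofReal |w' z| * ENNReal.ofReal (B y) := by
            refine setLIntegral_mono_ae' hset (Eventually.of_forall fun z hz => ?_)
            rw [← ENNReal.ofReal_mul (abs_nonneg _)]
            refine ENNReal.ofReal_le_ofReal (hbound (y, z) ⟨hy, hz.1⟩ ?_)
            exact lt_trans hz.2 hη'
        _ = (∫⁻ z in Ioo |y - κ| (y + κ) ∩ {z | |w z - c y| < η},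
            ENNReal.ofReal |w' z|) * ENNReal.ofReal (B y) :=
            lintegral_mul_const' _ _ ENNReal.ofReal_ne_top
        _ ≤ ((Z.card + 1) * ENNReal.ofReal (2 * η)) * ENNReal.ofReal (B y) := by
            refine mul_le_mul_left ((lintegral_mono_set fun z hz => ?_).trans
              (lintegral_abs_deriv_window_le hw hd hZ (c y) η)) _
            exact ⟨(abs_nonneg _).trans_lt hz.1.1, hz.2⟩
        _ = _ := by
            have hN : (Z.card + 1 : ENNReal) = ENNReal.ofReal (Z.card + 1) := by
              rw [ENNReal.ofReal_add (by positivity) zero_le_one, ENNReal.ofReal_natCast,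
                ENNReal.ofReal_one]
            rw [hN, ← ENNReal.ofReal_mul (by positivity), ← ENNReal.ofReal_mul (by positivity)]
    have h2 := (norm_integral_le_lintegral_norm (μ := volume.restrict
      (Ioo |y - κ| (y + κ) ∩ {z | |w z - c y| < η})) fun z => H (y, z)).trans
      (ENNReal.toReal_le_of_le_ofReal (by positivity) hle)
    rw [norm_mul, Real.norm_of_nonneg (by positivity : (0 : ℝ) ≤ (2 * η)⁻¹),
      inv_mul_le_iff₀ (by positivity)]
    linarith
  · have hYae : ∀ᵐ y : ℝ, y ∉ Y := measure_eq_zero_iff_ae_notMem.1 (hY.measure_zero volume)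
    filter_upwards [ae_restrict_mem measurableSet_Ioi, ae_restrict_of_ae hYae,
      ae_restrict_of_ae (Measure.ae_ne volume κ)] with y h1 h2 h3
    exact hl y ⟨h1, h2, h3⟩

theorem integral_slices {κ η : ℝ} {w c : ℝ → ℝ} {H : ℝ × ℝ → ℝ} (hw : Measurable w)
    (hint : Integrable ((triangleRegion κ ∩ {u | |w u.2 - c u.1| < η}).indicator H)) :
    ∫ u, (triangleRegion κ ∩ {u | |w u.2 - c u.1| < η}).indicator H u
      = ∫ y in Ioi (0 : ℝ), ∫ z in Ioo |y - κ| (y + κ) ∩ {z | |w z - c y| < η}, H (y, z) := by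
  rw [Measure.volume_eq_prod, integral_prod _ hint, ← integral_indicator measurableSet_Ioi]
  refine integral_congr_ae (Eventually.of_forall fun y => ?_)
  have hwin : MeasurableSet {z | |w z - c y| < η} :=
    measurableSet_lt (hw.sub_const _).abs measurable_const
  by_cases hy : 0 < y
  · rw [indicator_of_mem (show y ∈ Ioi (0 : ℝ) from hy),
      ← integral_indicator (measurableSet_Ioo.inter hwin)]
    refine integral_congr_ae (Eventually.of_forall fun z => ?_)
    simp only [indicator, triangleRegion, mem_inter_iff, mem_ofPred_eq, mem_Ioo, hy, true_and]
  · rw [indicator_of_notMem (show y ∉ Ioi (0 : ℝ) from hy)]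
    simp only [indicator, triangleRegion, mem_inter_iff, mem_ofPred_eq, hy, false_and, if_false]
    exact integral_zero _ _

/-- The window limit of a double integral over a shell `σ w(y) + w(z) = e` with `σ = ±1`. If the
gradient of the left-hand side does not degenerate on the shell, the integrand is the sum of a part
controlled by `w'(z)` and a part controlled by `w'(y)`, and these are treated by slices of constant
`y` and constant `z`. -/
theorem exists_tendsto_shell {w w' : ℝ → ℝ} {Z : Finset ℝ} (hw : Continuous w)
    (hd : ∀ t, 0 < t → HasDerivAt w (w' t) t) (hZ : ∀ t, 0 < t → w' t = 0 → t ∈ Z)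
    (hw'm : Measurable w') (hw'c : ContinuousOn w' (Ioi 0)) {κ : ℝ} (hκ : 0 < κ) {σ e : ℝ}
    (hσ : σ * σ = 1) {H : ℝ × ℝ → ℝ} (hH : Measurable H)
    (hHc : ContinuousOn H (Ioi 0 ×ˢ Ioi 0)) (hH0 : ∀ u ∈ triangleRegion κ, 0 ≤ H u)
    (hint : ∀ η, Integrable
      ((triangleRegion κ ∩ {u | |σ * w u.1 + w u.2 - e| < η}).indicator H)) {B : ℝ → ℝ}
    (hB : IntegrableOn B (Ioi 0)) (hB0 : ∀ y, 0 < y → 0 ≤ B y) {η₀ : ℝ} (hη₀ : 0 < η₀)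
    (hbound : ∀ u ∈ triangleRegion κ, |σ * w u.1 + w u.2 - e| < η₀ →
      0 < w' u.1 ^ 2 + w' u.2 ^ 2 ∧
      H u * |w' u.2| ≤ B u.1 * (w' u.1 ^ 2 + w' u.2 ^ 2) ∧
      H u * |w' u.1| ≤ B u.2 * (w' u.1 ^ 2 + w' u.2 ^ 2)) :
    ∃ l, Tendsto (fun η : ℝ => (2 * η)⁻¹ *
      ∫ u, (triangleRegion κ ∩ {u | |σ * w u.1 + w u.2 - e| < η}).indicator H u) (𝓝[>] 0)
      (𝓝 l) := by
  have hwm := hw.measurable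
  have hσ1 : |σ| = 1 := by
    have := abs_mul_abs_self σ
    rw [hσ] at this
    exact (mul_self_eq_one_iff.1 this).resolve_right fun h => by
      linarith [abs_nonneg σ]
  -- the part with the weight `w'(z)²`, sliced at constant `y`; excluded are those finitely many `y`
  -- which are stationary or for which the level is reached at a stationary `z`
  have key : ∀ K : ℝ × ℝ → ℝ, ∀ c : ℝ → ℝ, Measurable K → ContinuousOn K (Ioi 0 ×ˢ Ioi 0) →
      Measurable c → (∀ a, {y | 0 < y ∧ c y = a}.Finite) →
      (∀ u ∈ triangleRegion κ, |w u.2 - c u.1| < η₀ → 0 < w' u.1 ^ 2 + w' u.2 ^ 2 ∧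
        |K u| * |w' u.2| ≤ B u.1 * (w' u.1 ^ 2 + w' u.2 ^ 2)) →
      ∃ l, Tendsto (fun η : ℝ => (2 * η)⁻¹ * ∫ y in Ioi (0 : ℝ),
        ∫ z in Ioo |y - κ| (y + κ) ∩ {z | |w z - c y| < η},
          K (y, z) * (w' z ^ 2 / (w' y ^ 2 + w' z ^ 2))) (𝓝[>] 0) (𝓝 l) := by
    intro K c hK hKc hc hlev hb
    refine exists_tendsto_slices hw hd hZ hκ hc
      (H := fun u => K u * (w' u.2 ^ 2 / (w' u.1 ^ 2 + w' u.2 ^ 2))) (by fun_prop)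
      (Y := ↑Z ∪ ⋃ z ∈ Z, {y | 0 < y ∧ c y = w z})
      ((Finset.finite_toSet Z).union (Z.finite_toSet.biUnion fun z _ => hlev _)) ?_ ?_ hB hB0 hη₀ ?_
    · intro y hy hyY
      have hy' : w' y ≠ 0 := fun h => hyY (Or.inl (hZ y hy h))
      change ContinuousOn (fun z => K (y, z) * (w' z ^ 2 / (w' y ^ 2 + w' z ^ 2))) (Ioi 0)
      refine ContinuousOn.mul (hKc.comp (by fun_prop) fun z hz => ⟨hy, hz⟩)
        (ContinuousOn.div (by fun_prop) (by fun_prop) fun z _ => ?_)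
      have := sq_nonneg (w' z)
      have : 0 < w' y ^ 2 := by positivity
      linarith
    · intro y hy hyY z hz h h'
      exact hyY (Or.inr (mem_biUnion (hZ z hz h') ⟨hy, h.symm⟩))
    · intro u hu hwu
      obtain ⟨h1, h2⟩ := hb u hu hwu
      rw [abs_mul, abs_of_nonneg (by positivity : 0 ≤ w' u.2 ^ 2 / (w' u.1 ^ 2 + w' u.2 ^ 2)),
        mul_div_assoc', div_le_iff₀ h1]
      calc |K u| * w' u.2 ^ 2 = |K u| * |w' u.2| * |w' u.2| := by rw [← sq_abs]; ring
        _ ≤ B u.1 * (w' u.1 ^ 2 + w' u.2 ^ 2) * |w' u.2| :=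
          mul_le_mul_of_nonneg_right h2 (abs_nonneg _)
        _ = _ := by ring
  have hwin1 : ∀ y z, σ * w y + w z - e = w z - (e - σ * w y) := fun y z => by ring
  have hwin2 : ∀ y z, |σ * w y + w z - e| = |w y - σ * (e - w z)| := by
    intro y z
    rw [← one_mul |w y - σ * (e - w z)|, ← hσ1, ← abs_mul]
    congr 1
    rw [mul_sub, ← mul_assoc σ σ, hσ]
    ring
  have lev : ∀ a b, {y | 0 < y ∧ a - σ * w y = b}.Finite := fun a b =>
    (finite_level hd hZ (σ * (a - b))).subset fun y hy => ⟨hy.1, by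
      rw [← hy.2, sub_sub_cancel, ← mul_assoc, hσ, one_mul]⟩
  obtain ⟨l₁, h₁⟩ := key H (fun y => e - σ * w y) hH hHc (by fun_prop) (fun a => lev e a)
    fun u hu hwu => by
      obtain ⟨a1, a2, -⟩ := hbound u hu (by rwa [hwin1])
      rw [abs_of_nonneg (hH0 u hu)]
      exact ⟨a1, a2⟩
  obtain ⟨l₂, h₂⟩ := key (fun u => H u.swap) (fun z => σ * (e - w z)) (by fun_prop)
    (hHc.comp (by fun_prop) fun u hu => ⟨hu.2, hu.1⟩) (by fun_prop)
    (fun a => (lev (σ * e) a).subset fun y hy => ⟨hy.1, by rw [← hy.2]; ring⟩)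
    fun u hu hwu => by
      obtain ⟨a1, -, a2⟩ := hbound u.swap (swap_mem_triangleRegion.2 hu) (by rwa [hwin2])
      rw [abs_of_nonneg (hH0 _ (swap_mem_triangleRegion.2 hu))]
      rw [add_comm] at a1 a2
      exact ⟨a1, a2⟩
  refine ⟨l₁ + l₂, (h₁.add h₂).congr' ?_⟩
  filter_upwards [(nhdsWithin_le_nhds (Iio_mem_nhds hη₀) : Iio η₀ ∈ 𝓝[>] (0 : ℝ))] with η hη
  have hη : η < η₀ := hη
  set W : Set (ℝ × ℝ) := triangleRegion κ ∩ {u | |σ * w u.1 + w u.2 - e| < η} with hW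
  have hWm : MeasurableSet W := (measurableSet_triangleRegion κ).inter
    (measurableSet_lt (by fun_prop) measurable_const)
  set f₁ : ℝ × ℝ → ℝ := fun u => H u * (w' u.2 ^ 2 / (w' u.1 ^ 2 + w' u.2 ^ 2)) with hf₁
  set f₂ : ℝ × ℝ → ℝ := fun u => H u * (w' u.1 ^ 2 / (w' u.2 ^ 2 + w' u.1 ^ 2)) with hf₂
  have hpart : ∀ f : ℝ × ℝ → ℝ, Measurable f → (∀ u ∈ W, |f u| ≤ H u) →
      Integrable (W.indicator f) := by
    intro f hf hle
    refine (hint η).mono' (hf.indicator hWm).aestronglyMeasurable (Eventually.of_forall fun u => ?_)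
    by_cases hu : u ∈ W
    · rw [indicator_of_mem hu, indicator_of_mem hu]; exact hle u hu
    · rw [indicator_of_notMem hu, indicator_of_notMem hu, norm_zero]
  have hfrac : ∀ a b : ℝ, 0 ≤ a ^ 2 / (b ^ 2 + a ^ 2) ∧ a ^ 2 / (b ^ 2 + a ^ 2) ≤ 1 := fun a b =>
    ⟨by positivity, div_le_one_of_le₀ (by linarith [sq_nonneg b]) (by positivity)⟩
  have hi₁ : Integrable (W.indicator f₁) := hpart f₁ (by fun_prop) fun u hu => by
    obtain ⟨b1, b2⟩ := hfrac (w' u.2) (w' u.1)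
    rw [hf₁, abs_of_nonneg (mul_nonneg (hH0 u hu.1) b1)]
    exact mul_le_of_le_one_right (hH0 u hu.1) b2
  have hi₂ : Integrable (W.indicator f₂) := hpart f₂ (by fun_prop) fun u hu => by
    obtain ⟨b1, b2⟩ := hfrac (w' u.1) (w' u.2)
    rw [hf₂, abs_of_nonneg (mul_nonneg (hH0 u hu.1) b1)]
    exact mul_le_of_le_one_right (hH0 u hu.1) b2
  -- the two weights add up to one on the window, where the gradient does not vanish
  have hsum : ∫ u, W.indicator H u = (∫ u, W.indicator f₁ u) + ∫ u, W.indicator f₂ u := by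
    rw [← integral_add hi₁ hi₂]
    refine integral_congr_ae (Eventually.of_forall fun u => ?_)
    by_cases hu : u ∈ W
    · simp only [indicator_of_mem hu, hf₁, hf₂]
      obtain ⟨a1, -⟩ := hbound u hu.1 (lt_trans hu.2 hη)
      rw [add_comm (w' u.2 ^ 2), ← mul_add, ← add_div, add_comm (w' u.2 ^ 2), div_self a1.ne',
        mul_one]
    · simp only [indicator_of_notMem hu, add_zero]
  have e₁ : W = triangleRegion κ ∩ {u | |w u.2 - (e - σ * w u.1)| < η} := by
    simp only [hW, hwin1]
  have e₂ : ∀ u : ℝ × ℝ, W.indicator f₂ u.swap = (triangleRegion κ ∩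
      {u | |w u.2 - σ * (e - w u.1)| < η}).indicator (fun u => f₂ u.swap) u := by
    intro u
    have hmem : u.swap ∈ W ↔ u ∈ triangleRegion κ ∩ {u | |w u.2 - σ * (e - w u.1)| < η} := by
      simp only [hW, mem_inter_iff, swap_mem_triangleRegion, mem_ofPred_eq, Prod.fst_swap,
        Prod.snd_swap, hwin2]
    by_cases hu : u.swap ∈ W
    · rw [indicator_of_mem hu, indicator_of_mem (hmem.1 hu)]
    · rw [indicator_of_notMem hu, indicator_of_notMem fun h => hu (hmem.2 h)]
  have hi₂' := hi₂.swap
  have hs₂ : ∫ u, W.indicator f₂ u = ∫ u : ℝ × ℝ, W.indicator f₂ u.swap :=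
    (integral_prod_swap (W.indicator f₂)).symm
  simp only [Function.comp_def, e₂] at hi₂' hs₂
  rw [hsum, hs₂, mul_add, integral_slices hwm (c := fun z => σ * (e - w z)) hi₂']
  rw [e₁] at hi₁ ⊢
  rw [integral_slices hwm (c := fun y => e - σ * w y) hi₁]
  rfl

/-! ### The energy shells are nondegenerate away from finitely many momenta -/

/-- The derivative of the dispersion relation. -/
def dispDeriv (v : E → ℝ) (ν t : ℝ) : ℝ := ν * t * slopeFun v ν t / disp v ν t

theorem mem_stationary_of_dispDeriv_eq_zero (hv : IsAdmissible v V) (hν : ν ∈ Ioc 0 V) {t : ℝ}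
    (ht : 0 < t) (h : dispDeriv v ν t = 0) : t ∈ (hv.finite_stationary ν hν).toFinset := by
  have hw := disp_pos hv hν ht
  have hν0 := hν.1
  unfold dispDeriv at h
  rw [div_eq_zero_iff, or_iff_left hw.ne', mul_eq_zero, or_iff_right (by positivity)] at h
  exact (Set.Finite.mem_toFinset _).2 ⟨ht, h⟩

/-- The lengths `‖k‖` for which the energy shell of a decay of `k`, or of an absorption by `k`,
contains a point at which both group velocities vanish. -/
def resonantLengths (v : E → ℝ) (ν : ℝ) : Set ℝ :=
  {κ | 0 < κ ∧ ∃ t, ∃ y ∈ {t : ℝ | 0 < t ∧ slopeFun v ν t = 0},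
    ∃ z ∈ {t : ℝ | 0 < t ∧ slopeFun v ν t = 0}, gap v ν false t true κ y z = 0}

theorem finite_resonantLengths (hv : IsAdmissible v V) (hν : ν ∈ Ioc 0 V) :
    (resonantLengths v ν).Finite := by
  have hZ := hv.finite_stationary ν hν
  have hlev := finite_level (fun t ht => hasDerivAt_disp hv hν ht)
    (fun t ht h => mem_stationary_of_dispDeriv_eq_zero hv hν ht h)
  refine (Set.finite_iUnion fun t : Bool => hZ.biUnion fun y _ => hZ.biUnion fun z _ =>
    hlev (sgn t * disp v ν y + disp v ν z)).subset ?_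
  rintro κ ⟨hκ, t, y, hy, z, hz, h⟩
  refine mem_iUnion.2 ⟨t, mem_biUnion hy (mem_biUnion hz ⟨hκ, ?_⟩)⟩
  unfold gap at h
  simp only [sgn_true, sgn_false] at h
  linarith

theorem exists_slopeFun_sq_ge (hv : IsAdmissible v V) (hν : ν ∈ Ioc 0 V) {κ : ℝ} (hκ : 0 < κ)
    (hS : κ ∉ resonantLengths v ν) (t : Bool) :
    ∃ m₀ η₀ : ℝ, 0 < m₀ ∧ 0 < η₀ ∧ ∀ y z, 0 ≤ y → 0 ≤ z → |gap v ν false t true κ y z| < η₀ →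
      m₀ ≤ slopeFun v ν y ^ 2 + slopeFun v ν z ^ 2 := by
  obtain ⟨c, hc, hcev⟩ := hv.liminf_pos ν hν
  obtain ⟨R, hR⟩ := eventually_atTop.1 hcev
  have h0 := hv.vhat_zero_pos
  have hs := continuous_slopeFun (ν := ν) hv
  have hg := continuous_gap (ν := ν) hv false t true
  have hzero : slopeFun v ν 0 ≠ 0 := by simp [slopeFun, vhatRadial_zero, div_self h0.ne']
  have hK : IsCompact (Icc 0 R ×ˢ Icc 0 R : Set (ℝ × ℝ)) := isCompact_Icc.prod isCompact_Icc
  have hcont : Continuous fun u : ℝ × ℝ => slopeFun v ν u.1 ^ 2 + slopeFun v ν u.2 ^ 2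
      + gap v ν false t true κ u.1 u.2 ^ 2 := by
    have := hg.comp (by fun_prop : Continuous fun u : ℝ × ℝ => (κ, u.1, u.2))
    exact (by fun_prop : Continuous fun u : ℝ × ℝ => slopeFun v ν u.1 ^ 2
      + slopeFun v ν u.2 ^ 2).add (this.pow 2)
  obtain ⟨m, hm, hmin⟩ := hK.exists_forall_le' hcont.continuousOn (a := 0) (by
    rintro ⟨y, z⟩ ⟨hy, hz⟩
    simp only
    have n1 := sq_nonneg (slopeFun v ν y)
    have n2 := sq_nonneg (slopeFun v ν z)
    have n3 := sq_nonneg (gap v ν false t true κ y z)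
    by_contra hle
    have e1 : slopeFun v ν y = 0 := by rw [← sq_eq_zero_iff]; linarith
    have e2 : slopeFun v ν z = 0 := by rw [← sq_eq_zero_iff]; linarith
    have e3 : gap v ν false t true κ y z = 0 := by rw [← sq_eq_zero_iff]; linarith
    have pos : ∀ s, 0 ≤ s → slopeFun v ν s = 0 → 0 < s := fun s hs h =>
      hs.lt_of_ne fun h' => hzero (by subst h'; exact h)
    exact hS ⟨hκ, t, y, ⟨pos y hy.1 e1, e1⟩, z, ⟨pos z hz.1 e2, e2⟩, e3⟩)
  refine ⟨min (m / 2) (c ^ 2), √(m / 2), by positivity, by positivity, fun y z hy hz hgap => ?_⟩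
  rw [Real.lt_sqrt (abs_nonneg _), sq_abs] at hgap
  have n1 := sq_nonneg (slopeFun v ν y)
  have n2 := sq_nonneg (slopeFun v ν z)
  rcases le_total R y with h | h
  · have := pow_le_pow_left₀ hc.le (hR y h) 2
    exact (min_le_right _ _).trans (by linarith)
  rcases le_total R z with h' | h'
  · have := pow_le_pow_left₀ hc.le (hR z h') 2
    exact (min_le_right _ _).trans (by linarith)
  have : m ≤ slopeFun v ν y ^ 2 + slopeFun v ν z ^ 2 + gap v ν false t true κ y z ^ 2 :=
    hmin (y, z) ⟨⟨hy, h⟩, ⟨hz, h'⟩⟩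
  exact (min_le_left _ _).trans (by linarith)

/-- The energy shell is nondegenerate, quantitatively: near it, the two group velocities are not
both small. That the lower bound decays in `u.1` is harmless. -/
theorem exists_dispDeriv_sq_ge (hv : IsAdmissible v V) (hν : ν ∈ Ioc 0 V) {κ : ℝ} (hκ : 0 < κ)
    (hS : κ ∉ resonantLengths v ν) (t : Bool) :
    ∃ c η₀ : ℝ, 0 < c ∧ 0 < η₀ ∧ ∀ u ∈ triangleRegion κ, |gap v ν false t true κ u.1 u.2| < η₀ →
      (c / (1 + u.1)) ^ 2 ≤ dispDeriv v ν u.1 ^ 2 + dispDeriv v ν u.2 ^ 2 := by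
  obtain ⟨m, η₀, hm, hη₀, h⟩ := exists_slopeFun_sq_ge hv hν hκ hS t
  obtain ⟨_, C, _, hC, hb⟩ := exists_disp_bounds hv hν
  have hν0 := hν.1
  refine ⟨ν / C * √m / (1 + κ), η₀, by positivity, hη₀, fun u hu hgap => ?_⟩
  have hy : 0 < u.1 := hu.1
  have hz : 0 < u.2 := mem_triangleRegion_snd_pos hu
  have hm' := h u.1 u.2 hy.le hz.le hgap
  have hyz : 1 + u.2 ≤ (1 + κ) * (1 + u.1) := by
    have := hu.2.2
    have := mul_pos hκ hy
    linarith
  have hone : ∀ s, 0 < s → 1 + s ≤ (1 + κ) * (1 + u.1) →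
      (ν / C / ((1 + κ) * (1 + u.1))) ^ 2 * slopeFun v ν s ^ 2 ≤ dispDeriv v ν s ^ 2 := by
    intro s hs hle
    have hw := disp_pos hv hν hs
    have e : dispDeriv v ν s = ν * s / disp v ν s * slopeFun v ν s := by unfold dispDeriv; ring
    rw [e, mul_pow]
    refine mul_le_mul_of_nonneg_right (pow_le_pow_left₀ (by positivity) ?_ 2) (sq_nonneg _)
    have e2 : ν / C / (1 + s) = ν * s / (C * (s * (1 + s))) := by field_simp
    calc _ ≤ ν / C / (1 + s) := div_le_div_of_nonneg_left (by positivity) (by positivity) hle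
      _ = ν * s / (C * (s * (1 + s))) := e2
      _ ≤ _ := div_le_div_of_nonneg_left (by positivity) hw (hb s hs.le).2
  have h1 := hone u.1 hy (by have := mul_pos hκ hy; linarith)
  have h2 := hone u.2 hz hyz
  have h3 := mul_le_mul_of_nonneg_left hm' (sq_nonneg (ν / C / ((1 + κ) * (1 + u.1))))
  have e : (ν / C * √m / (1 + κ) / (1 + u.1)) ^ 2 = (ν / C / ((1 + κ) * (1 + u.1))) ^ 2 * m := by
    rw [show ν / C * √m / (1 + κ) / (1 + u.1) = ν / C / ((1 + κ) * (1 + u.1)) * √m by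
      field_simp, mul_pow, Real.sq_sqrt hm.le]
  rw [e]
  linarith

/-! ### Bounds for the rates on the energy shells -/

theorem exists_abs_sub_le (hv : IsAdmissible v V) (hν : ν ∈ Ioc 0 V) {a b : ℝ} (ha : 0 < a) :
    ∃ C : ℝ, 0 < C ∧ ∀ s ∈ Icc a b, ∀ t ∈ Icc a b, |vhatRadial v s * theta v ν s ^ 2
      - vhatRadial v t * theta v ν t ^ 2| ≤ C * |s - t| := by
  have hpos : ∀ t ∈ Icc a b, 0 < t := fun t ht => ha.trans_le ht.1
  have hV := continuous_vhatRadial hv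
  have hV' := continuous_deriv_vhatRadial hv
  have hw := continuous_disp (ν := ν) hv
  have hw' : ContinuousOn (dispDeriv v ν) (Icc a b) :=
    (continuousOn_disp_deriv hv hν).mono fun t ht => hpos t ht
  have hd : ∀ t ∈ Icc a b, HasDerivWithinAt
      (fun t => vhatRadial v t * (t ^ 2 / (2 * disp v ν t)))
      (deriv (vhatRadial v) t * (t ^ 2 / (2 * disp v ν t)) + vhatRadial v t *
        ((2 * t * (2 * disp v ν t) - t ^ 2 * (2 * dispDeriv v ν t)) / (2 * disp v ν t) ^ 2))
      (Icc a b) t := by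
    intro t ht
    have h1 := (hasDerivAt_disp hv hν (hpos t ht)).const_mul 2
    have h2 : HasDerivAt (fun t : ℝ => t ^ 2) (2 * t) t := by simpa using hasDerivAt_pow 2 t
    have h3 := disp_pos hv hν (hpos t ht)
    exact ((hasDerivAt_vhatRadial hv t).mul (h2.div h1 (by positivity))).hasDerivWithinAt
  have hcont : ContinuousOn (fun t => deriv (vhatRadial v) t * (t ^ 2 / (2 * disp v ν t))
      + vhatRadial v t * ((2 * t * (2 * disp v ν t) - t ^ 2 * (2 * dispDeriv v ν t))
        / (2 * disp v ν t) ^ 2)) (Icc a b) := by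
    refine (ContinuousOn.mul (by fun_prop) (ContinuousOn.div (by fun_prop) (by fun_prop) ?_)).add
      (ContinuousOn.mul (by fun_prop) (ContinuousOn.div (by fun_prop) (by fun_prop) ?_))
    · intro t ht
      have := disp_pos hv hν (hpos t ht)
      positivity
    · intro t ht
      have := disp_pos hv hν (hpos t ht)
      positivity
  obtain ⟨C, hC⟩ := isCompact_Icc.exists_bound_of_continuousOn hcont
  refine ⟨|C| + 1, by positivity, fun s hs t ht => ?_⟩
  rw [theta_sq hv hν (hpos s hs), theta_sq hv hν (hpos t ht)]
  refine ((convex_Icc a b).norm_image_sub_le_of_norm_hasDerivWithin_le hd hC ht hs).trans ?_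
  exact mul_le_mul_of_nonneg_right (by linarith [le_abs_self C]) (norm_nonneg _)

/-- The amplitude of the emission or absorption of a soft quasiparticle is small: the two terms of
order one cancel in the limit. -/
theorem exists_amp_sq_le_soft (hv : IsAdmissible v V) (hν : ν ∈ Ioc 0 V) {κ : ℝ} (hκ : 0 < κ) :
    ∃ C : ℝ, 0 < C ∧ ∀ t y z, 0 < y → y ≤ κ / 2 → |z - κ| ≤ y →
      amp v ν false t true κ y z ^ 2 ≤ C * y := by
  obtain ⟨M, hM, hb⟩ := exists_abs_vhatRadial_le v
  obtain ⟨c, C, hc, hC, hθ⟩ := exists_theta_bounds hv hν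
  obtain ⟨D, hD, hlip⟩ := exists_abs_sub_le hv hν (a := κ / 2) (b := 3 * κ / 2) (by positivity)
  have hup : ∀ s, 0 < s → theta v ν s ^ 2 ≤ C := fun s hs =>
    (hθ s hs).2.trans (mul_le_of_le_one_right hC.le ((div_le_one (by positivity)).2 (by linarith)))
  set q : ℝ := c * (κ / (1 + κ)) * (c * (1 / (1 + κ))) * (c * (κ / 2 / (1 + 2 * κ))) with hq
  have hq0 : 0 < q := by positivity
  refine ⟨((3 * M) ^ 2 * (C * C * C) + (D + M * C) ^ 2 / q) / 2, by positivity,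
    fun t y z hy hyκ hz => ?_⟩
  have hz' := abs_le.1 hz
  have hz1 : κ / 2 ≤ z := by linarith
  have hz2 : z ≤ 3 * κ / 2 := by linarith
  have hz0 : 0 < z := by linarith
  set a := theta v ν κ
  set b := theta v ν y
  set d := theta v ν z
  have a0 : 0 < a := theta_pos hv hν hκ
  have b0 : 0 < b := theta_pos hv hν hy
  have d0 : 0 < d := theta_pos hv hν hz0
  have ha : c * (κ / (1 + κ)) ≤ a ^ 2 := (hθ κ hκ).1
  have hb1 : c * (1 / (1 + κ)) * y ≤ b ^ 2 := by
    refine le_trans ?_ (hθ y hy).1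
    rw [mul_assoc]
    refine mul_le_mul_of_nonneg_left ?_ hc.le
    rw [one_div_mul_eq_div]
    exact div_le_div_of_nonneg_left hy.le (by positivity) (by linarith)
  have hb2 : b ^ 2 ≤ C * y := by
    refine (hθ y hy).2.trans (mul_le_mul_of_nonneg_left ?_ hC.le)
    exact div_le_self hy.le (by linarith)
  have hd1 : c * (κ / 2 / (1 + 2 * κ)) ≤ d ^ 2 := by
    refine le_trans ?_ (hθ z hz0).1
    refine mul_le_mul_of_nonneg_left ?_ hc.le
    exact div_le_div₀ hz0.le hz1 (by positivity) (by linarith)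
  have hlow : q * y ≤ (a * b * d) ^ 2 := by
    calc q * y = c * (κ / (1 + κ)) * (c * (1 / (1 + κ)) * y) * (c * (κ / 2 / (1 + 2 * κ))) := by
          rw [hq]; ring
      _ ≤ a ^ 2 * b ^ 2 * d ^ 2 := mul_le_mul (mul_le_mul ha hb1 (by positivity) (sq_nonneg _)) hd1
          (by positivity) (by positivity)
      _ = _ := by ring
  have hupp : (a * b * d) ^ 2 ≤ C * C * C * y := by
    calc (a * b * d) ^ 2 = a ^ 2 * b ^ 2 * d ^ 2 := by ring
      _ ≤ C * (C * y) * C := mul_le_mul (mul_le_mul (hup κ hκ) hb2 (sq_nonneg _) hC.le)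
          (hup z hz0) (sq_nonneg _) (by positivity)
      _ = _ := by ring
  have hsum : (vhatRadial v κ + vhatRadial v y + vhatRadial v z) ^ 2 ≤ (3 * M) ^ 2 := by
    refine sq_le_sq' ?_ ?_
    · linarith [abs_le.1 (hb κ), abs_le.1 (hb y), abs_le.1 (hb z)]
    · linarith [abs_le.1 (hb κ), abs_le.1 (hb y), abs_le.1 (hb z)]
  -- the coefficient of the singular factor `(θ(κ) θ(y) θ(z))⁻¹`; its terms in `κ` and `z` have opposite
  -- signs, so that it is of order `|z - κ| + y`, while the factor is of order `y ^ (-1/2)`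
  set N : ℝ := vhatRadial v κ * a ^ 2 * (sgn t * sgn true) + vhatRadial v y * b ^ 2
    * (sgn false * sgn true) + vhatRadial v z * d ^ 2 * (sgn false * sgn t) with hN
  have hNle : N ^ 2 ≤ ((D + M * C) * y) ^ 2 := by
    have e : N = sgn t * (vhatRadial v κ * a ^ 2 - vhatRadial v z * d ^ 2)
        - vhatRadial v y * b ^ 2 := by
      rw [hN]; simp only [sgn_true, sgn_false]; ring
    have h1 := hlip κ ⟨by linarith, by linarith⟩ z ⟨hz1, hz2⟩
    rw [abs_sub_comm κ z] at h1
    have h2 : |vhatRadial v y * b ^ 2| ≤ M * (C * y) := by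
      rw [abs_mul, abs_of_nonneg (sq_nonneg b)]
      exact mul_le_mul (hb y) hb2 (sq_nonneg _) hM.le
    have h3 : |sgn t| = 1 := by cases t <;> simp
    refine sq_le_sq.2 ?_
    rw [e, abs_of_nonneg (by positivity : 0 ≤ (D + M * C) * y)]
    refine (abs_sub _ _).trans ?_
    rw [abs_mul, h3, one_mul]
    have h4 := mul_le_mul_of_nonneg_left hz hD.le
    linarith
  have hamp : amp v ν false t true κ y z = ((vhatRadial v κ + vhatRadial v y + vhatRadial v z)
      * (a * b * d) - N / (a * b * d)) / 2 := rfl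
  have hP0 : 0 < a * b * d := by positivity
  generalize a * b * d = P at *
  generalize vhatRadial v κ + vhatRadial v y + vhatRadial v z = S at *
  have h1 : S ^ 2 * P ^ 2 ≤ (3 * M) ^ 2 * (C * C * C * y) :=
    mul_le_mul hsum hupp (sq_nonneg _) (by positivity)
  have h2 : (N / P) ^ 2 ≤ (D + M * C) ^ 2 / q * y := by
    rw [div_pow]
    calc N ^ 2 / P ^ 2 ≤ ((D + M * C) * y) ^ 2 / (q * y) :=
          div_le_div₀ (by positivity) hNle (by positivity) hlow
      _ = _ := by field_simp
  have h3 : ((S * P - N / P) / 2) ^ 2 ≤ (S ^ 2 * P ^ 2 + (N / P) ^ 2) / 2 := by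
    linarith [sq_nonneg (S * P + N / P)]
  rw [hamp]
  linarith

/-- For a decay the thermal weights are bounded at large momenta; for an absorption they decay. -/
theorem exists_mixing_sq_le_decay (hv : IsAdmissible v V) (hν : ν ∈ Ioc 0 V) (hβ : 0 < β) {κ : ℝ}
    (hκ : 0 < κ) : ∃ C : ℝ, 0 < C ∧ ∀ y z, 0 < y → 0 < z →
      (∀ t, mixing v ν β true t true κ y z ^ 2 ≤ C * ((1 + 1 / y) * (1 + 1 / z))) ∧
      mixing v ν β true false true κ y z ^ 2
        ≤ C * ((1 + 1 / y) * (1 + 1 / z) * (1 / (1 + y) ^ 6 + 1 / (1 + z) ^ 6)) := by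
  obtain ⟨C, hC, h1, h2⟩ := exists_therm_sq_le hv hν hβ
  refine ⟨4 * (C * (1 + 1 / κ) * C * C), by positivity, fun y z hy hz => ⟨fun t => ?_, ?_⟩⟩
  · refine (mixing_sq_le _ _ _ _ _ _).trans ((mixingSum_sq_le _ _ _ _ _ _).trans ?_)
    have key : ∀ s₁ s₂ s₃, therm v ν β s₁ κ ^ 2 * therm v ν β s₂ y ^ 2 * therm v ν β s₃ z ^ 2
        ≤ C * (1 + 1 / κ) * (C * (1 + 1 / y)) * (C * (1 + 1 / z)) := fun s₁ s₂ s₃ =>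
      mul_le_mul (mul_le_mul (h1 κ hκ s₁) (h1 y hy s₂) (sq_nonneg _) (by positivity))
        (h1 z hz s₃) (sq_nonneg _) (by positivity)
    linarith [key true t true, key (!true) (!t) (!true)]
  · refine (mixing_sq_le _ _ _ _ _ _).trans ((mixingSum_sq_le _ _ _ _ _ _).trans ?_)
    have k1 : therm v ν β true κ ^ 2 * therm v ν β false y ^ 2 * therm v ν β true z ^ 2
        ≤ C * (1 + 1 / κ) * (C * ((1 + 1 / y) / (1 + y) ^ 6)) * (C * (1 + 1 / z)) :=
      mul_le_mul (mul_le_mul (h1 κ hκ _) (h2 y hy) (sq_nonneg _) (by positivity))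
        (h1 z hz _) (sq_nonneg _) (by positivity)
    have k2 : therm v ν β (!true) κ ^ 2 * therm v ν β (!false) y ^ 2 * therm v ν β (!true) z ^ 2
        ≤ C * (1 + 1 / κ) * (C * (1 + 1 / y)) * (C * ((1 + 1 / z) / (1 + z) ^ 6)) :=
      mul_le_mul (mul_le_mul (h1 κ hκ _) (h1 y hy _) (sq_nonneg _) (by positivity))
        (h2 z hz) (sq_nonneg _) (by positivity)
    have hnn : 0 ≤ C * (1 + 1 / κ) * C * C
        * ((1 + 1 / y) * (1 + 1 / z) * (1 / (1 + y) ^ 6 + 1 / (1 + z) ^ 6)) := by positivity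
    have e : C * (1 + 1 / κ) * (C * ((1 + 1 / y) / (1 + y) ^ 6)) * (C * (1 + 1 / z))
        + C * (1 + 1 / κ) * (C * (1 + 1 / y)) * (C * ((1 + 1 / z) / (1 + z) ^ 6))
        = C * (1 + 1 / κ) * C * C
        * ((1 + 1 / y) * (1 + 1 / z) * (1 / (1 + y) ^ 6 + 1 / (1 + z) ^ 6)) := by ring
    linarith

/-- The integrand of a damping rate in bipolar coordinates. -/
def shellDensity (v : E → ℝ) (ν β : ℝ) (t : Bool) (κ : ℝ) (u : ℝ × ℝ) : ℝ :=
  u.1 * u.2 * rate v ν β false true t t true true κ u.1 u.2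

/-- Near the corner of the triangle region at which the first momentum vanishes, the singularities
of the thermal weights are compensated by the amplitude and the volume element. -/
theorem exists_shellDensity_le_soft (hv : IsAdmissible v V) (hν : ν ∈ Ioc 0 V) (hβ : 0 < β)
    {κ : ℝ} (hκ : 0 < κ) : ∃ C : ℝ, 0 < C ∧ ∀ t, ∀ u ∈ triangleRegion κ, u.1 ≤ κ / 2 →
      shellDensity v ν β t κ u ≤ C := by
  obtain ⟨C₁, hC₁, h1⟩ := exists_amp_sq_le_soft hv hν hκ
  obtain ⟨C₂, hC₂, h2⟩ := exists_mixing_sq_le_decay hv hν hβ hκ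
  have h0 := hv.vhat_zero_pos
  have hν0 := hν.1
  refine ⟨ν / vhat v 0 * C₁ * C₂ * (κ / 2 * (κ / 2 + 1) * (3 * κ / 2 + 1)), by positivity,
    fun t u hu huκ => ?_⟩
  have hy : 0 < u.1 := hu.1
  have hz : 0 < u.2 := mem_triangleRegion_snd_pos hu
  have hz2 := hu.2.2
  have hcorner : |u.2 - κ| ≤ u.1 := by
    have := abs_lt.1 hu.2.1
    exact abs_le.2 ⟨by linarith, by linarith⟩
  have h3 := h1 t u.1 u.2 hy huκ hcorner
  have h4 := (h2 u.1 u.2 hy hz).1 t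
  unfold shellDensity rate
  calc u.1 * u.2 * (ν / vhat v 0 * (amp v ν false t true κ u.1 u.2 ^ 2
        * mixing v ν β true t true κ u.1 u.2 ^ 2))
      ≤ u.1 * u.2 * (ν / vhat v 0 * (C₁ * u.1 * (C₂ * ((1 + 1 / u.1) * (1 + 1 / u.2))))) := by
        refine mul_le_mul_of_nonneg_left (mul_le_mul_of_nonneg_left ?_ (by positivity))
          (by positivity)
        exact mul_le_mul h3 h4 (sq_nonneg _) (by positivity)
    _ = ν / vhat v 0 * C₁ * C₂ * (u.1 * (u.1 + 1) * (u.2 + 1)) := by field_simp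
    _ ≤ _ := by
        refine mul_le_mul_of_nonneg_left ?_ (by positivity)
        exact mul_le_mul (mul_le_mul huκ (by linarith) (by positivity) (by positivity))
          (by linarith) (by positivity) (by positivity)

/-- On its energy shell, the integrand of a damping rate is bounded and decays. -/
theorem exists_shellDensity_le (hv : IsAdmissible v V) (hν : ν ∈ Ioc 0 V) (hβ : 0 < β)
    {κ : ℝ} (hκ : 0 < κ) (t : Bool) :
    ∃ C η₀ : ℝ, 0 < C ∧ 0 < η₀ ∧ ∀ u ∈ triangleRegion κ,
      |gap v ν false t true κ u.1 u.2| < η₀ → shellDensity v ν β t κ u * (1 + u.1) ^ 3 ≤ C := by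
  obtain ⟨C₀, hC₀, hsoft⟩ := exists_shellDensity_le_soft hv hν hβ hκ
  obtain ⟨C₁, hC₁, h1⟩ := exists_amp_sq_le hv hν hκ
  obtain ⟨C₂, hC₂, h2⟩ := exists_mixing_sq_le_decay hv hν hβ hκ
  obtain ⟨c, D, hc, hD, hdisp⟩ := exists_disp_bounds hv hν
  have h0 := hv.vhat_zero_pos
  have hν0 := hν.1
  have hw := disp_pos hv hν hκ
  -- a second momentum below `a` has energy at most `ω(κ) / 2`; in a decay with energy balance within
  -- `ω(κ) / 2`, the first momentum is below `R`
  set a : ℝ := min (κ / 2) (min 1 (disp v ν κ / (4 * D))) with ha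
  have ha0 : 0 < a := by positivity
  set R : ℝ := 2 * disp v ν κ / c with hR
  have hR0 : 0 < R := by positivity
  set A : ℝ := ν / vhat v 0 * C₁ * C₂ * (1 + 1 / a) ^ 4 with hA
  have hA0 : 0 < A := by positivity
  refine ⟨C₀ * (1 + 3 * κ / 2) ^ 3 + A * (R * (R + κ)) * (1 + R) ^ 3
    + A * (1 + κ) * (1 + (1 + κ) ^ 6), disp v ν κ / 2, by positivity, by positivity,
    fun u hu hgap => ?_⟩
  have hy : 0 < u.1 := hu.1
  have hz : 0 < u.2 := mem_triangleRegion_snd_pos hu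
  have hz1 := abs_lt.1 hu.2.1
  have hz2 := hu.2.2
  have p1 : 0 < C₀ * (1 + 3 * κ / 2) ^ 3 := by positivity
  have p2 : 0 < A * (R * (R + κ)) * (1 + R) ^ 3 := by positivity
  have p3 : 0 < A * (1 + κ) * (1 + (1 + κ) ^ 6) := by positivity
  have hnear : ∀ X, X ≤ C₀ → u.1 ≤ 3 * κ / 2 →
      X * (1 + u.1) ^ 3 ≤ C₀ * (1 + 3 * κ / 2) ^ 3 := fun X hX hle =>
    mul_le_mul hX (pow_le_pow_left₀ (by positivity) (by linarith) 3) (by positivity) hC₀.le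
  rcases le_total u.1 (κ / 2) with hyκ | hyκ
  · linarith [hnear _ (hsoft t u hu hyκ) (by linarith)]
  -- away from the corners, the rate itself is bounded
  have hy1 : 1 / u.1 ≤ 1 / a := one_div_le_one_div_of_le ha0 ((min_le_left _ _).trans hyκ)
  have hamp := h1 κ u.1 u.2 le_rfl hy hz false t true
  have hcoef : ∀ {X : ℝ}, 0 ≤ X → a ≤ u.2 → mixing v ν β true t true κ u.1 u.2 ^ 2
      ≤ C₂ * ((1 + 1 / u.1) * (1 + 1 / u.2) * X) → shellDensity v ν β t κ u ≤ u.1 * u.2 * (A * X) := by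
    intro X hX haz hmix
    have hz1 : 1 / u.2 ≤ 1 / a := one_div_le_one_div_of_le ha0 haz
    have e : (1 + 1 / u.1) * (1 + 1 / u.2) ≤ (1 + 1 / a) * (1 + 1 / a) :=
      mul_le_mul (by linarith) (by linarith) (by positivity) (by positivity)
    unfold shellDensity rate
    refine mul_le_mul_of_nonneg_left ?_ (by positivity)
    calc _ ≤ ν / vhat v 0 * (C₁ * ((1 + 1 / a) * (1 + 1 / a))
          * (C₂ * ((1 + 1 / a) * (1 + 1 / a) * X))) := by
          refine mul_le_mul_of_nonneg_left ?_ (by positivity)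
          refine mul_le_mul (hamp.trans (mul_le_mul_of_nonneg_left e hC₁.le))
            (hmix.trans (mul_le_mul_of_nonneg_left (mul_le_mul_of_nonneg_right e hX) hC₂.le))
            (sq_nonneg _) (by positivity)
      _ = _ := by rw [hA]; ring
  cases t
  · -- absorption: the energy balance keeps the second momentum away from zero
    have haz : a ≤ u.2 := by
      by_contra! hlt
      have hb1 : u.2 < 1 := hlt.trans_le ((min_le_right _ _).trans (min_le_left _ _))
      have hb2 : u.2 < disp v ν κ / (4 * D) :=
        hlt.trans_le ((min_le_right _ _).trans (min_le_right _ _))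
      rw [lt_div_iff₀ (by positivity)] at hb2
      have hb3 := (hdisp u.2 hz.le).2
      have hb4 : D * (u.2 * (1 + u.2)) ≤ D * (u.2 * 2) :=
        mul_le_mul_of_nonneg_left (mul_le_mul_of_nonneg_left (by linarith) hz.le) hD.le
      have hb5 := disp_nonneg (v := v) (ν := ν) hy.le
      have hg := (abs_lt.1 hgap).1
      unfold gap at hg
      simp only [sgn_true, sgn_false] at hg
      linarith
    set Y := 1 / (1 + u.1) ^ 6 with hY
    have hYz : 1 / (1 + u.2) ^ 6 ≤ (1 + κ) ^ 6 * Y := by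
      rw [hY, mul_one_div, div_le_div_iff₀ (by positivity) (by positivity), one_mul, ← mul_pow]
      refine pow_le_pow_left₀ (by positivity) ?_ 6
      have := mul_pos hκ hz
      linarith
    have hX := hcoef (by positivity) haz (h2 u.1 u.2 hy hz).2
    have hprod : u.1 * u.2 ≤ (1 + κ) * (1 + u.1) ^ 2 := by
      have := mul_pos hκ hy
      calc u.1 * u.2 ≤ (1 + u.1) * ((1 + κ) * (1 + u.1)) :=
            mul_le_mul (by linarith) (by linarith) hz.le (by positivity)
        _ = _ := by ring
    have hfin : shellDensity v ν β false κ u * (1 + u.1) ^ 3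
        ≤ A * (1 + κ) * (1 + (1 + κ) ^ 6) := by
      calc _ ≤ u.1 * u.2 * (A * (1 / (1 + u.1) ^ 6 + 1 / (1 + u.2) ^ 6)) * (1 + u.1) ^ 3 :=
            mul_le_mul_of_nonneg_right hX (by positivity)
        _ ≤ (1 + κ) * (1 + u.1) ^ 2 * (A * (Y + (1 + κ) ^ 6 * Y)) * (1 + u.1) ^ 3 := by
            refine mul_le_mul_of_nonneg_right (mul_le_mul hprod (mul_le_mul_of_nonneg_left
              (by linarith) hA0.le) (by positivity) (by positivity)) (by positivity)
        _ = A * (1 + κ) * (1 + (1 + κ) ^ 6) * (1 / (1 + u.1)) := by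
            rw [hY]; field_simp
        _ ≤ _ := mul_le_of_le_one_right p3.le ((div_le_one (by positivity)).2 (by linarith))
    linarith
  · rcases le_total u.2 (κ / 2) with hzκ | hzκ
    · have hswap : shellDensity v ν β true κ u = shellDensity v ν β true κ u.swap := by
        unfold shellDensity
        rw [Prod.fst_swap, Prod.snd_swap, rate_swap, mul_comm u.1]
      rw [hswap]
      linarith [hnear _ (hsoft true u.swap (swap_mem_triangleRegion.2 hu) hzκ) (by linarith)]
    · -- decay: the energy balance bounds both momenta
      have hyR : u.1 ≤ R := by
        have hb1 := (hdisp u.1 hy.le).1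
        have hb2 := disp_nonneg (v := v) (ν := ν) hz.le
        have hb3 : c * u.1 ≤ c * (u.1 * (1 + u.1)) :=
          mul_le_mul_of_nonneg_left (le_mul_of_one_le_right hy.le (by linarith)) hc.le
        have hg := (abs_lt.1 hgap).2
        unfold gap at hg
        simp only [sgn_true, sgn_false] at hg
        rw [hR, le_div_iff₀ hc]
        linarith
      have hX := hcoef (X := 1) zero_le_one ((min_le_left _ _).trans hzκ)
        (by rw [mul_one]; exact (h2 u.1 u.2 hy hz).1 true)
      have hfin : shellDensity v ν β true κ u * (1 + u.1) ^ 3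
          ≤ A * (R * (R + κ)) * (1 + R) ^ 3 := by
        refine mul_le_mul (hX.trans ?_) (pow_le_pow_left₀ (by positivity) (by linarith) 3)
          (by positivity) (by positivity)
        rw [mul_one, mul_comm]
        exact mul_le_mul_of_nonneg_left (mul_le_mul hyR (by linarith) hz.le hR0.le) hA0.le
      linarith

/-! ### Existence of the damping rates -/

/-- In bipolar coordinates the integrand is dominated on the shell, which is what the slicing in
`exists_tendsto_shell` requires. -/
theorem exists_isShellIntegral (hv : IsAdmissible v V) (hν : ν ∈ Ioc 0 V) (hβ : 0 < β) {k : E}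
    (hk : k ≠ 0) (hS : ‖k‖ ∉ resonantLengths v ν) (t : Bool) :
    ∃ γ, IsShellIntegral v ν β false true t true k γ := by
  have hκ : 0 < ‖k‖ := norm_pos_iff.2 hk
  set κ := ‖k‖ with hκdef
  obtain ⟨C, η₁, hC, hη₁, hdens⟩ := exists_shellDensity_le hv hν hβ hκ t
  obtain ⟨c, η₂, hc, hη₂, hgrad⟩ := exists_dispDeriv_sq_ge hv hν hκ hS t
  have hw := continuous_disp (ν := ν) hv
  have hrm := measurable_rate (β := β) (ν := ν) hv false true t t true true κ
  have hgm := measurable_gap (ν := ν) hv false t true κ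
  have hwin : ∀ u : ℝ × ℝ, sgn t * disp v ν u.1 + disp v ν u.2 - disp v ν κ
      = gap v ν false t true κ u.1 u.2 := by
    intro u
    unfold gap
    simp only [sgn_true, sgn_false]
    ring
  set G : ℝ → ℝ × ℝ → ℝ := fun η =>
    {u | |sgn t * disp v ν u.1 + disp v ν u.2 - disp v ν κ| < η}.indicator
      fun u => rate v ν β false true t t true true κ u.1 u.2 with hG
  have hWm : ∀ η, MeasurableSet
      {u : ℝ × ℝ | |sgn t * disp v ν u.1 + disp v ν u.2 - disp v ν κ| < η} := fun η =>
    measurableSet_lt (by fun_prop) measurable_const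
  have hGm : ∀ η, Measurable (G η) := fun η => hrm.indicator (hWm η)
  have hG0 : ∀ η u, 0 ≤ G η u := fun η u => indicator_nonneg
    (fun _ _ => rate_nonneg hv hν _ _ _ _ _ _ _ _ _) u
  have hGE : ∀ η, (fun p : E => G η (‖p‖, ‖p - k‖))
      = {p : E | |gap v ν false t true κ ‖p‖ ‖p - k‖| < η}.indicator
        fun p => rate v ν β false true t t true true κ ‖p‖ ‖p - k‖ := by
    intro η
    funext p
    simp only [hG, indicator, mem_ofPred_eq, hwin]
  have hgE := measurable_gap_norm (ν := ν) hv false t true k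
  have hWE : ∀ η, MeasurableSet {p : E | |gap v ν false t true κ ‖p‖ ‖p - k‖| < η} := fun η =>
    measurableSet_lt hgE.abs measurable_const
  have hGi : ∀ η, Integrable fun p : E => G η (‖p‖, ‖p - k‖) := by
    intro η
    rw [hGE, integrable_indicator_iff (hWE η)]
    exact integrableOn_window (measurable_rate_norm (β := β) hv false true t true k) hgE
      (fun _ => rate_nonneg hv hν _ _ _ _ _ _ _ _ _) (integrable_rate_div hv hν hβ hk _ _ _ _) η
  have hHG : ∀ η, (triangleRegion κ).indicator (fun u => u.1 * u.2 * G η u)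
      = (triangleRegion κ ∩ {u | |sgn t * disp v ν u.1 + disp v ν u.2 - disp v ν κ| < η}).indicator
        (shellDensity v ν β t κ) := by
    intro η
    rw [← indicator_indicator]
    congr 1
    funext u
    simp only [hG, indicator, shellDensity]
    split_ifs <;> simp
  have hD0 : ∀ u ∈ triangleRegion κ, 0 ≤ shellDensity v ν β t κ u := fun u hu =>
    mul_nonneg (mul_nonneg hu.1.le (mem_triangleRegion_snd_pos hu).le)
      (rate_nonneg hv hν _ _ _ _ _ _ _ _ _)
  have hB0 : ∀ y : ℝ, 0 ≤ C * (1 + κ) ^ 3 / c * (1 + y ^ 2)⁻¹ := fun y => by positivity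
  -- the bound in the first variable, and then in the second, which is of the same size
  have hmain : ∀ u ∈ triangleRegion κ,
      |sgn t * disp v ν u.1 + disp v ν u.2 - disp v ν κ| < min η₁ η₂ →
      0 < dispDeriv v ν u.1 ^ 2 + dispDeriv v ν u.2 ^ 2 ∧
      shellDensity v ν β t κ u * |dispDeriv v ν u.2|
        ≤ C * (1 + κ) ^ 3 / c * (1 + u.1 ^ 2)⁻¹ * (dispDeriv v ν u.1 ^ 2 + dispDeriv v ν u.2 ^ 2) ∧
      shellDensity v ν β t κ u * |dispDeriv v ν u.1|
        ≤ C * (1 + κ) ^ 3 / c * (1 + u.2 ^ 2)⁻¹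
          * (dispDeriv v ν u.1 ^ 2 + dispDeriv v ν u.2 ^ 2) := by
    intro u hu hgap
    rw [hwin] at hgap
    have hy : 0 < u.1 := hu.1
    have hz : 0 < u.2 := mem_triangleRegion_snd_pos hu
    have h1 := hdens u hu (hgap.trans_le (min_le_left _ _))
    have h2 := hgrad u hu (hgap.trans_le (min_le_right _ _))
    have h3 := hD0 u hu
    set s := dispDeriv v ν u.1 ^ 2 + dispDeriv v ν u.2 ^ 2 with hs
    set D := shellDensity v ν β t κ u
    have hs0 : 0 < s := lt_of_lt_of_le (by positivity) h2
    have hroot : c / (1 + u.1) ≤ √s := Real.le_sqrt_of_sq_le h2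
    have key : ∀ d r : ℝ, |d| ≤ √s → 0 < r → 1 + r ≤ (1 + κ) * (1 + u.1) →
        D * |d| ≤ C * (1 + κ) ^ 3 / c * (1 + r ^ 2)⁻¹ * s := by
      intro d r hd hr hle
      have e1 : √s ≤ s * ((1 + u.1) / c) := by
        rw [mul_div_assoc', le_div_iff₀ hc]
        have := mul_le_mul_of_nonneg_right hroot (by positivity : 0 ≤ √s * (1 + u.1))
        rw [← mul_assoc √s, Real.mul_self_sqrt hs0.le] at this
        calc √s * c = c / (1 + u.1) * (√s * (1 + u.1)) := by field_simp
          _ ≤ _ := this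
      have e2 : D ≤ C / (1 + u.1) ^ 3 := by rwa [le_div_iff₀ (by positivity)]
      have e3 : 1 / (1 + u.1) ^ 2 ≤ (1 + κ) ^ 3 * (1 + r ^ 2)⁻¹ := by
        rw [← div_eq_mul_inv, div_le_div_iff₀ (by positivity) (by positivity), one_mul]
        calc 1 + r ^ 2 ≤ (1 + r) ^ 2 := by linarith [sq_nonneg r, hr]
          _ ≤ ((1 + κ) * (1 + u.1)) ^ 2 := pow_le_pow_left₀ (by positivity) hle 2
          _ = (1 + κ) ^ 2 * (1 + u.1) ^ 2 := by ring
          _ ≤ (1 + κ) ^ 3 * (1 + u.1) ^ 2 := mul_le_mul_of_nonneg_right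
            (pow_le_pow_right₀ (by linarith) (by norm_num)) (by positivity)
      calc D * |d| ≤ C / (1 + u.1) ^ 3 * (s * ((1 + u.1) / c)) :=
            mul_le_mul e2 (hd.trans e1) (abs_nonneg _) (by positivity)
        _ = C / c * s * (1 / (1 + u.1) ^ 2) := by field_simp
        _ ≤ C / c * s * ((1 + κ) ^ 3 * (1 + r ^ 2)⁻¹) :=
            mul_le_mul_of_nonneg_left e3 (by positivity)
        _ = _ := by ring
    have hκy := mul_pos hκ hy
    have hz2 := hu.2.2
    refine ⟨hs0, key _ _ ?_ hy (by linarith), key _ _ ?_ hz (by linarith)⟩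
    · exact Real.abs_le_sqrt (by rw [hs]; linarith [sq_nonneg (dispDeriv v ν u.1)])
    · exact Real.abs_le_sqrt (by rw [hs]; linarith [sq_nonneg (dispDeriv v ν u.2)])
  obtain ⟨l, hl⟩ := exists_tendsto_shell hw (fun t ht => hasDerivAt_disp hv hν ht)
    (fun t ht h => mem_stationary_of_dispDeriv_eq_zero hv hν ht h)
    (by have := (continuous_slopeFun (ν := ν) hv).measurable
        have := hw.measurable
        fun_prop) (continuousOn_disp_deriv hv hν) hκ
    (σ := sgn t) (e := disp v ν κ) (by cases t <;> simp)
    (H := shellDensity v ν β t κ) (by unfold shellDensity; fun_prop)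
    (by
      have h1 := (continuousOn_rate hv hν hβ false true t t true true).comp
        (f := fun u : ℝ × ℝ => (κ, u.1, u.2)) (s := Ioi 0 ×ˢ Ioi 0) (by fun_prop)
        fun u hu => ⟨hκ, hu⟩
      exact ContinuousOn.mul (by fun_prop) h1) hD0
    (fun η => by rw [← hHG]; exact (integral_triangleRegion hk (hGm η) (hG0 η) (hGi η)).1)
    ((integrable_inv_one_add_sq.const_mul _).integrableOn) (fun y _ => hB0 y)
    (lt_min hη₁ hη₂) hmain
  refine ⟨2 * Real.pi / κ * l, (hl.const_mul (2 * Real.pi / κ)).congr fun η => ?_⟩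
  rw [← hHG, mul_left_comm, ← (integral_triangleRegion hk (hGm η) (hG0 η) (hGi η)).2, hGE,
    integral_indicator (hWE η)]

end BoseGas

end

theorem mainTheorem3 (v : BoseGas.E → ℝ) (V : ℝ) (hv : BoseGas.IsAdmissible v V)
    (ν : ℝ) (hν : ν ∈ Set.Ioc 0 V) :
    (∀ β : ℝ, 0 < β → ∀ L : ℝ, 0 < L → ∀ ε : ℝ, 0 < ε →
      BoseGas.GoldenRuleSummable v ν β L ε BoseGas.vac ∧
      ∀ k : BoseGas.Xi, BoseGas.GoldenRuleSummable v ν β L ε (BoseGas.quasi k)) ∧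
    (∀ β : ℝ, 0 < β → ∀ k : BoseGas.E, k ≠ 0 → ∀ γB γL : ℝ,
      BoseGas.IsBeliaevRate v ν β k γB → BoseGas.IsLandauRate v ν β k γL →
      BoseGas.IsEigenvalueShift v ν β k (-2 * Complex.I * ((γB : ℂ) + (γL : ℂ)))) ∧
    (∃ S : Set ℝ, S.Finite ∧ ∀ β : ℝ, 0 < β → ∀ k : BoseGas.E, k ≠ 0 → ‖k‖ ∉ S →
      (∃ γB : ℝ, BoseGas.IsBeliaevRate v ν β k γB) ∧
      (∃ γL : ℝ, BoseGas.IsLandauRate v ν β k γL)) := by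
  refine ⟨fun β hβ L hL ε hε => ⟨?_, fun k => ?_⟩, fun β hβ k hk γB γL hB hL => ?_,
    BoseGas.resonantLengths v ν, BoseGas.finite_resonantLengths hv hν,
    fun β hβ k hk hS => ⟨?_, ?_⟩⟩
  · rw [BoseGas.vac_eq]
    exact BoseGas.goldenRuleSummable hv hν hβ hL hε BoseGas.energy_zero
  · rw [BoseGas.quasi_eq]
    exact BoseGas.goldenRuleSummable hv hν hβ hL hε (BoseGas.energy_pairConfig k)
  · exact BoseGas.isEigenvalueShift hv hν hβ hk hB hL
  · obtain ⟨γ, h⟩ := BoseGas.exists_isShellIntegral hv hν hβ hk hS true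
    exact ⟨_, (BoseGas.isBeliaevRate_iff hv hν hβ hk).2 h⟩
  · obtain ⟨γ, h⟩ := BoseGas.exists_isShellIntegral hv hν hβ hk hS false
    exact ⟨_, (BoseGas.isLandauRate_iff hv hν hβ hk).2 h⟩
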